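/- Let $d,p\ge 1$ be integers, $\gamma_p=\binom{2p+1}{p+1}$, and let $\Delta$ be the discrete Laplacian on $\ell^2=\ell^2(\mathbb Z^d;\mathbb R)$. The scaled discrete Klein--Gordon equation $\ddot u+u+\epsilon u^{1+2p}=\epsilon\Delta u$ has, on the phase space $\ell^2\times\ell^2\ni z=(u,v)$, $v=\dot u$, the Hamiltonian $H=G+F$ with $$G=\tfrac12\sum_j(u_j^2+v_j^2),\qquad F=\frac{\epsilon}{2p+2}\sum_j u_j^{2p+2}+\frac{\epsilon}{2}\sum_{\text{bonds }\{j,h\}}(u_j-u_h)^2 ,$$ each nearest-neighbour bond being counted once. Write $X_f=(\partial_v f,-\partial_u f)$, $\{f,g\}=Dg\,[X_f]$, $\Phi_G^t$ for the ($2\pi$-periodic) flow of $X_G$, and identify $z$ with the complex sequence $\psi=\frac12(u-iv)$, so that $u=\psi+\bar\psi$ and $\Phi^t_G\psi=e^{it}\psi$. Normal form of order $r\ge1$. For $s=1,\dots,r$ put $F_1=F$, $F_s=\sum_{l=1}^{s-1}\frac{l}{s-1}\{\chi_l,F_{s-l}\}$ ($s\ge2$), $\Psi_s=\frac1sF_s+\sum_{l=1}^{s-1}\frac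 ls\{\chi_l,Z_{s-l}\}$, $Z_s=\frac1{2\pi}\int_0^{2\pi}\Psi_s\circ\Phi_G^t\,dt$, $\chi_s=\frac1{2\pi}\int_0^{2\pi}t\,(\Psi_s-Z_s)\circ\Phi_G^t\,dt$; set $\chi_l=0$ for $l>r$, and let $T_r(z)=\sum_{k\ge0}z_k$ with $z_0=z$, $z_k=\sum_{l=1}^k\frac lk\{\chi_l,z_{k-l}\}$. $T_r$ maps the normal form coordinates to the original ones, and $K_r=G+Z_1+\dots+Z_r$ is the truncated normal form. The generalized stationary dNLS equation, i.e. the equation for real $\mathfrak A\in\ell^2$ such that $\zeta_{\rm ds}(t)=\mathfrak A e^{i(1-\epsilon\Omega/2)t}$ solves $\dot z=X_{K_r}(z)$, is $$f_{r}(\mathfrak A,\epsilon):=\Omega\mathfrak A+\gamma_p|\mathfrak A|^{2p}\mathfrak A-\Delta\mathfrak A+\epsilon\cdot\epsilon^{-2}\,\partial_u(Z_2+\dots+Z_r)\big|_{(u,v)=(2\mathfrak A,0)}=0 .$$ Theorem. Let $\Omega\in\mathbb R$, let $\mathcal A\in\ell^2$ be real with $\Omega\mathcal A+\gamma_p|\mathcal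 A|^{2p}\mathcal A=\Delta\mathcal A$, assume that $J_\Omega=\Omega+(1+2p)\gamma_p|\mathcal A|^{2p}-\Delta$ is invertible on $\ell^2$, and let $R>2\|\mathcal A\|$. Then there are constants $\rho,\,c,\,C,\,\delta>0$ and $0<\epsilon_2^*<\epsilon_1^*<\epsilon^*\le\rho$, independent of $\epsilon$ and $r$, such that for all integers $r\ge1$ and all $0<\epsilon<\epsilon^*$ with $r\epsilon\le\rho$ the series $T_r$ converges absolutely on the ball $\|z\|<R$ and $T_r$ is injective there, and the following hold. 1. If in addition $\epsilon<\epsilon_1^*$, the equation $f_r(\cdot,\epsilon)=0$ has exactly one solution $\mathfrak A=\mathfrak A_r(\Omega,\epsilon)$ with $\|\mathfrak A-\mathcal A\|<\delta$; for each $r$ it is analytic in $\epsilon$ on $\{0<\epsilon<\epsilon_1^*,\ r\epsilon\le\rho\}$. Moreover $\|\mathfrak A-\mathcal A\|\le C\epsilon$, $f_r(\cdot,\epsilon)$ is differentiable at $\mathfrak A$ and $\|D_{\mathfrak A}f_r(\mathfrak A,\epsilon)-J_\Omega\|\le C\epsilon$ in operator norm, and $\zeta_{\rm ds}$ stays in the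 ball $\|z\|<R$ and solves $\dot z=X_{K_r}(z)$. 2. There are an analytic $\omega:(0,\epsilon_2^*)\to(0,\infty)$ with $|\omega(\epsilon)-1+\frac\epsilon2\Omega|\le C\epsilon^2$ and $1-\frac\epsilon2\Omega>0$ and, for each $r\geq 1$, real coefficients $\{\mathfrak A^{(m)}_r(\epsilon)\}_{m\in\mathbb Z}\in\ell^{2,2}(\mathbb Z;\ell^2)$ (norm $(\sum_m(1+m^2)^2\|\mathfrak A^{(m)}\|^2)^{1/2}$), analytic in $\epsilon$ on $\{0<\epsilon<\epsilon_2^*,\ r\epsilon\le\rho\}$, such that $\zeta_{\rm br}(t)=\sum_m\mathfrak A_r^{(m)}(\epsilon)e^{im\omega(\epsilon)t}$ stays in the ball $\|z\|<R$ and solves Hamilton's equations of $H\circ T_r$, and $z_{\rm br}=T_r(\zeta_{\rm br})$ is a solution of $\dot z=X_H(z)$ that does not depend on $r$. One has $\sum_{m\ne1}\|\mathfrak A_r^{(m)}\|+\|\mathfrak A_r^{(1)}-\mathfrak A_r\|<\delta$, and for each frequency $w$ with $|w-1+\frac\epsilon2\Omega|\le C\epsilon^2$ there is at most one breather of frequency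 $w$ in the ball $\|z\|<R$ with real coefficients in $\ell^{2,2}$ satisfying this inequality. At the optimal order $r=\lfloor\rho/\epsilon\rfloor$, $$\sum_{m\ne1}\|\mathfrak A_r^{(m)}(\epsilon)\|+\|\mathfrak A_r^{(1)}(\epsilon)-\mathfrak A_r(\Omega,\epsilon)\|\le C\exp(-c/\epsilon).$$ 3. For $0<\epsilon<\epsilon_2^*$ and $r=\lfloor\rho/\epsilon\rfloor$, let $z_{\rm ds}=T_r(\zeta_{\rm ds})$ and $z_{\rm br}=T_r(\zeta_{\rm br})$ be the soliton and the breather in the original coordinates, and $T_{\rm ds}=2\pi/(1-\frac\epsilon2\Omega)$, $T_{\rm br}=2\pi/\omega(\epsilon)$. Then $\sup_{|t|\le\max\{T_{\rm ds},T_{\rm br}\}}\|z_{\rm ds}(t)-z_{\rm br}(t)\|\le C\exp(-c/\epsilon)$. -/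

import Mathlib

noncomputable section

namespace KleinGordon

/-! ### Sequence spaces and operators on the lattice -/

/-- Real square-summable sequences on the cubic lattice of dimension `d`. -/
abbrev L2 (d : ℕ) : Type := lp (fun _ : Fin d → ℤ => ℝ) 2

/-- The real phase space of pairs `(u, v)`, `v = du/dt`, with the Hilbert norm
`(‖u‖ ^ 2 + ‖v‖ ^ 2) ^ (1/2)`. -/
abbrev Phase (d : ℕ) : Type := WithLp 2 (L2 d × L2 d)

theorem memlp_shift {d : ℕ} (k : Fin d → ℤ) (u : L2 d) :
    Memℓp (fun n => u (n + k)) 2 := by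
  have h := (memℓp_gen_iff (p := 2) (by norm_num)).1 (lp.memℓp u)
  exact (memℓp_gen_iff (p := 2) (by norm_num)).2 (h.comp_injective (add_left_injective k))

/-- Translation: `(shift k u) n = u (n + k)`. -/
def shift {d : ℕ} (k : Fin d → ℤ) : L2 d →L[ℝ] L2 d :=
  LinearMap.mkContinuous
    { toFun := fun u => ⟨fun n => u (n + k), memlp_shift k u⟩
      map_add' := fun _ _ => rfl
      map_smul' := fun _ _ => rfl } 1 (by
    intro u
    rw [one_mul]
    refine lp.norm_le_of_tsum_le (p := 2) (by norm_num) (norm_nonneg u) ?_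
    rw [lp.norm_rpow_eq_tsum (p := 2) (by norm_num) u]
    exact ((Equiv.addRight k).tsum_eq (fun n => ‖u n‖ ^ (2 : ENNReal).toReal)).le)

@[simp] theorem shift_apply {d : ℕ} (k : Fin d → ℤ) (u : L2 d) (n : Fin d → ℤ) :
    shift k u n = u (n + k) := rfl

/-- The unit vector of the lattice in direction `i`. -/
def unit {d : ℕ} (i : Fin d) : Fin d → ℤ := Pi.single i 1

/-- The discrete Laplacian, `(Δ u) n = ∑ |k - n| = 1, (u k - u n)`. -/
def laplacian (d : ℕ) : L2 d →L[ℝ] L2 d :=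
  ∑ i : Fin d, (shift (unit i) + shift (-unit i) - (2 : ℝ) • ContinuousLinearMap.id ℝ (L2 d))

theorem abs_mul_le {d : ℕ} (a x : L2 d) (n : Fin d → ℤ) : ‖a n * x n‖ ≤ ‖(‖a‖ • x) n‖ := by
  simp only [lp.coeFn_smul, Pi.smul_apply, smul_eq_mul, norm_mul, norm_norm]
  exact mul_le_mul_of_nonneg_right (lp.norm_apply_le_norm (by norm_num) a n) (norm_nonneg _)

theorem memlp_mul {d : ℕ} (a x : L2 d) : Memℓp (fun n => a n * x n) 2 :=
  (lp.memℓp (‖a‖ • x)).mono' (abs_mul_le a x)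

/-- Componentwise multiplication by `a`. -/
def mulOp {d : ℕ} (a : L2 d) : L2 d →L[ℝ] L2 d :=
  LinearMap.mkContinuous
    { toFun := fun x => ⟨fun n => a n * x n, memlp_mul a x⟩
      map_add' := fun x y => by ext n; exact mul_add (a n) (x n) (y n)
      map_smul' := fun c x => by ext n; exact mul_left_comm (a n) c (x n) } ‖a‖ (by
    intro x
    have h := lp.norm_mono (p := 2) (by norm_num)
      (x := (⟨fun n => a n * x n, memlp_mul a x⟩ : L2 d)) (y := ‖a‖ • x) (abs_mul_le a x)
    rwa [norm_smul, norm_norm] at h)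

@[simp] theorem mulOp_apply {d : ℕ} (a x : L2 d) (n : Fin d → ℤ) :
    mulOp a x n = a n * x n := rfl

/-- The coefficient `γ_p = (2 p + 1)! / (p! (p + 1)!)` of the nonlinearity of the dNLS equation. -/
def gammaCoeff (p : ℕ) : ℝ := (Nat.choose (1 + 2 * p) (1 + p) : ℝ)

/-- The stationary dNLS operator `Ω A + γ |A| ^ (2 p) A - Δ A` on real sequences. -/
def dnls {d : ℕ} (p : ℕ) (Ω : ℝ) (A : L2 d) : L2 d :=
  Ω • A + gammaCoeff p • (mulOp A ^ (2 * p)) A - laplacian d A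

/-- The Jacobian operator `Ω + (1 + 2 p) γ |A| ^ (2 p) - Δ`. -/
def jacobian {d : ℕ} (p : ℕ) (Ω : ℝ) (A : L2 d) : L2 d →L[ℝ] L2 d :=
  Ω • ContinuousLinearMap.id ℝ (L2 d) + ((1 + 2 * p : ℝ) * gammaCoeff p) • mulOp A ^ (2 * p)
    - laplacian d

/-! ### Hamiltonian formalism on the phase space -/

/-- The point `(u, v)` of the phase space. -/
def mkPhase {d : ℕ} (u v : L2 d) : Phase d := WithLp.toLp 2 (u, v)

/-- The Hamiltonian vector field `X_f = (∂f/∂v, -∂f/∂u)`. -/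
def hamField {d : ℕ} (f : Phase d → ℝ) (z : Phase d) : Phase d :=
  mkPhase (gradient f z).snd (-(gradient f z).fst)

/-- The Lie derivative of `g` along `X_χ`. For scalar `g` it is the Poisson bracket
`{χ, g} = ∑ j, (∂χ/∂v_j ∂g/∂u_j - ∂χ/∂u_j ∂g/∂v_j)`. -/
def lieD {d : ℕ} {W : Type} [NormedAddCommGroup W] [NormedSpace ℝ W]
    (χ : Phase d → ℝ) (g : Phase d → W) (z : Phase d) : W :=
  fderiv ℝ g z (hamField χ z)

/-- The integrable part `G = (1/2) ∑ (u_j ^ 2 + v_j ^ 2)`. -/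
def hamG {d : ℕ} (z : Phase d) : ℝ :=
  (1 / 2) * ∑' j, ((z.fst j) ^ 2 + (z.snd j) ^ 2)

/-- The perturbation `F`: the anharmonic part and the coupling, each lattice bond being counted
once, so that `G + F` is the Hamiltonian of
`u'' + u + ε u ^ (1 + 2 p) = ε Δ u`. -/
def hamF {d : ℕ} (p : ℕ) (ε : ℝ) (z : Phase d) : ℝ :=
  ε / (2 * p + 2) * ∑' j, (z.fst j) ^ (2 * p + 2)
    + ε / 2 * ∑' j, ∑ i : Fin d, (z.fst (j + unit i) - z.fst j) ^ 2

/-- The Hamiltonian of the scaled discrete Klein-Gordon equation. -/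
def hamH {d : ℕ} (p : ℕ) (ε : ℝ) (z : Phase d) : ℝ := hamG z + hamF p ε z

/-- The flow of `X_G`; it has period `2 π`. -/
def flowG {d : ℕ} (t : ℝ) (z : Phase d) : Phase d :=
  mkPhase (Real.cos t • z.fst + Real.sin t • z.snd) (-Real.sin t • z.fst + Real.cos t • z.snd)

/-- The average along the flow of `X_G`. -/
def average {d : ℕ} (Ψ : Phase d → ℝ) (z : Phase d) : ℝ :=
  1 / (2 * Real.pi) * ∫ t in (0 : ℝ)..(2 * Real.pi), Ψ (flowG t z)

/-- The solution `χ` of the homological equation `{G, χ} = Ψ - average Ψ`. -/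
def homological {d : ℕ} (Ψ : Phase d → ℝ) (z : Phase d) : ℝ :=
  1 / (2 * Real.pi) *
    ∫ t in (0 : ℝ)..(2 * Real.pi), t * (Ψ (flowG t z) - average Ψ (flowG t z))

/-! ### The resonant normal form -/

/-- The terms of the Lie series of `f` generated by the sequence `χ 1, χ 2, …`:
`f_0 = f` and `f_k = ∑ l = 1, …, k, (l / k) {χ_l, f_(k-l)}`. -/
def lieSeq {d : ℕ} {W : Type} [NormedAddCommGroup W] [NormedSpace ℝ W]
    (χ : ℕ → Phase d → ℝ) (f : Phase d → W) : ℕ → Phase d → W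
  | 0 => f
  | k + 1 => fun z => ∑ l : Fin (k + 1),
      (((l : ℕ) + 1 : ℝ) / ((k : ℝ) + 1)) • lieD (χ ((l : ℕ) + 1)) (lieSeq χ f (k - (l : ℕ))) z
  termination_by k => k

/-- The right-hand side of the homological equation of order `s + 1`, given the generating
sequence `χ` and the normal form terms `Z` of orders `1, …, s`:
`Ψ_(s+1) = F_(s+1) / (s + 1) + ∑ l = 1, …, s, (l / (s + 1)) {χ_l, Z_(s+1-l)}`, where
`F_(s+1)` is the term of index `s` in the Lie series of `F`. -/
def psiTerm {d : ℕ} (p : ℕ) (ε : ℝ) (χ Z : ℕ → Phase d → ℝ) (s : ℕ) (z : Phase d) : ℝ :=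
  1 / ((s : ℝ) + 1) * lieSeq χ (hamF p ε) s z
    + ∑ l ∈ Finset.Icc 1 s, ((l : ℝ) / ((s : ℝ) + 1)) * lieD (χ l) (Z (s + 1 - l)) z

/-- The construction of order `r`: the generating sequence `χ_1, …, χ_r` and the normal form terms
`Z_1, …, Z_r`, both continued by zero. -/
def normalForm {d : ℕ} (p : ℕ) (ε : ℝ) :
    ℕ → (ℕ → Phase d → ℝ) × (ℕ → Phase d → ℝ)
  | 0 => (fun _ _ => 0, fun _ _ => 0)
  | s + 1 =>
    let χ := (normalForm p ε s).1
    let Z := (normalForm p ε s).2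
    let Ψ := psiTerm p ε χ Z s
    (Function.update χ (s + 1) (homological Ψ), Function.update Z (s + 1) (average Ψ))

/-- The generating sequence of order `r`. -/
def genSeq {d : ℕ} (p : ℕ) (ε : ℝ) (r : ℕ) : ℕ → Phase d → ℝ := (normalForm p ε r).1

/-- The normal form term `Z_s` of order `ε ^ s` (for `1 ≤ s ≤ r`). -/
def nfTerm {d : ℕ} (p : ℕ) (ε : ℝ) (r s : ℕ) : Phase d → ℝ := (normalForm p ε r).2 s

/-- The terms `z_k` of the near-identity change of coordinates. -/
def coordTerm {d : ℕ} (p : ℕ) (ε : ℝ) (r k : ℕ) : Phase d → Phase d :=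
  lieSeq (genSeq p ε r) (fun z => z) k

/-- The change of coordinates of order `r`, from the normal form coordinates to the original
ones: `z + z_1 + z_2 + …`. -/
def coordMap {d : ℕ} (p : ℕ) (ε : ℝ) (r : ℕ) (z : Phase d) : Phase d :=
  ∑' k, coordTerm p ε r k z

/-- The truncated normal form `K = G + Z_1 + … + Z_r`. -/
def hamK {d : ℕ} (p : ℕ) (ε : ℝ) (r : ℕ) (z : Phase d) : ℝ :=
  hamG z + ∑ s ∈ Finset.Icc 1 r, nfTerm p ε r s z

/-- The Klein-Gordon Hamiltonian in the normal form coordinates of order `r`. -/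
def hamNF {d : ℕ} (p : ℕ) (ε : ℝ) (r : ℕ) (z : Phase d) : ℝ := hamH p ε (coordMap p ε r z)

/-! ### Solitons and breathers -/

/-- The phase point with complex coordinate `ψ = A e ^ (i θ)`, `A` real, where
`u = ψ + conj ψ` and `v = i (ψ - conj ψ)`. -/
def ofAmplitude {d : ℕ} (A : L2 d) (θ : ℝ) : Phase d :=
  mkPhase ((2 * Real.cos θ) • A) (-(2 * Real.sin θ) • A)

/-- The generalized stationary dNLS operator `f = f_0 + ε f_1`, which gives the amplitude equation
of the solutions `A e ^ (i (1 - ε Ω / 2) t)` of `dz/dt = X_K(z)`; the first normal form term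
contributes to `f_0`, the terms of orders `2, …, r` give `f_1`. -/
def genDnls {d : ℕ} (p : ℕ) (Ω ε : ℝ) (r : ℕ) (A : L2 d) : L2 d :=
  dnls p Ω A + ε • ((ε ^ 2)⁻¹ •
    (gradient (fun z => ∑ s ∈ Finset.Icc 2 r, nfTerm p ε r s z) (ofAmplitude A 0)).fst)

/-- The soliton `A e ^ (i (1 - ε Ω / 2) t)` of the normal form. -/
def soliton {d : ℕ} (Ω ε : ℝ) (A : L2 d) (t : ℝ) : Phase d :=
  ofAmplitude A ((1 - ε * Ω / 2) * t)

/-- The weighted space of Fourier coefficients: `b` in this space stands for the coefficients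
`A_m = b_m / (1 + m ^ 2)`, so its norm is `(∑ m, (1 + m ^ 2) ^ 2 ‖A_m‖ ^ 2) ^ (1/2)`. -/
abbrev L22 (d : ℕ) : Type := lp (fun _ : ℤ => L2 d) 2

/-- The Fourier coefficient `A_m` of an element of the weighted space. -/
def coeff {d : ℕ} (b : L22 d) (m : ℤ) : L2 d := (1 + (m : ℝ) ^ 2)⁻¹ • b m

/-- The periodic function with complex coordinate `ψ(τ) = ∑ m, A_m e ^ (i m τ)`. -/
def ofFourier {d : ℕ} (b : L22 d) (τ : ℝ) : Phase d :=
  ∑' m : ℤ, ofAmplitude (coeff b m) ((m : ℝ) * τ)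

/-- `b` gives a breather of frequency `w` in the normal form coordinates of order `r`: the
function `t ↦ ∑ m, A_m e ^ (i m w t)` stays in the ball of radius `R` and solves Hamilton's
equations of the transformed Klein-Gordon Hamiltonian. -/
def IsBreather {d : ℕ} (p : ℕ) (ε : ℝ) (r : ℕ) (R w : ℝ) (b : L22 d) : Prop :=
  ∀ t : ℝ, ‖ofFourier b (w * t)‖ < R ∧
    HasDerivAt (fun s => ofFourier b (w * s)) (hamField (hamNF p ε r) (ofFourier b (w * t))) t

/-- The distance `∑ m ≠ 1, ‖A_m‖ + ‖A_1 - B‖` of the Fourier coefficients from those of the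
soliton of amplitude `B`. -/
def fourierDist {d : ℕ} (b : L22 d) (B : L2 d) : ℝ :=
  ∑' m : ℤ, ‖coeff b m - if m = 1 then B else 0‖

/-- The couplings `ε < e` at which the construction of order `r ≥ 1` is used: `r ≤ ρ / ε`. -/
def Admissible (ρ e : ℝ) (r : ℕ) (ε : ℝ) : Prop := 1 ≤ r ∧ 0 < ε ∧ ε < e ∧ r * ε ≤ ρ

end KleinGordon

end

/-! Sizes. Every function in the normal form construction is a polynomial on the phase space. Its
size is measured by a real polynomial φ with nonnegative coefficients such that φ^(k)(‖z‖) bounds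
‖D^k f(z)‖ (`Maj`). If φ has degree at most N, then x φ'(x) ≤ N φ(x), so a derivative costs a factor
N/x on the same ball and no radius is given up (`Cls.fderiv_of_degree`). The degrees grow linearly
with the order, and the terms of order s turn out to have size about ε (C s ε)^(s-1)
(`normalForm_size`). Hence only r ε has to be small, and the remainder (C r ε)^r becomes
exponentially small at r = ⌊ρ/ε⌋.

Change of coordinates. Let η solve η' = -∑ t^l (l+1) X_{χ_{l+1}}(η). The recursion of the Lie series
says that ∑ t^k f_k(η(t)) does not depend on t, up to a tail for the partial sums; hence ∑ f_k(η(1))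
= f(η(0)) (`GenData.hasSum_curve`). With f the identity, T_r is the map η(1) ↦ η(0). With f = G and
f = F, H ∘ T_r is the sum of the Lie series of G and F, whose low orders are K_r by the homological
equations and whose tail is the remainder (`Size.exists_remainder`). The same argument for
derivatives shows that T_r is symplectic (`GenData.tsum_fderiv_hamC`).

Soliton. K_r is invariant under the flow of X_G and even under time reversal, so a soliton is a
solution of one amplitude equation. The average of F gives exactly the stationary dNLS equation, and
Z_2 + … + Z_r is O(ε²) uniformly in r. The amplitude equation is therefore an O(ε) perturbation in
C¹ of a nondegenerate problem (`exists_soliton`).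

Breather. It is constructed in the original coordinates, where no r occurs. In the rotating frame
the Klein–Gordon equation is a slow equation, and a reversible periodic orbit is a curve that meets
the reversal axis at the times 0 and π. At vanishing coupling this condition is the stationary dNLS
equation, so the implicit function theorem applies (`exists_kg_branch`). The frequency is a free
parameter and is set equal to that of the soliton, ω = 1 - εΩ/2; there is no phase drift to control.
The coefficients of order r are those of the image under the inverse of T_r.

Comparison. The image of the soliton under T_r solves the Klein–Gordon equation up to the remainder.
The implicit function theorem comes with a stability estimate: two approximate reversible solutions
differ by at most C/ε times their residual (`exists_kg_family`). At the optimal order this is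
exponentially small, the factor 1/ε being paid for by halving the rate. With zero residual the same
estimate is uniqueness. The uniform distance passes to the Fourier coefficients because the
equations also control the time derivative.

Analyticity. Polynomials act analytically on continuous curves by superposition, and Volterra
equations can be solved by the analytic implicit function theorem. The translates Z_ε(· + τ), and
their images under the inverse of T_r, are jointly analytic in (ε, τ). Time derivatives are
derivatives in τ, so they too are analytic in ε as continuous curves, and two of them give
coefficients in ℓ^{2,2}. -/

noncomputable section
open Polynomial
open scoped ContDiff

namespace KleinGordon

/-! ### Polynomial majorants -/

section Majorant
variable {E W V U : Type} [NormedAddCommGroup E] [NormedSpace ℝ E] [NormedAddCommGroup W]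
  [NormedSpace ℝ W] [NormedAddCommGroup V] [NormedSpace ℝ V] [NormedAddCommGroup U]
  [NormedSpace ℝ U]

/-- A polynomial with nonnegative coefficients is nonnegative and monotone on the half line. -/
theorem eval_nonneg_of_coeff {φ : ℝ[X]} (h : ∀ n, 0 ≤ φ.coeff n) {x : ℝ} (hx : 0 ≤ x) :
    0 ≤ φ.eval x := by
  rw [eval_eq_sum_range]
  exact Finset.sum_nonneg fun i _ => mul_nonneg (h i) (pow_nonneg hx i)

theorem eval_mono_of_coeff {φ : ℝ[X]} (h : ∀ n, 0 ≤ φ.coeff n) {x y : ℝ} (hx : 0 ≤ x)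
    (hxy : x ≤ y) : φ.eval x ≤ φ.eval y := by
  rw [eval_eq_sum_range, eval_eq_sum_range]
  exact Finset.sum_le_sum fun i _ =>
    mul_le_mul_of_nonneg_left (pow_le_pow_left₀ hx hxy i) (h i)

theorem derivative_coeff_nonneg {φ : ℝ[X]} (h : ∀ n, 0 ≤ φ.coeff n) (n : ℕ) :
    0 ≤ (derivative φ).coeff n := by
  rw [coeff_derivative]
  exact mul_nonneg (h _) (by positivity)

theorem iterate_derivative_coeff_nonneg {φ : ℝ[X]} (h : ∀ n, 0 ≤ φ.coeff n) (k n : ℕ) :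
    0 ≤ (derivative^[k] φ).coeff n := by
  induction k generalizing φ with
  | zero => exact h n
  | succ k ih => exact ih (derivative_coeff_nonneg h)

/-- The derivatives of `f` are dominated by those of the polynomial `φ` of the norm. -/
structure Maj (f : E → W) (φ : ℝ[X]) : Prop where
  smooth : ContDiff ℝ ∞ f
  nonneg : ∀ n, 0 ≤ φ.coeff n
  bound : ∀ k z, ‖iteratedFDeriv ℝ k f z‖ ≤ (derivative^[k] φ).eval ‖z‖

namespace Maj
variable {f g : E → W} {φ ψ : ℝ[X]}

theorem norm_le (h : Maj f φ) (z : E) : ‖f z‖ ≤ φ.eval ‖z‖ := by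
  simpa using h.bound 0 z

theorem fderiv (h : Maj f φ) : Maj (fderiv ℝ f) (derivative φ) where
  smooth := h.smooth.fderiv_right (m := ∞) (by simp)
  nonneg := derivative_coeff_nonneg h.nonneg
  bound k z := by
    rw [norm_iteratedFDeriv_fderiv]
    exact h.bound (k + 1) z

theorem of_fderiv (hf : ContDiff ℝ ∞ f) (hφ : ∀ n, 0 ≤ φ.coeff n)
    (h0 : ∀ z, ‖f z‖ ≤ φ.eval ‖z‖)
    (h1 : ∀ k z, ‖iteratedFDeriv ℝ k (_root_.fderiv ℝ f) z‖
      ≤ (derivative^[k] (derivative φ)).eval ‖z‖) : Maj f φ where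
  smooth := hf
  nonneg := hφ
  bound k z := by
    cases k with
    | zero => simpa using h0 z
    | succ k =>
      rw [← norm_iteratedFDeriv_fderiv]
      exact h1 k z

theorem add (hf : Maj f φ) (hg : Maj g ψ) : Maj (fun z => f z + g z) (φ + ψ) where
  smooth := hf.smooth.add hg.smooth
  nonneg n := by rw [coeff_add]; exact add_nonneg (hf.nonneg n) (hg.nonneg n)
  bound k z := by
    have := iteratedFDeriv_add_apply (i := k) (x := z)
      ((hf.smooth.of_le (mod_cast le_top : (k : WithTop ℕ∞) ≤ ∞)).contDiffAt)
      ((hg.smooth.of_le (mod_cast le_top : (k : WithTop ℕ∞) ≤ ∞)).contDiffAt)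
    have h2 : iteratedFDeriv ℝ k (fun z => f z + g z) z = _ := this
    rw [h2, iterate_map_add, eval_add]
    exact (norm_add_le _ _).trans (add_le_add (hf.bound k z) (hg.bound k z))

theorem const_smul (hf : Maj f φ) (c : ℝ) : Maj (fun z => c • f z) (|c| • φ) where
  smooth := contDiff_const.smul hf.smooth
  nonneg n := by
    rw [coeff_smul, smul_eq_mul]; exact mul_nonneg (abs_nonneg c) (hf.nonneg n)
  bound k z := by
    have := iteratedFDeriv_const_smul_apply (i := k) (x := z) (a := c)
      ((hf.smooth.of_le (mod_cast le_top : (k : WithTop ℕ∞) ≤ ∞)).contDiffAt)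
    have h2 : iteratedFDeriv ℝ k (fun z => c • f z) z = _ := this
    rw [h2, iterate_derivative_smul, eval_smul, norm_smul, smul_eq_mul, Real.norm_eq_abs]
    exact mul_le_mul_of_nonneg_left (hf.bound k z) (abs_nonneg c)

theorem sub (hf : Maj f φ) (hg : Maj g ψ) : Maj (fun z => f z - g z) (φ + ψ) := by
  have := hf.add (hg.const_smul (-1))
  simpa [sub_eq_add_neg] using this

theorem zero : Maj (fun _ : E => (0 : W)) 0 where
  smooth := contDiff_const
  nonneg n := by simp
  bound k z := by simp [iteratedFDeriv_fun_zero]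

/-- Leibniz' rule for a bilinear expression has the same binomial coefficients as Leibniz' rule for
φ ψ, so majorants multiply. -/
theorem bilin (hf : Maj f φ) {g : E → V} (hg : Maj g ψ) (B : W →L[ℝ] V →L[ℝ] U)
    (hB : ‖B‖ ≤ 1) : Maj (fun z => B (f z) (g z)) (φ * ψ) where
  smooth := (B.isBoundedBilinearMap.contDiff).comp (hf.smooth.prodMk hg.smooth)
  nonneg n := by
    rw [coeff_mul]
    exact Finset.sum_nonneg fun x _ => mul_nonneg (hf.nonneg _) (hg.nonneg _)
  bound k z := by
    refine (B.norm_iteratedFDeriv_le_of_bilinear_of_le_one hf.smooth hg.smooth z (n := k)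
      (mod_cast le_top) hB).trans ?_
    rw [mul_comm φ ψ, iterate_derivative_mul, eval_finsetSum]
    refine Finset.sum_le_sum fun i hi => ?_
    rw [eval_smul, eval_mul, nsmul_eq_mul, mul_assoc, mul_comm (eval _ _)]
    gcongr
    · exact eval_nonneg_of_coeff (iterate_derivative_coeff_nonneg hf.nonneg _) (norm_nonneg z)
    · exact hf.bound i z
    · exact hg.bound _ z

theorem clm (L : E →L[ℝ] W) : Maj (L : E → W) (‖L‖ • X) := by
  refine of_fderiv L.contDiff (fun n => ?_) (fun z => ?_) (fun k z => ?_)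
  · rw [coeff_smul, smul_eq_mul, coeff_X]; positivity
  · simpa using L.le_opNorm z
  · have : _root_.fderiv ℝ (L : E → W) = fun _ => L := by ext1 z; exact L.fderiv
    rw [this, derivative_smul, derivative_X]
    cases k with
    | zero => simp
    | succ k => simp [iteratedFDeriv_succ_const]

theorem mono_poly (hf : Maj f φ) (h : ∀ n, φ.coeff n ≤ ψ.coeff n) : Maj f ψ where
  smooth := hf.smooth
  nonneg n := (hf.nonneg n).trans (h n)
  bound k z := by
    refine (hf.bound k z).trans ?_
    have h1 : ∀ n, 0 ≤ (ψ - φ).coeff n := fun n => by rw [coeff_sub]; linarith [h n]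
    have h2 := eval_nonneg_of_coeff (iterate_derivative_coeff_nonneg h1 k) (norm_nonneg z)
    rw [iterate_derivative_sub, eval_sub] at h2
    linarith

theorem clm_comp (hf : Maj f φ) (L : W →L[ℝ] V) (hL : ‖L‖ ≤ 1) : Maj (fun z => L (f z)) φ where
  smooth := L.contDiff.comp hf.smooth
  nonneg := hf.nonneg
  bound k z := by
    refine (L.norm_iteratedFDeriv_comp_left (hf.smooth.contDiffAt (x := z)) (n := k)
      (mod_cast le_top)).trans ?_
    exact (mul_le_of_le_one_left (norm_nonneg _) hL).trans (hf.bound k z)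

/-- A majorant sees a point only through its norm. The isometries in question are the maps of the
flow of X_G, over which the averages are taken. -/
theorem comp_isometry (hf : Maj f φ) (L : E ≃ₗᵢ[ℝ] E) : Maj (fun z => f (L z)) φ where
  smooth := hf.smooth.comp L.contDiff
  nonneg := hf.nonneg
  bound k z := by
    have := L.norm_iteratedFDeriv_comp_right f z k
    have h2 : ‖iteratedFDeriv ℝ k (fun z => f (L z)) z‖ = _ := this
    rw [h2, ← L.norm_map z]
    exact hf.bound k (L z)

end Maj

/-! ### Majorants of integrals depending on a parameter -/

section Integral
open MeasureTheory

/-- Dominated differentiation under the integral sign; on the unit ball around z the derivatives are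
bounded by φ'(‖z‖ + 1), uniformly in t. -/
theorem hasFDerivAt_intervalIntegral {g : ℝ → E → W} {φ : ℝ[X]} {b : ℝ}
    (hb : 0 ≤ b) (hg : ContDiff ℝ ∞ (Function.uncurry g)) (h : ∀ t ∈ Set.Icc 0 b, Maj (g t) φ)
    (z : E) :
    HasFDerivAt (fun z => ∫ t in (0 : ℝ)..b, g t z)
      (∫ t in (0 : ℝ)..b, fderiv ℝ (g t) z) z := by
  have hg' : ContDiff ℝ ∞ (Function.uncurry fun t z => fderiv ℝ (g t) z) := by
    have : ContDiff ℝ ∞ (Function.uncurry fun (p : ℝ × E) z => g p.1 z) :=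
      hg.comp ((contDiff_fst.comp contDiff_fst).prodMk contDiff_snd)
    exact ContDiff.fderiv this contDiff_snd (by simp)
  have c1 : ∀ z, Continuous fun t => g t z := fun z =>
    hg.continuous.comp (continuous_id.prodMk continuous_const)
  have c2 : ∀ z, Continuous fun t => fderiv ℝ (g t) z := fun z =>
    hg'.continuous.comp (continuous_id.prodMk continuous_const)
  refine (intervalIntegral.hasFDerivAt_integral_of_dominated_of_fderiv_le (μ := volume)
    (s := Metric.ball z 1) (F' := fun z t => fderiv ℝ (g t) z)
    (bound := fun _ => (derivative φ).eval (‖z‖ + 1)) (Metric.ball_mem_nhds z one_pos)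
    (Filter.Eventually.of_forall fun z => (c1 z).aestronglyMeasurable)
    ((c1 z).intervalIntegrable _ _) ((c2 z).aestronglyMeasurable) ?_
    (by simp) ?_)
  · refine Filter.Eventually.of_forall fun t ht y hy => ?_
    rw [Set.uIoc_of_le hb] at ht
    have h' := h t (Set.Ioc_subset_Icc_self ht)
    refine (h'.fderiv.norm_le y).trans ?_
    refine eval_mono_of_coeff h'.fderiv.nonneg (norm_nonneg y) ?_
    have := norm_sub_norm_le y z
    rw [Metric.mem_ball, dist_eq_norm] at hy
    linarith
  · refine Filter.Eventually.of_forall fun t ht y _ => ?_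
    rw [Set.uIoc_of_le hb] at ht
    exact (((h t (Set.Ioc_subset_Icc_self ht)).smooth.differentiable (by simp)) y).hasFDerivAt

/-- The derivative of the integral is again an integral of the same kind, with majorant φ'.
Smoothness and the bounds follow by induction on the order. The auxiliary statements are made for
all target spaces because each differentiation changes the target. -/
theorem Maj.integral {b : ℝ} (hb : 0 ≤ b) {g : ℝ → E → W} {φ : ℝ[X]}
    (hg : ContDiff ℝ ∞ (Function.uncurry g)) (h : ∀ t ∈ Set.Icc 0 b, Maj (g t) φ) :
    Maj (fun z => ∫ t in (0 : ℝ)..b, g t z) (b • φ) := by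
  have key : ∀ {W : Type} [NormedAddCommGroup W] [NormedSpace ℝ W] {g : ℝ → E → W} {φ : ℝ[X]},
      ContDiff ℝ ∞ (Function.uncurry g) → (∀ t ∈ Set.Icc 0 b, Maj (g t) φ) → ∀ z,
        ‖∫ t in (0 : ℝ)..b, g t z‖ ≤ b * φ.eval ‖z‖ := by
    intro W _ _ g φ hg h z
    have := intervalIntegral.norm_integral_le_of_norm_le_const (a := 0) (b := b)
      (f := fun t => g t z)
      (fun t ht => (h t (by rw [Set.uIoc_of_le hb] at ht; exact Set.Ioc_subset_Icc_self ht)).norm_le z)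
    rwa [sub_zero, abs_of_nonneg hb, mul_comm] at this
  have hg' : ∀ {W : Type} [NormedAddCommGroup W] [NormedSpace ℝ W] {g : ℝ → E → W},
      ContDiff ℝ ∞ (Function.uncurry g) →
      ContDiff ℝ ∞ (Function.uncurry fun t z => _root_.fderiv ℝ (g t) z) := by
    intro W _ _ g hg
    have : ContDiff ℝ ∞ (Function.uncurry fun (p : ℝ × E) z => g p.1 z) :=
      hg.comp ((contDiff_fst.comp contDiff_fst).prodMk contDiff_snd)
    exact ContDiff.fderiv this contDiff_snd (by simp)
  have hd : ∀ {W : Type} [NormedAddCommGroup W] [NormedSpace ℝ W] {g : ℝ → E → W} {φ : ℝ[X]},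
      ContDiff ℝ ∞ (Function.uncurry g) → (∀ t ∈ Set.Icc 0 b, Maj (g t) φ) →
      _root_.fderiv ℝ (fun z => ∫ t in (0 : ℝ)..b, g t z)
        = fun z => ∫ t in (0 : ℝ)..b, _root_.fderiv ℝ (g t) z := by
    intro W _ _ g φ hg h
    ext1 z
    exact (hasFDerivAt_intervalIntegral hb hg h z).fderiv
  refine ⟨?_, fun n => ?_, ?_⟩
  · rw [contDiff_infty]
    intro n
    induction n generalizing W φ with
    | zero =>
      exact contDiff_zero.2 (continuous_iff_continuousAt.2 fun z =>
        (hasFDerivAt_intervalIntegral hb hg h z).continuousAt)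
    | succ n ih =>
      rw [Nat.cast_succ, contDiff_succ_iff_fderiv]
      refine ⟨fun z => (hasFDerivAt_intervalIntegral hb hg h z).differentiableAt, by simp, ?_⟩
      rw [hd hg h]
      exact ih (hg' hg) fun t ht => (h t ht).fderiv
  · rw [coeff_smul, smul_eq_mul]; exact mul_nonneg hb ((h 0 ⟨le_rfl, hb⟩).nonneg n)
  · intro k
    induction k generalizing W φ with
    | zero => intro z; simpa using key hg h z
    | succ k ih =>
      intro z
      rw [← norm_iteratedFDeriv_fderiv, hd hg h, Function.iterate_succ_apply, derivative_smul]
      exact ih (hg' hg) (fun t ht => (h t ht).fderiv) z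

end Integral

/-! ### Functions of bounded degree and size -/

/-- `f` is dominated by a polynomial of degree at most `N` whose value at `x` is at most `a`. -/
def Cls (x : ℝ) (N : ℕ) (a : ℝ) (f : E → W) : Prop :=
  ∃ φ : ℝ[X], φ.natDegree ≤ N ∧ φ.eval x ≤ a ∧ Maj f φ

/-- For a polynomial of degree `N` with nonnegative coefficients, `x φ'(x) ≤ N φ(x)`. -/
theorem mul_eval_derivative_le {φ : ℝ[X]} (h : ∀ n, 0 ≤ φ.coeff n) {N : ℕ}
    (hN : φ.natDegree ≤ N) {x : ℝ} (hx : 0 ≤ x) :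
    x * (derivative φ).eval x ≤ N * φ.eval x := by
  rw [derivative_eval, sum_over_range _ (by simp), Finset.mul_sum, eval_eq_sum_range,
    Finset.mul_sum]
  refine Finset.sum_le_sum fun i hi => ?_
  have hi' : i ≤ N := (Nat.lt_succ_iff.1 (Finset.mem_range.1 hi)).trans hN
  cases i with
  | zero => simpa using mul_nonneg (Nat.cast_nonneg N) (h 0)
  | succ i =>
    have : x * (φ.coeff (i + 1) * ((i + 1 : ℕ) : ℝ) * x ^ (i + 1 - 1))
      = ((i + 1 : ℕ) : ℝ) * (φ.coeff (i + 1) * x ^ (i + 1)) := by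
      rw [Nat.add_sub_cancel]; ring
    rw [this]
    exact mul_le_mul_of_nonneg_right (by exact_mod_cast hi')
      (mul_nonneg (h _) (pow_nonneg hx _))

/-- Cauchy's estimate for majorants. -/
theorem eval_half_derivative_le {φ : ℝ[X]} (h : ∀ n, 0 ≤ φ.coeff n) {x y : ℝ} (hy : 0 ≤ y)
    (hxy : y ≤ x) : (x - y) * (derivative φ).eval y ≤ φ.eval x := by
  rw [derivative_eval, sum_over_range _ (by simp), Finset.mul_sum, eval_eq_sum_range]
  refine Finset.sum_le_sum fun i _ => ?_
  cases i with
  | zero => simpa using h 0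
  | succ i =>
    -- The estimate for a single power, which is Bernoulli's inequality for x / y.
    have hB : ((i + 1 : ℕ) : ℝ) * y ^ i * (x - y) ≤ x ^ (i + 1) := by
      have h1 := one_add_mul_le_pow (a := x / y - 1) (by
        have : 0 ≤ x / y := div_nonneg (hy.trans hxy) hy
        linarith) (i + 1)
      rcases hy.eq_or_lt with rfl | hy'
      · rcases Nat.eq_zero_or_pos i with rfl | hi
        · simp
        · rw [zero_pow hi.ne']; simpa using pow_nonneg hxy _
      · have h2 : (1 + ((i + 1 : ℕ) : ℝ) * (x / y - 1)) * y ^ (i + 1) ≤ x ^ (i + 1) := by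
          refine (mul_le_mul_of_nonneg_right h1 (by positivity)).trans (le_of_eq ?_)
          rw [← mul_pow]; congr 1; field_simp; ring
        have h3 : (1 + ((i + 1 : ℕ) : ℝ) * (x / y - 1)) * y ^ (i + 1)
          = y ^ (i + 1) + ((i + 1 : ℕ) : ℝ) * y ^ i * (x - y) := by
          rw [pow_succ]; field_simp
        have : 0 ≤ y ^ (i + 1) := by positivity
        linarith
    rw [Nat.add_sub_cancel]
    have := mul_le_mul_of_nonneg_left hB (h (i + 1))
    calc (x - y) * (φ.coeff (i + 1) * ((i + 1 : ℕ) : ℝ) * y ^ i)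
        = φ.coeff (i + 1) * (((i + 1 : ℕ) : ℝ) * y ^ i * (x - y)) := by ring
      _ ≤ _ := this

namespace Cls
variable {f g : E → W} {x a b : ℝ} {N M : ℕ}

theorem smooth (h : Cls x N a f) : ContDiff ℝ ∞ f := h.choose_spec.2.2.smooth

theorem differentiable (h : Cls x N a f) : Differentiable ℝ f :=
  h.smooth.differentiable (by simp)

theorem nonneg (h : Cls x N a f) (hx : 0 ≤ x) : 0 ≤ a := by
  obtain ⟨φ, -, h2, h3⟩ := h
  exact (eval_nonneg_of_coeff h3.nonneg hx).trans h2

theorem mono (h : Cls x N a f) (hN : N ≤ M) (ha : a ≤ b) : Cls x M b f := by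
  obtain ⟨φ, h1, h2, h3⟩ := h
  exact ⟨φ, h1.trans hN, h2.trans ha, h3⟩

theorem congr (h : Cls x N a f) (e : ∀ z, g z = f z) : Cls x N a g := by
  rwa [funext e]

theorem norm_le (h : Cls x N a f) {z : E} (hz : ‖z‖ ≤ x) : ‖f z‖ ≤ a := by
  obtain ⟨φ, h1, h2, h3⟩ := h
  exact (h3.norm_le z).trans ((eval_mono_of_coeff h3.nonneg (norm_nonneg z) hz).trans h2)

theorem add (hf : Cls x N a f) (hg : Cls x N b g) : Cls x N (a + b) fun z => f z + g z := by
  obtain ⟨φ, h1, h2, h3⟩ := hf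
  obtain ⟨ψ, k1, k2, k3⟩ := hg
  exact ⟨φ + ψ, natDegree_add_le_of_degree_le h1 k1, by rw [eval_add]; linarith, h3.add k3⟩

theorem sub (hf : Cls x N a f) (hg : Cls x N b g) : Cls x N (a + b) fun z => f z - g z := by
  obtain ⟨φ, h1, h2, h3⟩ := hf
  obtain ⟨ψ, k1, k2, k3⟩ := hg
  exact ⟨φ + ψ, natDegree_add_le_of_degree_le h1 k1, by rw [eval_add]; linarith, h3.sub k3⟩

theorem const_smul (hf : Cls x N a f) (c : ℝ) : Cls x N (|c| * a) fun z => c • f z := by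
  obtain ⟨φ, h1, h2, h3⟩ := hf
  exact ⟨|c| • φ, (natDegree_smul_le _ _).trans h1, by
    rw [eval_smul, smul_eq_mul]; exact mul_le_mul_of_nonneg_left h2 (abs_nonneg c),
    h3.const_smul c⟩

theorem zero : Cls x N 0 (fun _ : E => (0 : W)) := ⟨0, by simp, by simp, Maj.zero⟩

theorem sum {ι : Type*} (s : Finset ι) {F : ι → E → W} {c : ι → ℝ}
    (h : ∀ i ∈ s, Cls x N (c i) (F i)) : Cls x N (∑ i ∈ s, c i) (fun z => ∑ i ∈ s, F i z) := by
  classical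
  induction s using Finset.induction_on with
  | empty => simpa using zero
  | insert a s ha ih =>
    simp only [Finset.sum_insert ha]
    exact (h a (by simp)).add (ih fun i hi => h i (by simp [hi]))

/-- The radius is kept and the price is the degree. All brackets of the recursive construction are
estimated in this way. -/
theorem fderiv_of_degree (hx : 0 < x) (h : Cls x N a f) : Cls x N (N * a / x) (fderiv ℝ f) := by
  obtain ⟨φ, h1, h2, h3⟩ := h
  refine ⟨derivative φ, (natDegree_derivative_le φ).trans (by omega), ?_, h3.fderiv⟩
  rw [le_div_iff₀ hx, mul_comm]
  exact (mul_eval_derivative_le h3.nonneg h1 hx.le).trans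
    (mul_le_mul_of_nonneg_left h2 (Nat.cast_nonneg N))

/-- Here the price is a part of the radius and the degree does not enter. This version serves where
a fixed number of derivatives must be bounded uniformly in the order. -/
theorem fderiv {y : ℝ} (hy : 0 ≤ y) (hyx : y < x) (h : Cls x N a f) :
    Cls y N (a / (x - y)) (fderiv ℝ f) := by
  obtain ⟨φ, h1, h2, h3⟩ := h
  refine ⟨derivative φ, (natDegree_derivative_le φ).trans (by omega), ?_, h3.fderiv⟩
  rw [le_div_iff₀ (sub_pos.2 hyx), mul_comm]
  exact (eval_half_derivative_le h3.nonneg hy hyx.le).trans h2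

theorem bilin (hx : 0 ≤ x) (hf : Cls x N a f) {g : E → V} (hg : Cls x M b g)
    (B : W →L[ℝ] V →L[ℝ] U) (hB : ‖B‖ ≤ 1) : Cls x (N + M) (a * b) fun z => B (f z) (g z) := by
  have ha := hf.nonneg hx
  obtain ⟨φ, h1, h2, h3⟩ := hf
  obtain ⟨ψ, k1, k2, k3⟩ := hg
  refine ⟨φ * ψ, natDegree_mul_le.trans (add_le_add h1 k1), ?_, h3.bilin k3 B hB⟩
  rw [eval_mul]
  exact mul_le_mul h2 k2 (eval_nonneg_of_coeff k3.nonneg hx) ha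

theorem clm_comp (hf : Cls x N a f) (L : W →L[ℝ] V) (hL : ‖L‖ ≤ 1) :
    Cls x N a fun z => L (f z) := by
  obtain ⟨φ, h1, h2, h3⟩ := hf
  exact ⟨φ, h1, h2, h3.clm_comp L hL⟩

theorem clm (L : E →L[ℝ] W) : Cls x 1 (‖L‖ * x) (L : E → W) :=
  ⟨‖L‖ • X, (natDegree_smul_le _ _).trans natDegree_X_le, by simp, Maj.clm L⟩

end Cls

end Majorant

/-! ### Linear maps of the phase space -/

section PhaseMaps
variable {d : ℕ}

@[simp] theorem mkPhase_fst (u v : L2 d) : (mkPhase u v).fst = u := rfl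
@[simp] theorem mkPhase_snd (u v : L2 d) : (mkPhase u v).snd = v := rfl

theorem phase_ext {z w : Phase d} (h1 : z.fst = w.fst) (h2 : z.snd = w.snd) : z = w :=
  (WithLp.ofLp_injective 2) (Prod.ext h1 h2)

theorem phase_norm_sq (z : Phase d) : ‖z‖ ^ 2 = ‖z.fst‖ ^ 2 + ‖z.snd‖ ^ 2 :=
  WithLp.prod_norm_sq_eq_of_L2 z

theorem phase_inner (z w : Phase d) :
    inner ℝ z w = inner ℝ z.fst w.fst + inner ℝ z.snd w.snd := WithLp.prod_inner_apply z w

theorem norm_fst_le (z : Phase d) : ‖z.fst‖ ≤ ‖z‖ := by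
  refine (sq_le_sq₀ (norm_nonneg _) (norm_nonneg z)).1 ?_
  rw [phase_norm_sq]; nlinarith [sq_nonneg ‖z.snd‖]

theorem norm_snd_le (z : Phase d) : ‖z.snd‖ ≤ ‖z‖ := by
  refine (sq_le_sq₀ (norm_nonneg _) (norm_nonneg z)).1 ?_
  rw [phase_norm_sq]; nlinarith [sq_nonneg ‖z.fst‖]

theorem norm_mkPhase_zero_right (u : L2 d) : ‖mkPhase u 0‖ = ‖u‖ := by
  have := phase_norm_sq (mkPhase u 0)
  simp only [mkPhase_fst, mkPhase_snd, norm_zero] at this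
  exact (pow_left_inj₀ (norm_nonneg _) (norm_nonneg _) two_ne_zero).1 (by linarith)

/-- The projection to the positions. -/
def fstC (d : ℕ) : Phase d →L[ℝ] L2 d := WithLp.fstL 2 ℝ (L2 d) (L2 d)
/-- The projection to the momenta. -/
def sndC (d : ℕ) : Phase d →L[ℝ] L2 d := WithLp.sndL 2 ℝ (L2 d) (L2 d)

@[simp] theorem fstC_apply (z : Phase d) : fstC d z = z.fst := rfl
@[simp] theorem sndC_apply (z : Phase d) : sndC d z = z.snd := rfl

theorem norm_fstC_le : ‖fstC d‖ ≤ 1 :=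
  ContinuousLinearMap.opNorm_le_bound _ zero_le_one fun z => by
    rw [one_mul]; exact norm_fst_le z

/-- The inclusion of the positions. -/
def inlC (d : ℕ) : L2 d →L[ℝ] Phase d :=
  LinearMap.mkContinuous
    { toFun := fun u => mkPhase u 0
      map_add' := fun u v => phase_ext rfl (by simp)
      map_smul' := fun c u => phase_ext rfl (by simp) } 1
    fun u => by rw [one_mul]; exact (norm_mkPhase_zero_right u).le

@[simp] theorem inlC_apply (u : L2 d) : inlC d u = mkPhase u 0 := rfl

theorem norm_inlC_le : ‖inlC d‖ ≤ 1 :=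
  ContinuousLinearMap.opNorm_le_bound _ zero_le_one fun z => by
    rw [one_mul]; exact (norm_mkPhase_zero_right z).le

/-- The symplectic matrix `(u, v) ↦ (v, -u)`. -/
def symp (d : ℕ) : Phase d ≃ₗᵢ[ℝ] Phase d where
  toFun z := mkPhase z.snd (-z.fst)
  invFun z := mkPhase (-z.snd) z.fst
  map_add' z w := phase_ext rfl (by simp [add_comm])
  map_smul' c z := phase_ext rfl (by simp)
  left_inv z := phase_ext (by simp) (by simp)
  right_inv z := phase_ext (by simp) (by simp)
  norm_map' z := by
    refine (pow_left_inj₀ (norm_nonneg _) (norm_nonneg _) two_ne_zero).1 ?_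
    rw [phase_norm_sq, phase_norm_sq]
    simp [add_comm]

theorem symp_apply (z : Phase d) : symp d z = mkPhase z.snd (-z.fst) := rfl

theorem symp_symp (z : Phase d) : symp d (symp d z) = -z :=
  phase_ext (by simp [symp_apply]) (by simp [symp_apply])

theorem inner_symp_left (z w : Phase d) : inner ℝ (symp d z) w = -inner ℝ z (symp d w) := by
  simp only [phase_inner, symp_apply, mkPhase_fst, mkPhase_snd, inner_neg_left, inner_neg_right]
  ring

/-- The reversal `(u, v) ↦ (u, -v)`. -/
def reversal (d : ℕ) : Phase d ≃ₗᵢ[ℝ] Phase d where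
  toFun z := mkPhase z.fst (-z.snd)
  invFun z := mkPhase z.fst (-z.snd)
  map_add' z w := phase_ext rfl (by simp [add_comm])
  map_smul' c z := phase_ext rfl (by simp)
  left_inv z := phase_ext (by simp) (by simp)
  right_inv z := phase_ext (by simp) (by simp)
  norm_map' z := by
    refine (pow_left_inj₀ (norm_nonneg _) (norm_nonneg _) two_ne_zero).1 ?_
    rw [phase_norm_sq, phase_norm_sq]
    simp

theorem reversal_apply (z : Phase d) : reversal d z = mkPhase z.fst (-z.snd) := rfl

theorem reversal_reversal (z : Phase d) : reversal d (reversal d z) = z :=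
  phase_ext (by simp [reversal_apply]) (by simp [reversal_apply])

theorem symp_reversal (z : Phase d) : symp d (reversal d z) = -reversal d (symp d z) :=
  phase_ext (by simp [symp_apply, reversal_apply]) (by simp [symp_apply, reversal_apply])

theorem inner_reversal (z w : Phase d) :
    inner ℝ (reversal d z) (reversal d w) = inner ℝ z w := (reversal d).inner_map_map z w

theorem flowG_flowG (s t : ℝ) (z : Phase d) : flowG s (flowG t z) = flowG (s + t) z := by
  refine phase_ext ?_ ?_ <;>
  · simp only [flowG, mkPhase_fst, mkPhase_snd, Real.cos_add, Real.sin_add]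
    module

theorem flowG_zero (z : Phase d) : flowG 0 z = z :=
  phase_ext (by simp [flowG]) (by simp [flowG])

/-- The flow of `X_G` as an isometry. -/
def flowE (d : ℕ) (t : ℝ) : Phase d ≃ₗᵢ[ℝ] Phase d where
  toFun z := flowG t z
  invFun z := flowG (-t) z
  map_add' z w := by
    refine phase_ext ?_ ?_ <;>
    · simp only [flowG, mkPhase_fst, mkPhase_snd, WithLp.add_fst, WithLp.add_snd]
      module
  map_smul' c z := by
    refine phase_ext ?_ ?_ <;>
    · simp only [flowG, mkPhase_fst, mkPhase_snd, WithLp.smul_fst, WithLp.smul_snd,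
        RingHom.id_apply]
      module
  left_inv z := by
    change flowG (-t) (flowG t z) = z
    rw [flowG_flowG, neg_add_cancel, flowG_zero]
  right_inv z := by
    change flowG t (flowG (-t) z) = z
    rw [flowG_flowG, add_neg_cancel, flowG_zero]
  norm_map' z := by
    refine (pow_left_inj₀ (norm_nonneg _) (norm_nonneg _) two_ne_zero).1 ?_
    rw [phase_norm_sq, phase_norm_sq]
    simp only [flowG, mkPhase_fst, mkPhase_snd, LinearEquiv.coe_mk, LinearMap.coe_mk, AddHom.coe_mk]
    rw [norm_add_sq_real, norm_add_sq_real]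
    simp only [norm_smul, inner_smul_left, inner_smul_right, Real.norm_eq_abs, mul_pow, sq_abs,
      abs_neg, conj_trivial, map_neg]
    have := Real.sin_sq_add_cos_sq t
    linear_combination (‖z.fst‖ ^ 2 + ‖z.snd‖ ^ 2) * this

theorem flowE_apply (t : ℝ) (z : Phase d) : flowE d t z = flowG t z := rfl

theorem norm_flowG (t : ℝ) (z : Phase d) : ‖flowG t z‖ = ‖z‖ := (flowE d t).norm_map z

theorem flowG_eq (t : ℝ) (z : Phase d) :
    flowG t z = Real.cos t • z + Real.sin t • symp d z := by
  refine phase_ext rfl ?_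
  simp only [flowG, symp_apply, mkPhase_snd, WithLp.add_snd, WithLp.smul_snd]
  module

theorem flowG_symp (t : ℝ) (z : Phase d) : flowG t (symp d z) = symp d (flowG t z) := by
  simp only [flowG_eq, map_add, map_smul]

theorem flowG_reversal (t : ℝ) (z : Phase d) :
    flowG t (reversal d z) = reversal d (flowG (-t) z) := by
  simp only [flowG_eq, map_add, map_smul, symp_reversal, Real.cos_neg, Real.sin_neg, neg_smul,
    smul_neg]
  simp

theorem inner_flowG (t : ℝ) (z w : Phase d) :
    inner ℝ (flowG t z) (flowG t w) = inner ℝ z w := (flowE d t).inner_map_map z w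

theorem inner_flowG_left (t : ℝ) (z w : Phase d) :
    inner ℝ (flowG t z) w = inner ℝ z (flowG (-t) w) := by
  rw [← inner_flowG t z, flowG_flowG, add_neg_cancel, flowG_zero]

theorem flowG_add_two_pi (t : ℝ) (z : Phase d) : flowG (t + 2 * Real.pi) z = flowG t z := by
  simp [flowG_eq]

theorem contDiff_flowG : ContDiff ℝ ∞ (Function.uncurry (flowG (d := d))) := by
  have : Function.uncurry (flowG (d := d))
      = fun p : ℝ × Phase d => Real.cos p.1 • p.2 + Real.sin p.1 • symp d p.2 := by
    ext1 p; exact flowG_eq p.1 p.2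
  rw [this]
  exact ((Real.contDiff_cos.comp contDiff_fst).smul contDiff_snd).add
    ((Real.contDiff_sin.comp contDiff_fst).smul ((symp d).contDiff.comp contDiff_snd))

theorem hasDerivAt_flowG (t : ℝ) (z : Phase d) :
    HasDerivAt (fun s => flowG s z) (symp d (flowG t z)) t := by
  have h : HasDerivAt (fun s => Real.cos s • z + Real.sin s • symp d z)
      (-Real.sin t • z + Real.cos t • symp d z) t :=
    ((Real.hasDerivAt_cos t).smul_const z).add ((Real.hasDerivAt_sin t).smul_const _)
  have e : symp d (flowG t z) = -Real.sin t • z + Real.cos t • symp d z := by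
    rw [flowG_eq, map_add, map_smul, map_smul, symp_symp]; module
  rw [e]
  exact h.congr_of_eventuallyEq (Filter.Eventually.of_forall fun s => flowG_eq s z)

theorem ofAmplitude_eq (A : L2 d) (θ : ℝ) : ofAmplitude A θ = flowG θ (mkPhase ((2 : ℝ) • A) 0) := by
  refine phase_ext ?_ ?_ <;>
  · simp only [ofAmplitude, flowG, mkPhase_fst, mkPhase_snd]
    module

theorem norm_ofAmplitude (A : L2 d) (θ : ℝ) : ‖ofAmplitude A θ‖ = 2 * ‖A‖ := by
  rw [ofAmplitude_eq, norm_flowG, norm_mkPhase_zero_right, norm_smul]; simp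

/-- The linear map from covectors to Hamiltonian vectors. -/
def hamC (d : ℕ) : (Phase d →L[ℝ] ℝ) →L[ℝ] Phase d :=
  LinearMap.mkContinuous
    { toFun := fun l => symp d ((InnerProductSpace.toDual ℝ (Phase d)).symm l)
      map_add' := fun l m => by simp
      map_smul' := fun c l => by simp } 1
    fun l => by simp

theorem norm_hamC_le : ‖hamC d‖ ≤ 1 := LinearMap.mkContinuous_norm_le _ zero_le_one _

theorem hamField_eq (f : Phase d → ℝ) (z : Phase d) : hamField f z = hamC d (fderiv ℝ f z) := rfl

theorem hamField_eq_symp (f : Phase d → ℝ) (z : Phase d) :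
    hamField f z = symp d (gradient f z) := rfl

theorem inner_symp_hamC (l : Phase d →L[ℝ] ℝ) (w : Phase d) :
    inner ℝ (symp d (hamC d l)) w = -l w := by
  change inner ℝ (symp d (symp d ((InnerProductSpace.toDual ℝ (Phase d)).symm l))) w = _
  rw [symp_symp, inner_neg_left, InnerProductSpace.toDual_symm_apply]

theorem inner_gradient (f : Phase d → ℝ) (z w : Phase d) :
    inner ℝ (gradient f z) w = fderiv ℝ f z w := InnerProductSpace.toDual_symm_apply

end PhaseMaps

/-! ### Size of the Lie series -/

section LieBounds
variable {d : ℕ} {W : Type} [NormedAddCommGroup W] [NormedSpace ℝ W]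

theorem Cls.hamField {x a : ℝ} {N : ℕ} {χ : Phase d → ℝ} (hx : 0 < x) (h : Cls x N a χ) :
    Cls x N (N * a / x) (hamField χ) :=
  (h.fderiv_of_degree hx).clm_comp (hamC d) norm_hamC_le

/-- A bracket is a product of two first derivatives, each costing degree over radius. The degree is
not lowered by two; additive degrees are enough and make the bookkeeping linear in the order. -/
theorem Cls.lieD {x a b : ℝ} {N M : ℕ} {χ : Phase d → ℝ} {g : Phase d → W} (hx : 0 < x)
    (hχ : Cls x N a χ) (hg : Cls x M b g) :
    Cls x (N + M) ((M * b / x) * (N * a / x)) (lieD χ g) := by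
  have := (hg.fderiv_of_degree hx).bilin hx.le (hχ.hamField hx)
    (ContinuousLinearMap.id ℝ (Phase d →L[ℝ] W)) ContinuousLinearMap.norm_id_le
  rw [add_comm N M]
  exact this

theorem lieSeq_zero (χ : ℕ → Phase d → ℝ) (f : Phase d → W) : lieSeq χ f 0 = f := by
  rw [lieSeq]

theorem lieSeq_succ (χ : ℕ → Phase d → ℝ) (f : Phase d → W) (k : ℕ) (z : Phase d) :
    lieSeq χ f (k + 1) z = ∑ l ∈ Finset.range (k + 1),
      (((l : ℝ) + 1) / ((k : ℝ) + 1)) • lieD (χ (l + 1)) (lieSeq χ f (k - l)) z := by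
  rw [lieSeq, Finset.sum_range]

/-- In the bracket of χ_{l+1} with the term of index k - l the two derivatives cost D (l+1) and D
(k-l+1). The weight 1/(k+1) of the recursion absorbs the second factor; what is left is (l+1)²,
which the hypothesis on the sum pays for. Thus the ratio μ is the same for all k although the
degrees are unbounded. -/
theorem Cls.lieSeq {χ : ℕ → Phase d → ℝ} {D : ℕ} {a : ℕ → ℝ} {μ b x : ℝ} (hx : 0 < x)
    (hμ : 0 < μ) (hχ : ∀ l, 1 ≤ l → Cls x (D * l) (a l) (χ l))
    (hsum : ∀ n, ∑ l ∈ Finset.range n,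
      (D / x) ^ 2 * ((l : ℝ) + 1) ^ 2 * a (l + 1) * (μ ^ (l + 1))⁻¹ ≤ 1)
    {f : Phase d → W} (hf : Cls x D b f) (k : ℕ) :
    Cls x (D * (k + 1)) (μ ^ k * b) (lieSeq χ f k) := by
  induction k using Nat.strong_induction_on with
  | _ k ih =>
    cases k with
    | zero => simpa [lieSeq_zero] using hf
    | succ k =>
      have hb := hf.nonneg hx.le
      have e : KleinGordon.lieSeq χ f (k + 1) = fun z => ∑ l ∈ Finset.range (k + 1),
          (((l : ℝ) + 1) / ((k : ℝ) + 1)) •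
            KleinGordon.lieD (χ (l + 1)) (KleinGordon.lieSeq χ f (k - l)) z := by
        ext1 z; exact lieSeq_succ χ f k z
      rw [e]
      have h1 : ∀ l ∈ Finset.range (k + 1), Cls x (D * (k + 1 + 1))
          (((D / x) ^ 2 * ((l : ℝ) + 1) ^ 2 * a (l + 1) * (μ ^ (l + 1))⁻¹) * (μ ^ (k + 1) * b))
          (fun z => (((l : ℝ) + 1) / ((k : ℝ) + 1)) •
            KleinGordon.lieD (χ (l + 1)) (KleinGordon.lieSeq χ f (k - l)) z) := by
        intro l hl
        have hl' : l ≤ k := Nat.lt_succ_iff.1 (Finset.mem_range.1 hl)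
        have hA := (hχ (l + 1) (by omega)).nonneg hx.le
        refine ((Cls.lieD hx (hχ (l + 1) (by omega)) (ih (k - l) (by omega))).const_smul
          (((l : ℝ) + 1) / ((k : ℝ) + 1))).mono ?_ ?_
        · rw [← mul_add]
          exact Nat.mul_le_mul_left _ (by omega)
        · have hk : (0 : ℝ) < (k : ℝ) + 1 := by positivity
          rw [abs_of_nonneg (by positivity)]
          push_cast [Nat.cast_sub hl']
          have h2 : μ ^ (k + 1) = μ ^ (k - l) * μ ^ (l + 1) := by
            rw [← pow_add]; congr 1; omega
          rw [h2]
          have h3 : ((k : ℝ) - l + 1) / (k + 1) ≤ 1 := by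
            rw [div_le_one hk]; linarith [(Nat.cast_nonneg l : (0 : ℝ) ≤ l)]
          have h4 : 0 ≤ (D / x) ^ 2 * ((l : ℝ) + 1) ^ 2 * a (l + 1) * (μ ^ (k - l) * b) := by
            positivity
          calc ((l : ℝ) + 1) / (k + 1) * (D * (k - l + 1) * (μ ^ (k - l) * b) / x
                * (D * (l + 1) * a (l + 1) / x))
              = ((k : ℝ) - l + 1) / (k + 1) *
                ((D / x) ^ 2 * ((l : ℝ) + 1) ^ 2 * a (l + 1) * (μ ^ (k - l) * b)) := by ring
            _ ≤ 1 * ((D / x) ^ 2 * ((l : ℝ) + 1) ^ 2 * a (l + 1) * (μ ^ (k - l) * b)) :=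
                mul_le_mul_of_nonneg_right h3 h4
            _ = _ := by field_simp
      refine (Cls.sum _ h1).mono le_rfl ?_
      rw [← Finset.sum_mul]
      exact mul_le_of_le_one_left (by positivity) (hsum _)

end LieBounds

/-! ### The Klein-Gordon Hamiltonian -/

section Hamiltonian
variable {d : ℕ}

theorem l2_inner (u w : L2 d) : inner ℝ u w = ∑' j, u j * w j := by
  rw [lp.inner_eq_tsum]
  exact tsum_congr fun j => by simp [mul_comm]

theorem l2_summable_mul (u w : L2 d) : Summable fun j => u j * w j := by
  have := lp.summable_inner (𝕜 := ℝ) u w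
  exact this.congr fun j => by simp [mul_comm]

theorem shift_shift (k l : Fin d → ℤ) (u : L2 d) : shift k (shift l u) = shift (k + l) u := by
  ext n; simp [add_assoc]

theorem inner_shift_shift (k : Fin d → ℤ) (u w : L2 d) :
    inner ℝ (shift k u) (shift k w) = inner ℝ u w := by
  rw [l2_inner, l2_inner]
  exact (Equiv.addRight k).tsum_eq fun n => u n * w n

theorem inner_shift_right (k : Fin d → ℤ) (u w : L2 d) :
    inner ℝ u (shift k w) = inner ℝ (shift (-k) u) w := by
  rw [← inner_shift_shift k (shift (-k) u) w, shift_shift, add_neg_cancel]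
  congr 1
  ext n; simp

theorem norm_mulOp_le (a : L2 d) : ‖mulOp a‖ ≤ ‖a‖ := by
  unfold mulOp
  exact LinearMap.mkContinuous_norm_le _ (norm_nonneg a) _

/-- Componentwise multiplication as a bounded bilinear map. -/
def mulB (d : ℕ) : L2 d →L[ℝ] L2 d →L[ℝ] L2 d :=
  LinearMap.mkContinuous
    { toFun := mulOp
      map_add' := fun a b => by ext x n; exact add_mul (a n) (b n) (x n)
      map_smul' := fun c a => by ext x n; exact mul_assoc c (a n) (x n) } 1
    fun a => by rw [one_mul]; exact norm_mulOp_le a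

@[simp] theorem mulB_apply (a : L2 d) : mulB d a = mulOp a := rfl

theorem norm_mulB_le : ‖mulB d‖ ≤ 1 := LinearMap.mkContinuous_norm_le _ zero_le_one _

theorem mulOp_pow_apply (a x : L2 d) (k : ℕ) (n : Fin d → ℤ) :
    (mulOp a ^ k) x n = a n ^ k * x n := by
  induction k with
  | zero => simp
  | succ k ih =>
    rw [pow_succ']
    change a n * (mulOp a ^ k) x n = _
    rw [ih]; ring

theorem inner_mulOp_pow (a x y : L2 d) (k : ℕ) :
    inner ℝ ((mulOp a ^ k) x) y = inner ℝ x ((mulOp a ^ k) y) := by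
  rw [l2_inner, l2_inner]
  exact tsum_congr fun j => by rw [mulOp_pow_apply, mulOp_pow_apply]; ring

/-- The componentwise power `u ^ (k + 1)`. -/
def upow (k : ℕ) (u : L2 d) : L2 d := (mulOp u ^ k) u

theorem upow_succ (k : ℕ) (u : L2 d) : upow (k + 1) u = mulB d u (upow k u) := by
  rw [upow, pow_succ']; rfl

theorem upow_apply (k : ℕ) (u : L2 d) (n : Fin d → ℤ) : upow k u n = u n ^ (k + 1) := by
  rw [upow, mulOp_pow_apply, pow_succ]

theorem hasFDerivAt_upow (k : ℕ) (u : L2 d) :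
    HasFDerivAt (upow k) (((k : ℝ) + 1) • mulOp u ^ k) u := by
  induction k with
  | zero =>
    have : (upow 0 : L2 d → L2 d) = fun u => u := by ext u n; simp [upow]
    rw [this]
    have h2 : (((0 : ℕ) : ℝ) + 1) • mulOp u ^ 0 = ContinuousLinearMap.id ℝ (L2 d) := by
      simp; rfl
    rw [h2]
    exact hasFDerivAt_id u
  | succ k ih =>
    have h1 := (mulB d).hasFDerivAt_of_bilinear (hasFDerivAt_id u) ih
    have h2 : (upow (k + 1) : L2 d → L2 d) = fun u => mulB d (id u) (upow k u) := by
      ext1 u; exact upow_succ k u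
    rw [h2]
    refine h1.congr_fderiv ?_
    ext h n
    change u n * (((k : ℝ) + 1) * (mulOp u ^ k) h n) + h n * upow k u n
      = (((k + 1 : ℕ) : ℝ) + 1) * (mulOp u ^ (k + 1)) h n
    rw [mulOp_pow_apply, mulOp_pow_apply, upow_apply]
    push_cast; ring

/-- The force `u ^ (2 p + 1) - Δ u`. -/
def force (p : ℕ) (u : L2 d) : L2 d := upow (2 * p) u - laplacian d u

theorem hamG_eq (z : Phase d) : hamG z = 1 / 2 * inner ℝ z z := by
  rw [hamG, phase_inner, l2_inner, l2_inner,
    ← (l2_summable_mul z.fst z.fst).tsum_add (l2_summable_mul z.snd z.snd)]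
  simp only [pow_two]

/-- The difference operator in direction `i`. -/
def diffOp (i : Fin d) : L2 d →L[ℝ] L2 d := shift (unit i) - ContinuousLinearMap.id ℝ (L2 d)

/-- Summation by parts. Only the positive directions occur, which is how each bond is counted once;
the two shifts of the Laplacian come from the two cross terms. -/
theorem sum_inner_diffOp (u w : L2 d) :
    ∑ i, inner ℝ (diffOp i u) (diffOp i w) = -inner ℝ (laplacian d u) w := by
  rw [laplacian, _root_.sum_apply, sum_inner, ← Finset.sum_neg_distrib]
  refine Finset.sum_congr rfl fun i _ => ?_
  simp only [diffOp, _root_.sub_apply, _root_.add_apply,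
    _root_.smul_apply, ContinuousLinearMap.id_apply, inner_sub_left,
    inner_sub_right, inner_add_left, inner_smul_left, conj_trivial]
  rw [inner_shift_shift, inner_shift_right]
  ring

theorem hamF_eq (p : ℕ) (ε : ℝ) (z : Phase d) :
    hamF p ε z = ε / (2 * p + 2) * inner ℝ z.fst (upow (2 * p) z.fst)
      + ε / 2 * ∑ i, inner ℝ (diffOp i z.fst) (diffOp i z.fst) := by
  rw [hamF]
  congr 2
  · rw [l2_inner]
    exact tsum_congr fun j => by rw [upow_apply]; ring
  · simp only [l2_inner]
    rw [← Summable.tsum_finsetSum fun i _ => l2_summable_mul (diffOp i z.fst) (diffOp i z.fst)]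
    refine tsum_congr fun j => Finset.sum_congr rfl fun i _ => ?_
    rw [pow_two]; rfl

theorem hasFDerivAt_hamG (z : Phase d) : HasFDerivAt hamG (innerSL ℝ z) z := by
  have h : HasFDerivAt (fun z : Phase d => 1 / 2 * inner ℝ z z) _ z :=
    ((hasFDerivAt_id z).inner ℝ (hasFDerivAt_id z)).const_mul (1 / 2 : ℝ)
  have e : (hamG : Phase d → ℝ) = fun z => 1 / 2 * inner ℝ z z := by ext1 z; exact hamG_eq z
  rw [e]
  refine h.congr_fderiv ?_
  ext h
  simp only [id, _root_.smul_apply, ContinuousLinearMap.comp_apply,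
    fderivInnerCLM_apply, ContinuousLinearMap.prod_apply, ContinuousLinearMap.id_apply,
    innerSL_apply_apply, smul_eq_mul]
  rw [real_inner_comm z h]; ring

theorem hasFDerivAt_hamF (p : ℕ) (ε : ℝ) (z : Phase d) :
    HasFDerivAt (hamF p ε) (ε • (innerSL ℝ (force p z.fst)).comp (fstC d)) z := by
  have hf : HasFDerivAt (fun z : Phase d => z.fst) (fstC d) z := (fstC d).hasFDerivAt
  have h1 := (hf.inner ℝ ((hasFDerivAt_upow (2 * p) z.fst).comp z hf)).const_mul
    (ε / (2 * p + 2))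
  have h2 : ∀ i ∈ (Finset.univ : Finset (Fin d)),
      HasFDerivAt (fun z : Phase d => inner ℝ (diffOp i z.fst) (diffOp i z.fst)) _ z := fun i _ =>
    (((diffOp i).hasFDerivAt.comp z hf).inner ℝ ((diffOp i).hasFDerivAt.comp z hf))
  have h3 := h1.add ((HasFDerivAt.fun_sum h2).const_mul (ε / 2))
  refine (h3.congr_of_eventuallyEq (Filter.Eventually.of_forall fun z => hamF_eq p ε z)).congr_fderiv ?_
  ext h
  simp only [_root_.add_apply, _root_.smul_apply,
    ContinuousLinearMap.comp_apply, fderivInnerCLM_apply, ContinuousLinearMap.prod_apply,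
    innerSL_apply_apply, smul_eq_mul, fstC_apply, Function.comp, _root_.sum_apply,
    force, inner_sub_left, inner_smul_right]
  have h4 : ∑ i, (inner ℝ (diffOp i z.fst) (diffOp i h.fst)
      + inner ℝ (diffOp i h.fst) (diffOp i z.fst)) = -(2 * inner ℝ (laplacian d z.fst) h.fst) := by
    simp only [real_inner_comm (diffOp _ z.fst) (diffOp _ h.fst)]
    rw [← Finset.sum_add_distrib.symm, sum_inner_diffOp]; ring
  rw [h4, upow, inner_mulOp_pow, real_inner_comm _ h.fst, inner_mulOp_pow]
  have : (2 * (p : ℝ) + 2) ≠ 0 := by positivity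
  push_cast
  field_simp
  ring

theorem gradient_hamG (z : Phase d) : gradient hamG z = z := by
  rw [gradient, (hasFDerivAt_hamG z).fderiv]
  exact (InnerProductSpace.toDual ℝ (Phase d)).symm_apply_apply z

theorem gradient_hamF (p : ℕ) (ε : ℝ) (z : Phase d) :
    gradient (hamF p ε) z = mkPhase (ε • force p z.fst) 0 := by
  refine ext_inner_right ℝ fun w => ?_
  rw [inner_gradient, (hasFDerivAt_hamF p ε z).fderiv, phase_inner]
  simp [inner_smul_left]

theorem hamField_hamG (z : Phase d) : hamField hamG z = symp d z := by
  rw [hamField_eq_symp, gradient_hamG]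

theorem hamField_hamF (p : ℕ) (ε : ℝ) (z : Phase d) :
    hamField (hamF p ε) z = mkPhase 0 (-(ε • force p z.fst)) := by
  rw [hamField_eq_symp, gradient_hamF]; rfl

theorem hamF_smul (p : ℕ) (ε : ℝ) (z : Phase d) : hamF p ε z = ε * hamF p 1 z := by
  rw [hamF_eq, hamF_eq]; ring

section Sizes
variable {x : ℝ}

theorem cls_fst (hx : 0 ≤ x) : Cls x 1 x (fun z : Phase d => z.fst) :=
  (Cls.clm (fstC d)).mono le_rfl (mul_le_of_le_one_left hx norm_fstC_le)

theorem cls_upow (hx : 0 ≤ x) (k : ℕ) :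
    Cls x (k + 1) (x ^ (k + 1)) (fun z : Phase d => upow k z.fst) := by
  induction k with
  | zero =>
    have : (fun z : Phase d => upow 0 z.fst) = fun z => z.fst := by ext z n; simp [upow_apply]
    rw [this]
    simpa using cls_fst hx
  | succ k ih =>
    have := (cls_fst (d := d) hx).bilin hx ih (mulB d) norm_mulB_le
    have e : (fun z : Phase d => upow (k + 1) z.fst)
      = fun z => mulB d z.fst (upow k z.fst) := by ext1 z; exact upow_succ k z.fst
    rw [e, add_comm (k + 1) 1, pow_add, pow_one]
    exact this

theorem norm_innerSL_le_one {E : Type} [NormedAddCommGroup E] [InnerProductSpace ℝ E] :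
    ‖(innerSL ℝ : E →L[ℝ] E →L[ℝ] ℝ)‖ ≤ 1 :=
  ContinuousLinearMap.opNorm_le_bound _ zero_le_one fun x => by
    rw [one_mul, innerSL_apply_norm]

theorem exists_cls_hamF (hx : 0 ≤ x) (p : ℕ) :
    ∃ a, Cls x (2 * p + 2) a (hamF (d := d) p 1) := by
  have h1 := ((cls_fst (d := d) hx).bilin hx (cls_upow hx (2 * p)) (innerSL ℝ)
    norm_innerSL_le_one).const_smul (1 / (2 * p + 2))
  have hD : ∀ i : Fin d, Cls x 1 (‖(diffOp i).comp (fstC d)‖ * x)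
      (fun z : Phase d => diffOp i z.fst) := fun i => Cls.clm ((diffOp i).comp (fstC d))
  have h2 : ∀ i ∈ (Finset.univ : Finset (Fin d)), Cls x 2 _
    (fun z : Phase d => innerSL ℝ (diffOp i z.fst) (diffOp i z.fst)) := fun i _ =>
    (hD i).bilin hx (hD i) (innerSL ℝ) norm_innerSL_le_one
  have h3 := ((Cls.sum _ h2).const_smul (1 / 2)).mono (M := 2 * p + 2) (by omega) le_rfl
  have h4 := (h1.mono (M := 2 * p + 2) (by omega) le_rfl).add h3
  exact ⟨_, h4.congr fun z => hamF_eq p 1 z⟩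

theorem cls_hamG (hx : 0 ≤ x) : Cls x 2 (x ^ 2) (hamG (d := d)) := by
  have h0 : Cls x 1 x (ContinuousLinearMap.id ℝ (Phase d) : Phase d → Phase d) :=
    (Cls.clm _).mono le_rfl (mul_le_of_le_one_left hx ContinuousLinearMap.norm_id_le)
  have h1 := (h0.bilin hx h0 (innerSL ℝ) norm_innerSL_le_one).const_smul (1 / 2)
  refine (h1.congr fun z => hamG_eq z).mono le_rfl ?_
  rw [abs_of_nonneg (by norm_num)]
  nlinarith [sq_nonneg x]

theorem cls_id (hx : 0 ≤ x) : Cls x 1 x (fun z : Phase d => z) :=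
  (Cls.clm (ContinuousLinearMap.id ℝ (Phase d))).mono le_rfl
    (mul_le_of_le_one_left hx ContinuousLinearMap.norm_id_le)

end Sizes
end Hamiltonian

/-! ### Size of the normal form -/

/-! ### Convolution sums -/

section Sums

/-- Each of the m + 1 denominators is at least m + 1. -/
theorem sum_inv_mul_le (m : ℕ) :
    ∑ l ∈ Finset.range (m + 1), (((l : ℝ) + 1) * ((m : ℝ) - l + 1))⁻¹ ≤ 1 := by
  have : ∀ l ∈ Finset.range (m + 1),
      (((l : ℝ) + 1) * ((m : ℝ) - l + 1))⁻¹ ≤ ((m : ℝ) + 1)⁻¹ := by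
    intro l hl
    have hl' : (l : ℝ) ≤ m := by exact_mod_cast Nat.lt_succ_iff.1 (Finset.mem_range.1 hl)
    have h0 : (0 : ℝ) ≤ l := Nat.cast_nonneg l
    refine inv_anti₀ (by positivity) ?_
    nlinarith
  refine (Finset.sum_le_sum this).trans ?_
  rw [Finset.sum_const, Finset.card_range, nsmul_eq_mul]
  push_cast
  exact (mul_inv_cancel₀ (by positivity)).le

theorem sum_inv_sq_le (m : ℕ) : ∑ j ∈ Finset.range m, (((j : ℝ) + 1) ^ 2)⁻¹ ≤ 2 := by
  cases m with
  | zero => simp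
  | succ m =>
    -- The induction closes only for the sharper bound, through 1/(m+2)² ≤ 1/(m+1) - 1/(m+2).
    have : ∑ j ∈ Finset.range (m + 1), (((j : ℝ) + 1) ^ 2)⁻¹ ≤ 2 - ((m : ℝ) + 1)⁻¹ := by
      induction m with
      | zero => norm_num
      | succ m ih =>
        rw [Finset.sum_range_succ]
        push_cast
        have h : ((((m : ℝ) + 1) + 1) ^ 2)⁻¹ ≤ ((m : ℝ) + 1)⁻¹ - (((m : ℝ) + 1) + 1)⁻¹ := by
          have e : ((m : ℝ) + 1)⁻¹ - (((m : ℝ) + 1) + 1)⁻¹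
            = (((m : ℝ) + 1) * (((m : ℝ) + 1) + 1))⁻¹ := by field_simp; ring
          rw [e]
          exact inv_anti₀ (by positivity) (by nlinarith)
        linarith
    have h2 : 0 ≤ ((m : ℝ) + 1)⁻¹ := by positivity
    linarith

/-- Partial fractions: with a = l + 1 and b = m - l + 1 one has a + b = m + 2, hence (m+2)/(a b²) =
1/(a b) + 1/b². -/
theorem sum_inv_mul_sq_le (m : ℕ) :
    ∑ l ∈ Finset.range (m + 1), (((l : ℝ) + 1) * ((m : ℝ) - l + 1) ^ 2)⁻¹ ≤ 3 / ((m : ℝ) + 2) := by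
  have h1 : ∀ l ∈ Finset.range (m + 1), (((l : ℝ) + 1) * ((m : ℝ) - l + 1) ^ 2)⁻¹
      = ((m : ℝ) + 2)⁻¹ * ((((l : ℝ) + 1) * ((m : ℝ) - l + 1))⁻¹ + (((m : ℝ) - l + 1) ^ 2)⁻¹) := by
    intro l hl
    have hl' : (l : ℝ) ≤ m := by exact_mod_cast Nat.lt_succ_iff.1 (Finset.mem_range.1 hl)
    have h0 : (0 : ℝ) ≤ l := Nat.cast_nonneg l
    have h2 : (m : ℝ) - l + 1 ≠ 0 := by linarith
    have h3 : (m : ℝ) + 2 ≠ 0 := by linarith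
    field_simp
    ring
  have h2 : ∑ l ∈ Finset.range (m + 1), (((m : ℝ) - l + 1) ^ 2)⁻¹ ≤ 2 := by
    rw [← Finset.sum_range_reflect]
    refine le_of_eq_of_le (Finset.sum_congr rfl fun j hj => ?_) (sum_inv_sq_le (m + 1))
    have : j ≤ m := Nat.lt_succ_iff.1 (Finset.mem_range.1 hj)
    rw [Nat.add_sub_cancel, Nat.cast_sub this]
    congr 2; ring
  rw [Finset.sum_congr rfl h1, ← Finset.mul_sum, Finset.sum_add_distrib, div_eq_inv_mul]
  refine mul_le_mul_of_nonneg_left ?_ (by positivity)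
  linarith [sum_inv_mul_le m]

end Sums

/-! ### Size of averages and of solutions of the homological equation -/

section Averages
variable {d : ℕ} {x a : ℝ} {N : ℕ} {Ψ : Phase d → ℝ}

theorem contDiff_comp_flowG (h : ContDiff ℝ ∞ Ψ) :
    ContDiff ℝ ∞ (Function.uncurry fun t z => Ψ (flowG t z)) :=
  h.comp contDiff_flowG

theorem Cls.integral {E W : Type} [NormedAddCommGroup E] [NormedSpace ℝ E]
    [NormedAddCommGroup W] [NormedSpace ℝ W] {b : ℝ} (hb : 0 ≤ b) {g : ℝ → E → W}
    (hg : ContDiff ℝ ∞ (Function.uncurry g)) {φ : ℝ[X]} (h : ∀ t ∈ Set.Icc 0 b, Maj (g t) φ)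
    (hN : φ.natDegree ≤ N) (ha : φ.eval x ≤ a) :
    Cls x N (b * a) (fun z => ∫ t in (0 : ℝ)..b, g t z) :=
  ⟨b • φ, (natDegree_smul_le _ _).trans hN, by
    rw [eval_smul, smul_eq_mul]; exact mul_le_mul_of_nonneg_left ha hb, Maj.integral hb hg h⟩

theorem Cls.average (h : Cls x N a Ψ) : Cls x N a (average Ψ) := by
  obtain ⟨φ, h1, h2, h3⟩ := h
  have h4 := (Cls.integral Real.two_pi_pos.le (contDiff_comp_flowG h3.smooth)
    (fun t _ => h3.comp_isometry (flowE d t)) h1 h2).const_smul (1 / (2 * Real.pi))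
  refine Cls.mono (f := KleinGordon.average Ψ) h4 le_rfl (le_of_eq ?_)
  rw [abs_of_pos (by positivity)]
  field_simp

/-- The constant 4π: the mean over a period of a function of size 2 a with a weight t that is at
most 2π. -/
theorem Cls.homological (h : Cls x N a Ψ) : Cls x N (4 * Real.pi * a) (homological Ψ) := by
  obtain ⟨φ, h1, h2, h3⟩ := h.sub h.average
  have hs : ContDiff ℝ ∞ (Function.uncurry fun t z =>
      t * (Ψ (flowG t z) - KleinGordon.average Ψ (flowG t z))) :=
    contDiff_fst.mul (contDiff_comp_flowG h3.smooth)
  have hm : ∀ t ∈ Set.Icc 0 (2 * Real.pi),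
      Maj (fun z => t * (Ψ (flowG t z) - KleinGordon.average Ψ (flowG t z)))
        ((2 * Real.pi) • φ) := fun t ht => by
    refine ((h3.comp_isometry (flowE d t)).const_smul t).mono_poly fun n => ?_
    rw [coeff_smul, coeff_smul, smul_eq_mul, smul_eq_mul, abs_of_nonneg ht.1]
    exact mul_le_mul_of_nonneg_right ht.2 (h3.nonneg n)
  have h4 := (Cls.integral Real.two_pi_pos.le hs hm ((natDegree_smul_le _ _).trans h1)
    (x := x) (a := 2 * Real.pi * (a + a)) (by
      rw [eval_smul, smul_eq_mul]
      exact mul_le_mul_of_nonneg_left h2 (by positivity))).const_smul (1 / (2 * Real.pi))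
  refine Cls.mono (f := KleinGordon.homological Ψ) h4 le_rfl (le_of_eq ?_)
  rw [abs_of_pos (by positivity)]
  field_simp
  ring

end Averages

/-! ### Size of the generating functions and of the normal form terms -/

section NormalForm
variable {d : ℕ}

/-- The generating function of order `s`. -/
def chiS (p : ℕ) (ε : ℝ) (s : ℕ) : Phase d → ℝ := (normalForm p ε s).1 s

/-- The normal form term of order `s`. -/
def zetS (p : ℕ) (ε : ℝ) (s : ℕ) : Phase d → ℝ := (normalForm p ε s).2 s

/-- A later step never changes an earlier term, so the sequences of order r are truncations of
sequences that do not depend on r. -/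
theorem normalForm_apply (p : ℕ) (ε : ℝ) (r s : ℕ) :
    (normalForm (d := d) p ε r).1 s = (if s ≤ r then chiS p ε s else fun _ => 0) ∧
    (normalForm (d := d) p ε r).2 s = (if s ≤ r then zetS p ε s else fun _ => 0) := by
  induction r with
  | zero =>
    cases s with
    | zero => simp [chiS, zetS]
    | succ s => simp [normalForm]
  | succ r ih =>
    by_cases h : s = r + 1
    · subst h; simp [chiS, zetS]
    · have e : s ≤ r + 1 ↔ s ≤ r := by omega
      rw [normalForm]
      simp only [Function.update_of_ne h, e]
      exact ih

theorem genSeq_apply (p : ℕ) (ε : ℝ) (r s : ℕ) :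
    genSeq (d := d) p ε r s = if s ≤ r then chiS p ε s else fun _ => 0 :=
  (normalForm_apply p ε r s).1

theorem nfTerm_apply (p : ℕ) (ε : ℝ) (r s : ℕ) :
    nfTerm (d := d) p ε r s = if s ≤ r then zetS p ε s else fun _ => 0 :=
  (normalForm_apply p ε r s).2

theorem lieSeq_congr {W : Type} [NormedAddCommGroup W] [NormedSpace ℝ W]
    {χ χ' : ℕ → Phase d → ℝ} (f : Phase d → W) {k : ℕ} (h : ∀ l, 1 ≤ l → l ≤ k → χ l = χ' l) :
    lieSeq χ f k = lieSeq χ' f k := by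
  induction k using Nat.strong_induction_on with
  | _ k ih =>
    cases k with
    | zero => rw [lieSeq_zero, lieSeq_zero]
    | succ k =>
      ext1 z
      rw [lieSeq_succ, lieSeq_succ]
      refine Finset.sum_congr rfl fun l hl => ?_
      have := Finset.mem_range.1 hl
      rw [h (l + 1) (by omega) (by omega), ih (k - l) (by omega) fun i h1 h2 => h i h1 (by omega)]

/-- The right-hand side of the homological equation of order `s + 1`. -/
def psiS (p : ℕ) (ε : ℝ) (s : ℕ) : Phase d → ℝ := psiTerm p ε (chiS p ε) (zetS p ε) s

theorem psiTerm_eq (p : ℕ) (ε : ℝ) (s : ℕ) :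
    psiTerm (d := d) p ε (normalForm p ε s).1 (normalForm p ε s).2 s = psiS p ε s := by
  ext1 z
  rw [psiS, psiTerm, psiTerm]
  congr 1
  · rw [lieSeq_congr]
    intro l _ hl
    rw [(normalForm_apply p ε s l).1, if_pos hl]
  · refine Finset.sum_congr rfl fun l hl => ?_
    rw [Finset.mem_Icc] at hl
    rw [(normalForm_apply p ε s l).1, if_pos hl.2, (normalForm_apply p ε s _).2,
      if_pos (by omega)]

theorem chiS_succ (p : ℕ) (ε : ℝ) (s : ℕ) :
    chiS (d := d) p ε (s + 1) = homological (psiS p ε s) := by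
  rw [chiS, normalForm, ← psiTerm_eq]
  simp

theorem zetS_succ (p : ℕ) (ε : ℝ) (s : ℕ) :
    zetS (d := d) p ε (s + 1) = average (psiS p ε s) := by
  rw [zetS, normalForm, ← psiTerm_eq]
  simp

theorem psiS_apply (p : ℕ) (ε : ℝ) (s : ℕ) (z : Phase d) :
    psiS p ε s z = 1 / ((s : ℝ) + 1) * lieSeq (chiS p ε) (hamF p ε) s z
      + ∑ l ∈ Finset.range s, (((l : ℝ) + 1) / ((s : ℝ) + 1))
        * lieD (chiS p ε (l + 1)) (zetS p ε (s - l)) z := by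
  rw [psiS, psiTerm]
  congr 1
  have h : Finset.Icc 1 s = Finset.Ico (0 + 1) (s + 1) := by ext l; simp
  rw [h, ← Finset.sum_Ico_add', ← Finset.range_eq_Ico]
  refine Finset.sum_congr rfl fun l _ => ?_
  rw [Nat.add_sub_add_right]
  push_cast
  rfl

/-- The constants of the estimates of the normal form on the ball of radius `x`, where `f₀` is the
size of the perturbation. -/
def nfA (f₀ : ℝ) : ℝ := 8 * Real.pi * f₀
/-- The rate of growth of the normal form. -/
def nfC (p : ℕ) (x f₀ : ℝ) : ℝ := 6 * (((2 * p + 2 : ℕ) : ℝ) / x) ^ 2 * nfA f₀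

/-- An ansatz that reproduces itself under the recursion. The derivatives in a bracket bring in the
degrees, which cancel one or two powers in the denominators (j+1)² and (j+1)³; the convolution sums
restore the decay up to a factor comparable to the order, and this factor is absorbed by the n in
the ratio C n ε. The bound n for the orders is left free: n = r is taken for the generating sequence
of order r, and n = s where a single term of order s is to be bounded independently of r. -/
theorem normalForm_size {p : ℕ} {x f₀ ε : ℝ} (hx : 0 < x) (hf : 0 < f₀) (hε : 0 < ε)
    (hF : Cls x (2 * p + 2) f₀ (hamF (d := d) p 1)) {n : ℕ} (j : ℕ) (hj : j + 1 ≤ n) :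
    Cls x ((2 * p + 2) * (j + 1)) (f₀ * ε * (nfC p x f₀ * n * ε) ^ j / ((j : ℝ) + 1) ^ 2)
      (lieSeq (chiS (d := d) p ε) (hamF p ε) j) ∧
    Cls x ((2 * p + 2) * (j + 1)) (2 * f₀ * ε * (nfC p x f₀ * n * ε) ^ j / ((j : ℝ) + 1) ^ 3)
      (zetS (d := d) p ε (j + 1)) ∧
    Cls x ((2 * p + 2) * (j + 1)) (nfA f₀ * ε * (nfC p x f₀ * n * ε) ^ j / ((j : ℝ) + 1) ^ 3)
      (chiS (d := d) p ε (j + 1)) := by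
  set D := 2 * p + 2 with hD
  set A := nfA f₀ with hAdef
  set K := ((D : ℝ) / x) ^ 2 with hK
  have hC : nfC p x f₀ = 6 * K * A := rfl
  set Cc := nfC p x f₀ with hCc
  have hA : 0 < A := by rw [hAdef, nfA]; positivity
  have hD0 : (0 : ℝ) < D := by rw [hD]; positivity
  have hK0 : 0 < K := by positivity
  have hC0 : 0 < Cc := by rw [hC]; positivity
  induction j using Nat.strong_induction_on with
  | _ j ih =>
  have hn : (j : ℝ) + 1 ≤ n := by exact_mod_cast hj
  set μ := Cc * n * ε with hμ
  have hn0 : (0 : ℝ) < n := by have : (0 : ℝ) ≤ j := Nat.cast_nonneg j; linarith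
  have hμ0 : 0 < μ := by positivity
  have h1 : Cls x (D * (j + 1)) (f₀ * ε * μ ^ j / ((j : ℝ) + 1) ^ 2)
      (lieSeq (chiS (d := d) p ε) (hamF p ε) j) := by
    cases j with
    | zero =>
      rw [lieSeq_zero]
      refine ((hF.const_smul ε).congr fun z => hamF_smul p ε z).mono (by omega) ?_
      rw [abs_of_pos hε]; simp [mul_comm]
    | succ m =>
      have ht : ∀ l ∈ Finset.range (m + 1), Cls x (D * (m + 1 + 1))
          (K * A * f₀ * ε ^ 2 * μ ^ m / ((m : ℝ) + 1) * (((l : ℝ) + 1) * ((m : ℝ) - l + 1))⁻¹)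
          (fun z => (((l : ℝ) + 1) / ((m : ℝ) + 1)) • lieD (chiS p ε (l + 1))
            (lieSeq (chiS (d := d) p ε) (hamF p ε) (m - l)) z) := by
        intro l hl
        have hl' : l ≤ m := Nat.lt_succ_iff.1 (Finset.mem_range.1 hl)
        have hlr : (l : ℝ) ≤ m := by exact_mod_cast hl'
        have hml : (0 : ℝ) < (m : ℝ) - l + 1 := by linarith
        refine ((Cls.lieD hx (ih l (by omega) (by omega)).2.2
          (ih (m - l) (by omega) (by omega)).1).const_smul _).mono ?_ (le_of_eq ?_)
        · rw [← mul_add]; exact Nat.mul_le_mul_left _ (by omega)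
        · have e : μ ^ m = μ ^ (m - l) * μ ^ l := by rw [← pow_add]; congr 1; omega
          rw [abs_of_nonneg (by positivity), e, hK]
          push_cast [Nat.cast_sub hl']
          field_simp
      refine ((Cls.sum _ ht).congr fun z => lieSeq_succ _ _ _ z).mono le_rfl ?_
      rw [← Finset.mul_sum]
      refine (mul_le_of_le_one_right (by positivity) (sum_inv_mul_le m)).trans ?_
      rw [div_le_div_iff₀ (by positivity) (by positivity), pow_succ]
      push_cast at hn ⊢
      -- The order in question is m + 2 ≤ n, so one of the two factors m + 2 is paid for by n and
      -- the other by m + 1.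
      have h5 : K * A * ((m : ℝ) + 1 + 1) ^ 2 ≤ Cc * n * (m + 1) := by
        rw [hC]
        have hm : (0 : ℝ) ≤ m := Nat.cast_nonneg m
        have h6 : ((m : ℝ) + 1 + 1) ^ 2 ≤ 6 * n * (m + 1) := by nlinarith
        nlinarith [mul_le_mul_of_nonneg_left h6 (mul_pos hK0 hA).le]
      have h7 := mul_le_mul_of_nonneg_left h5 (by positivity : 0 ≤ f₀ * ε ^ 2 * μ ^ m)
      calc K * A * f₀ * ε ^ 2 * μ ^ m * ((m : ℝ) + 1 + 1) ^ 2
          = f₀ * ε ^ 2 * μ ^ m * (K * A * ((m : ℝ) + 1 + 1) ^ 2) := by ring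
        _ ≤ _ := h7
        _ = f₀ * ε * (μ ^ m * (Cc * n * ε)) * (m + 1) := by ring
  have h2 : Cls x (D * (j + 1)) (2 * f₀ * ε * μ ^ j / ((j : ℝ) + 1) ^ 3) (psiS (d := d) p ε j) := by
    have h3 := (h1.const_smul (1 / ((j : ℝ) + 1)))
    have ht : ∀ l ∈ Finset.range j, Cls x (D * (j + 1))
        (K * A * (2 * f₀) * ε ^ 2 * μ ^ (j - 1) / ((j : ℝ) + 1)
          * (((l : ℝ) + 1) * ((j : ℝ) - 1 - l + 1) ^ 2)⁻¹)
        (fun z => (((l : ℝ) + 1) / ((j : ℝ) + 1)) * lieD (chiS (d := d) p ε (l + 1))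
            (zetS p ε (j - l)) z) := by
      intro l hl
      have hl' : l + 1 ≤ j := Finset.mem_range.1 hl
      obtain ⟨m, rfl⟩ : ∃ m, j = m + 1 := ⟨j - 1, by omega⟩
      have hlr : (l : ℝ) ≤ m := by exact_mod_cast (by omega : l ≤ m)
      have hml : (0 : ℝ) < (m : ℝ) - l + 1 := by linarith
      have hz := (ih (m - l) (by omega) (by omega)).2.1
      rw [show m - l + 1 = m + 1 - l by omega] at hz
      refine ((Cls.lieD hx (ih l (by omega) (by omega)).2.2 hz).const_smul _).mono ?_ (le_of_eq ?_)
      · rw [← mul_add]; exact Nat.mul_le_mul_left _ (by omega)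
      · have e : μ ^ m = μ ^ (m - l) * μ ^ l := by rw [← pow_add]; congr 1; omega
        rw [abs_of_nonneg (by positivity), Nat.add_sub_cancel, e, hK]
        push_cast [Nat.cast_sub (show l ≤ m + 1 by omega), Nat.cast_sub (show l ≤ m by omega)]
        rw [show (m : ℝ) + 1 - l = m - l + 1 by ring, show (m : ℝ) + 1 - 1 - l + 1 = m - l + 1 by ring]
        field_simp
    refine ((h3.add (Cls.sum _ ht)).congr fun z => psiS_apply p ε j z).mono le_rfl ?_
    rw [← Finset.mul_sum, abs_of_pos (by positivity)]
    have h8 : 1 / ((j : ℝ) + 1) * (f₀ * ε * μ ^ j / ((j : ℝ) + 1) ^ 2)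
        = f₀ * ε * μ ^ j / ((j : ℝ) + 1) ^ 3 := by field_simp
    rw [h8]
    -- Of the constant 2 f₀ one half is the Lie series of the perturbation; the other half is
    -- reserved for the brackets with the earlier normal form terms.
    suffices h9 : K * A * (2 * f₀) * ε ^ 2 * μ ^ (j - 1) / ((j : ℝ) + 1)
        * ∑ l ∈ Finset.range j, (((l : ℝ) + 1) * ((j : ℝ) - 1 - l + 1) ^ 2)⁻¹
        ≤ f₀ * ε * μ ^ j / ((j : ℝ) + 1) ^ 3 by
      calc _ ≤ f₀ * ε * μ ^ j / ((j : ℝ) + 1) ^ 3 + f₀ * ε * μ ^ j / ((j : ℝ) + 1) ^ 3 := by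
            linarith
        _ = _ := by ring
    cases j with
    | zero => simp; positivity
    | succ m =>
      have h10 := sum_inv_mul_sq_le m
      rw [Nat.add_sub_cancel]
      push_cast at hn ⊢
      simp only [add_sub_cancel_right]
      refine (mul_le_mul_of_nonneg_left h10 (by positivity)).trans ?_
      rw [show (m : ℝ) + 2 = m + 1 + 1 by ring, div_mul_div_comm,
        div_le_div_iff₀ (by positivity) (by positivity), pow_succ]
      -- The 6 in `nfC` is 2 · 3: the constant 2 f₀ of the normal form terms times the 3 of
      -- `sum_inv_mul_sq_le`.
      have h5 : 6 * (K * A) * ((m : ℝ) + 1 + 1) ≤ Cc * n := by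
        rw [hC]
        have := mul_le_mul_of_nonneg_left hn (mul_pos hK0 hA).le
        linarith
      have h7 := mul_le_mul_of_nonneg_left h5
        (by positivity : 0 ≤ f₀ * ε ^ 2 * μ ^ m * ((m : ℝ) + 1 + 1) ^ 2)
      calc _ = f₀ * ε ^ 2 * μ ^ m * ((m : ℝ) + 1 + 1) ^ 2 * (6 * (K * A) * ((m : ℝ) + 1 + 1)) := by
            ring
        _ ≤ _ := h7
        _ = f₀ * ε * (μ ^ m * (Cc * n * ε)) * ((m + 1 + 1) * (m + 1 + 1)) := by ring
  refine ⟨h1, ?_, ?_⟩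
  · rw [zetS_succ]; exact h2.average
  · rw [chiS_succ]
    refine h2.homological.mono le_rfl (le_of_eq ?_)
    rw [hAdef, nfA]; ring

end NormalForm

/-! ### Algebraic properties of the normal form -/

section Lie
variable {d : ℕ} {W : Type} [NormedAddCommGroup W] [NormedSpace ℝ W]

theorem hamField_smul {χ : Phase d → ℝ} (h : Differentiable ℝ χ) (c : ℝ) (z : Phase d) :
    hamField (fun z => c * χ z) z = c • hamField χ z := by
  rw [hamField_eq, hamField_eq, fderiv_const_mul (h z), map_smul]

theorem lieD_smul {χ : Phase d → ℝ} {g : Phase d → W} (hχ : Differentiable ℝ χ)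
    (hg : Differentiable ℝ g) (c c' : ℝ) (z : Phase d) :
    lieD (fun z => c * χ z) (fun z => c' • g z) z = (c * c') • lieD χ g z := by
  rw [lieD, lieD, hamField_smul hχ, fderiv_fun_const_smul (hg z), _root_.smul_apply, map_smul,
    smul_smul, mul_comm]

theorem lieD_sub {χ : Phase d → ℝ} {g h : Phase d → W} (hg : Differentiable ℝ g)
    (hh : Differentiable ℝ h) (z : Phase d) :
    lieD χ (fun z => g z - h z) z = lieD χ g z - lieD χ h z := by
  rw [lieD, fderiv_fun_sub (hg z) (hh z)]; rfl

theorem fderiv_comp_reversal (g : Phase d → W) (z w : Phase d) :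
    fderiv ℝ g (reversal d z) (reversal d w) = fderiv ℝ (fun z => g (reversal d z)) z w := by
  have := (reversal d).toContinuousLinearEquiv.comp_right_fderiv (f := g) (x := z)
  exact (DFunLike.congr_fun this w).symm

/-- The reversal is antisymplectic; the sign this produces is cancelled by the oddness of χ, and the
field is equivariant. -/
theorem hamField_reversal {χ : Phase d → ℝ} (h : ∀ z, χ (reversal d z) = -χ z) (z : Phase d) :
    hamField χ (reversal d z) = reversal d (hamField χ z) := by
  have h1 : gradient χ (reversal d z) = -reversal d (gradient χ z) := by
    refine ext_inner_right ℝ fun w => ?_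
    rw [inner_gradient, ← reversal_reversal w, fderiv_comp_reversal, inner_neg_left,
      inner_reversal, inner_gradient, show (fun z => χ (reversal d z)) = fun z => -χ z from funext h,
      fderiv_fun_neg]
    rfl
  rw [hamField_eq_symp, h1, map_neg, symp_reversal, neg_neg, hamField_eq_symp]

/-- The map σ is the identity for scalar functions, whose parity is then preserved, and the reversal
itself for the identity map, whose Lie series is then equivariant. -/
theorem lieD_reversal {χ : Phase d → ℝ} (h : ∀ z, χ (reversal d z) = -χ z) {g : Phase d → W}
    (σ : W ≃L[ℝ] W) (hg : ∀ z, g (reversal d z) = σ (g z)) (z : Phase d) :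
    lieD χ g (reversal d z) = σ (lieD χ g z) := by
  rw [lieD, hamField_reversal h, fderiv_comp_reversal, funext hg]
  exact DFunLike.congr_fun (σ.comp_fderiv (f := g) (x := z)) _

theorem lieSeq_reversal {χ : ℕ → Phase d → ℝ} (h : ∀ l, 1 ≤ l → ∀ z, χ l (reversal d z) = -χ l z)
    {f : Phase d → W} (σ : W ≃L[ℝ] W) (hf : ∀ z, f (reversal d z) = σ (f z)) (k : ℕ)
    (z : Phase d) : lieSeq χ f k (reversal d z) = σ (lieSeq χ f k z) := by
  induction k using Nat.strong_induction_on generalizing z with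
  | _ k ih =>
    cases k with
    | zero => rw [lieSeq_zero, hf]
    | succ k =>
      rw [lieSeq_succ, lieSeq_succ, map_sum]
      refine Finset.sum_congr rfl fun l hl => ?_
      rw [map_smul, lieD_reversal (h (l + 1) (by omega)) σ (ih (k - l) (by omega))]

theorem lieSeq_smul {χ χ' : ℕ → Phase d → ℝ} {ε c : ℝ}
    (h : ∀ l, 1 ≤ l → ∀ z, χ' l z = ε ^ l * χ l z) (hχ : ∀ l, 1 ≤ l → Differentiable ℝ (χ l))
    {f f' : Phase d → W} (hf : ∀ z, f' z = c • f z) (hd : ∀ k, Differentiable ℝ (lieSeq χ f k))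
    (k : ℕ) (z : Phase d) : lieSeq χ' f' k z = (c * ε ^ k) • lieSeq χ f k z := by
  induction k using Nat.strong_induction_on generalizing z with
  | _ k ih =>
    cases k with
    | zero => simp [lieSeq_zero, hf]
    | succ k =>
      rw [lieSeq_succ, lieSeq_succ, Finset.smul_sum]
      refine Finset.sum_congr rfl fun l hl => ?_
      have hl' : l < k + 1 := Finset.mem_range.1 hl
      rw [funext (h (l + 1) (by omega)), funext (ih (k - l) (by omega)),
        lieD_smul (hχ (l + 1) (by omega)) (hd _), smul_comm]
      rw [mul_left_comm, ← pow_add, show l + 1 + (k - l) = k + 1 by omega]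

end Lie

/-! ### Invariance, parity and the homological equation -/

section Averages
variable {d : ℕ} {Ψ : Phase d → ℝ}

theorem periodic_comp_flowG (Ψ : Phase d → ℝ) (z : Phase d) :
    Function.Periodic (fun t => Ψ (flowG t z)) (2 * Real.pi) := fun t => by
  simp only [flowG_add_two_pi]

theorem continuous_flowG (z : Phase d) : Continuous fun t => flowG t z :=
  continuous_iff_continuousAt.2 fun t => (hasDerivAt_flowG t z).continuousAt

theorem average_flowG (Ψ : Phase d → ℝ) (s : ℝ) (z : Phase d) :
    average Ψ (flowG s z) = average Ψ z := by
  rw [average, average]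
  congr 1
  simp only [flowG_flowG]
  rw [intervalIntegral.integral_comp_add_right (fun t => Ψ (flowG t z)), zero_add, add_comm _ s]
  have := (periodic_comp_flowG Ψ z).intervalIntegral_add_eq s 0
  rw [this, zero_add]

theorem average_reversal (h : ∀ z, Ψ (reversal d z) = Ψ z) (z : Phase d) :
    average Ψ (reversal d z) = average Ψ z := by
  rw [average, average]
  congr 1
  simp only [flowG_reversal, h]
  rw [intervalIntegral.integral_comp_neg (fun t => Ψ (flowG t z))]
  have := (periodic_comp_flowG Ψ z).intervalIntegral_add_eq (-(2 * Real.pi)) 0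
  rw [neg_add_cancel, zero_add] at this
  rw [neg_zero, this]

theorem integral_sub_average (h : Continuous Ψ) (z : Phase d) (s : ℝ) :
    ∫ t in s..s + 2 * Real.pi, (Ψ (flowG t z) - average Ψ (flowG t z)) = 0 := by
  have hp : Function.Periodic (fun t => Ψ (flowG t z) - average Ψ (flowG t z)) (2 * Real.pi) :=
    fun t => by simp only [flowG_add_two_pi]
  rw [hp.intervalIntegral_add_eq s 0, zero_add]
  simp only [average_flowG]
  have hc : Continuous fun t => Ψ (flowG t z) := h.comp (continuous_flowG z)
  rw [intervalIntegral.integral_sub (hc.intervalIntegrable _ _)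
    (intervalIntegrable_const), intervalIntegral.integral_const, average]
  have := Real.pi_pos
  simp only [sub_zero, smul_eq_mul]
  field_simp
  ring

/-- Reversal turns the flow around, and t ↦ 2π - t turns it back while replacing the weight t by 2π
- t. The constant 2π drops out because the averaged function has mean zero, and the sign remains. -/
theorem homological_reversal (hc : Continuous Ψ) (h : ∀ z, Ψ (reversal d z) = Ψ z) (z : Phase d) :
    homological Ψ (reversal d z) = -homological Ψ z := by
  have h2 : ∀ t, Ψ (flowG t (reversal d z)) - average Ψ (flowG t (reversal d z))
      = Ψ (flowG (2 * Real.pi - t) z) - average Ψ (flowG (2 * Real.pi - t) z) := fun t => by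
    rw [flowG_reversal, h, average_reversal h, ← flowG_add_two_pi (-t), neg_add_eq_sub]
  set g : ℝ → ℝ := fun t => Ψ (flowG t z) - average Ψ (flowG t z) with hg
  have hgc : Continuous g := by
    have : g = fun t => Ψ (flowG t z) - average Ψ z := by ext t; simp only [hg, average_flowG]
    rw [this]
    exact (hc.comp (continuous_flowG z)).sub continuous_const
  rw [homological, homological]
  simp only [h2]
  have h3 : ∫ t in (0 : ℝ)..(2 * Real.pi), t * g (2 * Real.pi - t)
      = ∫ t in (0 : ℝ)..(2 * Real.pi), (2 * Real.pi - t) * g t := by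
    have := intervalIntegral.integral_comp_sub_left (a := 0) (b := 2 * Real.pi)
      (fun t => (2 * Real.pi - t) * g t) (2 * Real.pi)
    simpa using this
  have h4 : ∫ t in (0 : ℝ)..(2 * Real.pi), (2 * Real.pi - t) * g t
      = 2 * Real.pi * (∫ t in (0 : ℝ)..(2 * Real.pi), g t)
        - ∫ t in (0 : ℝ)..(2 * Real.pi), t * g t := by
    have i1 : Continuous fun t => 2 * Real.pi * g t := continuous_const.mul hgc
    have i2 : Continuous fun t => t * g t := continuous_id.mul hgc
    rw [← intervalIntegral.integral_const_mul, ← intervalIntegral.integral_sub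
      (i1.intervalIntegrable _ _) (i2.intervalIntegrable _ _)]
    exact intervalIntegral.integral_congr fun t _ => by ring
  have h5 : ∫ t in (0 : ℝ)..(2 * Real.pi), g t = 0 := by
    have := integral_sub_average hc z 0
    rwa [zero_add] at this
  change 1 / (2 * Real.pi) * (∫ t in (0 : ℝ)..(2 * Real.pi), t * g (2 * Real.pi - t)) = _
  rw [h3, h4, h5]
  ring

/-- The homological equation. -/
theorem lieD_homological (hc : ContDiff ℝ ∞ Ψ) (hh : Differentiable ℝ (homological Ψ))
    (z : Phase d) : lieD (homological Ψ) hamG z = -(Ψ z - average Ψ z) := by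
  set g : ℝ → ℝ := fun t => Ψ (flowG t z) - average Ψ (flowG t z) with hg
  have hgc : Continuous g := by
    have : g = fun t => Ψ (flowG t z) - average Ψ z := by ext t; simp only [hg, average_flowG]
    rw [this]
    exact (hc.continuous.comp (continuous_flowG z)).sub continuous_const
  have hgp : Function.Periodic g (2 * Real.pi) := fun t => by
    simp only [hg, flowG_add_two_pi]
  -- Along the flow the weight becomes s - τ on the shifted period [τ, τ + 2π]; the part -τ
  -- integrates to zero. The dependence on τ is then only in the limits of integration, and the two
  -- boundary terms give 2π g(0) as the derivative at zero.
  have h1 : ∀ τ, homological Ψ (flowG τ z) = 1 / (2 * Real.pi) *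
      ((∫ s in (0 : ℝ)..(τ + 2 * Real.pi), s * g s) - ∫ s in (0 : ℝ)..τ, s * g s) := fun τ => by
    have hi : ∀ a b, IntervalIntegrable (fun s => s * g s) MeasureTheory.volume a b :=
      fun a b => (continuous_id.mul hgc).intervalIntegrable _ _
    rw [homological, intervalIntegral.integral_interval_sub_left (hi _ _) (hi _ _)]
    congr 1
    have e1 : ∫ t in (0 : ℝ)..(2 * Real.pi), t * g (t + τ)
        = ∫ s in τ..(τ + 2 * Real.pi), (s - τ) * g s := by
      have := intervalIntegral.integral_comp_add_right (a := 0) (b := 2 * Real.pi)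
        (fun s => (s - τ) * g s) τ
      rw [zero_add, add_comm _ τ] at this
      rw [← this]
      exact intervalIntegral.integral_congr fun t _ => by simp
    have e2 : ∫ s in τ..(τ + 2 * Real.pi), (s - τ) * g s
        = (∫ s in τ..(τ + 2 * Real.pi), s * g s) - τ * ∫ s in τ..(τ + 2 * Real.pi), g s := by
      have i1 : Continuous fun t => τ * g t := continuous_const.mul hgc
      rw [← intervalIntegral.integral_const_mul, ← intervalIntegral.integral_sub (hi _ _)
        (i1.intervalIntegrable _ _)]
      exact intervalIntegral.integral_congr fun t _ => by ring
    rw [integral_sub_average hc.continuous z τ, mul_zero, sub_zero] at e2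
    rw [← e2, ← e1]
    simp only [hg, flowG_flowG]
  have hd : HasDerivAt (fun τ => homological Ψ (flowG τ z)) (g 0) 0 := by
    have hcont : Continuous fun s => s * g s := continuous_id.mul hgc
    have a1 : HasDerivAt (fun τ => ∫ s in (0 : ℝ)..(τ + 2 * Real.pi), s * g s)
        ((0 + 2 * Real.pi) * g (0 + 2 * Real.pi)) 0 :=
      HasDerivAt.comp_add_const 0 (2 * Real.pi)
        (f := fun τ => ∫ s in (0 : ℝ)..τ, s * g s)
        (hcont.integral_hasStrictDerivAt 0 (0 + 2 * Real.pi)).hasDerivAt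
    have a2 : HasDerivAt (fun τ => ∫ s in (0 : ℝ)..τ, s * g s) (0 * g 0) 0 :=
      (hcont.integral_hasStrictDerivAt 0 0).hasDerivAt
    have a3 := (a1.sub a2).const_mul (1 / (2 * Real.pi))
    rw [hgp 0] at a3
    have e : g 0 = 1 / (2 * Real.pi) * ((0 + 2 * Real.pi) * g 0 - 0 * g 0) := by
      have := Real.pi_pos
      field_simp; ring
    rw [e]
    exact a3.congr_of_eventuallyEq (Filter.Eventually.of_forall h1)
  have hd2 : HasDerivAt (fun τ => homological Ψ (flowG τ z))
      (fderiv ℝ (homological Ψ) z (symp d z)) 0 := by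
    have := hasDerivAt_flowG 0 z
    rw [flowG_zero] at this
    have h3 := (hh (flowG 0 z)).hasFDerivAt
    rw [flowG_zero] at h3
    exact HasFDerivAt.comp_hasDerivAt_of_eq 0 h3 this (flowG_zero z).symm
  have h6 := hd.unique hd2
  rw [lieD, (hasFDerivAt_hamG z).fderiv, innerSL_apply_apply, hamField_eq_symp, real_inner_comm,
    inner_symp_left, inner_gradient, ← h6]
  simp [hg, flowG_zero]

end Averages

/-! ### Smoothness, parity, the normal form identity and homogeneity in the coupling -/

section NormalForm
variable {d : ℕ} {p : ℕ} {ε : ℝ}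

/-- A qualitative consequence of the size estimates, on the ball of radius 1 and with n = j + 1. No
bound has to be small here, so every positive coupling is allowed. -/
theorem normalForm_smooth (hε : 0 < ε) (j : ℕ) :
    ContDiff ℝ ∞ (lieSeq (chiS (d := d) p ε) (hamF p ε) j) ∧
    ContDiff ℝ ∞ (zetS (d := d) p ε (j + 1)) ∧ ContDiff ℝ ∞ (chiS (d := d) p ε (j + 1)) ∧
    ContDiff ℝ ∞ (psiS (d := d) p ε j) := by
  obtain ⟨a, ha⟩ := exists_cls_hamF (d := d) zero_le_one p
  have h := fun j => normalForm_size (d := d) (f₀ := max a 1) one_pos (by positivity) hε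
    (ha.mono le_rfl (le_max_left _ _)) (n := j + 1) j le_rfl
  refine ⟨(h j).1.smooth, (h j).2.1.smooth, (h j).2.2.smooth, ?_⟩
  rw [funext (psiS_apply p ε j)]
  refine (contDiff_const.mul (h j).1.smooth).add (ContDiff.sum fun l hl => ?_)
  have hl' : l < j := Finset.mem_range.1 hl
  have h2 := (h (j - l - 1)).2.1
  rw [show j - l - 1 + 1 = j - l by omega] at h2
  exact contDiff_const.mul (Cls.lieD one_pos (h l).2.2 h2).smooth

theorem chiS_differentiable (hε : 0 < ε) {l : ℕ} (hl : 1 ≤ l) :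
    Differentiable ℝ (chiS (d := d) p ε l) := by
  obtain ⟨j, rfl⟩ : ∃ j, l = j + 1 := ⟨l - 1, by omega⟩
  exact (normalForm_smooth hε j).2.2.1.differentiable (by simp)

theorem zetS_differentiable (hε : 0 < ε) {l : ℕ} (hl : 1 ≤ l) :
    Differentiable ℝ (zetS (d := d) p ε l) := by
  obtain ⟨j, rfl⟩ : ∃ j, l = j + 1 := ⟨l - 1, by omega⟩
  exact (normalForm_smooth hε j).2.1.differentiable (by simp)

theorem hamF_reversal (z : Phase d) : hamF p ε (reversal d z) = hamF p ε z := by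
  rw [hamF_eq, hamF_eq]; rfl

/-- Averaging preserves parity and solving the homological equation reverses it. As the perturbation
is even, all normal form terms are even and all generating functions are odd. -/
theorem normalForm_reversal (hε : 0 < ε) (j : ℕ) :
    (∀ z, psiS (d := d) p ε j (reversal d z) = psiS p ε j z) ∧
    (∀ z, zetS (d := d) p ε (j + 1) (reversal d z) = zetS p ε (j + 1) z) ∧
    (∀ z, chiS (d := d) p ε (j + 1) (reversal d z) = -chiS p ε (j + 1) z) := by
  induction j using Nat.strong_induction_on with
  | _ j ih =>
  have h1 : ∀ z, psiS (d := d) p ε j (reversal d z) = psiS p ε j z := by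
    intro z
    rw [psiS_apply, psiS_apply]
    congr 1
    · have e : lieSeq (chiS (d := d) p ε) (hamF p ε) j
          = lieSeq (fun l => if l ≤ j then chiS (d := d) p ε l else 0) (hamF p ε) j :=
        lieSeq_congr _ fun l _ h => by rw [if_pos h]
      rw [e]
      congr 1
      refine lieSeq_reversal (σ := ContinuousLinearEquiv.refl ℝ ℝ) (fun l hl z => ?_)
        (fun z => hamF_reversal z) j z
      by_cases hlj : l ≤ j
      · obtain ⟨i, rfl⟩ : ∃ i, l = i + 1 := ⟨l - 1, by omega⟩
        simp only [if_pos hlj]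
        exact (ih i (by omega)).2.2 z
      · simp [if_neg hlj]
    · refine Finset.sum_congr rfl fun l hl => ?_
      have hl' : l < j := Finset.mem_range.1 hl
      congr 1
      refine lieD_reversal (ih l hl').2.2 (ContinuousLinearEquiv.refl ℝ ℝ) ?_ z
      have := (ih (j - l - 1) (by omega)).2.1
      rwa [show j - l - 1 + 1 = j - l by omega] at this
  refine ⟨h1, ?_, ?_⟩
  · rw [zetS_succ]; exact average_reversal h1
  · rw [chiS_succ]; exact homological_reversal (normalForm_smooth hε j).2.2.2.continuous h1

theorem zetS_flowG {l : ℕ} (hl : 1 ≤ l) (t : ℝ) (z : Phase d) :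
    zetS p ε l (flowG t z) = zetS p ε l z := by
  obtain ⟨j, rfl⟩ : ∃ j, l = j + 1 := ⟨l - 1, by omega⟩
  rw [zetS_succ, average_flowG]

/-- The normal form identity. -/
theorem lieSeq_hamG_add (hε : 0 < ε) (s : ℕ) (z : Phase d) :
    lieSeq (chiS p ε) hamG (s + 1) z + lieSeq (chiS p ε) (hamF p ε) s z = zetS p ε (s + 1) z := by
  induction s using Nat.strong_induction_on generalizing z with
  | _ s ih =>
  rw [lieSeq_succ, Finset.sum_range_succ, Nat.sub_self, lieSeq_zero]
  -- The newest generating function acts only on G, and its contribution is prescribed by the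
  -- homological equation. In all other brackets the Lie series of G is replaced by means of the
  -- induction hypothesis.
  have h0 : lieD (chiS p ε (s + 1)) hamG z = -(psiS p ε s z - zetS p ε (s + 1) z) := by
    rw [chiS_succ, zetS_succ]
    have := chiS_differentiable (d := d) (p := p) hε (l := s + 1) (by omega)
    rw [chiS_succ] at this
    exact lieD_homological (normalForm_smooth hε s).2.2.2 this z
  have h1 : ∀ l ∈ Finset.range s,
      (((l : ℝ) + 1) / ((s : ℝ) + 1)) • lieD (chiS p ε (l + 1)) (lieSeq (chiS p ε) hamG (s - l)) z
      = (((l : ℝ) + 1) / ((s : ℝ) + 1)) * lieD (chiS p ε (l + 1)) (zetS p ε (s - l)) z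
        - (((l : ℝ) + 1) / ((s : ℝ) + 1)) *
          lieD (chiS p ε (l + 1)) (lieSeq (chiS p ε) (hamF p ε) (s - 1 - l)) z := by
    intro l hl
    have hl' : l < s := Finset.mem_range.1 hl
    have e : lieSeq (chiS (d := d) p ε) hamG (s - l)
        = fun z => zetS p ε (s - l) z - lieSeq (chiS p ε) (hamF p ε) (s - 1 - l) z := by
      ext1 w
      have := ih (s - 1 - l) (by omega) w
      rw [show s - 1 - l + 1 = s - l by omega] at this
      linarith
    rw [e, lieD_sub (zetS_differentiable hε (by omega))
      ((normalForm_smooth hε _).1.differentiable (by simp)), smul_eq_mul, mul_sub]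
  -- The brackets with the earlier terms of the perturbation resum to the next one with the weight
  -- s/(s+1). Together with the weight 1/(s+1) in Ψ this is the full term that the claim adds to the
  -- Lie series of G.
  have h2 : ∑ l ∈ Finset.range s, (((l : ℝ) + 1) / ((s : ℝ) + 1)) *
      lieD (chiS p ε (l + 1)) (lieSeq (chiS p ε) (hamF p ε) (s - 1 - l)) z
      = (s : ℝ) / (s + 1) * lieSeq (chiS p ε) (hamF p ε) s z := by
    cases s with
    | zero => simp
    | succ m =>
      rw [lieSeq_succ, Finset.mul_sum]
      refine Finset.sum_congr rfl fun l _ => ?_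
      rw [Nat.add_sub_cancel, smul_eq_mul]
      have : (m : ℝ) + 1 ≠ 0 := by positivity
      push_cast
      field_simp
  rw [Finset.sum_congr rfl h1, Finset.sum_sub_distrib, h2, h0, psiS_apply]
  have : (s : ℝ) + 1 ≠ 0 := by positivity
  rw [div_self this, one_smul]
  field_simp
  ring

/-- Each order is a fixed polynomial times a power of the coupling. This is the source of
analyticity in ε for fixed r. -/
theorem normalForm_scaling (j : ℕ) :
    (∀ z, zetS (d := d) p ε (j + 1) z = ε ^ (j + 1) * zetS p 1 (j + 1) z) ∧
    (∀ z, chiS (d := d) p ε (j + 1) z = ε ^ (j + 1) * chiS p 1 (j + 1) z) := by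
  induction j using Nat.strong_induction_on with
  | _ j ih =>
  have h1 : ∀ z, psiS (d := d) p ε j z = ε ^ (j + 1) * psiS p 1 j z := by
    intro z
    rw [psiS_apply, psiS_apply, mul_add]
    congr 1
    · have e : ∀ ε, lieSeq (chiS (d := d) p ε) (hamF p ε) j
          = lieSeq (fun l => if l ≤ j then chiS (d := d) p ε l else 0) (hamF p ε) j := fun ε =>
        lieSeq_congr _ fun l _ h => by rw [if_pos h]
      rw [e, e, lieSeq_smul (ε := ε) (c := ε) (χ := fun l => if l ≤ j then chiS p 1 l else 0)
        (f := hamF p 1), smul_eq_mul]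
      · ring
      · intro l hl z
        by_cases hlj : l ≤ j
        · obtain ⟨i, rfl⟩ : ∃ i, l = i + 1 := ⟨l - 1, by omega⟩
          simp only [if_pos hlj]
          exact (ih i (by omega)).2 z
        · simp [if_neg hlj]
      · intro l hl
        by_cases hlj : l ≤ j
        · simp only [if_pos hlj]; exact chiS_differentiable one_pos hl
        · simp only [if_neg hlj]; exact differentiable_const _
      · exact fun z => hamF_smul p ε z
      · intro k
        obtain ⟨a, ha⟩ := exists_cls_hamF (d := d) zero_le_one p
        have hs := fun j => (normalForm_size (d := d) (f₀ := max a 1) one_pos (by positivity)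
          (one_pos : (0 : ℝ) < 1) (ha.mono le_rfl (le_max_left _ _)) (n := j + 1) j le_rfl).2.2
        have hk : ∀ k, ∃ a N, Cls 1 N a (lieSeq (fun l => if l ≤ j then chiS (d := d) p 1 l else 0)
            (hamF p 1) k) := by
          intro k
          induction k using Nat.strong_induction_on with
          | _ k ihk =>
          cases k with
          | zero => rw [lieSeq_zero]; exact ⟨_, _, ha⟩
          | succ k =>
            choose! b N hb using ihk
            have ht : ∀ l ∈ Finset.range (k + 1), ∃ a N, Cls 1 N a fun z =>
                (((l : ℝ) + 1) / ((k : ℝ) + 1)) •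
                lieD ((fun l => if l ≤ j then chiS (d := d) p 1 l else 0) (l + 1)) (lieSeq
                  (fun l => if l ≤ j then chiS (d := d) p 1 l else 0) (hamF p 1) (k - l)) z := by
              intro l _
              have hc : ∃ a N, Cls 1 N a
                  ((fun l => if l ≤ j then chiS (d := d) p 1 l else 0) (l + 1)) := by
                by_cases hlj : l + 1 ≤ j
                · simp only [if_pos hlj]; exact ⟨_, _, hs l⟩
                · simp only [if_neg hlj]; exact ⟨_, 0, Cls.zero⟩
              obtain ⟨a', N', hc⟩ := hc
              exact ⟨_, _, (Cls.lieD one_pos hc (hb (k - l) (by omega))).const_smul _⟩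
            choose! b' N' hb' using ht
            refine ⟨_, (Finset.range (k + 1)).sup N', (Cls.sum _ fun l hl =>
              (hb' l hl).mono (Finset.le_sup hl) le_rfl).congr fun z => lieSeq_succ _ _ _ z⟩
        obtain ⟨a, N, h⟩ := hk k
        exact h.differentiable
    · rw [Finset.mul_sum]
      refine Finset.sum_congr rfl fun l hl => ?_
      have hl' : l < j := Finset.mem_range.1 hl
      have hz := (ih (j - l - 1) (by omega)).1
      rw [show j - l - 1 + 1 = j - l by omega] at hz
      rw [funext (ih l hl').2, funext hz]
      have := lieD_smul (chiS_differentiable (d := d) (p := p) one_pos (l := l + 1) (by omega))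
        (zetS_differentiable (d := d) (p := p) one_pos (l := j - l) (by omega))
        (ε ^ (l + 1)) (ε ^ (j - l)) z
      simp only [smul_eq_mul] at this
      rw [this, ← pow_add, show l + 1 + (j - l) = j + 1 by omega]
      ring
  refine ⟨fun z => ?_, fun z => ?_⟩
  · rw [zetS_succ, zetS_succ, average, average]
    simp only [h1, intervalIntegral.integral_const_mul]
    ring
  · have h2 : ∀ z, average (psiS (d := d) p ε j) z = ε ^ (j + 1) * average (psiS p 1 j) z := by
      intro z
      rw [average, average]
      simp only [h1, intervalIntegral.integral_const_mul]
      ring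
    rw [chiS_succ, chiS_succ, homological, homological]
    simp only [h1, h2, ← mul_sub, mul_left_comm _ (ε ^ (j + 1)), intervalIntegral.integral_const_mul]

end NormalForm

/-! ### Convergence of the Lie series along characteristics -/

section Ode
open Set Metric ODE
open scoped NNReal

/-- The fixed point of the Picard iteration, with the information that the solution stays in the
ball on which the field is controlled. -/
theorem IsPicardLindelof.exists_mem_closedBall {E : Type*} [NormedAddCommGroup E]
    [NormedSpace ℝ E] [CompleteSpace E] {f : ℝ → E → E} {tmin tmax : ℝ} {t₀ : Icc tmin tmax}
    {x₀ : E} {a L K : ℝ≥0} (hf : IsPicardLindelof f t₀ x₀ a 0 L K) :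
    ∃ α : ℝ → E, α t₀ = x₀ ∧ ∀ t ∈ Icc tmin tmax, α t ∈ closedBall x₀ a ∧
      HasDerivWithinAt α (f t (α t)) (Icc tmin tmax) t := by
  have hx : x₀ ∈ closedBall x₀ ((0 : ℝ≥0) : ℝ) := by simp
  obtain ⟨α, hα⟩ := FunSpace.exists_isFixedPt_next hf hx
  refine ⟨α.compProj, by rw [FunSpace.compProj_val, ← hα, FunSpace.next_apply₀],
    fun t ht => ⟨α.compProj_mem_closedBall hf.mul_max_le, ?_⟩⟩
  apply hasDerivWithinAt_picard_Icc t₀.2 hf.continuousOn_uncurry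
    α.continuous_compProj.continuousOn (fun _ ht' ↦ α.compProj_mem_closedBall hf.mul_max_le)
    x₀ ht |>.congr_of_mem _ ht
  intro t' ht'
  nth_rw 1 [← hα]
  rw [FunSpace.compProj_of_mem ht', FunSpace.next_apply]

/-- A bounded Lipschitz vector field on a ball has solutions on the unit interval. -/
theorem exists_curve {E : Type*} [NormedAddCommGroup E] [NormedSpace ℝ E] [CompleteSpace E]
    {f : ℝ → E → E} {x₀ : E} {t₀ : ℝ} (ht₀ : t₀ ∈ Icc (0 : ℝ) 1) {m L : ℝ} (hm : 0 ≤ m)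
    (hL : 0 ≤ L) (hlip : ∀ t ∈ Icc (0 : ℝ) 1, ∀ y ∈ closedBall x₀ m, ∀ z ∈ closedBall x₀ m,
      ‖f t y - f t z‖ ≤ L * ‖y - z‖)
    (hc : ∀ y ∈ closedBall x₀ m, ContinuousOn (f · y) (Icc 0 1))
    (hb : ∀ t ∈ Icc (0 : ℝ) 1, ∀ y ∈ closedBall x₀ m, ‖f t y‖ ≤ m) :
    ∃ α : ℝ → E, α t₀ = x₀ ∧ ∀ t ∈ Icc (0 : ℝ) 1, ‖α t - x₀‖ ≤ m ∧
      HasDerivWithinAt α (f t (α t)) (Icc 0 1) t := by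
  have : IsPicardLindelof f (⟨t₀, ht₀⟩ : Icc (0 : ℝ) 1) x₀ ⟨m, hm⟩ 0 ⟨m, hm⟩ ⟨L, hL⟩ := by
    refine ⟨fun t ht => LipschitzOnWith.of_dist_le_mul fun y hy z hz => ?_, hc, hb, ?_⟩
    · rw [dist_eq_norm, dist_eq_norm]; exact hlip t ht y hy z hz
    · simp only [NNReal.coe_zero, sub_zero]
      exact mul_le_of_le_one_right hm (max_le (by linarith [ht₀.1]) ht₀.2)
  obtain ⟨α, h1, h2⟩ := IsPicardLindelof.exists_mem_closedBall this
  refine ⟨α, h1, fun t ht => ⟨?_, (h2 t ht).2⟩⟩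
  rw [← dist_eq_norm]; exact (h2 t ht).1

end Ode

/-! ### Cancellation in truncated double sums -/

section Abel

theorem abel_sum {W : Type*} [AddCommMonoid W] (h : ℕ → ℕ → W) (r : ℕ)
    (h0 : ∀ l j, r ≤ l → h l j = 0) (N n : ℕ) (hn : n ≤ N) :
    ∑ j ∈ Finset.range N, ∑ l ∈ Finset.range r, (if l + j < n then h l j else 0)
      = ∑ k ∈ Finset.range n, ∑ l ∈ Finset.range (k + 1), h l (k - l) := by
  induction n with
  | zero => simp
  | succ n ih =>
    rw [Finset.sum_range_succ, ← ih (by omega)]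
    have h1 : ∀ j l, (if l + j < n + 1 then h l j else 0)
        = (if l + j < n then h l j else 0) + (if l + j = n then h l j else 0) := by
      intro j l
      rcases lt_trichotomy (l + j) n with h | h | h
      · rw [if_pos (by omega), if_pos h, if_neg (by omega), add_zero]
      · rw [if_pos (by omega), if_neg (by omega), if_pos h, zero_add]
      · rw [if_neg (by omega), if_neg (by omega), if_neg (by omega), add_zero]
    simp only [h1, Finset.sum_add_distrib]
    congr 1
    rw [Finset.sum_comm]
    have h2 : ∀ l, ∑ j ∈ Finset.range N, (if l + j = n then h l j else 0)
        = if l < n + 1 then h l (n - l) else 0 := by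
      intro l
      by_cases hl : l < n + 1
      · rw [if_pos hl, Finset.sum_eq_single (n - l)]
        · rw [if_pos (by omega)]
        · intro j _ hj; rw [if_neg (by omega)]
        · intro hj; exact absurd (Finset.mem_range.2 (by omega)) hj
      · rw [if_neg hl]
        exact Finset.sum_eq_zero fun j _ => if_neg (by omega)
    simp only [h2]
    rw [← Finset.sum_filter]
    refine Finset.sum_subset_zero_on_sdiff (fun l hl => ?_) (fun l hl => ?_) (fun _ _ => rfl)
    · exact Finset.mem_range.2 (Finset.mem_filter.1 hl).2
    · rw [Finset.mem_sdiff, Finset.mem_filter, Finset.mem_range, Finset.mem_range] at hl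
      exact h0 _ _ (by by_contra h; exact hl.2 ⟨by omega, hl.1⟩)

/-- Both sums contain the entries with l + j < n, which cancel. The others satisfy l + j ≥ n, and
there are at most r (n + 1) of them since the columns l ≥ r vanish. -/
theorem abel_bound {W : Type*} [NormedAddCommGroup W] [NormedSpace ℝ W] {g : ℕ → ℕ → W}
    {r n : ℕ} {t c : ℝ} (ht : t ∈ Set.Icc (0 : ℝ) 1) (hc : 0 ≤ c)
    (h0 : ∀ l j, r ≤ l → g l j = 0) (hg : ∀ l j, n ≤ l + j → ‖g l j‖ ≤ c) :
    ‖∑ k ∈ Finset.range n, t ^ k • ∑ l ∈ Finset.range (k + 1), g l (k - l)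
      - ∑ j ∈ Finset.range (n + 1), t ^ j • ∑ l ∈ Finset.range r, t ^ l • g l j‖
      ≤ ((n : ℝ) + 1) * (r * c) := by
  have h1 := abel_sum (fun l j => t ^ (l + j) • g l j) r (fun l j h => by simp [h0 l j h])
    (n + 1) n (by omega)
  have h2 : ∑ k ∈ Finset.range n, t ^ k • ∑ l ∈ Finset.range (k + 1), g l (k - l)
      = ∑ k ∈ Finset.range n, ∑ l ∈ Finset.range (k + 1), t ^ (l + (k - l)) • g l (k - l) := by
    refine Finset.sum_congr rfl fun k _ => ?_
    rw [Finset.smul_sum]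
    refine Finset.sum_congr rfl fun l hl => ?_
    have := Finset.mem_range.1 hl
    rw [show l + (k - l) = k by omega]
  rw [h2, ← h1, ← Finset.sum_sub_distrib]
  refine (norm_sum_le _ _).trans ?_
  have h3 : ∀ j ∈ Finset.range (n + 1), ‖∑ l ∈ Finset.range r,
      (if l + j < n then t ^ (l + j) • g l j else 0)
      - t ^ j • ∑ l ∈ Finset.range r, t ^ l • g l j‖ ≤ r * c := by
    intro j _
    rw [Finset.smul_sum, ← Finset.sum_sub_distrib]
    refine (norm_sum_le _ _).trans ?_
    refine (Finset.sum_le_card_nsmul _ _ c fun l _ => ?_).trans (by simp)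
    rw [smul_smul, ← pow_add, add_comm j l]
    split_ifs with h
    · simpa using hc
    · rw [zero_sub, norm_neg, norm_smul, norm_pow, Real.norm_of_nonneg ht.1]
      exact (mul_le_of_le_one_left (norm_nonneg _) (pow_le_one₀ ht.1 ht.2)).trans
        (hg l j (by omega))
  refine (Finset.sum_le_card_nsmul _ _ _ h3).trans ?_
  simp

end Abel

/-- A generating sequence of order `r` whose Lie series converge geometrically on the ball of
radius `x`. -/
structure GenData {d : ℕ} (χ : ℕ → Phase d → ℝ) (r D : ℕ) (x μ : ℝ) (a : ℕ → ℝ) : Prop where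
  D_pos : 0 < D
  x_gt : 2 < x
  μ_pos : 0 < μ
  μ_lt : μ < 1
  cls : ∀ l, 1 ≤ l → Cls x (D * l) (a l) (χ l)
  sum_le : ∀ n, ∑ l ∈ Finset.range n,
      (D / x) ^ 2 * ((l : ℝ) + 1) ^ 2 * a (l + 1) * (μ ^ (l + 1))⁻¹ ≤ 1
  zero : ∀ l, r < l → χ l = fun _ => 0

/-- The time dependent Hamiltonian vector field whose flow is the change of coordinates. -/
def drift {d : ℕ} (χ : ℕ → Phase d → ℝ) (r : ℕ) (t : ℝ) (z : Phase d) : Phase d :=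
  ∑ l ∈ Finset.range r, t ^ l • ((l : ℝ) + 1) • hamField (χ (l + 1)) z

namespace GenData
variable {d : ℕ} {χ : ℕ → Phase d → ℝ} {r D : ℕ} {x μ : ℝ} {a : ℕ → ℝ}
  {W : Type} [NormedAddCommGroup W] [NormedSpace ℝ W] {f : Phase d → W} {b : ℝ}

theorem x_pos (h : GenData χ r D x μ a) : 0 < x := by linarith [h.x_gt]

theorem lieSeq (h : GenData χ r D x μ a) (hf : Cls x D b f) (k : ℕ) :
    Cls x (D * (k + 1)) (μ ^ k * b) (lieSeq χ f k) :=
  Cls.lieSeq h.x_pos h.μ_pos h.cls h.sum_le hf k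

theorem K_pos (h : GenData χ r D x μ a) : 0 < ((D : ℝ) / x) ^ 2 := by
  have := h.x_pos
  have : (0 : ℝ) < D := by exact_mod_cast h.D_pos
  positivity

theorem mul_le (h : GenData χ r D x μ a) (l : ℕ) :
    ((l : ℝ) + 1) * a (l + 1) ≤ μ ^ (l + 1) / ((D : ℝ) / x) ^ 2 := by
  have hK := h.K_pos
  have hμ := h.μ_pos
  have ha : ∀ l, 0 ≤ a (l + 1) := fun l => (h.cls (l + 1) (by omega)).nonneg h.x_pos.le
  have h1 : (D / x) ^ 2 * ((l : ℝ) + 1) ^ 2 * a (l + 1) * (μ ^ (l + 1))⁻¹ ≤ 1 := by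
    refine le_trans ?_ (h.sum_le (l + 1))
    exact Finset.single_le_sum (f := fun l : ℕ =>
      (D / x) ^ 2 * ((l : ℝ) + 1) ^ 2 * a (l + 1) * (μ ^ (l + 1))⁻¹)
      (fun i _ => by have := ha i; positivity) (Finset.self_mem_range_succ l)
  rw [le_div_iff₀ hK]
  rw [← div_eq_mul_inv, div_le_one (by positivity)] at h1
  refine le_trans ?_ h1
  have h2 : ((l : ℝ) + 1) ≤ ((l : ℝ) + 1) ^ 2 := by nlinarith [(Nat.cast_nonneg l : (0 : ℝ) ≤ l)]
  have h3 := mul_le_mul_of_nonneg_right h2 (mul_nonneg hK.le (ha l))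
  nlinarith

/-- Giving up one unit of radius for a derivative replaces the factor degree over radius by 1, so
the derivatives form a geometric series with the same ratio μ. -/
theorem fderiv_bound (h : GenData χ r D x μ a) (hf : Cls x D b f) (k : ℕ) {z : Phase d}
    (hz : ‖z‖ ≤ x - 1) : ‖fderiv ℝ (KleinGordon.lieSeq χ f k) z‖ ≤ μ ^ k * b := by
  have := (h.lieSeq hf k).fderiv (y := x - 1) (by linarith [h.x_gt]) (by linarith)
  simpa using this.norm_le hz

theorem fderiv2_bound (h : GenData χ r D x μ a) (hf : Cls x D b f) (k : ℕ) {z : Phase d}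
    (hz : ‖z‖ ≤ x - 2) :
    ‖fderiv ℝ (fderiv ℝ (KleinGordon.lieSeq χ f k)) z‖ ≤ μ ^ k * b := by
  have := ((h.lieSeq hf k).fderiv (y := x - 1) (by linarith [h.x_gt]) (by linarith)).fderiv
    (y := x - 2) (by linarith [h.x_gt]) (by linarith)
  have h2 := this.norm_le hz
  rw [show x - (x - 1) = 1 by ring, show x - 1 - (x - 2) = 1 by ring] at h2
  simpa using h2

theorem hamField_bound (h : GenData χ r D x μ a) {l : ℕ} (hl : 1 ≤ l) {z : Phase d}
    (hz : ‖z‖ ≤ x - 1) : ‖hamField (χ l) z‖ ≤ a l := by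
  have : Cls (x - 1) (D * l) (a l / (x - (x - 1))) (hamField (χ l)) :=
    ((h.cls l hl).fderiv (y := x - 1) (by linarith [h.x_gt]) (by linarith)).clm_comp
      (hamC d) norm_hamC_le
  simpa using this.norm_le hz

theorem fderiv_hamField_bound (h : GenData χ r D x μ a) {l : ℕ} (hl : 1 ≤ l) {z : Phase d}
    (hz : ‖z‖ ≤ x - 2) : ‖fderiv ℝ (hamField (χ l)) z‖ ≤ a l := by
  have : Cls (x - 1) (D * l) (a l / (x - (x - 1))) (hamField (χ l)) :=
    ((h.cls l hl).fderiv (y := x - 1) (by linarith [h.x_gt]) (by linarith)).clm_comp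
      (hamC d) norm_hamC_le
  have h2 := (this.fderiv (y := x - 2) (by linarith [h.x_gt]) (by linarith)).norm_le hz
  rw [show x - (x - 1) = 1 by ring, show x - 1 - (x - 2) = 1 by ring] at h2
  simpa using h2

theorem hamField_differentiable (h : GenData χ r D x μ a) {l : ℕ} (hl : 1 ≤ l) :
    Differentiable ℝ (hamField (χ l)) := ((h.cls l hl).hamField h.x_pos).differentiable

theorem hamField_zero (h : GenData χ r D x μ a) {l : ℕ} (hl : r < l) (z : Phase d) :
    hamField (χ l) z = 0 := by
  rw [hamField_eq, h.zero l hl]; simp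

theorem tendsto_error (h : GenData χ r D x μ a) (c : ℝ) :
    Filter.Tendsto (fun n : ℕ => ((n : ℝ) + 1) * (r * (μ ^ n * c))) Filter.atTop (nhds 0) := by
  have h1 := tendsto_self_mul_const_pow_of_lt_one h.μ_pos.le h.μ_lt
  have h2 := tendsto_pow_atTop_nhds_zero_of_lt_one h.μ_pos.le h.μ_lt
  have h3 := (h1.add h2).const_mul (r * c)
  simp only [add_zero, mul_zero] at h3
  refine h3.congr fun n => ?_
  ring

theorem succ_smul_lieSeq (χ : ℕ → Phase d → ℝ) (f : Phase d → W) (k : ℕ) (z : Phase d) :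
    ((k : ℝ) + 1) • KleinGordon.lieSeq χ f (k + 1) z = ∑ l ∈ Finset.range (k + 1),
      ((l : ℝ) + 1) • lieD (χ (l + 1)) (KleinGordon.lieSeq χ f (k - l)) z := by
  rw [lieSeq_succ, Finset.smul_sum]
  refine Finset.sum_congr rfl fun l _ => ?_
  rw [smul_smul]
  congr 1
  field_simp

/-- The partial sum S(t) = ∑ t^k f_k(η(t)) has a derivative in which the factors k t^(k-1) f_k,
expanded by the recursion, cancel against the derivatives along the drift, except for entries with l
+ j ≥ n. Their sum is at most (n+1) r μ^n c and tends to zero. Since S(0) = f(η(0)), the mean value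
inequality on [0, 1] identifies the sum of the series at η(1). -/
theorem hasSum_curve (h : GenData χ r D x μ a) (hf : Cls x D b f) [CompleteSpace W]
    {η : ℝ → Phase d} (hη : ∀ t ∈ Set.Icc (0 : ℝ) 1, ‖η t‖ ≤ x - 1 ∧
      HasDerivWithinAt η (-drift χ r t (η t)) (Set.Icc 0 1) t) :
    HasSum (fun k => KleinGordon.lieSeq χ f k (η 1)) (f (η 0)) := by
  have hb := hf.nonneg h.x_pos.le
  have hμ := h.μ_pos
  have hK := h.K_pos
  set F := KleinGordon.lieSeq χ f with hF
  have hsum : Summable fun k => F k (η 1) := by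
    refine Summable.of_norm_bounded (g := fun k => μ ^ k * b)
      ((summable_geometric_of_lt_one hμ.le h.μ_lt).mul_right b) fun k => ?_
    exact (h.lieSeq hf k).norm_le (by linarith [(hη 1 (by simp)).1])
  set g : ℝ → ℕ → ℕ → W := fun t l j => ((l : ℝ) + 1) • lieD (χ (l + 1)) (F j) (η t) with hg
  have hg0 : ∀ t, ∀ l j, r ≤ l → g t l j = 0 := fun t l j hl => by
    simp only [hg, lieD, h.hamField_zero (show r < l + 1 by omega), map_zero, smul_zero]
  set c : ℝ := b / ((D : ℝ) / x) ^ 2 with hc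
  have hgb : ∀ t ∈ Set.Icc (0 : ℝ) 1, ∀ n l j, n ≤ l + j → ‖g t l j‖ ≤ μ ^ n * c := by
    intro t ht n l j hn
    have h1 := h.fderiv_bound hf j (hη t ht).1
    have h2 := h.hamField_bound (l := l + 1) (by omega) (hη t ht).1
    have h3 : ‖lieD (χ (l + 1)) (F j) (η t)‖ ≤ μ ^ j * b * a (l + 1) :=
      ((fderiv ℝ (F j) (η t)).le_opNorm _).trans (mul_le_mul h1 h2 (norm_nonneg _) (by positivity))
    simp only [hg]
    rw [norm_smul, Real.norm_of_nonneg (by positivity)]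
    calc ((l : ℝ) + 1) * ‖lieD (χ (l + 1)) (F j) (η t)‖
        ≤ ((l : ℝ) + 1) * (μ ^ j * b * a (l + 1)) := by gcongr
      _ = μ ^ j * b * (((l : ℝ) + 1) * a (l + 1)) := by ring
      _ ≤ μ ^ j * b * (μ ^ (l + 1) / ((D : ℝ) / x) ^ 2) := by gcongr; exact h.mul_le l
      _ = μ ^ (l + j + 1) * c := by rw [hc]; ring
      _ ≤ μ ^ n * c := by
        refine mul_le_mul_of_nonneg_right ?_ (by positivity)
        exact pow_le_pow_of_le_one hμ.le h.μ_lt.le (by omega)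
  have hkey : ∀ n : ℕ, ‖∑ k ∈ Finset.range (n + 1), F k (η 1) - f (η 0)‖
      ≤ ((n : ℝ) + 1) * (r * (μ ^ n * c)) := by
    intro n
    set S : ℝ → W := fun t => ∑ k ∈ Finset.range (n + 1), t ^ k • F k (η t) with hS
    have hd : ∀ t ∈ Set.Icc (0 : ℝ) 1, HasDerivWithinAt S
        (∑ k ∈ Finset.range n, t ^ k • ∑ l ∈ Finset.range (k + 1), g t l (k - l)
          - ∑ j ∈ Finset.range (n + 1), t ^ j • ∑ l ∈ Finset.range r, t ^ l • g t l j)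
        (Set.Icc 0 1) t := by
      intro t ht
      have h1 : ∀ k ∈ Finset.range (n + 1), HasDerivWithinAt (fun t => t ^ k • F k (η t))
          (t ^ k • fderiv ℝ (F k) (η t) (-drift χ r t (η t)) + ((k : ℝ) * t ^ (k - 1)) • F k (η t))
          (Set.Icc 0 1) t := fun k _ =>
        ((hasDerivAt_pow k t).hasDerivWithinAt).smul
          ((((h.lieSeq hf k).differentiable (η t)).hasFDerivAt).comp_hasDerivWithinAt t (hη t ht).2)
      refine (HasDerivWithinAt.fun_sum h1).congr_deriv ?_
      rw [Finset.sum_add_distrib, Finset.sum_range_succ' (fun k => ((k : ℝ) * t ^ (k - 1)) • F k (η t)),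
        add_comm, sub_eq_add_neg, ← Finset.sum_neg_distrib]
      congr 1
      · simp only [Nat.cast_zero, zero_mul, zero_smul, add_zero, Nat.add_sub_cancel]
        refine Finset.sum_congr rfl fun k _ => ?_
        rw [mul_comm, mul_smul]
        push_cast
        rw [succ_smul_lieSeq]
      · refine Finset.sum_congr rfl fun j _ => ?_
        rw [map_neg, smul_neg, drift, map_sum]
        congr 2
        refine Finset.sum_congr rfl fun l _ => ?_
        rw [map_smul, map_smul]; rfl
    have h2 := norm_image_sub_le_of_norm_deriv_le_segment_01' hd fun t ht =>
      abel_bound (Set.Ico_subset_Icc_self ht) (by positivity) (hg0 t)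
        (hgb t (Set.Ico_subset_Icc_self ht) n)
    have e1 : S 1 = ∑ k ∈ Finset.range (n + 1), F k (η 1) := by simp [hS]
    have e0 : S 0 = f (η 0) := by
      simp only [hS]
      rw [Finset.sum_range_succ', Finset.sum_eq_zero]
      · simp [hF, lieSeq_zero]
      · intro k _; simp
    rwa [e1, e0] at h2
  have ht : Filter.Tendsto (fun n => ∑ k ∈ Finset.range (n + 1), F k (η 1)) Filter.atTop
      (nhds (f (η 0))) := by
    rw [tendsto_iff_norm_sub_tendsto_zero]
    exact squeeze_zero (fun n => norm_nonneg _) hkey (h.tendsto_error c)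
  have h3 := hsum.hasSum
  have h4 := (h3.tendsto_sum_nat).comp (Filter.tendsto_add_atTop_nat 1)
  rw [← tendsto_nhds_unique h4 ht]
  exact h3

end GenData

/-! ### The Lie series of the identity is a canonical transformation -/

theorem two_le_smooth : (2 : WithTop ℕ∞) ≤ ∞ := 
  show ((2 : ℕ∞) : WithTop ℕ∞) ≤ _ from WithTop.coe_le_coe.2 le_top

/-- With M = ∑ t^k P_k, the term M ∘ A is subtracted and added again so that the derivative takes
the form M' = e + M ∘ A, where e is a difference of the kind estimated by `abel_bound`. -/
theorem sum_deriv_pow_smul {E : Type*} [NormedAddCommGroup E] [NormedSpace ℝ E] (t : ℝ) (n : ℕ)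
    (P : ℕ → E →L[ℝ] E) (Q : ℕ → E →L[ℝ] E →L[ℝ] E) (v : E) (A : E →L[ℝ] E) :
    ∑ k ∈ Finset.range (n + 1), (t ^ k • Q k (-v) + ((k : ℝ) * t ^ (k - 1)) • P k)
      = ∑ k ∈ Finset.range n, t ^ k • (((k : ℝ) + 1) • P (k + 1))
        - ∑ k ∈ Finset.range (n + 1), t ^ k • (Q k v + P k ∘L A)
        + (∑ k ∈ Finset.range (n + 1), t ^ k • P k) ∘L A := by
  rw [Finset.sum_add_distrib, Finset.sum_range_succ' (fun k => ((k : ℝ) * t ^ (k - 1)) • P k)]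
  have e1 : ∑ k ∈ Finset.range n, (((k + 1 : ℕ) : ℝ) * t ^ (k + 1 - 1)) • P (k + 1)
      = ∑ k ∈ Finset.range n, t ^ k • (((k : ℝ) + 1) • P (k + 1)) := by
    refine Finset.sum_congr rfl fun k _ => ?_
    rw [Nat.add_sub_cancel, mul_comm, mul_smul]
    push_cast
    rfl
  simp only [e1, map_neg, smul_neg, smul_add, Finset.sum_add_distrib, Finset.sum_neg_distrib,
    ContinuousLinearMap.finsetSum_comp, ContinuousLinearMap.smul_comp, Nat.cast_zero, zero_mul,
    zero_smul, add_zero]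
  abel

/-- This is the derivative of M H M* applied to α, when M' = e + M A. The hypothesis on A says that
it is infinitesimally symplectic, so the two terms with A cancel and only the error e is left. -/
theorem norm_canonical_defect_le {E : Type*} [NormedAddCommGroup E] [NormedSpace ℝ E]
    (H : (E →L[ℝ] ℝ) →L[ℝ] E) (hH : ‖H‖ ≤ 1) (α : E →L[ℝ] ℝ) {A M e : E →L[ℝ] E} {c : ℝ}
    (hM : ‖M‖ ≤ c) (hA : ∀ m : E →L[ℝ] ℝ, H (m ∘L A) = -A (H m)) :
    ‖(e + M ∘L A) (H (α ∘L M)) + M (H (α ∘L (e + M ∘L A)))‖ ≤ ‖e‖ * (2 * ‖α‖ * c) := by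
  have hLn : ∀ B : E →L[ℝ] E, ‖H (α ∘L B)‖ ≤ ‖α‖ * ‖B‖ := fun B => by
    have h1 := H.le_of_opNorm_le hH (α ∘L B)
    rw [one_mul] at h1
    exact h1.trans (ContinuousLinearMap.opNorm_comp_le _ _)
  have h5 : (e + M ∘L A) (H (α ∘L M)) + M (H (α ∘L (e + M ∘L A)))
      = e (H (α ∘L M)) + M (H (α ∘L e)) := by
    rw [ContinuousLinearMap.comp_add, map_add H, ← ContinuousLinearMap.comp_assoc, hA]
    simp only [_root_.add_apply, ContinuousLinearMap.comp_apply, map_add, map_neg]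
    abel
  have hc : 0 ≤ c := (norm_nonneg _).trans hM
  have h6 : ‖e (H (α ∘L M))‖ ≤ ‖e‖ * (‖α‖ * c) :=
    (e.le_opNorm _).trans (mul_le_mul_of_nonneg_left ((hLn _).trans
      (mul_le_mul_of_nonneg_left hM (norm_nonneg _))) (norm_nonneg _))
  have h7 : ‖M (H (α ∘L e))‖ ≤ c * (‖α‖ * ‖e‖) :=
    (M.le_opNorm _).trans (mul_le_mul hM (hLn _) (norm_nonneg _) hc)
  rw [h5]
  calc _ ≤ ‖e‖ * (‖α‖ * c) + c * (‖α‖ * ‖e‖) := norm_add_le_of_le h6 h7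
    _ = _ := by ring

section
variable {d : ℕ}

theorem apply_hamC_symm (m n : Phase d →L[ℝ] ℝ) : n (hamC d m) = -m (hamC d n) := by
  have key : inner ℝ (hamC d n) (symp d (hamC d m)) = n (hamC d m) := by
    have := inner_symp_hamC n (hamC d m)
    rw [inner_symp_left] at this
    linarith
  rw [← key, real_inner_comm, inner_symp_hamC]

/-- The linearization of a Hamiltonian field is the symplectic matrix times a symmetric Hessian; the
symmetry of the second derivative is the whole content. -/
theorem hamC_comp_fderiv_hamField {χ : Phase d → ℝ} (hχ : ContDiff ℝ 2 χ) (z : Phase d)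
    (m : Phase d →L[ℝ] ℝ) :
    hamC d (m ∘L fderiv ℝ (hamField χ) z) = -fderiv ℝ (hamField χ) z (hamC d m) := by
  have hd : DifferentiableAt ℝ (fderiv ℝ χ) z :=
    (hχ.fderiv_right (m := 1) le_rfl).differentiable one_ne_zero z
  have h1 : fderiv ℝ (hamField χ) z = hamC d ∘L fderiv ℝ (fderiv ℝ χ) z :=
    ((hamC d).hasFDerivAt.comp z hd.hasFDerivAt).fderiv
  have hs : ∀ v w, fderiv ℝ (fderiv ℝ χ) z v w = fderiv ℝ (fderiv ℝ χ) z w v := fun v w =>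
    (hχ.contDiffAt.isSymmSndFDerivAt (by simp)) v w
  refine ext_inner_right ℝ fun w => ?_
  obtain ⟨w, rfl⟩ := (symp d).surjective w
  have key : ∀ l : Phase d →L[ℝ] ℝ, inner ℝ (hamC d l) (symp d w) = l w := fun l => by
    have := inner_symp_hamC l w
    rw [inner_symp_left] at this
    linarith
  rw [inner_neg_left, h1, key]
  simp only [ContinuousLinearMap.comp_apply]
  rw [key, apply_hamC_symm, hs]

end

namespace GenData
variable {d : ℕ} {χ : ℕ → Phase d → ℝ} {r D : ℕ} {x μ : ℝ} {a : ℕ → ℝ}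

/-- The argument of `hasSum_curve` for the differentiated recursion. Each bracket now yields a
second derivative along the field and a first derivative composed with the linearized field; the
latter give the term M ∘ A. Two derivatives explain the radius x - 2. -/
theorem hasDerivWithinAt_partial (h : GenData χ r D x μ a) {b : ℝ}
    (hf : Cls x D b (fun z : Phase d => z)) {η : ℝ → Phase d} {t : ℝ}
    (hη : ‖η t‖ ≤ x - 2) (hη' : HasDerivWithinAt η (-drift χ r t (η t)) (Set.Icc 0 1) t)
    (ht : t ∈ Set.Icc (0 : ℝ) 1) (n : ℕ) :
    ∃ e : Phase d →L[ℝ] Phase d,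
      ‖e‖ ≤ ((n : ℝ) + 1) * (r * (μ ^ n * (2 * b / ((D : ℝ) / x) ^ 2))) ∧
      HasDerivWithinAt
        (fun t => ∑ k ∈ Finset.range (n + 1), t ^ k •
          fderiv ℝ (KleinGordon.lieSeq χ (fun z => z) k) (η t))
        (e + (∑ k ∈ Finset.range (n + 1), t ^ k •
          fderiv ℝ (KleinGordon.lieSeq χ (fun z => z) k) (η t)) ∘L
          ∑ l ∈ Finset.range r, t ^ l • ((l : ℝ) + 1) • fderiv ℝ (hamField (χ (l + 1))) (η t))
        (Set.Icc 0 1) t := by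
  have hb := hf.nonneg h.x_pos.le
  have hμ := h.μ_pos
  have hK := h.K_pos
  set F := KleinGordon.lieSeq χ (fun z : Phase d => z) with hF
  have hsm : ∀ j, ContDiff ℝ ∞ (F j) := fun j => (h.lieSeq hf j).smooth
  have hd1 : ∀ j z, DifferentiableAt ℝ (F j) z := fun j z => (h.lieSeq hf j).differentiable z
  have hd2 : ∀ j z, DifferentiableAt ℝ (fderiv ℝ (F j)) z := fun j z =>
    ((hsm j).fderiv_right (m := 1) (by norm_cast)).differentiable one_ne_zero z
  have hsymm : ∀ j z v w, fderiv ℝ (fderiv ℝ (F j)) z v w = fderiv ℝ (fderiv ℝ (F j)) z w v :=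
    fun j z v w => (((hsm j).of_le two_le_smooth).contDiffAt.isSymmSndFDerivAt (by simp)) v w
  set g : ℕ → ℕ → Phase d →L[ℝ] Phase d := fun l j => ((l : ℝ) + 1) •
    (fderiv ℝ (fderiv ℝ (F j)) (η t) (hamField (χ (l + 1)) (η t))
      + fderiv ℝ (F j) (η t) ∘L fderiv ℝ (hamField (χ (l + 1))) (η t)) with hg
  have hg0 : ∀ l j, r ≤ l → g l j = 0 := fun l j hl => by
    have e1 : hamField (χ (l + 1)) = fun _ => 0 :=
      funext fun z => h.hamField_zero (show r < l + 1 by omega) z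
    simp [hg, e1]
  have hgb : ∀ l j, n ≤ l + j → ‖g l j‖ ≤ μ ^ n * (2 * b / ((D : ℝ) / x) ^ 2) := by
    intro l j hn
    have h1 := h.fderiv_bound hf j (z := η t) (by linarith)
    have h2 := h.hamField_bound (l := l + 1) (z := η t) (by omega) (by linarith)
    have h3 := h.fderiv_hamField_bound (l := l + 1) (z := η t) (by omega) hη
    have h4 := h.fderiv2_bound hf j (z := η t) hη
    have h5 : ‖fderiv ℝ (fderiv ℝ (F j)) (η t) (hamField (χ (l + 1)) (η t))‖
        ≤ μ ^ j * b * a (l + 1) := (ContinuousLinearMap.le_opNorm _ _).trans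
          (mul_le_mul h4 h2 (norm_nonneg _) (by positivity))
    have h6 : ‖fderiv ℝ (F j) (η t) ∘L fderiv ℝ (hamField (χ (l + 1))) (η t)‖
        ≤ μ ^ j * b * a (l + 1) := (ContinuousLinearMap.opNorm_comp_le _ _).trans
          (mul_le_mul h1 h3 (norm_nonneg _) (by positivity))
    simp only [hg]
    rw [norm_smul, Real.norm_of_nonneg (by positivity)]
    calc ((l : ℝ) + 1) * _ ≤ ((l : ℝ) + 1) * (μ ^ j * b * a (l + 1) + μ ^ j * b * a (l + 1)) := by
          gcongr; exact norm_add_le_of_le h5 h6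
      _ = 2 * μ ^ j * b * (((l : ℝ) + 1) * a (l + 1)) := by ring
      _ ≤ 2 * μ ^ j * b * (μ ^ (l + 1) / ((D : ℝ) / x) ^ 2) := by gcongr; exact h.mul_le l
      _ = μ ^ (l + j + 1) * (2 * b / ((D : ℝ) / x) ^ 2) := by ring
      _ ≤ μ ^ n * (2 * b / ((D : ℝ) / x) ^ 2) := by
        refine mul_le_mul_of_nonneg_right ?_ (by positivity)
        exact pow_le_pow_of_le_one hμ.le h.μ_lt.le (by omega)
  have hsucc : ∀ k : ℕ, ((k : ℝ) + 1) • fderiv ℝ (F (k + 1)) (η t)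
      = ∑ l ∈ Finset.range (k + 1), g l (k - l) := by
    intro k
    have e1 : ∀ l ∈ Finset.range (k + 1), HasFDerivAt
        (fun z => ((l : ℝ) + 1) • lieD (χ (l + 1)) (F (k - l)) z) (g l (k - l)) (η t) := by
      intro l _
      refine HasFDerivAt.fun_const_smul (𝕜 := ℝ) ?_ ((l : ℝ) + 1)
      refine ((hd2 (k - l) (η t)).hasFDerivAt.clm_apply
        (h.hamField_differentiable (by omega) (η t)).hasFDerivAt).congr_fderiv ?_
      ext1 w
      simp only [_root_.add_apply, ContinuousLinearMap.comp_apply, ContinuousLinearMap.flip_apply]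
      rw [add_comm, hsymm]
    have e2 := HasFDerivAt.fun_sum e1
    have e3 : (fun z => ∑ l ∈ Finset.range (k + 1), ((l : ℝ) + 1) • lieD (χ (l + 1)) (F (k - l)) z)
        = fun z => ((k : ℝ) + 1) • F (k + 1) z := by
      funext z; rw [hF, succ_smul_lieSeq]
    rw [e3] at e2
    exact (((hd1 (k + 1) (η t)).hasFDerivAt.fun_const_smul ((k : ℝ) + 1)).unique e2)
  refine ⟨_, abel_bound ht (by positivity) hg0 hgb, ?_⟩
  have h1 : ∀ k ∈ Finset.range (n + 1), HasDerivWithinAt (fun t => t ^ k • fderiv ℝ (F k) (η t))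
      (t ^ k • fderiv ℝ (fderiv ℝ (F k)) (η t) (-drift χ r t (η t))
        + ((k : ℝ) * t ^ (k - 1)) • fderiv ℝ (F k) (η t)) (Set.Icc 0 1) t := fun k _ =>
    ((hasDerivAt_pow k t).hasDerivWithinAt).smul
      ((hd2 k (η t)).hasFDerivAt.comp_hasDerivWithinAt t hη')
  refine (HasDerivWithinAt.fun_sum h1).congr_deriv ?_
  have e2 : ∀ j, ∑ l ∈ Finset.range r, t ^ l • g l j
      = fderiv ℝ (fderiv ℝ (F j)) (η t) (drift χ r t (η t)) + fderiv ℝ (F j) (η t) ∘L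
        ∑ l ∈ Finset.range r, t ^ l • ((l : ℝ) + 1) • fderiv ℝ (hamField (χ (l + 1))) (η t) := by
    intro j
    rw [drift, map_sum, ContinuousLinearMap.comp_finsetSum, ← Finset.sum_add_distrib]
    refine Finset.sum_congr rfl fun l _ => ?_
    simp only [hg, map_smul, ContinuousLinearMap.comp_smul, smul_add]
  rw [sum_deriv_pow_smul t n (fun k => fderiv ℝ (F k) (η t)) (fun k => fderiv ℝ (fderiv ℝ (F k)) (η t))
    _ (∑ l ∈ Finset.range r, t ^ l • ((l : ℝ) + 1) • fderiv ℝ (hamField (χ (l + 1))) (η t))]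
  simp only [e2, hsucc]

set_option maxHeartbeats 800000 in
/-- The derivative of the sum of the Lie series of the identity is symplectic. -/
theorem tsum_fderiv_hamC (h : GenData χ r D x μ a) {b : ℝ}
    (hf : Cls x D b (fun z : Phase d => z)) {η : ℝ → Phase d}
    (hη : ∀ t ∈ Set.Icc (0 : ℝ) 1, ‖η t‖ ≤ x - 2 ∧
      HasDerivWithinAt η (-drift χ r t (η t)) (Set.Icc 0 1) t) (α : Phase d →L[ℝ] ℝ) :
    (∑' k, fderiv ℝ (KleinGordon.lieSeq χ (fun z => z) k) (η 1)) (hamC d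
      (α ∘L ∑' k, fderiv ℝ (KleinGordon.lieSeq χ (fun z => z) k) (η 1))) = hamC d α := by
  have hb := hf.nonneg h.x_pos.le
  have hμ := h.μ_pos
  have hK := h.K_pos
  set F := KleinGordon.lieSeq χ (fun z : Phase d => z) with hF
  set M : ℕ → ℝ → Phase d →L[ℝ] Phase d := fun n t =>
    ∑ k ∈ Finset.range (n + 1), t ^ k • fderiv ℝ (F k) (η t) with hM
  have hMb : ∀ n, ∀ t ∈ Set.Icc (0 : ℝ) 1, ‖M n t‖ ≤ b / (1 - μ) := by
    intro n t ht
    refine (norm_sum_le _ _).trans ?_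
    have h1 : ∀ k ∈ Finset.range (n + 1), ‖t ^ k • fderiv ℝ (F k) (η t)‖ ≤ μ ^ k * b := by
      intro k _
      rw [norm_smul, norm_pow, Real.norm_of_nonneg ht.1]
      exact (mul_le_of_le_one_left (norm_nonneg _) (pow_le_one₀ ht.1 ht.2)).trans
        (h.fderiv_bound hf k (by linarith [(hη t ht).1]))
    refine (Finset.sum_le_sum h1).trans ?_
    rw [← Finset.sum_mul, div_eq_inv_mul]
    refine mul_le_mul_of_nonneg_right ?_ hb
    rw [← tsum_geometric_of_lt_one hμ.le h.μ_lt]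
    exact (summable_geometric_of_lt_one hμ.le h.μ_lt).sum_le_tsum _ fun _ _ => by positivity
  have hsum : Summable fun k => fderiv ℝ (F k) (η 1) := by
    refine Summable.of_norm_bounded (g := fun k => μ ^ k * b)
      ((summable_geometric_of_lt_one hμ.le h.μ_lt).mul_right b) fun k => ?_
    exact h.fderiv_bound hf k (by linarith [(hη 1 (by simp)).1])
  set L : (Phase d →L[ℝ] Phase d) →L[ℝ] Phase d :=
    hamC d ∘L ContinuousLinearMap.compL ℝ (Phase d) (Phase d) ℝ α with hL
  -- At t = 0 the partial sum is the identity, so M H M* is H there, and along the curve it changes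
  -- by at most a tail. The flow itself is never differentiated with respect to its initial value.
  have hkey : ∀ n : ℕ, ‖M n 1 (L (M n 1)) - hamC d α‖
      ≤ ((n : ℝ) + 1) * (r * (μ ^ n * (2 * b / ((D : ℝ) / x) ^ 2 * (2 * ‖α‖ * (b / (1 - μ)))))) := by
    intro n
    have hd : ∀ t ∈ Set.Icc (0 : ℝ) 1, ∃ y : Phase d, ‖y‖ ≤ ((n : ℝ) + 1) *
        (r * (μ ^ n * (2 * b / ((D : ℝ) / x) ^ 2 * (2 * ‖α‖ * (b / (1 - μ)))))) ∧
        HasDerivWithinAt (fun t => M n t (L (M n t))) y (Set.Icc 0 1) t := by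
      intro t ht
      obtain ⟨e, he, h1⟩ := h.hasDerivWithinAt_partial hf (hη t ht).1 (hη t ht).2 ht n
      set A := ∑ l ∈ Finset.range r, t ^ l • ((l : ℝ) + 1) • fderiv ℝ (hamField (χ (l + 1))) (η t)
        with hA
      have hmA : ∀ m : Phase d →L[ℝ] ℝ, hamC d (m ∘L A) = -A (hamC d m) := by
        intro m
        simp only [hA, ContinuousLinearMap.comp_finsetSum, ContinuousLinearMap.comp_smul, map_sum,
          map_smul, _root_.sum_apply, _root_.smul_apply, ← Finset.sum_neg_distrib]
        refine Finset.sum_congr rfl fun l _ => ?_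
        rw [hamC_comp_fderiv_hamField (((h.cls (l + 1) (by omega)).smooth).of_le
          two_le_smooth), smul_neg, smul_neg]
      have h2 : HasDerivWithinAt (M n) (e + M n t ∘L A) (Set.Icc 0 1) t := h1
      have h3 : HasDerivWithinAt (fun t => L (M n t)) (L (e + M n t ∘L A)) (Set.Icc 0 1) t :=
        L.hasFDerivAt.comp_hasDerivWithinAt t h2
      refine ⟨_, ?_, h2.clm_apply h3⟩
      have hc : 0 ≤ b / (1 - μ) := div_nonneg hb (by linarith [h.μ_lt])
      refine (norm_canonical_defect_le (hamC d) norm_hamC_le α (hMb n t ht) hmA).trans ?_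
      refine (mul_le_mul_of_nonneg_right he (by positivity)).trans (le_of_eq ?_)
      ring
    choose! y hy hyd using hd
    have h2 := norm_image_sub_le_of_norm_deriv_le_segment_01' hyd fun t ht =>
      hy t (Set.Ico_subset_Icc_self ht)
    have e0 : M n 0 = ContinuousLinearMap.id ℝ (Phase d) := by
      simp only [hM]
      rw [Finset.sum_range_succ', Finset.sum_eq_zero]
      · simp only [hF, lieSeq_zero, pow_zero, one_smul, zero_add]
        exact fderiv_fun_id
      · intro k _; rw [pow_succ, mul_zero]; exact zero_smul ℝ (fderiv ℝ (F (k + 1)) (η 0))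
    have e1 : L (ContinuousLinearMap.id ℝ (Phase d)) = hamC d α := by
      simp [hL]
    rwa [e0, e1] at h2
  have e1 : ∀ n, M n 1 = ∑ k ∈ Finset.range (n + 1), fderiv ℝ (F k) (η 1) := fun n => by simp [hM]
  have h3 : Filter.Tendsto (fun n => M n 1) Filter.atTop (nhds (∑' k, fderiv ℝ (F k) (η 1))) := by
    simp only [e1]
    exact (hsum.hasSum.tendsto_sum_nat).comp (Filter.tendsto_add_atTop_nat 1)
  have h4 : Filter.Tendsto (fun n => M n 1 (L (M n 1))) Filter.atTop
      (nhds ((∑' k, fderiv ℝ (F k) (η 1)) (L (∑' k, fderiv ℝ (F k) (η 1))))) :=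
    (isBoundedBilinearMap_apply.continuous.tendsto
      ((∑' k, fderiv ℝ (F k) (η 1)), L (∑' k, fderiv ℝ (F k) (η 1)))).comp
      (h3.prodMk_nhds ((L.continuous.tendsto _).comp h3))
  have h5 : Filter.Tendsto (fun n => M n 1 (L (M n 1))) Filter.atTop (nhds (hamC d α)) := by
    rw [tendsto_iff_norm_sub_tendsto_zero]
    exact squeeze_zero (fun n => norm_nonneg _) hkey (h.tendsto_error _)
  exact tendsto_nhds_unique h4 h5

end GenData

/-- The sum of the Lie series of the identity. -/
def lieMap {d : ℕ} (χ : ℕ → Phase d → ℝ) (z : Phase d) : Phase d :=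
  ∑' k, lieSeq χ (fun z => z) k z

/-- A generating sequence so small that the sum of the Lie series of the identity is close to
the identity. -/
structure SmallGen {d : ℕ} (χ : ℕ → Phase d → ℝ) (r D : ℕ) (x μ : ℝ) (a : ℕ → ℝ) : Prop extends
    GenData χ r D x μ a where
  four_lt : 4 < x
  small : 4 * (x + x ^ 2) * μ ≤ 1

namespace SmallGen
open Set Metric
variable {d : ℕ} {χ : ℕ → Phase d → ℝ} {r D : ℕ} {x μ : ℝ} {a : ℕ → ℝ}
  {W : Type} [NormedAddCommGroup W] [NormedSpace ℝ W] {f : Phase d → W} {b : ℝ}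

theorem cls_id (h : SmallGen χ r D x μ a) : Cls x D x (fun z : Phase d => z) :=
  (KleinGordon.cls_id (by linarith [h.four_lt])).mono h.D_pos le_rfl

/-- The left-hand side starts at order μ, so one power of μ is left over after comparison with the
summability hypothesis: the sum is at most x² μ. This bounds the drift and its Lipschitz constant.
-/
theorem sum_coeff_le (h : SmallGen χ r D x μ a) :
    ∑ l ∈ Finset.range r, ((l : ℝ) + 1) * a (l + 1) ≤ 1 / 4 := by
  have hμ := h.μ_pos
  have hx := h.x_pos
  have hD : (1 : ℝ) ≤ D := by exact_mod_cast h.D_pos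
  have ha : ∀ l, 0 ≤ a (l + 1) := fun l => (h.cls (l + 1) (by omega)).nonneg hx.le
  have h1 := h.sum_le r
  have h2 : ∑ l ∈ Finset.range r, ((l : ℝ) + 1) * a (l + 1) ≤ x ^ 2 * μ *
      ∑ l ∈ Finset.range r, (D / x) ^ 2 * ((l : ℝ) + 1) ^ 2 * a (l + 1) * (μ ^ (l + 1))⁻¹ := by
    rw [Finset.mul_sum]
    refine Finset.sum_le_sum fun l _ => ?_
    have e1 : x ^ 2 * μ * ((D / x) ^ 2 * ((l : ℝ) + 1) ^ 2 * a (l + 1) * (μ ^ (l + 1))⁻¹)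
        = (D : ℝ) ^ 2 * (((l : ℝ) + 1) * (((l : ℝ) + 1) * a (l + 1))) * (μ ^ l)⁻¹ := by
      field_simp
      ring
    rw [e1]
    have e2 : 1 ≤ (μ ^ l)⁻¹ := (one_le_inv₀ (by positivity)).2 (pow_le_one₀ hμ.le h.μ_lt.le)
    have e3 : 0 ≤ ((l : ℝ) + 1) * a (l + 1) := mul_nonneg (by positivity) (ha l)
    calc ((l : ℝ) + 1) * a (l + 1) = 1 * (1 * (((l : ℝ) + 1) * a (l + 1))) * 1 := by ring
      _ ≤ (D : ℝ) ^ 2 * (((l : ℝ) + 1) * (((l : ℝ) + 1) * a (l + 1))) * (μ ^ l)⁻¹ := by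
        gcongr
        · nlinarith
        · linarith [(Nat.cast_nonneg l : (0 : ℝ) ≤ l)]
  have h3 := h.small
  have h4 : x ^ 2 * μ * ∑ l ∈ Finset.range r,
      (D / x) ^ 2 * ((l : ℝ) + 1) ^ 2 * a (l + 1) * (μ ^ (l + 1))⁻¹ ≤ x ^ 2 * μ * 1 := by
    gcongr
  nlinarith [mul_pos hx hμ]

theorem drift_le (h : SmallGen χ r D x μ a) {t : ℝ} (ht : t ∈ Icc (0 : ℝ) 1) {z : Phase d}
    (hz : ‖z‖ ≤ x - 1) : ‖drift χ r t z‖ ≤ 1 / 4 := by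
  refine (norm_sum_le _ _).trans (le_trans (Finset.sum_le_sum fun l _ => ?_) h.sum_coeff_le)
  rw [norm_smul, norm_pow, Real.norm_of_nonneg ht.1, norm_smul, Real.norm_of_nonneg (by positivity)]
  refine (mul_le_of_le_one_left (by positivity) (pow_le_one₀ ht.1 ht.2)).trans ?_
  gcongr
  exact h.hamField_bound (by omega) hz

theorem drift_lip (h : SmallGen χ r D x μ a) {t : ℝ} (ht : t ∈ Icc (0 : ℝ) 1) {z w : Phase d}
    (hz : ‖z‖ ≤ x - 2) (hw : ‖w‖ ≤ x - 2) : ‖drift χ r t z - drift χ r t w‖ ≤ 1 / 4 * ‖z - w‖ := by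
  have hd : ∀ y : Phase d, HasFDerivAt (drift χ r t)
      (∑ l ∈ Finset.range r, t ^ l • ((l : ℝ) + 1) • fderiv ℝ (hamField (χ (l + 1))) y) y :=
    fun y => HasFDerivAt.fun_sum fun l _ =>
      (((h.hamField_differentiable (by omega) y).hasFDerivAt.fun_const_smul _).fun_const_smul _)
  refine (convex_closedBall (0 : Phase d) (x - 2)).norm_image_sub_le_of_norm_hasFDerivWithin_le
    (fun y _ => (hd y).hasFDerivWithinAt) (fun y hy => ?_) (by simpa using hw) (by simpa using hz)
  refine (norm_sum_le _ _).trans (le_trans (Finset.sum_le_sum fun l _ => ?_) h.sum_coeff_le)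
  rw [norm_smul, norm_pow, Real.norm_of_nonneg ht.1, norm_smul, Real.norm_of_nonneg (by positivity)]
  refine (mul_le_of_le_one_left (by positivity) (pow_le_one₀ ht.1 ht.2)).trans ?_
  gcongr
  exact h.fderiv_hamField_bound (by omega) (by simpa using hy)

/-- The drift is at most 1/4, so in unit time the curve stays within 1/4 of its prescribed value.
The choice t₀ = 1 prescribes a point where the series is summed, t₀ = 0 a value of the sum. -/
theorem exists_curve (h : SmallGen χ r D x μ a) {t₀ : ℝ} (ht₀ : t₀ ∈ Icc (0 : ℝ) 1)
    {y : Phase d} (hy : ‖y‖ ≤ x - 3) :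
    ∃ η : ℝ → Phase d, η t₀ = y ∧ ∀ t ∈ Icc (0 : ℝ) 1, ‖η t‖ ≤ x - 2 ∧
      HasDerivWithinAt η (-drift χ r t (η t)) (Icc 0 1) t := by
  have hball : ∀ z ∈ closedBall y (1 / 4), ‖z‖ ≤ x - 2 := fun z hz => by
    rw [mem_closedBall, dist_eq_norm] at hz
    have := norm_le_norm_add_norm_sub' z y
    linarith
  obtain ⟨η, h1, h2⟩ := KleinGordon.exists_curve (f := fun t z => -drift χ r t z) (x₀ := y)
    ht₀ (m := 1 / 4) (L := 1 / 4) (by norm_num) (by norm_num)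
    (fun t ht z hz w hw => by
      rw [neg_sub_neg, norm_sub_rev]
      exact h.drift_lip ht (hball z hz) (hball w hw))
    (fun z _ => by unfold drift; fun_prop)
    (fun t ht z hz => by rw [norm_neg]; exact h.drift_le ht (by linarith [hball z hz]))
  exact ⟨η, h1, fun t ht => ⟨hball _ (by rw [mem_closedBall, dist_eq_norm]; exact (h2 t ht).1),
    (h2 t ht).2⟩⟩

/-- The Lie series of f is f composed with the Lie series of the identity, since both are determined
by the initial point of the same curve ending at y. -/
theorem hasSum (h : SmallGen χ r D x μ a) (hf : Cls x D b f) [CompleteSpace W] {y : Phase d}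
    (hy : ‖y‖ ≤ x - 3) : HasSum (fun k => KleinGordon.lieSeq χ f k y) (f (lieMap χ y)) := by
  obtain ⟨η, rfl, h2⟩ := h.exists_curve (t₀ := 1) (by simp) hy
  have hη : ∀ t ∈ Icc (0 : ℝ) 1, ‖η t‖ ≤ x - 1 ∧
      HasDerivWithinAt η (-drift χ r t (η t)) (Icc 0 1) t :=
    fun t ht => ⟨by linarith [(h2 t ht).1], (h2 t ht).2⟩
  have h3 := h.hasSum_curve h.cls_id hη
  rw [lieMap, h3.tsum_eq]
  exact h.hasSum_curve hf hη

theorem lieMap_curve (h : SmallGen χ r D x μ a) {η : ℝ → Phase d}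
    (hη : ∀ t ∈ Icc (0 : ℝ) 1, ‖η t‖ ≤ x - 2 ∧
      HasDerivWithinAt η (-drift χ r t (η t)) (Icc 0 1) t) : lieMap χ (η 1) = η 0 :=
  (h.hasSum_curve h.cls_id fun t ht => ⟨by linarith [(hη t ht).1], (hη t ht).2⟩).tsum_eq

theorem exists_lieMap_eq (h : SmallGen χ r D x μ a) {z : Phase d} (hz : ‖z‖ ≤ x - 3) :
    ∃ y, ‖y‖ ≤ x - 2 ∧ lieMap χ y = z := by
  obtain ⟨η, rfl, h2⟩ := h.exists_curve (t₀ := 0) (by simp) hz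
  exact ⟨η 1, (h2 1 (by simp)).1, h.lieMap_curve h2⟩

theorem summable_norm (h : SmallGen χ r D x μ a) {y : Phase d} (hy : ‖y‖ ≤ x) :
    Summable fun k => ‖KleinGordon.lieSeq χ (fun z => z) k y‖ :=
  Summable.of_nonneg_of_le (fun _ => norm_nonneg _) (fun k => (h.lieSeq h.cls_id k).norm_le hy)
    ((summable_geometric_of_lt_one h.μ_pos.le h.μ_lt).mul_right x)

theorem summable_fderiv (h : SmallGen χ r D x μ a) {y : Phase d} (hy : ‖y‖ ≤ x - 1) :
    Summable fun k => fderiv ℝ (KleinGordon.lieSeq χ (fun z => z) k) y :=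
  Summable.of_norm_bounded ((summable_geometric_of_lt_one h.μ_pos.le h.μ_lt).mul_right x)
    fun k => h.fderiv_bound h.cls_id k hy

theorem tail_le (h : SmallGen χ r D x μ a) : ∑' k : ℕ, μ ^ (k + 1) * x ≤ 2 * x * μ ∧
    2 * x * μ ≤ 1 / 2 := by
  have hμ := h.μ_pos
  have hx := h.four_lt
  have h1 := h.small
  have h2 : μ ≤ 1 / 2 := by nlinarith
  constructor
  · rw [tsum_mul_right]
    simp only [pow_succ]
    rw [tsum_mul_right, tsum_geometric_of_lt_one hμ.le h.μ_lt]
    have h3 : (1 - μ)⁻¹ ≤ 2 := by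
      rw [inv_le_comm₀ (by linarith) (by norm_num)]; linarith
    nlinarith [mul_pos hμ (by linarith : 0 < x)]
  · nlinarith [mul_pos hμ (by positivity : 0 < x ^ 2)]

theorem norm_lieMap_sub_le (h : SmallGen χ r D x μ a) {y : Phase d} (hy : ‖y‖ ≤ x) :
    ‖lieMap χ y - y‖ ≤ 2 * x * μ := by
  have h1 := (h.summable_norm hy).of_norm
  rw [lieMap, h1.tsum_eq_zero_add, lieSeq_zero, add_sub_cancel_left]
  refine le_trans ?_ h.tail_le.1
  refine tsum_of_norm_bounded (Summable.hasSum ?_) fun k => (h.lieSeq h.cls_id (k + 1)).norm_le hy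
  exact ((summable_nat_add_iff 1).2 (summable_geometric_of_lt_one h.μ_pos.le h.μ_lt)).mul_right x

theorem hasFDerivAt_lieMap (h : SmallGen χ r D x μ a) {y : Phase d} (hy : ‖y‖ < x - 1) :
    HasFDerivAt (lieMap χ) (∑' k, fderiv ℝ (KleinGordon.lieSeq χ (fun z => z) k) y) y := by
  refine hasFDerivAt_tsum_of_isPreconnected (𝕜 := ℝ) (u := fun k => μ ^ k * x) (s := ball 0 (x - 1))
    (x₀ := 0) ((summable_geometric_of_lt_one h.μ_pos.le h.μ_lt).mul_right x) isOpen_ball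
    (convex_ball 0 (x - 1)).isPreconnected
    (fun k z _ => ((h.lieSeq h.cls_id k).differentiable z).hasFDerivAt)
    (fun k z hz => h.fderiv_bound h.cls_id k (by simpa using (mem_ball.1 hz).le))
    (by simp; linarith [h.four_lt]) ((h.summable_norm (y := 0) (by simp; linarith [h.x_pos])).of_norm)
    (by simpa using hy)

theorem norm_fderiv_lieMap_sub_le (h : SmallGen χ r D x μ a) {y : Phase d} (hy : ‖y‖ < x - 1) :
    ‖fderiv ℝ (lieMap χ) y - ContinuousLinearMap.id ℝ (Phase d)‖ ≤ 1 / 2 := by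
  rw [(h.hasFDerivAt_lieMap hy).fderiv, (h.summable_fderiv hy.le).tsum_eq_zero_add, lieSeq_zero,
    fderiv_fun_id, add_sub_cancel_left]
  refine le_trans ?_ (h.tail_le.1.trans h.tail_le.2)
  refine tsum_of_norm_bounded (Summable.hasSum ?_) fun k => h.fderiv_bound h.cls_id (k + 1) hy.le
  exact ((summable_nat_add_iff 1).2 (summable_geometric_of_lt_one h.μ_pos.le h.μ_lt)).mul_right x

theorem norm_lieMap_sub_sub_le (h : SmallGen χ r D x μ a) {y z : Phase d} (hy : ‖y‖ < x - 1)
    (hz : ‖z‖ < x - 1) : ‖lieMap χ y - lieMap χ z - (y - z)‖ ≤ 1 / 2 * ‖y - z‖ := by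
  have h1 := (convex_ball (0 : Phase d) (x - 1)).norm_image_sub_le_of_norm_hasFDerivWithin_le
    (f := fun y => lieMap χ y - y) (C := 1 / 2) (fun w hw =>
      ((h.hasFDerivAt_lieMap (by simpa using hw)).sub (hasFDerivAt_id w)).hasFDerivWithinAt)
    (fun w hw => by
      have hw' : ‖w‖ < x - 1 := by simpa using hw
      have := h.norm_fderiv_lieMap_sub_le hw'
      rwa [(h.hasFDerivAt_lieMap hw').fderiv] at this)
    (by simpa using hz : z ∈ ball (0 : Phase d) (x - 1)) (by simpa using hy)
  rwa [show lieMap χ y - y - (lieMap χ z - z) = lieMap χ y - lieMap χ z - (y - z) by abel] at h1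

theorem half_norm_sub_le (h : SmallGen χ r D x μ a) {y z : Phase d} (hy : ‖y‖ < x - 1)
    (hz : ‖z‖ < x - 1) : 1 / 2 * ‖y - z‖ ≤ ‖lieMap χ y - lieMap χ z‖ := by
  have h1 := h.norm_lieMap_sub_sub_le hy hz
  have h2 := norm_sub_norm_le (y - z) (lieMap χ y - lieMap χ z)
  rw [norm_sub_rev] at h1
  linarith

theorem injOn (h : SmallGen χ r D x μ a) : InjOn (lieMap χ) (ball 0 (x - 1)) := by
  intro y hy z hz e
  have h1 := h.half_norm_sub_le (by simpa using hy) (by simpa using hz)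
  rw [e, sub_self, norm_zero] at h1
  exact sub_eq_zero.1 (norm_le_zero_iff.1 (by linarith))

/-- Canonical transformations intertwine Hamiltonian vector fields. -/
theorem fderiv_lieMap_hamField (h : SmallGen χ r D x μ a) {H : Phase d → ℝ} {y : Phase d}
    (hy : ‖y‖ ≤ x - 3) (hH : DifferentiableAt ℝ H (lieMap χ y)) :
    fderiv ℝ (lieMap χ) y (hamField (fun z => H (lieMap χ z)) y) = hamField H (lieMap χ y) := by
  have hT := h.hasFDerivAt_lieMap (y := y) (by linarith)
  have h1 : fderiv ℝ (fun z => H (lieMap χ z)) y = fderiv ℝ H (lieMap χ y) ∘L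
      ∑' k, fderiv ℝ (KleinGordon.lieSeq χ (fun z => z) k) y :=
    (hH.hasFDerivAt.comp y hT).fderiv
  rw [hamField_eq, hamField_eq, h1, hT.fderiv]
  obtain ⟨η, rfl, h2⟩ := h.exists_curve (t₀ := 1) (by simp) hy
  exact h.tsum_fderiv_hamC h.cls_id h2 _

theorem fderiv_lieMap_injective (h : SmallGen χ r D x μ a) {y : Phase d} (hy : ‖y‖ < x - 1) :
    Function.Injective (fderiv ℝ (lieMap χ) y) := by
  refine (injective_iff_map_eq_zero _).2 fun v hv => ?_
  have h1 := (fderiv ℝ (lieMap χ) y - ContinuousLinearMap.id ℝ (Phase d)).le_of_opNorm_le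
    (h.norm_fderiv_lieMap_sub_le hy) v
  simp only [_root_.sub_apply, hv, ContinuousLinearMap.id_apply, zero_sub, norm_neg] at h1
  exact norm_le_zero_iff.1 (by linarith)

end SmallGen

/-! ### The normal form of the Klein-Gordon Hamiltonian -/

/-- `f₀` bounds the perturbation, at `ε = 1`, on the ball of radius `x`. -/
structure Size (d p : ℕ) (x f₀ : ℝ) : Prop where
  four_lt : 4 < x
  pos : 0 < f₀
  cls : Cls x (2 * p + 2) f₀ (hamF (d := d) p 1)

theorem exists_size (d p : ℕ) {x : ℝ} (hx : 4 < x) : ∃ f₀, Size d p x f₀ := by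
  obtain ⟨a, ha⟩ := exists_cls_hamF (d := d) (by linarith : 0 ≤ x) p
  have := ha.nonneg (by linarith)
  exact ⟨a + 1, hx, by linarith, ha.mono le_rfl (by linarith)⟩

namespace Size
open Set Metric
variable {d p : ℕ} {x f₀ ε : ℝ} {r : ℕ}

theorem x_pos (S : Size d p x f₀) : 0 < x := by linarith [S.four_lt]

theorem nfA_pos (S : Size d p x f₀) : 0 < nfA f₀ := by
  have := S.pos
  have := Real.pi_pos
  rw [nfA]; positivity

theorem nfC_pos (S : Size d p x f₀) : 0 < nfC p x f₀ := by
  have := S.nfA_pos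
  have := S.x_pos
  rw [nfC]; positivity

/-- The ratio of the Lie series of order `r` is small. -/
def Small (p : ℕ) (x f₀ : ℝ) (r : ℕ) (ε : ℝ) : Prop :=
  1 ≤ r ∧ 0 < ε ∧ 4 * (x + x ^ 2) * (nfC p x f₀ * r * ε) ≤ 1

theorem mu_pos (S : Size d p x f₀) (h : Small p x f₀ r ε) : 0 < nfC p x f₀ * r * ε := by
  have h1 := S.nfC_pos
  have h2 := h.2.1
  have h3 : (0 : ℝ) < r := by exact_mod_cast h.1
  positivity

theorem mu_lt (S : Size d p x f₀) (h : Small p x f₀ r ε) : nfC p x f₀ * r * ε < 1 / 16 := by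
  have h1 := S.mu_pos h
  have h2 := h.2.2
  have h3 := S.four_lt
  nlinarith

/-- With μ = C r ε every nonzero term of the sum in `GenData` is at most 1/(6 r), because C contains
the factor 6 (D/x)² A, and there are at most r such terms. -/
theorem smallGen (S : Size d p x f₀) (h : Small p x f₀ r ε) :
    SmallGen (genSeq (d := d) p ε r) r (2 * p + 2) x (nfC p x f₀ * r * ε)
      (fun l => if l ≤ r then nfA f₀ * ε * (nfC p x f₀ * r * ε) ^ (l - 1) / (l : ℝ) ^ 3 else 0) := by
  have hμ := S.mu_pos h
  have hA := S.nfA_pos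
  have hC := S.nfC_pos
  have hx := S.x_pos
  have hε := h.2.1
  have hr : (0 : ℝ) < r := by exact_mod_cast h.1
  refine ⟨⟨by omega, by linarith [S.four_lt], hμ, by linarith [S.mu_lt h], fun l hl => ?_,
    fun n => ?_, fun l hl => ?_⟩, S.four_lt, h.2.2⟩
  · obtain ⟨j, rfl⟩ : ∃ j, l = j + 1 := ⟨l - 1, by omega⟩
    rw [genSeq_apply]
    split_ifs with hj
    · simpa using (normalForm_size hx S.pos hε S.cls j hj).2.2
    · exact (Cls.zero (N := 0)).mono (Nat.zero_le _) le_rfl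
  · set μ := nfC p x f₀ * r * ε with hμd
    have h1 : ∀ l ∈ Finset.range n, (((2 * p + 2 : ℕ) : ℝ) / x) ^ 2 * ((l : ℝ) + 1) ^ 2 *
        (if l + 1 ≤ r then nfA f₀ * ε * μ ^ (l + 1 - 1) / ((l + 1 : ℕ) : ℝ) ^ 3 else 0)
          * (μ ^ (l + 1))⁻¹ ≤ if l + 1 ≤ r then (6 * (r : ℝ))⁻¹ else 0 := by
      intro l _
      split_ifs with hl
      · have e1 : (((2 * p + 2 : ℕ) : ℝ) / x) ^ 2 * ((l : ℝ) + 1) ^ 2 *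
            (nfA f₀ * ε * μ ^ (l + 1 - 1) / ((l + 1 : ℕ) : ℝ) ^ 3) * (μ ^ (l + 1))⁻¹
            = (((2 * p + 2 : ℕ) : ℝ) / x) ^ 2 * nfA f₀ * ε / μ * ((l : ℝ) + 1)⁻¹ := by
          rw [Nat.add_sub_cancel, pow_succ μ l]
          push_cast
          field_simp
        have e2 : (((2 * p + 2 : ℕ) : ℝ) / x) ^ 2 * nfA f₀ * ε / μ = (6 * (r : ℝ))⁻¹ := by
          rw [hμd, nfC]
          have : (0 : ℝ) < ((2 * p + 2 : ℕ) : ℝ) := by positivity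
          field_simp
        rw [e1, e2]
        refine mul_le_of_le_one_right (by positivity) (inv_le_one_of_one_le₀ ?_)
        linarith [(Nat.cast_nonneg l : (0 : ℝ) ≤ l)]
      · simp
    refine (Finset.sum_le_sum h1).trans ?_
    rw [← Finset.sum_filter, Finset.sum_const, nsmul_eq_mul]
    have h2 : ((Finset.range n).filter fun l => l + 1 ≤ r).card ≤ r := by
      refine (Finset.card_le_card (t := Finset.range r) fun l hl => ?_).trans (by simp)
      exact Finset.mem_range.2 (Finset.mem_filter.1 hl).2
    have h3 : (((Finset.range n).filter fun l => l + 1 ≤ r).card : ℝ) ≤ r := by exact_mod_cast h2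
    calc _ ≤ (r : ℝ) * (6 * (r : ℝ))⁻¹ := by gcongr
      _ ≤ 1 := by field_simp; norm_num
  · rw [genSeq_apply, if_neg (by omega)]

theorem lieSeq_genSeq_add (hε : 0 < ε) {k : ℕ} (hk : k < r) (z : Phase d) :
    lieSeq (genSeq p ε r) hamG (k + 1) z + lieSeq (genSeq p ε r) (hamF p ε) k z
      = nfTerm p ε r (k + 1) z := by
  rw [lieSeq_congr (χ := genSeq p ε r) (χ' := chiS p ε) _ (fun l _ hl => by rw [genSeq_apply, if_pos (by omega)]),
    lieSeq_congr (χ := genSeq p ε r) (χ' := chiS p ε) _ (fun l _ hl => by rw [genSeq_apply, if_pos (by omega)]),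
    lieSeq_hamG_add hε, nfTerm_apply, if_pos (by omega)]

theorem cls_hamF (S : Size d p x f₀) (hε : 0 < ε) : Cls x (2 * p + 2) (ε * f₀) (hamF (d := d) p ε) := by
  have := (S.cls.const_smul ε).congr (g := hamF p ε) fun z => by rw [hamF_smul]; rfl
  rwa [abs_of_pos hε] at this

theorem cls_hamG (S : Size d p x f₀) : Cls x (2 * p + 2) (x ^ 2) (hamG (d := d)) :=
  (KleinGordon.cls_hamG S.x_pos.le).mono (by omega) le_rfl

theorem coordMap_eq (p : ℕ) (ε : ℝ) (r : ℕ) :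
    coordMap (d := d) p ε r = lieMap (genSeq p ε r) := rfl

/-- The Hamiltonian in the coordinates of order `r` is the truncated normal form up to a
geometrically small remainder. -/
theorem exists_remainder (S : Size d p x f₀) (h : Small p x f₀ r ε) (hε : ε ≤ 1) {y : Phase d}
    (hy : ‖y‖ < x - 3) : ∃ R' : Phase d →L[ℝ] ℝ,
      ‖R'‖ ≤ 2 * (x ^ 2 + f₀) * (nfC p x f₀ * r * ε) ^ r ∧
      HasFDerivAt (fun z => hamNF p ε r z - hamK p ε r z) R' y := by
  have G := S.smallGen h
  set χ := genSeq (d := d) p ε r with hχ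
  set μ := nfC p x f₀ * r * ε with hμd
  have hμ : 0 < μ := S.mu_pos h
  have hμ1 : μ < 1 / 16 := S.mu_lt h
  have hf := S.pos
  -- The perturbation is itself of first order, so its k-th term is paired with the term of index k
  -- + 1 of G. The first r pairs are Z_1, …, Z_r by the normal form identity, and the remaining
  -- pairs form the remainder.
  set T : ℕ → Phase d → ℝ := fun k z => lieSeq χ hamG (k + 1) z + lieSeq χ (hamF p ε) k z with hT
  have hTd : ∀ k z, HasFDerivAt (T k) (fderiv ℝ (lieSeq χ hamG (k + 1)) z
      + fderiv ℝ (lieSeq χ (hamF p ε) k) z) z := fun k z =>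
    ((G.lieSeq S.cls_hamG (k + 1)).differentiable z).hasFDerivAt.add
      ((G.lieSeq (S.cls_hamF h.2.1) k).differentiable z).hasFDerivAt
  have hTb : ∀ k {z : Phase d}, ‖z‖ ≤ x - 1 → ‖fderiv ℝ (lieSeq χ hamG (k + 1)) z
      + fderiv ℝ (lieSeq χ (hamF p ε) k) z‖ ≤ μ ^ k * (x ^ 2 + f₀) := by
    intro k z hz
    have h1 := G.fderiv_bound S.cls_hamG (k + 1) hz
    have h2 := G.fderiv_bound (S.cls_hamF h.2.1) k hz
    refine (norm_add_le_of_le h1 h2).trans ?_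
    have h3 : μ ^ (k + 1) * x ^ 2 ≤ μ ^ k * x ^ 2 := by
      refine mul_le_mul_of_nonneg_right (pow_le_pow_of_le_one hμ.le (by linarith) (by omega))
        (by positivity)
    have h4 : μ ^ k * (ε * f₀) ≤ μ ^ k * f₀ := by
      refine mul_le_mul_of_nonneg_left (mul_le_of_le_one_left hf.le hε) (by positivity)
    linarith
  have hs : Summable fun k : ℕ => μ ^ (k + r) * (x ^ 2 + f₀) :=
    ((summable_nat_add_iff r).2 (summable_geometric_of_lt_one hμ.le (by linarith))).mul_right _
  have hsumT : ∀ {z : Phase d}, ‖z‖ ≤ x - 3 → HasSum (fun k => T k z)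
      (hamNF p ε r z - hamG z) := by
    intro z hz
    have h1 := G.hasSum S.cls_hamG hz
    have h2 := G.hasSum (S.cls_hamF h.2.1) hz
    have h3 := (hasSum_nat_add_iff' 1).2 h1
    simp only [Finset.range_one, Finset.sum_singleton, lieSeq_zero] at h3
    have h4 := h3.add h2
    rwa [show hamG (lieMap χ z) - hamG z + hamF p ε (lieMap χ z) = hamNF p ε r z - hamG z by
      rw [hamNF, hamH, coordMap_eq]; ring] at h4
  have hrem : ∀ {z : Phase d}, ‖z‖ ≤ x - 3 → HasSum (fun k => T (k + r) z)
      (hamNF p ε r z - hamK p ε r z) := by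
    intro z hz
    have h1 := (hasSum_nat_add_iff' r).2 (hsumT hz)
    have h2 : ∑ k ∈ Finset.range r, T k z = ∑ s ∈ Finset.Icc 1 r, nfTerm p ε r s z := by
      rw [Finset.range_eq_Ico, Finset.sum_congr rfl (g := fun k => nfTerm p ε r (k + 1) z)
        fun k hk => lieSeq_genSeq_add h.2.1 (Finset.mem_Ico.1 hk).2 z,
        Finset.sum_Ico_add' (fun k => nfTerm p ε r k z) 0 r 1]
      rfl
    rw [h2] at h1
    rwa [hamK, ← sub_sub]
  refine ⟨∑' k, (fderiv ℝ (lieSeq χ hamG (k + r + 1)) y + fderiv ℝ (lieSeq χ (hamF p ε) (k + r)) y),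
    ?_, ?_⟩
  · have hc : ∑' k : ℕ, μ ^ (k + r) * (x ^ 2 + f₀) ≤ 2 * (x ^ 2 + f₀) * μ ^ r := by
      rw [tsum_mul_right]
      simp only [pow_add]
      rw [tsum_mul_right, tsum_geometric_of_lt_one hμ.le (by linarith)]
      have h3 : (1 - μ)⁻¹ ≤ 2 := by
        rw [inv_le_comm₀ (by linarith) (by norm_num)]; linarith
      calc (1 - μ)⁻¹ * μ ^ r * (x ^ 2 + f₀) ≤ 2 * μ ^ r * (x ^ 2 + f₀) := by gcongr
        _ = _ := by ring
    refine le_trans ?_ hc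
    exact tsum_of_norm_bounded hs.hasSum fun k => hTb (k + r) (by linarith)
  · have h1 := hasFDerivAt_tsum_of_isPreconnected (𝕜 := ℝ) (s := ball (0 : Phase d) (x - 3))
      (x₀ := 0) (x := y) hs isOpen_ball (convex_ball 0 (x - 3)).isPreconnected
      (fun k z _ => hTd (k + r) z)
      (fun k z hz => hTb (k + r) (by have := mem_ball_zero_iff.1 hz; linarith))
      (by simp; linarith [S.four_lt]) (hrem (by simp; linarith [S.four_lt])).summable (by simpa using hy)
    refine h1.congr_of_eventuallyEq ?_
    filter_upwards [isOpen_ball.mem_nhds (show y ∈ ball (0 : Phase d) (x - 3) by simpa using hy)]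
      with z hz
    exact (hrem (mem_ball_zero_iff.1 hz).le).tsum_eq.symm

/-- The part of the normal form of orders `2, …, r` is of order `ε ^ 2`. -/
theorem cls_sum_nfTerm (S : Size d p x f₀) (h : Small p x f₀ r ε) :
    Cls x ((2 * p + 2) * r) (4 * f₀ * nfC p x f₀ * ε ^ 2)
      (fun z : Phase d => ∑ s ∈ Finset.Icc 2 r, nfTerm p ε r s z) := by
  have hf := S.pos
  have hC := S.nfC_pos
  have hε := h.2.1
  have h1 : ∀ s ∈ Finset.Icc 2 r, Cls x ((2 * p + 2) * r)
      (2 * f₀ * nfC p x f₀ * ε ^ 2 * ((s : ℝ) ^ 2)⁻¹) (nfTerm (d := d) p ε r s) := by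
    intro s hs
    rw [Finset.mem_Icc] at hs
    rw [nfTerm_apply, if_pos hs.2]
    obtain ⟨j, rfl⟩ : ∃ j, s = j + 2 := ⟨s - 2, by omega⟩
    -- The ratio is taken with n equal to the order s = j + 2 and not with n = r. As C s ε ≤ 1, its
    -- power s - 1 is at most C s ε, which leaves a multiple of ε²/s², summable uniformly in r.
    refine ((normalForm_size S.x_pos hf hε S.cls (n := j + 2) (j + 1) le_rfl).2.1).mono
      (Nat.mul_le_mul_left _ hs.2) ?_
    set ν := nfC p x f₀ * ((j + 2 : ℕ) : ℝ) * ε with hν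
    have hν0 : 0 < ν := by positivity
    have hν1 : ν ≤ 1 := by
      have := S.mu_lt h
      have h2 : ((j + 2 : ℕ) : ℝ) ≤ r := by exact_mod_cast hs.2
      have : ν ≤ nfC p x f₀ * r * ε := by rw [hν]; gcongr
      linarith
    have h3 : ν ^ (j + 1) ≤ ν := by
      calc ν ^ (j + 1) ≤ ν ^ 1 := pow_le_pow_of_le_one hν0.le hν1 (by omega)
        _ = ν := pow_one ν
    calc 2 * f₀ * ε * ν ^ (j + 1) / (((j + 1 : ℕ) : ℝ) + 1) ^ 3
        ≤ 2 * f₀ * ε * ν / (((j + 1 : ℕ) : ℝ) + 1) ^ 3 := by gcongr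
      _ = 2 * f₀ * nfC p x f₀ * ε ^ 2 * (((j + 2 : ℕ) : ℝ) ^ 2)⁻¹ := by
        rw [hν]; push_cast
        have : (0 : ℝ) < j + 2 := by positivity
        rw [show (j : ℝ) + 1 + 1 = j + 2 by ring]
        field_simp
  refine (Cls.sum _ h1).mono le_rfl ?_
  rw [← Finset.mul_sum]
  have h2 : ∑ s ∈ Finset.Icc 2 r, ((s : ℝ) ^ 2)⁻¹ ≤ 2 := by
    refine le_trans ?_ (sum_inv_sq_le r)
    have e : ∑ j ∈ Finset.range r, (((j : ℝ) + 1) ^ 2)⁻¹ = ∑ s ∈ Finset.Icc 1 r, ((s : ℝ) ^ 2)⁻¹ := by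
      have := Finset.sum_Ico_add' (fun k : ℕ => ((k : ℝ) ^ 2)⁻¹) 0 r 1
      rw [← Finset.range_eq_Ico] at this
      push_cast at this
      rw [this]; rfl
    rw [e]
    exact Finset.sum_le_sum_of_subset_of_nonneg (Finset.Icc_subset_Icc_left (by omega))
      fun _ _ _ => by positivity
  calc _ ≤ 2 * f₀ * nfC p x f₀ * ε ^ 2 * 2 := by gcongr
    _ = _ := by ring

end Size

/-! ### Polynomial maps between Banach spaces -/

section Poly
variable {E W : Type} [NormedAddCommGroup E] [NormedSpace ℝ E] [NormedAddCommGroup W]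
  [NormedSpace ℝ W]

/-- Finite sums of diagonals of bounded multilinear maps. -/
def IsPoly (f : E → W) : Prop :=
  ∃ (n : ℕ) (M : (k : ℕ) → ContinuousMultilinearMap ℝ (fun _ : Fin k => E) W),
    ∀ z, f z = ∑ k ∈ Finset.range n, M k fun _ => z

theorem IsPoly.contDiff {f : E → W} (h : IsPoly f) : ContDiff ℝ ω f := by
  obtain ⟨n, M, hM⟩ := h
  rw [funext hM]
  refine ContDiff.sum fun k _ => ?_
  exact (M k).contDiff.comp (contDiff_pi.2 fun _ => contDiff_id)

/-- Induction on the order: the derivative is polynomial, and integration along the ray t ↦ t z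
turns its component of degree k into one of degree k + 1 with the factor 1/(k+1). -/
theorem IsPoly.of_iteratedFDeriv_eq_zero (n : ℕ) {W : Type} [NormedAddCommGroup W]
    [NormedSpace ℝ W] {f : E → W} (hf : ContDiff ℝ ∞ f)
    (h : ∀ z, iteratedFDeriv ℝ n f z = 0) : IsPoly f := by
  induction n generalizing W with
  | zero =>
    refine ⟨0, fun _ => 0, fun z => ?_⟩
    rw [Finset.sum_range_zero, ← norm_eq_zero, ← norm_iteratedFDeriv_zero (𝕜 := ℝ), h z, norm_zero]
  | succ n ih =>
    obtain ⟨m, M, hM⟩ := ih (f := fderiv ℝ f) (hf.fderiv_right (by norm_cast)) fun z => by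
      rw [← norm_eq_zero, norm_iteratedFDeriv_fderiv, h z, norm_zero]
    refine ⟨m + 1, fun k => match k with
      | 0 => ContinuousMultilinearMap.constOfIsEmpty ℝ _ (f 0)
      | k + 1 => ((k : ℝ) + 1)⁻¹ • (M k).uncurryRight, fun z => ?_⟩
    rw [Finset.sum_range_succ']
    have hd : ∀ t : ℝ, HasDerivAt (fun t : ℝ => f (t • z) - ∑ k ∈ Finset.range m,
        t ^ (k + 1) • ((k : ℝ) + 1)⁻¹ • M k (fun _ => z) z) 0 t := by
      intro t
      have h1 : HasDerivAt (fun t : ℝ => f (t • z)) (fderiv ℝ f (t • z) z) t := by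
        have h2 : HasDerivAt (fun t : ℝ => t • z) z t := by
          simpa using (hasDerivAt_id t).smul_const z
        exact ((hf.differentiable (by simp)) (t • z)).hasFDerivAt.comp_hasDerivAt t h2
      have h2 : ∀ k ∈ Finset.range m, HasDerivAt
          (fun t : ℝ => t ^ (k + 1) • ((k : ℝ) + 1)⁻¹ • M k (fun _ => z) z)
          (t ^ k • M k (fun _ => z) z) t := fun k _ => by
        refine ((hasDerivAt_pow (k + 1) t).smul_const _).congr_deriv ?_
        rw [smul_smul, Nat.add_sub_cancel]
        congr 1
        push_cast
        field_simp
      refine (h1.sub (HasDerivAt.fun_sum h2)).congr_deriv ?_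
      rw [hM, _root_.sum_apply, sub_eq_zero]
      refine Finset.sum_congr rfl fun k _ => ?_
      have := (M k).map_smul_univ (fun _ => t) (fun _ => z)
      rw [this]
      simp
    have hc := is_const_of_deriv_eq_zero (fun t => (hd t).differentiableAt)
      (fun t => (hd t).deriv) 1 0
    simp only [one_smul, one_pow, zero_smul] at hc
    rw [sub_eq_iff_eq_add] at hc
    rw [hc]
    have e : ∑ k ∈ Finset.range m, (0 : ℝ) ^ (k + 1) • ((k : ℝ) + 1)⁻¹ • M k (fun _ => z) z = 0 :=
      Finset.sum_eq_zero fun k _ => by simp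
    rw [e, sub_zero, add_comm]
    congr 1

/-- The derivatives of order above the degree of the majorant vanish. -/
theorem Maj.isPoly {f : E → W} {φ : ℝ[X]} (h : Maj f φ) : IsPoly f := by
  refine IsPoly.of_iteratedFDeriv_eq_zero (φ.natDegree + 1) h.smooth fun z => ?_
  have h1 := h.bound (φ.natDegree + 1) z
  rw [Polynomial.iterate_derivative_eq_zero (Nat.lt_succ_self _), Polynomial.eval_zero] at h1
  exact norm_le_zero_iff.1 h1

theorem Cls.isPoly {f : E → W} {x a : ℝ} {N : ℕ} (h : Cls x N a f) : IsPoly f :=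
  h.choose_spec.2.2.isPoly

variable {K : Type} [TopologicalSpace K] [CompactSpace K]

/-- The action of a bounded multilinear map on continuous functions. -/
def superposeMultilinear {k : ℕ} (M : ContinuousMultilinearMap ℝ (fun _ : Fin k => E) W) :
    ContinuousMultilinearMap ℝ (fun _ : Fin k => C(K, E)) C(K, W) :=
  MultilinearMap.mkContinuous
    { toFun := fun y => ⟨fun s => M fun i => y i s,
        M.cont.comp (continuous_pi fun i => (y i).continuous)⟩
      map_update_add' := fun {inst} y i a b => by
        ext s
        have e : ∀ c : C(K, E), (fun j => Function.update y i c j s)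
            = Function.update (fun j => y j s) i (c s) := fun c => by
          ext j
          by_cases h : j = i
          · subst h; simp
          · simp [h]
        have := M.map_update_add (fun j => y j s) i (a s) (b s)
        simp only [ContinuousMap.coe_mk, ContinuousMap.add_apply, e]
        convert this
      map_update_smul' := fun {inst} y i c a => by
        ext s
        have e : ∀ c : C(K, E), (fun j => Function.update y i c j s)
            = Function.update (fun j => y j s) i (c s) := fun c => by
          ext j
          by_cases h : j = i
          · subst h; simp
          · simp [h]
        have := M.map_update_smul (fun j => y j s) i c (a s)
        simp only [ContinuousMap.coe_mk, ContinuousMap.smul_apply, e]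
        convert this } ‖M‖ (by
    intro y
    refine (ContinuousMap.norm_le _ (by positivity)).2 fun s => ?_
    refine (M.le_opNorm _).trans ?_
    gcongr with i
    exact (y i).norm_coe_le_norm s)

variable (K) in
/-- The superposition operator of a continuous map. -/
def superpose (f : E → W) (hf : Continuous f) (y : C(K, E)) : C(K, W) :=
  ⟨fun s => f (y s), hf.comp y.continuous⟩

@[simp] theorem superpose_apply (f : E → W) (hf : Continuous f) (y : C(K, E)) (s : K) :
    superpose K f hf y s = f (y s) := rfl

/-- A bounded multilinear map acts pointwise on continuous functions as a bounded multilinear map.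
Superposition with a polynomial is therefore analytic on spaces of curves, and no complex extension
is needed. -/
theorem IsPoly.superpose {f : E → W} (h : IsPoly f) (hf : Continuous f) :
    IsPoly (superpose K f hf) := by
  obtain ⟨n, M, hM⟩ := h
  refine ⟨n, fun k => superposeMultilinear (M k), fun y => ?_⟩
  ext s
  rw [superpose_apply, hM, ContinuousMap.coe_sum, Finset.sum_apply]
  rfl

theorem IsPoly.fderiv_superpose {f : E → W} (h : IsPoly f) (hf : Continuous f) (y v : C(K, E))
    (s : K) : fderiv ℝ (KleinGordon.superpose K f hf) y v s = fderiv ℝ f (y s) (v s) := by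
  have h1 := ((h.superpose (K := K) hf).contDiff.differentiable (by simp) y).hasFDerivAt
  have h2 := (ContinuousMap.evalCLM ℝ s : C(K, W) →L[ℝ] W).hasFDerivAt.comp y h1
  have h3 := (h.contDiff.differentiable (by simp) (y s)).hasFDerivAt.comp y
    (ContinuousMap.evalCLM ℝ s : C(K, E) →L[ℝ] E).hasFDerivAt
  exact DFunLike.congr_fun (h2.unique h3) v

end Poly

/-! ### Analytic implicit functions and analytic dependence of flows on parameters -/

section Implicit
open Filter Topology Metric

/-- The analytic implicit function theorem, with uniqueness and stability. -/
theorem exists_analytic_implicit {Q E F : Type*} [NormedAddCommGroup Q] [NormedSpace ℝ Q]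
    [CompleteSpace Q] [NormedAddCommGroup E] [NormedSpace ℝ E] [CompleteSpace E]
    [NormedAddCommGroup F] [NormedSpace ℝ F] [CompleteSpace F] {f : Q × E → F} {q₀ : Q} {x₀ : E}
    (hf : ContDiffAt ℝ ω f (q₀, x₀)) (h0 : f (q₀, x₀) = 0) {A : E →L[ℝ] F}
    (hA : ∀ v, fderiv ℝ f (q₀, x₀) (0, v) = A v) (hb : Function.Bijective A) :
    ∃ g : Q → E, g q₀ = x₀ ∧ ContDiffAt ℝ ω g q₀ ∧ (∀ᶠ q in 𝓝 q₀, f (q, g q) = 0) ∧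
      ∃ C > 0, ∃ ρ > 0, ∀ q ∈ ball q₀ ρ, ∀ x ∈ ball x₀ ρ, ∀ x' ∈ ball x₀ ρ,
        ‖x - x'‖ ≤ C * ‖f (q, x) - f (q, x')‖ := by
  let e := ContinuousLinearEquiv.ofBijective A (LinearMap.ker_eq_bot.2 hb.1)
    (LinearMap.range_eq_top.2 hb.2)
  have he : ∀ v, e v = A v := fun v => rfl
  have hi : (fderiv ℝ f (q₀, x₀) ∘L .inr ℝ Q E).IsInvertible := by
    refine ⟨e, ?_⟩
    ext v
    exact (hA v).symm
  have hn : (ω : WithTop ℕ∞) ≠ 0 := by simp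
  refine ⟨hf.implicitFunction hn hi, hf.implicitFunction_apply_self hn hi,
    hf.contDiffAt_implicitFunction hn hi, ?_, ?_⟩
  · have := hf.eventually_apply_implicitFunction hn hi
    rwa [h0] at this
  · set C : ℝ := ‖(e.symm : F →L[ℝ] E)‖ + 1 with hC
    have hC0 : 0 < C := by positivity
    -- Stability: strict differentiability with the constant 1/(2 C), where C bounds the inverse of
    -- A, lets half of ‖x - x'‖ be absorbed.
    have h1 := ((hf.hasStrictFDerivAt hn).isLittleO).bound (show 0 < 1 / (2 * C) by positivity)
    obtain ⟨ρ, hρ, h2⟩ := Metric.eventually_nhds_iff.1 h1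
    refine ⟨2 * C, by positivity, ρ, hρ, fun q hq x hx x' hx' => ?_⟩
    have h3 := @h2 ((q, x), (q, x')) (by
      simp only [Prod.dist_eq]
      exact max_lt (max_lt hq hx) (max_lt hq hx'))
    simp only [Prod.mk_sub_mk, sub_self, hA, Prod.norm_mk, norm_zero] at h3
    rw [max_eq_right (norm_nonneg _)] at h3
    have h4 : ‖x - x'‖ ≤ C * ‖A (x - x')‖ := by
      have := (e.symm : F →L[ℝ] E).le_opNorm (e (x - x'))
      simp only [ContinuousLinearEquiv.coe_coe, ContinuousLinearEquiv.symm_apply_apply] at this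
      rw [he] at this
      refine this.trans ?_
      gcongr
      linarith
    have h5 := norm_le_norm_add_norm_sub' (A (x - x')) (f (q, x) - f (q, x'))
    rw [norm_sub_rev (A (x - x'))] at h5
    have h6 : C * (1 / (2 * C) * ‖x - x'‖) = ‖x - x'‖ / 2 := by field_simp
    nlinarith [mul_le_mul_of_nonneg_left h3 hC0.le, mul_le_mul_of_nonneg_left h5 hC0.le]

end Implicit

/-! ### Integral equations of Volterra type -/

section Volterra
open Set
variable {X : Type*} [NormedAddCommGroup X] [NormedSpace ℝ X] {b : ℝ}

theorem continuous_IccExtend (hb : 0 ≤ b) (y : C(Icc 0 b, X)) : Continuous (IccExtend hb y) :=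
  y.continuous.Icc_extend'

theorem norm_IccExtend_le (hb : 0 ≤ b) (y : C(Icc 0 b, X)) (t : ℝ) : ‖IccExtend hb y t‖ ≤ ‖y‖ :=
  y.norm_coe_le_norm _

/-- The primitive of a continuous function on an interval. -/
def volterra (hb : 0 ≤ b) : C(Icc 0 b, X) →L[ℝ] C(Icc 0 b, X) :=
  LinearMap.mkContinuous
    { toFun := fun y => ⟨fun t => ∫ s in (0 : ℝ)..t, IccExtend hb y s,
        (intervalIntegral.continuous_primitive
          (fun _ _ => (continuous_IccExtend hb y).intervalIntegrable _ _) 0).comp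
          continuous_subtype_val⟩
      map_add' := fun y z => by
        ext t
        exact intervalIntegral.integral_add ((continuous_IccExtend hb y).intervalIntegrable _ _)
          ((continuous_IccExtend hb z).intervalIntegrable _ _)
      map_smul' := fun c y => by
        ext t
        exact intervalIntegral.integral_smul c _ } b (by
    intro y
    refine (ContinuousMap.norm_le _ (by positivity)).2 fun t => ?_
    refine (intervalIntegral.norm_integral_le_of_norm_le_const
      fun s _ => norm_IccExtend_le hb y s).trans ?_
    rw [sub_zero, abs_of_nonneg t.2.1, mul_comm]
    gcongr
    exact t.2.2)

theorem volterra_apply (hb : 0 ≤ b) (y : C(Icc 0 b, X)) (t : Icc 0 b) :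
    volterra hb y t = ∫ s in (0 : ℝ)..t, IccExtend hb y s := rfl

theorem hasDerivWithinAt_volterra [CompleteSpace X] (hb : 0 ≤ b) (c : X) (y : C(Icc 0 b, X))
    {t : ℝ} (ht : t ∈ Icc 0 b) :
    HasDerivWithinAt (IccExtend hb (ContinuousMap.const (Icc 0 b) c + volterra hb y : C(Icc 0 b, X)))
      (y ⟨t, ht⟩) (Icc 0 b) t := by
  have h1 : HasDerivAt (fun u => c + ∫ s in (0 : ℝ)..u, IccExtend hb y s) (IccExtend hb y t) t :=
    ((continuous_IccExtend hb y).integral_hasStrictDerivAt 0 t).hasDerivAt.const_add c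
  rw [IccExtend_of_mem hb y ht] at h1
  refine h1.hasDerivWithinAt.congr (fun s hs => ?_) ?_
  · rw [IccExtend_of_mem hb _ hs]; rfl
  · rw [IccExtend_of_mem hb _ ht]; rfl

theorem eq_const_add_volterra [CompleteSpace X] (hb : 0 ≤ b) {α : ℝ → X} {y f : C(Icc 0 b, X)}
    (hy : ∀ t : Icc 0 b, y t = α t)
    (h : ∀ t : Icc 0 b, HasDerivWithinAt α (f t) (Icc 0 b) t) :
    y = ContinuousMap.const _ (α 0) + volterra hb f := by
  ext t
  rw [ContinuousMap.add_apply, ContinuousMap.const_apply, volterra_apply, hy]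
  have hsub : Icc 0 (t : ℝ) ⊆ Icc 0 b := Icc_subset_Icc_right t.2.2
  have h1 := intervalIntegral.integral_eq_sub_of_hasDeriv_right (f := α) (f' := IccExtend hb f)
    (a := 0) (b := t) (by
      rw [uIcc_of_le t.2.1]
      exact fun s hs => ((h ⟨s, hsub hs⟩).continuousWithinAt).mono hsub)
    (fun s hs => by
      rw [min_eq_left t.2.1, max_eq_right t.2.1] at hs
      have hs' : s ∈ Icc 0 b := hsub (Ioo_subset_Icc_self hs)
      rw [IccExtend_of_mem hb f hs']
      have h2 := (h ⟨s, hs'⟩).hasDerivAt (Icc_mem_nhds hs.1 (hs.2.trans_le t.2.2))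
      exact h2.hasDerivWithinAt)
    ((continuous_IccExtend hb f).intervalIntegrable _ _)
  rw [h1]
  abel

/-- The operator A is local in time, so the estimate can be made pointwise in t and the iterated
integrals produce t^n / n!. -/
theorem norm_pow_volterra_comp_le (hb : 0 ≤ b) {A : C(Icc 0 b, X) →L[ℝ] C(Icc 0 b, X)} {M : ℝ}
    (hM : 0 ≤ M) (hA : ∀ h t, ‖A h t‖ ≤ M * ‖h t‖) (n : ℕ) (h : C(Icc 0 b, X)) (t : Icc 0 b) :
    ‖((volterra hb ∘L A) ^ n) h t‖ ≤ (M * t) ^ n / (n.factorial : ℝ) * ‖h‖ := by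
  induction n generalizing t with
  | zero => simpa using h.norm_coe_le_norm t
  | succ n ih =>
    rw [pow_succ', mul_apply_eq_comp, ContinuousLinearMap.comp_apply, volterra_apply]
    have h1 : ∀ s ∈ Icc (0 : ℝ) t, ‖IccExtend hb (A (((volterra hb ∘L A) ^ n) h)) s‖
        ≤ M ^ (n + 1) / (n.factorial : ℝ) * ‖h‖ * s ^ n := by
      intro s hs
      have hs' : s ∈ Icc 0 b := ⟨hs.1, hs.2.trans t.2.2⟩
      rw [IccExtend_of_mem hb _ hs']
      refine (hA _ _).trans ((mul_le_mul_of_nonneg_left (ih ⟨s, hs'⟩) hM).trans (le_of_eq ?_))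
      rw [mul_pow]; ring
    refine (intervalIntegral.norm_integral_le_of_norm_le t.2.1
      (MeasureTheory.ae_of_all _ fun s hs => h1 s (Ioc_subset_Icc_self hs))
      (by apply Continuous.intervalIntegrable; fun_prop)).trans (le_of_eq ?_)
    rw [intervalIntegral.integral_const_mul, integral_pow, Nat.factorial_succ]
    push_cast
    field_simp
    simp only [zero_pow (Nat.succ_ne_zero n), sub_zero, mul_pow]
    ring

/-- Some power T^n is a contraction by the factorial bound, and 1 - T is a factor of 1 - T^n with
which it commutes. Neither M nor the length b has to be small. -/
theorem isUnit_one_sub_volterra_comp [CompleteSpace X] (hb : 0 ≤ b)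
    {A : C(Icc 0 b, X) →L[ℝ] C(Icc 0 b, X)} {M : ℝ} (hM : 0 ≤ M)
    (hA : ∀ h t, ‖A h t‖ ≤ M * ‖h t‖) : IsUnit (1 - volterra hb ∘L A) := by
  set T := volterra hb ∘L A with hT
  obtain ⟨n, hn⟩ : ∃ n : ℕ, (M * b) ^ n / (n.factorial : ℝ) < 1 :=
    ((FloorSemiring.tendsto_pow_div_factorial_atTop (M * b)).eventually_lt_const one_pos).exists
  have h1 : ‖T ^ n‖ < 1 := by
    refine lt_of_le_of_lt (ContinuousLinearMap.opNorm_le_bound _ (by positivity) fun h => ?_) hn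
    refine (ContinuousMap.norm_le _ (by positivity)).2 fun t => ?_
    refine (norm_pow_volterra_comp_le hb hM hA n h t).trans ?_
    have := t.2.1
    have := t.2.2
    gcongr
  have h2 := isUnit_one_sub_of_norm_lt_one (R := C(Icc 0 b, X) →L[ℝ] C(Icc 0 b, X)) h1
  rw [← mul_neg_geom_sum] at h2
  refine ((Commute.isUnit_mul_iff ?_).1 h2).1
  exact (Commute.one_left _).sub_left
    (Commute.sum_right _ _ _ fun i _ => (Commute.refl T).pow_right i)

open Filter Topology in
/-- Analytic dependence of solutions of integral equations of Volterra type on parameters. -/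
theorem exists_analytic_flow [CompleteSpace X] {Q : Type*} [NormedAddCommGroup Q]
    [NormedSpace ℝ Q] [CompleteSpace Q] (hb : 0 ≤ b) {V : Q × C(Icc 0 b, X) → C(Icc 0 b, X)}
    {c : Q → X} {q₀ : Q} {y₀ : C(Icc 0 b, X)} (hV : ContDiffAt ℝ ω V (q₀, y₀))
    (hc : ContDiffAt ℝ ω c q₀) {M : ℝ} (hM : 0 ≤ M)
    (hb' : ∀ h t, ‖fderiv ℝ V (q₀, y₀) (0, h) t‖ ≤ M * ‖h t‖)
    (h0 : y₀ = ContinuousMap.const _ (c q₀) + volterra hb (V (q₀, y₀))) :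
    ∃ g : Q → C(Icc 0 b, X), g q₀ = y₀ ∧ ContDiffAt ℝ ω g q₀ ∧
      (∀ᶠ q in 𝓝 q₀, g q = ContinuousMap.const _ (c q) + volterra hb (V (q, g q))) ∧
      ∃ ρ > 0, ∀ q ∈ Metric.ball q₀ ρ, ∀ y ∈ Metric.ball y₀ ρ,
        y = ContinuousMap.const _ (c q) + volterra hb (V (q, y)) → y = g q := by
  set cst : X →L[ℝ] C(Icc 0 b, X) := LinearMap.mkContinuous
    { toFun := fun x => ContinuousMap.const _ x
      map_add' := fun _ _ => rfl
      map_smul' := fun _ _ => rfl } 1 (fun x => by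
        rw [one_mul]; exact (ContinuousMap.norm_le _ (norm_nonneg _)).2 fun _ => le_rfl) with hcst
  set Vo : C(Icc 0 b, X) →L[ℝ] C(Icc 0 b, X) := volterra hb with hVo
  set f : Q × C(Icc 0 b, X) → C(Icc 0 b, X) :=
    fun v => v.2 - (cst (c v.1) + Vo (V v)) with hfdef
  have hf : ContDiffAt ℝ ω f (q₀, y₀) := by
    have h1 : ContDiffAt ℝ ω (fun v => Vo (V v)) (q₀, y₀) := by
      exact Vo.contDiff.contDiffAt.comp (q₀, y₀) hV
    exact contDiffAt_snd.sub ((cst.contDiff.contDiffAt.comp (q₀, y₀)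
      (hc.comp (f := Prod.fst) (q₀, y₀) contDiffAt_fst)).add h1)
  set A : C(Icc 0 b, X) →L[ℝ] C(Icc 0 b, X) := fderiv ℝ V (q₀, y₀) ∘L .inr ℝ Q _ with hAdef
  have hVd := (hV.differentiableAt (by simp)).hasFDerivAt
  have hcd := (hc.differentiableAt (by simp)).hasFDerivAt
  have hfd : HasFDerivAt f (ContinuousLinearMap.snd ℝ Q _ - (cst ∘L fderiv ℝ c q₀ ∘L
      ContinuousLinearMap.fst ℝ Q _ + Vo ∘L fderiv ℝ V (q₀, y₀))) (q₀, y₀) := by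
    have h1 : HasFDerivAt (fun v => Vo (V v)) (Vo ∘L fderiv ℝ V (q₀, y₀))
        (q₀, y₀) := by
      exact Vo.hasFDerivAt.comp (q₀, y₀) hVd
    have h2 : HasFDerivAt (fun v : Q × C(Icc 0 b, X) => cst (c v.1)) (cst ∘L fderiv ℝ c q₀ ∘L
        ContinuousLinearMap.fst ℝ Q _) (q₀, y₀) :=
      cst.hasFDerivAt.comp (q₀, y₀) (hcd.comp (q₀, y₀) hasFDerivAt_fst)
    exact hasFDerivAt_snd.sub (h2.add h1)
  have hu := isUnit_one_sub_volterra_comp hb hM (A := A) fun h t => hb' h t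
  obtain ⟨g, hg0, hg, hge, C, hC, ρ, hρ, hst⟩ := exists_analytic_implicit hf
    (sub_eq_zero.2 h0) (A := 1 - volterra hb ∘L A) (fun v => by
      rw [hfd.fderiv]
      change v - (cst (fderiv ℝ c q₀ 0) + Vo (fderiv ℝ V (q₀, y₀) (0, v)))
        = v - Vo (fderiv ℝ V (q₀, y₀) (0, v))
      rw [map_zero, map_zero, zero_add])
    (ContinuousLinearMap.isUnit_iff_bijective.1 hu)
  refine ⟨g, hg0, hg, hge.mono fun q hq => sub_eq_zero.1 hq, ?_⟩
  have h3 : ∀ᶠ q in 𝓝 q₀, g q ∈ Metric.ball y₀ ρ := by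
    have := hg.continuousAt
    rw [ContinuousAt, hg0] at this
    exact this (Metric.ball_mem_nhds _ hρ)
  obtain ⟨ρ', hρ', h4⟩ := Metric.eventually_nhds_iff_ball.1 (h3.and hge)
  refine ⟨min ρ ρ', lt_min hρ hρ', fun q hq y hy e => ?_⟩
  have hq1 := Metric.ball_subset_ball (min_le_left ρ ρ') hq
  have hq2 := h4 q (Metric.ball_subset_ball (min_le_right ρ ρ') hq)
  have h5 := hst q hq1 y (Metric.ball_subset_ball (min_le_left ρ ρ') hy) (g q) hq2.1
  have h6 : f (q, y) = 0 := sub_eq_zero.2 e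
  rw [h6, hq2.2, sub_zero, norm_zero, mul_zero] at h5
  exact sub_eq_zero.1 (norm_le_zero_iff.1 h5)

end Volterra

/-! ### The averaged force and the stationary dNLS equation -/

/-- Wallis' recursion. The case k = 1 is used over the half period of a reversible orbit, k = 2 over
the full period of the average. -/
theorem integral_cos_pow_even (k n : ℕ) :
    ∫ s in (0 : ℝ)..k * Real.pi, Real.cos s ^ (2 * n)
      = k * Real.pi * ((Nat.centralBinom n : ℝ) / 4 ^ n) := by
  induction n with
  | zero => simp
  | succ n ih =>
    rw [show 2 * (n + 1) = 2 * n + 2 by ring, integral_cos_pow, ih]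
    have h := Nat.succ_mul_centralBinom_succ n
    have h' : ((n : ℝ) + 1) * (Nat.centralBinom (n + 1) : ℝ)
        = 2 * (2 * n + 1) * Nat.centralBinom n := by exact_mod_cast h
    simp only [Real.sin_nat_mul_pi, Real.sin_zero, mul_zero, sub_self, zero_div, zero_add]
    have e : (Nat.centralBinom (n + 1) : ℝ)
        = 2 * (2 * n + 1) * Nat.centralBinom n / ((n : ℝ) + 1) := by
      rw [eq_div_iff (by positivity), mul_comm, h']
    rw [e, pow_succ]
    push_cast
    field_simp
    ring

/-- The origin of γ_p: the power 2^(2p+1) comes from u = 2 A cos s, and the central binomial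
coefficient is twice the binomial coefficient in `gammaCoeff`. -/
theorem centralBinom_div_four_pow (p : ℕ) :
    2 ^ (2 * p + 1) * ((Nat.centralBinom (p + 1) : ℝ) / 4 ^ (p + 1)) = gammaCoeff p := by
  have h1 : Nat.centralBinom (p + 1) = 2 * Nat.choose (1 + 2 * p) (1 + p) := by
    rw [Nat.centralBinom_eq_two_mul_choose, show 2 * (p + 1) = (2 * p + 1) + 1 by ring,
      Nat.choose_succ_succ, add_comm 1 (2 * p), add_comm 1 p]
    have := Nat.choose_symm_half p
    rw [Nat.succ_eq_add_one]
    omega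
  rw [h1, gammaCoeff, show (4 : ℝ) = 2 ^ 2 by norm_num, ← pow_mul,
    show 2 * (p + 1) = (2 * p + 1) + 1 by ring, pow_succ (2 : ℝ) (2 * p + 1)]
  push_cast
  field_simp

variable {d : ℕ}

theorem force_cos (p : ℕ) (c : ℝ) (A : L2 d) : c • force p (c • (2 : ℝ) • A)
    = c ^ (2 * (p + 1)) • (2 : ℝ) ^ (2 * p + 1) • upow (2 * p) A
      - c ^ (2 * 1) • (2 : ℝ) • laplacian d A := by
  have h : upow (2 * p) (c • (2 : ℝ) • A) = (c * 2) ^ (2 * p + 1) • upow (2 * p) A := by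
    ext n
    simp only [upow_apply, lp.coeFn_smul, Pi.smul_apply, smul_eq_mul]
    ring
  rw [force, h, map_smul, map_smul, smul_sub, smul_smul, smul_smul, smul_smul, smul_smul,
    smul_smul]
  congr 2
  · ring
  · ring

theorem integral_cos_force (p k : ℕ) (A : L2 d) :
    ∫ s in (0 : ℝ)..k * Real.pi, Real.cos s • force p (Real.cos s • (2 : ℝ) • A)
      = (k * Real.pi) • (gammaCoeff p • upow (2 * p) A - laplacian d A) := by
  simp only [force_cos]
  rw [intervalIntegral.integral_sub (by apply Continuous.intervalIntegrable; fun_prop)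
    (by apply Continuous.intervalIntegrable; fun_prop), intervalIntegral.integral_smul_const,
    intervalIntegral.integral_smul_const, integral_cos_pow_even, integral_cos_pow_even,
    smul_smul, smul_smul, smul_sub, smul_smul, ← centralBinom_div_four_pow]
  congr 2
  · ring
  · norm_num [Nat.centralBinom]
    ring

theorem dnls_eq (p : ℕ) (Ω : ℝ) (A : L2 d) :
    dnls p Ω A = Ω • A + (gammaCoeff p • upow (2 * p) A - laplacian d A) := by
  rw [dnls, upow]; abel

theorem hasFDerivAt_dnls (p : ℕ) (Ω : ℝ) (A : L2 d) :
    HasFDerivAt (dnls p Ω) (jacobian p Ω A) A := by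
  have h1 := (((hasFDerivAt_id A).fun_const_smul Ω).add
    ((hasFDerivAt_upow (2 * p) A).fun_const_smul (gammaCoeff p))).sub (laplacian d).hasFDerivAt
  refine (h1.congr_fderiv ?_).congr_of_eventuallyEq (Filter.Eventually.of_forall fun B => ?_)
  · rw [jacobian, smul_smul]
    congr 3
    push_cast; ring
  · rw [dnls_eq, ← add_sub_assoc]; rfl

/-! ### The Klein-Gordon equation in the rotating frame -/

section Rotating
open Set

theorem pi_nonneg' : (0 : ℝ) ≤ Real.pi := Real.pi_pos.le

/-- Curves over half a period. -/
abbrev HalfCurve (d : ℕ) : Type := C(Icc (0 : ℝ) Real.pi, Phase d)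

theorem continuous_flowG_comp {T : Type*} [TopologicalSpace T] {θ : T → ℝ} {y : T → Phase d}
    (hθ : Continuous θ) (hy : Continuous y) : Continuous fun s => flowG (θ s) (y s) := by
  simp only [flowG_eq]
  exact ((Real.continuous_cos.comp hθ).smul hy).add
    ((Real.continuous_sin.comp hθ).smul ((symp d).continuous.comp hy))

/-- Rotation of a curve with angular velocity `c`. -/
def rotate (d : ℕ) (c : ℝ) : HalfCurve d →L[ℝ] HalfCurve d :=
  LinearMap.mkContinuous
    { toFun := fun y => ⟨fun s => flowG (c * s) (y s),
        continuous_flowG_comp (continuous_const.mul continuous_subtype_val) y.continuous⟩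
      map_add' := fun y z => by ext1 s; exact (flowE d (c * s)).map_add _ _
      map_smul' := fun k y => by ext1 s; exact (flowE d (c * s)).map_smul _ _ } 1 (by
    intro y
    rw [one_mul]
    refine (ContinuousMap.norm_le _ (norm_nonneg _)).2 fun s => ?_
    exact (norm_flowG _ _).le.trans (y.norm_coe_le_norm s))

theorem rotate_apply (c : ℝ) (y : HalfCurve d) (s : Icc (0 : ℝ) Real.pi) :
    rotate d c y s = flowG (c * s) (y s) := rfl

theorem isPoly_hamField_hamF (d p : ℕ) : IsPoly (hamField (hamF (d := d) p 1)) :=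
  ((exists_cls_hamF zero_le_one p).choose_spec.hamField one_pos).isPoly

theorem continuous_hamField_hamF (d p : ℕ) : Continuous (hamField (hamF (d := d) p 1)) :=
  (isPoly_hamField_hamF d p).contDiff.continuous

/-- The action of `symp` on curves. -/
def sympC (d : ℕ) : HalfCurve d →L[ℝ] HalfCurve d :=
  ((symp d).toContinuousLinearEquiv : Phase d →L[ℝ] Phase d).compLeftContinuous ℝ _

theorem sympC_apply (y : HalfCurve d) (s : Icc (0 : ℝ) Real.pi) :
    sympC d y s = symp d (y s) := rfl

/-- The slow vector field of the Klein-Gordon equation in the rotating frame. -/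
def slowField (p : ℕ) (v : ℝ × HalfCurve d) : HalfCurve d :=
  v.1 • sympC d v.2 + rotate d (-1) (superpose _ _ (continuous_hamField_hamF d p) (rotate d 1 v.2))

theorem slowField_apply (p : ℕ) (σ : ℝ) (y : HalfCurve d) (s : Icc (0 : ℝ) Real.pi) :
    slowField p (σ, y) s
      = σ • symp d (y s) + flowG (-s) (hamField (hamF p 1) (flowG s (y s))) := by
  rw [slowField, ContinuousMap.add_apply, ContinuousMap.smul_apply, sympC_apply, rotate_apply,
    superpose_apply, rotate_apply, one_mul, neg_one_mul]

theorem contDiff_slowField (p : ℕ) : ContDiff ℝ ω (slowField (d := d) p) := by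
  have h1 : ContDiff ℝ ω (superpose (Icc (0 : ℝ) Real.pi) _ (continuous_hamField_hamF d p)) :=
    ((isPoly_hamField_hamF d p).superpose _).contDiff
  exact (contDiff_fst.smul ((sympC d).contDiff.comp contDiff_snd)).add
    ((rotate d (-1)).contDiff.comp (h1.comp ((rotate d 1).contDiff.comp contDiff_snd)))

/-- Constant curves on the reversal axis. -/
def constC (d : ℕ) : L2 d →L[ℝ] HalfCurve d :=
  LinearMap.mkContinuous
    { toFun := fun a => ContinuousMap.const _ (inlC d a)
      map_add' := fun a b => by rw [map_add]; rfl
      map_smul' := fun c a => by rw [map_smul]; rfl } 1 (fun a => by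
        refine (ContinuousMap.norm_le _ (by positivity)).2 fun _ => ?_
        exact (inlC d).le_of_opNorm_le norm_inlC_le a)

theorem constC_apply (a : L2 d) : constC d a = ContinuousMap.const _ (mkPhase a 0) := rfl

/-- The second component at the end of half a period. -/
def endC (d : ℕ) : HalfCurve d →L[ℝ] L2 d :=
  sndC d ∘L ContinuousMap.evalCLM ℝ ⟨Real.pi, right_mem_Icc.2 pi_nonneg'⟩

theorem endC_apply (y : HalfCurve d) :
    endC d y = (y ⟨Real.pi, right_mem_Icc.2 pi_nonneg'⟩).snd := rfl

/-- The primitive of a curve. -/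
def primC (d : ℕ) : HalfCurve d →L[ℝ] HalfCurve d := volterra pi_nonneg'

/-- The zeros of this map are the reversible periodic solutions of the Klein-Gordon equation; the
parameters are `κ = ε / w` and `σ = (1 - w) / ε`, where `w` is the frequency. -/
def kgMap (p : ℕ) (v : (ℝ × ℝ) × (L2 d × HalfCurve d)) : HalfCurve d × L2 d :=
  (v.2.2 - (constC d v.2.1 + v.1.1 • primC d (slowField p (v.1.2, v.2.2))),
    endC d (primC d (slowField p (v.1.2, v.2.2))))

theorem contDiff_kgMap (p : ℕ) : ContDiff ℝ ω (kgMap (d := d) p) := by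
  have h1 : ContDiff ℝ ω fun v : (ℝ × ℝ) × (L2 d × HalfCurve d) =>
      primC d (slowField p (v.1.2, v.2.2)) :=
    (primC d).contDiff.comp ((contDiff_slowField p).comp
      ((contDiff_snd.comp contDiff_fst).prodMk (contDiff_snd.comp contDiff_snd)))
  exact ((contDiff_snd.comp contDiff_snd).sub
    (((constC d).contDiff.comp (contDiff_fst.comp contDiff_snd)).add
      ((contDiff_fst.comp contDiff_fst).smul h1))).prodMk ((endC d).contDiff.comp h1)

/-- At κ = 0 the curve is constant in the rotating frame. The end condition, which `kgMap` records
without the factor κ in front of the slow field, then averages the force over half a period and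
becomes the stationary dNLS equation. -/
theorem endC_primC_const (p : ℕ) (Ω : ℝ) (A : L2 d) :
    endC d (primC d (slowField p (Ω / 2, constC d ((2 : ℝ) • A)))) = -Real.pi • dnls p Ω A := by
  have h1 : ∀ s ∈ uIcc 0 Real.pi, (IccExtend pi_nonneg'
      (slowField p (Ω / 2, constC d ((2 : ℝ) • A))) s).snd
      = -(Ω • A) - Real.cos s • force p (Real.cos s • (2 : ℝ) • A) := by
    intro s hs
    rw [uIcc_of_le pi_nonneg'] at hs
    rw [IccExtend_of_mem _ _ hs, slowField_apply, constC_apply, ContinuousMap.const_apply,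
      hamField_hamF]
    have e1 : (flowG s (mkPhase ((2 : ℝ) • A) 0)).fst = Real.cos s • (2 : ℝ) • A := by
      simp [flowG]
    rw [e1, one_smul, WithLp.add_snd, WithLp.smul_snd, symp_apply, mkPhase_snd, flowG, mkPhase_snd,
      mkPhase_fst, mkPhase_snd, Real.cos_neg, mkPhase_fst, smul_zero, zero_add, smul_neg, smul_neg,
      smul_smul, ← sub_eq_add_neg]
    congr 3
    ring
  have h2 : endC d (primC d (slowField p (Ω / 2, constC d ((2 : ℝ) • A))))
      = ∫ s in (0 : ℝ)..Real.pi, (IccExtend pi_nonneg'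
      (slowField p (Ω / 2, constC d ((2 : ℝ) • A))) s).snd :=
    ((sndC d).intervalIntegral_comp_comm
      ((continuous_IccExtend _ _).intervalIntegrable 0 Real.pi)).symm
  rw [h2, intervalIntegral.integral_congr h1]
  have h3 := integral_cos_force p 1 A
  rw [Nat.cast_one, one_mul] at h3
  have hc : Continuous fun s => Real.cos s • force p (Real.cos s • (2 : ℝ) • A) := by
    simp only [force_cos]; fun_prop
  rw [intervalIntegral.integral_sub (by simp) (hc.intervalIntegrable _ _), h3,
    intervalIntegral.integral_const, sub_zero, dnls_eq]
  module

end Rotating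

/-! ### Reversible periodic orbits from the implicit function theorem -/

section Branch
open Set Metric Filter Topology
variable {d : ℕ}

/-- Eliminating the curve by y = ι a + f reduces the system to the single equation M ι a = g - M f.
-/
theorem bijective_prod_of_unit {X Y : Type*} [NormedAddCommGroup X] [NormedSpace ℝ X]
    [NormedAddCommGroup Y] [NormedSpace ℝ Y] (ι : Y →L[ℝ] X) (M : X →L[ℝ] Y) (u : (Y →L[ℝ] Y)ˣ)
    {c : ℝ} (hc : c ≠ 0) (h : ∀ a, M (ι a) = c • (u : Y →L[ℝ] Y) a) :
    Function.Bijective ((ContinuousLinearMap.snd ℝ Y X - ι ∘L ContinuousLinearMap.fst ℝ Y X).prod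
      (M ∘L ContinuousLinearMap.snd ℝ Y X)) := by
  constructor
  · refine (injective_iff_map_eq_zero _).2 fun v hv => ?_
    have e1 : v.2 - ι v.1 = 0 := congrArg Prod.fst hv
    have e2 : M v.2 = 0 := congrArg Prod.snd hv
    rw [sub_eq_zero] at e1
    rw [e1, h] at e2
    have e4 : v.1 = 0 := by
      have := congrArg (↑u⁻¹ : Y →L[ℝ] Y) ((smul_eq_zero.1 e2).resolve_left hc)
      rw [← mul_apply_eq_comp, u.inv_mul, map_zero] at this
      exact this
    exact Prod.ext e4 (by rw [e1, e4, map_zero]; rfl)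
  · rintro ⟨f, g⟩
    set a : Y := c⁻¹ • (↑u⁻¹ : Y →L[ℝ] Y) (g - M f) with ha
    refine ⟨(a, f + ι a), Prod.ext (add_sub_cancel_right f (ι a)) ?_⟩
    change M (f + ι a) = g
    rw [map_add, h, ha, map_smul, ← mul_apply_eq_comp, u.mul_inv, smul_smul, mul_inv_cancel₀ hc,
      one_smul]
    exact add_sub_cancel (M f) g

theorem zero_smul_halfCurve (y : HalfCurve d) : (0 : ℝ) • y = 0 := zero_smul ℝ y

/-- Differentiation of `endC_primC_const` with respect to the initial position a = 2 A; the inner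
derivative is the factor 1/2. -/
theorem fderiv_average_apply {p : ℕ} {Ω : ℝ} {A : L2 d} {M : HalfCurve d →L[ℝ] L2 d}
    (hMd : HasFDerivAt (fun y => endC d (primC d (slowField p (Ω / 2, y)))) M
      (constC d ((2 : ℝ) • A))) (a : L2 d) :
    M (constC d a) = -(Real.pi / 2) • jacobian p Ω A a := by
  set Φ : HalfCurve d → L2 d := fun y => endC d (primC d (slowField p (Ω / 2, y))) with hΦ
  have h1 : HasFDerivAt (fun a => Φ (constC d a)) (M ∘L constC d) ((2 : ℝ) • A) :=
    hMd.comp _ (constC d).hasFDerivAt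
  have h2 : HasFDerivAt (fun a : L2 d => -Real.pi • dnls p Ω ((1 / 2 : ℝ) • a))
      (-Real.pi • (jacobian p Ω A ∘L ((1 / 2 : ℝ) • ContinuousLinearMap.id ℝ (L2 d))))
      ((2 : ℝ) • A) := by
    refine HasFDerivAt.fun_const_smul ?_ _
    have h3 := hasFDerivAt_dnls p Ω ((1 / 2 : ℝ) • (2 : ℝ) • A)
    have h4 : HasFDerivAt (fun a : L2 d => (1 / 2 : ℝ) • a)
      ((1 / 2 : ℝ) • ContinuousLinearMap.id ℝ (L2 d)) ((2 : ℝ) • A) :=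
      (hasFDerivAt_id _).fun_const_smul _
    have h5 := h3.comp _ h4
    rwa [smul_smul, show (1 / 2 : ℝ) * 2 = 1 by norm_num, one_smul] at h5
  have h6 : (fun a => Φ (constC d a)) = fun a => -Real.pi • dnls p Ω ((1 / 2 : ℝ) • a) := by
    funext a
    have := endC_primC_const p Ω ((1 / 2 : ℝ) • a)
    rwa [smul_smul, show (2 : ℝ) * (1 / 2) = 1 by norm_num, one_smul] at this
  rw [h6] at h1
  have := DFunLike.congr_fun (h1.unique h2) a
  simp only [ContinuousLinearMap.comp_apply, _root_.smul_apply, ContinuousLinearMap.id_apply,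
    map_smul] at this
  rw [this, smul_smul]
  congr 1
  ring

/-- The reversible periodic solutions of the Klein-Gordon equation which bifurcate from a
nondegenerate solution of the stationary dNLS equation. -/
theorem exists_kg_branch {p : ℕ} {Ω : ℝ} {A : L2 d} (hA : dnls p Ω A = 0)
    (hJ : IsUnit (jacobian p Ω A)) :
    ∃ g : ℝ × ℝ → L2 d × HalfCurve d, g (0, Ω / 2) = ((2 : ℝ) • A, constC d ((2 : ℝ) • A)) ∧
      ContDiffAt ℝ ω g (0, Ω / 2) ∧ (∀ᶠ q in 𝓝 ((0 : ℝ), Ω / 2), kgMap p (q, g q) = 0) ∧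
      ∃ C > 0, ∃ ρ > 0, ∀ q ∈ ball ((0 : ℝ), Ω / 2) ρ,
        ∀ x ∈ ball ((2 : ℝ) • A, constC d ((2 : ℝ) • A)) ρ,
        ∀ x' ∈ ball ((2 : ℝ) • A, constC d ((2 : ℝ) • A)) ρ,
          ‖x - x'‖ ≤ C * ‖kgMap p (q, x) - kgMap p (q, x')‖ := by
  set Φ : HalfCurve d → L2 d := fun y => endC d (primC d (slowField p (Ω / 2, y))) with hΦ
  have hΦc : ContDiff ℝ ω Φ := (endC d).contDiff.comp ((primC d).contDiff.comp
    ((contDiff_slowField p).comp (contDiff_const.prodMk contDiff_id)))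
  set M := fderiv ℝ Φ (constC d ((2 : ℝ) • A)) with hM
  have hMd : HasFDerivAt Φ M (constC d ((2 : ℝ) • A)) :=
    (hΦc.differentiable (by simp) _).hasFDerivAt
  have hMa : ∀ a, M (constC d a) = -(Real.pi / 2) • jacobian p Ω A a :=
    fderiv_average_apply hMd
  have hf := (contDiff_kgMap (d := d) p).contDiffAt
    (x := (((0 : ℝ), Ω / 2), ((2 : ℝ) • A, constC d ((2 : ℝ) • A))))
  have h0 : kgMap p (((0 : ℝ), Ω / 2), ((2 : ℝ) • A, constC d ((2 : ℝ) • A))) = 0 := by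
    rw [kgMap, endC_primC_const, hA, smul_zero]
    refine Prod.ext ?_ rfl
    change constC d ((2 : ℝ) • A) - (constC d ((2 : ℝ) • A) + (0 : ℝ) • _) = 0
    rw [zero_smul_halfCurve, add_zero, sub_self]
  set L : L2 d × HalfCurve d →L[ℝ] HalfCurve d × L2 d :=
    (ContinuousLinearMap.snd ℝ _ _ - constC d ∘L ContinuousLinearMap.fst ℝ _ _).prod
      (M ∘L ContinuousLinearMap.snd ℝ _ _) with hL
  have hLd : ∀ v, fderiv ℝ (kgMap p) (((0 : ℝ), Ω / 2), ((2 : ℝ) • A, constC d ((2 : ℝ) • A)))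
      (0, v) = L v := by
    intro v
    have h1 := (hf.differentiableAt (by simp)).hasFDerivAt.comp
      ((2 : ℝ) • A, constC d ((2 : ℝ) • A))
      ((hasFDerivAt_const ((0 : ℝ), Ω / 2) ((2 : ℝ) • A, constC d ((2 : ℝ) • A))).prodMk
        (hasFDerivAt_id ((2 : ℝ) • A, constC d ((2 : ℝ) • A))))
    have h2 : HasFDerivAt (fun v : L2 d × HalfCurve d => (v.2 - constC d v.1, Φ v.2)) L
        ((2 : ℝ) • A, constC d ((2 : ℝ) • A)) :=
      (hasFDerivAt_snd.sub ((constC d).hasFDerivAt.comp _ hasFDerivAt_fst)).prodMk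
        (HasFDerivAt.comp (g := Φ) ((2 : ℝ) • A, constC d ((2 : ℝ) • A)) hMd hasFDerivAt_snd)
    have h3 : (kgMap p ∘ Prod.mk ((0 : ℝ), Ω / 2))
        = fun v : L2 d × HalfCurve d => (v.2 - constC d v.1, Φ v.2) := by
      funext v
      change (v.2 - (constC d v.1 + (0 : ℝ) • _), _) = _
      rw [zero_smul_halfCurve, add_zero]
    rw [h3] at h1
    exact DFunLike.congr_fun (h1.unique h2) v
  obtain ⟨u, hu⟩ := hJ
  have hb : Function.Bijective L := bijective_prod_of_unit (constC d) M u
    (neg_ne_zero.2 (div_pos Real.pi_pos two_pos).ne') fun a => by rw [hMa, hu]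
  exact exists_analytic_implicit hf h0 hLd hb

theorem hamField_hamF_smul (p : ℕ) (ε : ℝ) (z : Phase d) :
    hamField (hamF p ε) z = ε • hamField (hamF p 1) z := by
  rw [hamField_hamF, hamField_hamF, one_smul]
  refine phase_ext ?_ ?_
  · simp
  · simp [smul_neg]

theorem hamField_hamH (p : ℕ) (ε : ℝ) (z : Phase d) :
    hamField (hamH p ε) z = symp d z + ε • hamField (hamF p 1) z := by
  have e : (hamH p ε : Phase d → ℝ) = fun z => hamG z + hamF p ε z := rfl
  rw [← hamField_hamF_smul, hamField_eq, e, fderiv_fun_add (hasFDerivAt_hamG z).differentiableAt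
    (hasFDerivAt_hamF p ε z).differentiableAt, map_add, ← hamField_eq, ← hamField_eq, hamField_hamG]

theorem hasDerivWithinAt_flowG_comp {y : ℝ → Phase d} {y' : Phase d} {s : Set ℝ} {t : ℝ} (c : ℝ)
    (hy : HasDerivWithinAt y y' s t) :
    HasDerivWithinAt (fun t => flowG (c * t) (y t))
      (c • symp d (flowG (c * t) (y t)) + flowG (c * t) y') s t := by
  have hc : HasDerivWithinAt (fun t => c * t) c s t := by
    simpa using (hasDerivWithinAt_id t s).const_mul c
  have h1 := (hc.cos.smul hy).add (hc.sin.smul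
    ((symp d).toContinuousLinearEquiv.hasFDerivAt.comp_hasDerivWithinAt t hy))
  refine (h1.congr_deriv ?_).congr (fun s _ => flowG_eq _ _) (flowG_eq _ _)
  simp only [flowG_eq, map_add, map_smul, symp_symp]
  change Real.cos (c * t) • y' + (-Real.sin (c * t) * c) • y t
    + (Real.sin (c * t) • symp d y' + (Real.cos (c * t) * c) • symp d (y t)) = _
  module

/-- A zero of `kgMap` gives a solution of the Klein-Gordon equation over half a period. -/
theorem hasDerivWithinAt_of_kgMap {p : ℕ} {ε w : ℝ} (hε : ε ≠ 0) (hw : w ≠ 0) {a : L2 d}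
    {y : HalfCurve d} (h : kgMap p ((ε / w, (1 - w) / ε), (a, y)) = 0) :
    (∀ t (ht : t ∈ Icc 0 Real.pi), HasDerivWithinAt (IccExtend pi_nonneg' (rotate d 1 y))
      (w⁻¹ • hamField (hamH p ε) (rotate d 1 y ⟨t, ht⟩)) (Icc 0 Real.pi) t) ∧
    (y ⟨0, left_mem_Icc.2 pi_nonneg'⟩) = mkPhase a 0 ∧
    (y ⟨Real.pi, right_mem_Icc.2 pi_nonneg'⟩).snd = 0 := by
  have e1 : y = constC d a + (ε / w) • primC d (slowField p ((1 - w) / ε, y)) :=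
    sub_eq_zero.1 (congrArg Prod.fst h)
  have e2 : endC d (primC d (slowField p ((1 - w) / ε, y))) = 0 := congrArg Prod.snd h
  refine ⟨fun t ht => ?_, ?_, ?_⟩
  · have h1 := hasDerivWithinAt_volterra pi_nonneg' (mkPhase a 0)
      ((ε / w) • slowField p ((1 - w) / ε, y)) ht
    have e3 : (ContinuousMap.const (Icc 0 Real.pi) (mkPhase a 0)
        + volterra pi_nonneg' ((ε / w) • slowField p ((1 - w) / ε, y)) : HalfCurve d) = y := by
      rw [map_smul]; exact e1.symm
    rw [e3] at h1
    have h2 := hasDerivWithinAt_flowG_comp 1 h1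
    rw [IccExtend_of_mem _ _ ht] at h2
    refine (h2.congr_deriv ?_).congr (fun s hs => ?_) ?_
    · rw [rotate_apply, one_mul, one_smul, hamField_hamH, ContinuousMap.smul_apply, slowField_apply]
      rw [← flowE_apply t ((ε / w) • _), map_smul, map_add, map_smul]
      simp only [flowE_apply, flowG_flowG, add_neg_cancel, flowG_zero, flowG_symp]
      -- The identity w⁻¹ = 1 + κ σ separates the rotation of unit speed from the slow motion of
      -- speed κ.
      have : (1 : ℝ) + ε / w * ((1 - w) / ε) = w⁻¹ := by field_simp; ring
      rw [← this]
      have h3 : ε / w = (1 + ε / w * ((1 - w) / ε)) * ε := by rw [this]; field_simp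
      rw [smul_add, smul_add, smul_smul, smul_smul _ ε, ← h3, add_smul, one_smul]
      abel
    · rw [IccExtend_of_mem _ _ hs, IccExtend_of_mem _ _ hs, rotate_apply]
    · rw [IccExtend_of_mem _ _ ht, IccExtend_of_mem _ _ ht, rotate_apply]
  · rw [e1, ContinuousMap.add_apply, ContinuousMap.smul_apply, primC, volterra_apply]
    simp [constC_apply]
  · have : endC d y = 0 := by
      rw [e1, map_add, map_smul, e2]; simp [endC_apply, constC_apply]
    exact this

theorem norm_primC_le : ‖primC d‖ ≤ Real.pi := by
  unfold primC volterra
  exact LinearMap.mkContinuous_norm_le _ pi_nonneg' _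

theorem norm_rotate_le (c : ℝ) : ‖rotate d c‖ ≤ 1 := by
  unfold rotate
  exact LinearMap.mkContinuous_norm_le _ zero_le_one _

/-- A reversible approximate solution over half a period is an approximate zero of `kgMap`. -/
theorem norm_kgMap_le {p : ℕ} {ε w : ℝ} (hε : 0 < ε) (hw : 0 < w) {z : ℝ → Phase d}
    {res : HalfCurve d} {zc : HalfCurve d} (hzc : ∀ t, zc t = z t)
    (hz : ∀ t : Icc 0 Real.pi, HasDerivWithinAt z
      (w⁻¹ • hamField (hamH p ε) (z t) + res t) (Icc 0 Real.pi) t)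
    (h0 : (z 0).snd = 0) (hπ : (z Real.pi).snd = 0) :
    ‖kgMap p ((ε / w, (1 - w) / ε), ((z 0).fst, rotate d (-1) zc))‖
      ≤ Real.pi * (1 + w / ε) * ‖res‖ := by
  set y := rotate d (-1) zc with hy
  set κ := ε / w with hκ
  have hκ0 : 0 < κ := by positivity
  set σ := (1 - w) / ε with hσ
  have hws : w⁻¹ = 1 + κ * σ := by rw [hκ, hσ]; field_simp; ring
  have hwε : w⁻¹ * ε = κ := by rw [hκ]; field_simp
  have e1 : y = ContinuousMap.const _ (flowG (-1 * 0) (z 0)) + volterra pi_nonneg'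
      (κ • slowField p (σ, y) + rotate d (-1) res) := by
    refine eq_const_add_volterra pi_nonneg' (α := fun t => flowG (-1 * t) (z t)) (fun t => ?_)
      fun t => ?_
    · rw [hy, rotate_apply, hzc]
    · refine (hasDerivWithinAt_flowG_comp (-1) (hz t)).congr_deriv ?_
      rw [ContinuousMap.add_apply, ContinuousMap.smul_apply, slowField_apply, hy, rotate_apply,
        rotate_apply, hzc, flowG_flowG, neg_one_mul, add_neg_cancel, flowG_zero, hamField_hamH]
      simp only [← flowE_apply, map_add, map_smul]
      simp only [flowE_apply, flowG_symp]
      rw [smul_add, smul_smul _ ε, hwε, hws, add_smul, one_smul, smul_add, smul_smul]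
      module
  have e2 : flowG (-1 * 0) (z 0) = mkPhase (z 0).fst 0 := by
    rw [mul_zero, flowG_zero]
    exact phase_ext rfl h0
  have e3 : y - (constC d (z 0).fst + κ • primC d (slowField p (σ, y)))
      = primC d (rotate d (-1) res) := by
    rw [e2, map_add, map_smul] at e1
    rw [constC_apply, primC]
    conv_lhs => lhs; rw [e1]
    abel
  have e4 : endC d y = 0 := by
    rw [endC_apply, hy, rotate_apply, hzc]
    simp [flowG, hπ]
  -- The end condition holds exactly for y, so the slow part misses it only by the residual.
  -- Dividing by κ is what costs the factor w / ε.
  have e5 : κ • endC d (primC d (slowField p (σ, y))) = -endC d (primC d (rotate d (-1) res)) := by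
    rw [← e3, map_sub, map_add, map_smul, e4]
    simp [endC_apply, constC_apply]
  have hn1 : ‖primC d (rotate d (-1) res)‖ ≤ Real.pi * ‖res‖ := by
    refine ((primC d).le_of_opNorm_le norm_primC_le _).trans ?_
    refine mul_le_mul_of_nonneg_left ?_ pi_nonneg'
    simpa using (rotate d (-1)).le_of_opNorm_le (norm_rotate_le (-1)) res
  have hn2 : ‖endC d (primC d (rotate d (-1) res))‖ ≤ Real.pi * ‖res‖ :=
    (norm_snd_le _).trans ((ContinuousMap.norm_coe_le_norm _ _).trans hn1)
  have hn3 : ‖endC d (primC d (slowField p (σ, y)))‖ ≤ Real.pi * (w / ε) * ‖res‖ := by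
    have h1 := congrArg norm e5
    rw [norm_smul, norm_neg, Real.norm_of_nonneg hκ0.le] at h1
    have h2 : ‖endC d (primC d (slowField p (σ, y)))‖
        = w / ε * ‖endC d (primC d (rotate d (-1) res))‖ := by
      rw [← h1, hκ]; field_simp
    rw [h2]
    calc w / ε * ‖endC d (primC d (rotate d (-1) res))‖ ≤ w / ε * (Real.pi * ‖res‖) := by gcongr
      _ = _ := by ring
  have hp := Real.pi_pos
  have hr := norm_nonneg res
  have hq : 0 ≤ w / ε := by positivity
  rw [kgMap, Prod.norm_mk]
  refine max_le ?_ (hn3.trans ?_)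
  · rw [e3]
    refine hn1.trans ?_
    nlinarith [mul_nonneg (mul_nonneg hp.le hq) hr]
  · nlinarith [mul_nonneg hp.le hr]

end Branch

/-! ### The soliton of the normal form -/

section ApproxLinear
open Set Metric
variable {E : Type*} [NormedAddCommGroup E] [NormedSpace ℝ E]

theorem norm_sub_le_of_approx {f : E → E} (u : (E →L[ℝ] E)ˣ) {k : ℝ} (hk : 0 < k)
    (hu : ‖(↑u⁻¹ : E →L[ℝ] E)‖ ≤ k) {x y : E}
    (h : ‖f x - f y - (u : E →L[ℝ] E) (x - y)‖ ≤ 1 / (2 * k) * ‖x - y‖) :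
    ‖x - y‖ ≤ 2 * k * ‖f x - f y‖ := by
  have h1 : ‖x - y‖ ≤ k * ‖(u : E →L[ℝ] E) (x - y)‖ := by
    have := (↑u⁻¹ : E →L[ℝ] E).le_of_opNorm_le hu ((u : E →L[ℝ] E) (x - y))
    rwa [← mul_apply_eq_comp, u.inv_mul] at this
  have h2 := norm_le_norm_add_norm_sub' ((u : E →L[ℝ] E) (x - y)) (f x - f y)
  rw [norm_sub_rev ((u : E →L[ℝ] E) (x - y))] at h2
  have h3 : k * (1 / (2 * k) * ‖x - y‖) = ‖x - y‖ / 2 := by field_simp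
  nlinarith [mul_le_mul_of_nonneg_left h hk.le, mul_le_mul_of_nonneg_left h2 hk.le]

theorem isUnit_of_norm_sub_le [CompleteSpace E] (u : (E →L[ℝ] E)ˣ) {k : ℝ} (hk : 0 < k)
    (hu : ‖(↑u⁻¹ : E →L[ℝ] E)‖ ≤ k) {D : E →L[ℝ] E}
    (h : ‖D - (u : E →L[ℝ] E)‖ ≤ 1 / (2 * k)) : IsUnit D := by
  have e : D = u * (1 - ↑u⁻¹ * (u - D)) := by
    rw [mul_sub, mul_one, ← mul_assoc, u.mul_inv, one_mul]; abel
  rw [e]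
  refine u.isUnit.mul (isUnit_one_sub_of_norm_lt_one ?_)
  rw [norm_sub_rev] at h
  calc ‖(↑u⁻¹ : E →L[ℝ] E) * (u - D)‖ ≤ ‖(↑u⁻¹ : E →L[ℝ] E)‖ * ‖(u : E →L[ℝ] E) - D‖ := norm_mul_le _ _
    _ ≤ k * (1 / (2 * k)) := by gcongr
    _ < 1 := by field_simp; norm_num

/-- The map is compared with a fixed invertible operator instead of its own derivative, so one bound
k serves all orders r and all couplings. -/
theorem exists_zero_of_approx [CompleteSpace E] {f : E → E} (u : (E →L[ℝ] E)ˣ) {k : ℝ} (hk : 0 < k)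
    (hu : ‖(↑u⁻¹ : E →L[ℝ] E)‖ ≤ k) {a : E} {η : ℝ}
    (h : ∀ x ∈ closedBall a (2 * k * η), ∀ y ∈ closedBall a (2 * k * η),
      ‖f x - f y - (u : E →L[ℝ] E) (x - y)‖ ≤ 1 / (2 * k) * ‖x - y‖) (hη : ‖f a‖ ≤ η) :
    ∃ x, ‖x - a‖ ≤ 2 * k * η ∧ f x = 0 := by
  have hη0 : 0 ≤ η := (norm_nonneg _).trans hη
  have hf : ApproximatesLinearOn f (u : E →L[ℝ] E) (closedBall a (2 * k * η))
      ⟨1 / (2 * k), by positivity⟩ := fun x hx y hy => h x hx y hy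
  have h1 := hf.surjOn_closedBall_of_nonlinearRightInverse
    ⟨fun y => (↑u⁻¹ : E →L[ℝ] E) y, ⟨k, hk.le⟩, fun y => (↑u⁻¹ : E →L[ℝ] E).le_of_opNorm_le hu y,
      fun y => by rw [← mul_apply_eq_comp, u.mul_inv]; rfl⟩ (b := a)
    (ε := 2 * k * η) (by positivity) subset_rfl
  obtain ⟨x, hx, hx0⟩ := h1 (show (0 : E) ∈ _ by
    rw [mem_closedBall, dist_eq_norm, zero_sub, norm_neg]
    refine hη.trans (le_of_eq ?_)
    change η = (k⁻¹ - 1 / (2 * k)) * (2 * k * η)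
    field_simp
    ring)
  exact ⟨x, by rwa [mem_closedBall, dist_eq_norm] at hx, hx0⟩

end ApproxLinear

/-! ### The generalized dNLS equation as a perturbation of the dNLS equation -/

section Soliton
open Set Metric Filter Topology
variable {d p : ℕ} {x f₀ ε : ℝ} {r : ℕ}

theorem ofAmplitude_zero (B : L2 d) : ofAmplitude B 0 = inlC d ((2 : ℝ) • B) := by
  rw [ofAmplitude_eq, flowG_zero]; rfl

theorem gradient_fst (f : Phase d → ℝ) (z : Phase d) :
    (gradient f z).fst = -(sndC d (hamField f z)) := (neg_neg _).symm

/-- The contribution of the orders `2, …, r` to the generalized stationary dNLS operator. -/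
def highOrder (p : ℕ) (ε : ℝ) (r : ℕ) (B : L2 d) : L2 d :=
  -(ε⁻¹ • sndC d (hamField (fun z => ∑ s ∈ Finset.Icc 2 r, nfTerm p ε r s z)
    (inlC d ((2 : ℝ) • B))))

theorem genDnls_eq (hε : ε ≠ 0) (Ω : ℝ) (r : ℕ) (B : L2 d) :
    genDnls p Ω ε r B = dnls p Ω B + highOrder p ε r B := by
  rw [genDnls, gradient_fst, ofAmplitude_zero, highOrder, smul_smul, smul_neg]
  congr 3
  field_simp

namespace Size

/-- The terms of orders 2, …, r have size O(ε²), uniformly in r, and the factor ε · ε⁻² leaves O(ε).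
The field and its linearization use up two units of radius. -/
theorem hasFDerivAt_highOrder (S : Size d p x f₀) (h : Small p x f₀ r ε) {B : L2 d}
    (hB : 2 * ‖B‖ ≤ x - 2) :
    ‖highOrder p ε r B‖ ≤ 8 * f₀ * nfC p x f₀ * ε ∧ ∃ N : L2 d →L[ℝ] L2 d,
      ‖N‖ ≤ 8 * f₀ * nfC p x f₀ * ε ∧ HasFDerivAt (highOrder p ε r) N B := by
  have hε := h.2.1
  have hf := S.pos
  have hC := S.nfC_pos
  have hz : ‖inlC d ((2 : ℝ) • B)‖ ≤ x - 2 := by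
    rw [inlC_apply, norm_mkPhase_zero_right, norm_smul]; simpa using hB
  have h1 : Cls (x - 1) ((2 * p + 2) * r) (4 * f₀ * nfC p x f₀ * ε ^ 2 / (x - (x - 1)))
      (hamField (fun z : Phase d => ∑ s ∈ Finset.Icc 2 r, nfTerm p ε r s z)) :=
    ((S.cls_sum_nfTerm h).fderiv (by linarith [S.four_lt]) (by linarith)).clm_comp (hamC d)
      norm_hamC_le
  rw [sub_sub_cancel, div_one] at h1
  have h2 := h1.fderiv (y := x - 2) (by linarith [S.four_lt]) (by linarith)
  rw [show x - 1 - (x - 2) = 1 by ring, div_one] at h2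
  set X := hamField (fun z : Phase d => ∑ s ∈ Finset.Icc 2 r, nfTerm p ε r s z) with hX
  constructor
  · rw [highOrder, norm_neg, norm_smul, Real.norm_of_nonneg (inv_nonneg.2 hε.le)]
    have h3 : ‖sndC d (X (inlC d ((2 : ℝ) • B)))‖ ≤ 4 * f₀ * nfC p x f₀ * ε ^ 2 :=
      (norm_snd_le _).trans (h1.norm_le (by linarith))
    calc ε⁻¹ * _ ≤ ε⁻¹ * (4 * f₀ * nfC p x f₀ * ε ^ 2) := by gcongr
      _ = 4 * f₀ * nfC p x f₀ * ε := by field_simp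
      _ ≤ _ := by nlinarith [mul_pos (mul_pos hf hC) hε]
  · refine ⟨-(ε⁻¹ • (sndC d ∘L fderiv ℝ X (inlC d ((2 : ℝ) • B)) ∘L inlC d ∘L
      ((2 : ℝ) • ContinuousLinearMap.id ℝ (L2 d)))), ?_, ?_⟩
    · refine ContinuousLinearMap.opNorm_le_bound _ (by positivity) fun v => ?_
      have h4 := (fderiv ℝ X (inlC d ((2 : ℝ) • B))).le_of_opNorm_le (h2.norm_le hz)
        (inlC d ((2 : ℝ) • v))
      have e : ‖inlC d ((2 : ℝ) • v)‖ = ‖(2 : ℝ)‖ * ‖v‖ := by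
        rw [inlC_apply, norm_mkPhase_zero_right, norm_smul]
      rw [e] at h4
      change ‖-(ε⁻¹ • sndC d (fderiv ℝ X (inlC d ((2 : ℝ) • B)) (inlC d ((2 : ℝ) • v))))‖ ≤ _
      rw [norm_neg, norm_smul, Real.norm_of_nonneg (inv_nonneg.2 hε.le)]
      calc ε⁻¹ * _ ≤ ε⁻¹ * (4 * f₀ * nfC p x f₀ * ε ^ 2 * (‖(2 : ℝ)‖ * ‖v‖)) := by
            gcongr; exact (norm_snd_le _).trans h4
        _ = _ := by rw [Real.norm_of_nonneg zero_le_two]; field_simp; ring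
    · have h5 : HasFDerivAt (fun B : L2 d => inlC d ((2 : ℝ) • B))
          (inlC d ∘L ((2 : ℝ) • ContinuousLinearMap.id ℝ (L2 d))) B :=
        (inlC d).hasFDerivAt.comp B ((hasFDerivAt_id B).fun_const_smul (2 : ℝ))
      exact (((sndC d).hasFDerivAt.comp B ((h1.differentiable _).hasFDerivAt.comp B h5)).fun_const_smul
        ε⁻¹).fun_neg

end Size

theorem contDiff_jacobian (p : ℕ) (Ω : ℝ) : ContDiff ℝ ω (jacobian (d := d) p Ω) := by
  have h : ContDiff ℝ ω (mulOp (d := d)) := (mulB d).contDiff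
  unfold jacobian
  exact (contDiff_const.add ((h.pow (2 * p)).const_smul _)).sub contDiff_const

theorem contDiff_dnls (p : ℕ) (Ω : ℝ) : ContDiff ℝ ω (dnls (d := d) p Ω) := by
  have h : ContDiff ℝ ω (mulOp (d := d)) := (mulB d).contDiff
  unfold dnls
  exact ((contDiff_id.const_smul Ω).add
    (((h.pow (2 * p)).clm_apply contDiff_id).const_smul _)).sub (laplacian d).contDiff

/-- On a ball around A the derivative of the generalized operator differs from the Jacobian at A by
L ‖B - A‖ + c ε with constants that do not depend on r. The inverse of that one Jacobian then yields
uniqueness, invertibility of the derivative and existence within O(ε). -/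
theorem exists_soliton (S : Size d p x f₀) {Ω : ℝ} {A : L2 d} (hA : dnls p Ω A = 0)
    (hJ : IsUnit (jacobian p Ω A)) (hx : 2 * ‖A‖ < x - 2) :
    ∃ δ > 0, ∃ e > 0, ∃ C > 0, 2 * (‖A‖ + δ) ≤ x - 2 ∧ ∀ r ε, Size.Small p x f₀ r ε → ε ≤ e →
      (∀ B ∈ ball A δ, ∀ B' ∈ ball A δ, genDnls p Ω ε r B = 0 → genDnls p Ω ε r B' = 0 → B = B') ∧
      (∀ B ∈ ball A δ, ∃ D : L2 d →L[ℝ] L2 d, HasFDerivAt (genDnls p Ω ε r) D B ∧ IsUnit D ∧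
        ‖D - jacobian p Ω A‖ ≤ C * (‖B - A‖ + ε)) ∧
      ∃ B ∈ ball A δ, genDnls p Ω ε r B = 0 ∧ ‖B - A‖ ≤ C * ε := by
  obtain ⟨u, hu⟩ := hJ
  set k : ℝ := ‖(↑u⁻¹ : L2 d →L[ℝ] L2 d)‖ + 1 with hk
  have hk0 : 0 < k := by positivity
  have huk : ‖(↑u⁻¹ : L2 d →L[ℝ] L2 d)‖ ≤ k := by rw [hk]; linarith
  obtain ⟨L, t, ht, hL⟩ := ((contDiff_jacobian (d := d) p Ω).contDiffAt (x := A)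
    |>.of_le le_top : ContDiffAt ℝ 1 _ A).exists_lipschitzOnWith
  obtain ⟨δ₁, hδ₁, hball⟩ := Metric.mem_nhds_iff.1 ht
  set c := 8 * f₀ * nfC p x f₀ with hc
  have hf := S.pos
  have hC := S.nfC_pos
  have hc0 : 0 < c := by positivity
  have hL0 : (0 : ℝ) ≤ L := L.2
  -- The variation of the Jacobian over the ball may use 1/(4 k), and below the O(ε) perturbation
  -- another 1/(4 k); together they stay within the margin 1/(2 k) allowed by the inverse.
  set δ := min δ₁ (min ((x - 2 - 2 * ‖A‖) / 2) (1 / (4 * k * (L + 1)))) with hδ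
  have hδ0 : 0 < δ := lt_min hδ₁ (lt_min (by linarith) (by positivity))
  have hδ2 : 2 * (‖A‖ + δ) ≤ x - 2 := by
    have : δ ≤ (x - 2 - 2 * ‖A‖) / 2 := (min_le_right _ _).trans (min_le_left _ _)
    linarith
  have hδ3 : L * δ ≤ 1 / (4 * k) := by
    have h1 : δ ≤ 1 / (4 * k * (L + 1)) := (min_le_right _ _).trans (min_le_right _ _)
    calc L * δ ≤ (L + 1) * (1 / (4 * k * (L + 1))) := by
          apply mul_le_mul (by linarith) h1 hδ0.le (by linarith)
      _ = 1 / (4 * k) := by field_simp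
  set e := min (1 / (4 * k * c)) (δ / (4 * k * c)) with he
  refine ⟨δ, hδ0, e, lt_min (by positivity) (by positivity), max (2 * k * c) (L + c),
    lt_max_of_lt_left (by positivity), hδ2, fun r ε h hεe => ?_⟩
  have hε := h.2.1
  have hcε : c * ε ≤ 1 / (4 * k) := by
    calc c * ε ≤ c * (1 / (4 * k * c)) := by
          gcongr; exact hεe.trans (min_le_left _ _)
      _ = _ := by field_simp
  have hcε2 : 2 * k * (c * ε) ≤ δ / 2 := by
    calc 2 * k * (c * ε) ≤ 2 * k * (c * (δ / (4 * k * c))) := by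
          gcongr; exact hεe.trans (min_le_right _ _)
      _ = _ := by field_simp; ring
  have hD : ∀ B ∈ ball A δ, ∃ D : L2 d →L[ℝ] L2 d, HasFDerivAt (genDnls p Ω ε r) D B ∧
      ‖D - jacobian p Ω A‖ ≤ L * ‖B - A‖ + c * ε := by
    intro B hB
    have hB' : ‖B - A‖ < δ := by rwa [mem_ball, dist_eq_norm] at hB
    have hBn : 2 * ‖B‖ ≤ x - 2 := by
      have := norm_le_norm_add_norm_sub' B A
      linarith
    obtain ⟨-, N, hN, hNd⟩ := S.hasFDerivAt_highOrder h hBn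
    have e1 : genDnls p Ω ε r = fun B : L2 d => dnls p Ω B + highOrder p ε r B :=
      funext fun B => genDnls_eq hε.ne' Ω r B
    refine ⟨jacobian p Ω B + N, by rw [e1]; exact (hasFDerivAt_dnls p Ω B).add hNd, ?_⟩
    have h2 := hL.dist_le_mul B (hball (ball_subset_ball (min_le_left _ _) hB)) A
      (hball (mem_ball_self hδ₁))
    rw [dist_eq_norm, dist_eq_norm] at h2
    rw [add_sub_right_comm]
    exact norm_add_le_of_le h2 hN
  have hD2 : ∀ B ∈ ball A δ, ∀ D : L2 d →L[ℝ] L2 d, ‖D - jacobian p Ω A‖ ≤ L * ‖B - A‖ + c * ε →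
      ‖D - (u : L2 d →L[ℝ] L2 d)‖ ≤ 1 / (2 * k) := by
    intro B hB D h1
    rw [hu]
    have hB' : ‖B - A‖ < δ := by rwa [mem_ball, dist_eq_norm] at hB
    refine h1.trans ?_
    have : (L : ℝ) * ‖B - A‖ ≤ L * δ := by gcongr
    calc _ ≤ 1 / (4 * k) + 1 / (4 * k) := by linarith
      _ = 1 / (2 * k) := by field_simp; ring
  have happ : ∀ B ∈ ball A δ, ∀ B' ∈ ball A δ, ‖genDnls p Ω ε r B - genDnls p Ω ε r B'
      - (u : L2 d →L[ℝ] L2 d) (B - B')‖ ≤ 1 / (2 * k) * ‖B - B'‖ := by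
    intro B hB B' hB'
    choose! D hDd hDn using hD
    have := (convex_ball A δ).norm_image_sub_le_of_norm_hasFDerivWithin_le
      (f := fun B => genDnls p Ω ε r B - (u : L2 d →L[ℝ] L2 d) B) (C := 1 / (2 * k))
      (f' := fun B => D B - (u : L2 d →L[ℝ] L2 d))
      (fun B hB => ((hDd B hB).sub (u : L2 d →L[ℝ] L2 d).hasFDerivAt).hasFDerivWithinAt)
      (fun B hB => hD2 B hB _ (hDn B hB)) hB' hB
    rw [map_sub]
    refine le_of_eq_of_le (congrArg norm ?_) this
    abel
  refine ⟨fun B hB B' hB' h1 h2 => ?_, fun B hB => ?_, ?_⟩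
  · have := norm_sub_le_of_approx u hk0 huk (happ B hB B' hB')
    rw [h1, h2, sub_zero, norm_zero, mul_zero] at this
    exact sub_eq_zero.1 (norm_le_zero_iff.1 this)
  · obtain ⟨D, hDd, hDn⟩ := hD B hB
    refine ⟨D, hDd, isUnit_of_norm_sub_le u hk0 huk (hD2 B hB D hDn), hDn.trans ?_⟩
    have h1 : (L : ℝ) ≤ max (2 * k * c) (L + c) := le_max_of_le_right (by linarith)
    have h2 : c ≤ max (2 * k * c) (L + c) := le_max_of_le_right (by linarith)
    rw [mul_add]
    gcongr
  · have hsub : closedBall A (2 * k * (c * ε)) ⊆ ball A δ := closedBall_subset_ball (by linarith)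
    obtain ⟨B, hB, hB0⟩ := exists_zero_of_approx u hk0 huk
      (fun B hB B' hB' => happ B (hsub hB) B' (hsub hB')) (η := c * ε) (by
        rw [genDnls_eq hε.ne', hA, zero_add]
        exact (S.hasFDerivAt_highOrder h (by linarith)).1)
    refine ⟨B, hsub (by rwa [mem_closedBall, dist_eq_norm]), hB0, hB.trans ?_⟩
    rw [← mul_assoc]
    gcongr
    exact le_max_left _ _

end Soliton

/-! ### The soliton as a relative equilibrium, and its analyticity -/

section SolitonField
open Set Metric Filter Topology
variable {d p : ℕ} {x f₀ ε : ℝ} {r : ℕ}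

theorem gradient_flowG {f : Phase d → ℝ} (h : ∀ t z, f (flowG t z) = f z) (t : ℝ) (z : Phase d) :
    gradient f (flowG t z) = flowG t (gradient f z) := by
  refine ext_inner_right ℝ fun w => ?_
  obtain ⟨w, rfl⟩ := (flowE d t).surjective w
  rw [flowE_apply, inner_gradient, inner_flowG, inner_gradient]
  have h1 := (flowE d t).toContinuousLinearEquiv.comp_right_fderiv (f := f) (x := z)
  have h2 := DFunLike.congr_fun h1 w
  have h3 : (f ∘ (flowE d t).toContinuousLinearEquiv) = f := funext fun z => h t z
  rw [h3] at h2
  exact h2.symm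

theorem hamField_flowG {f : Phase d → ℝ} (h : ∀ t z, f (flowG t z) = f z) (t : ℝ) (z : Phase d) :
    hamField f (flowG t z) = flowG t (hamField f z) := by
  rw [hamField_eq_symp, gradient_flowG h, ← flowG_symp, ← hamField_eq_symp]

theorem gradient_reversal {f : Phase d → ℝ} (h : ∀ z, f (reversal d z) = f z) (z : Phase d) :
    gradient f (reversal d z) = reversal d (gradient f z) := by
  refine ext_inner_right ℝ fun w => ?_
  rw [inner_gradient, ← reversal_reversal w, fderiv_comp_reversal, inner_reversal, inner_gradient]
  simp only [h]

theorem gradient_snd_of_even {f : Phase d → ℝ} (h : ∀ z, f (reversal d z) = f z) (a : L2 d) :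
    (gradient f (mkPhase a 0)).snd = 0 := by
  have h1 := gradient_reversal h (mkPhase a 0)
  rw [reversal_apply, mkPhase_fst, mkPhase_snd, neg_zero, reversal_apply] at h1
  have h2 := congrArg WithLp.snd h1
  rw [mkPhase_snd] at h2
  have h3 : (2 : ℝ) • (gradient f (mkPhase a 0)).snd = 0 := by
    rw [two_smul]
    nth_rewrite 1 [h2]
    exact neg_add_cancel _
  exact (smul_eq_zero.1 h3).resolve_left two_ne_zero

/-- Differentiation under the average, tested with vectors (w, 0): both the argument and the test
vector are rotated, whence the two factors cos t of the averaged force. -/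
theorem gradient_average_hamF (p : ℕ) (ε : ℝ) (B : L2 d) :
    (gradient (average (hamF p ε)) (mkPhase ((2 : ℝ) • B) 0)).fst
      = ε • (gammaCoeff p • upow (2 * p) B - laplacian d B) := by
  obtain ⟨a, φ, -, -, hφ⟩ := exists_cls_hamF (d := d) zero_le_one p
  have hFm : Maj (hamF (d := d) p ε) (|ε| • φ) := by
    have := hφ.const_smul ε
    have e : (fun z : Phase d => ε • hamF p 1 z) = hamF p ε := funext fun z => (hamF_smul p ε z).symm
    rwa [e] at this
  set z : Phase d := mkPhase ((2 : ℝ) • B) 0 with hz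
  have h1 := hasFDerivAt_intervalIntegral (g := fun t z => hamF p ε (flowG t z)) (b := 2 * Real.pi)
    (by positivity) (contDiff_comp_flowG hFm.smooth)
    (fun t _ => hFm.comp_isometry (flowE d t)) z
  have h2 : HasFDerivAt (average (hamF p ε)) _ z := h1.const_mul (1 / (2 * Real.pi))
  have h3 : ∀ t, fderiv ℝ (fun z => hamF p ε (flowG t z)) z
      = (ε • (innerSL ℝ (force p (Real.cos t • (2 : ℝ) • B))).comp (fstC d)) ∘L
        ((flowE d t).toContinuousLinearEquiv : Phase d →L[ℝ] Phase d) := by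
    intro t
    have := (hasFDerivAt_hamF p ε (flowG t z)).comp z
      (flowE d t).toContinuousLinearEquiv.hasFDerivAt
    have e : (flowG t z).fst = Real.cos t • (2 : ℝ) • B := by simp [flowG, hz]
    rw [e] at this
    exact this.fderiv
  refine ext_inner_right ℝ fun w => ?_
  have h4 : inner ℝ (gradient (average (hamF p ε)) z).fst w
      = inner ℝ (gradient (average (hamF p ε)) z) (mkPhase w 0) := by
    rw [phase_inner, mkPhase_fst, mkPhase_snd, inner_zero_right, add_zero]
  have hcont : Continuous fun t => fderiv ℝ (fun z => hamF p ε (flowG t z)) z :=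
    (ContDiff.fderiv (n := 0) (m := ∞) (f := fun t z => hamF p ε (flowG t z)) (g := fun _ => z)
      (contDiff_comp_flowG hFm.smooth) contDiff_const (by simp)).continuous
  rw [h4, inner_gradient, h2.fderiv, _root_.smul_apply,
    ContinuousLinearMap.intervalIntegral_apply (hcont.intervalIntegrable _ _)]
  have h5 : ∀ t, fderiv ℝ (fun z => hamF p ε (flowG t z)) z (mkPhase w 0)
      = ε * inner ℝ w (Real.cos t • force p (Real.cos t • (2 : ℝ) • B)) := by
    intro t
    rw [h3]
    have e : (flowG t (mkPhase w 0 : Phase d)).fst = Real.cos t • w := by simp [flowG]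
    change ε * inner ℝ (force p (Real.cos t • (2 : ℝ) • B)) (flowG t (mkPhase w 0)).fst = _
    rw [e, inner_smul_right, inner_smul_right, real_inner_comm]
  simp only [h5]
  rw [intervalIntegral.integral_const_mul]
  have h6 := integral_cos_force p 2 B
  have h7 : ∫ t in (0 : ℝ)..2 * Real.pi,
      inner ℝ w (Real.cos t • force p (Real.cos t • (2 : ℝ) • B))
      = inner ℝ w (∫ t in (0 : ℝ)..2 * Real.pi,
        Real.cos t • force p (Real.cos t • (2 : ℝ) • B)) := by
    refine (innerSL ℝ w).intervalIntegral_comp_comm ?_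
    apply Continuous.intervalIntegrable
    simp only [force_cos]
    fun_prop
  push_cast at h6
  rw [h7, h6, inner_smul_right, inner_smul_left, real_inner_comm, smul_eq_mul]
  simp only [conj_trivial]
  field_simp

theorem fst_gradient_nfTerm_one (p : ℕ) (ε : ℝ) {r : ℕ} (hr : 1 ≤ r) (B : L2 d) :
    (gradient (nfTerm p ε r 1) (mkPhase ((2 : ℝ) • B) 0)).fst
      = ε • (gammaCoeff p • upow (2 * p) B - laplacian d B) := by
  have h : zetS (d := d) p ε (0 + 1) = average (hamF p ε) := by
    rw [zetS_succ]
    congr 1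
    ext z
    simp [psiS_apply, lieSeq_zero]
  rw [nfTerm_apply, if_pos hr, ← gradient_average_hamF, ← h]

/-- On the reversal axis the v-components of the gradients of the even normal form terms vanish. In
the u-component Z_1 contributes ε (f_0 - Ω B), with f_0 the stationary dNLS operator at B, and the
higher orders contribute -ε f_0 by the amplitude equation; what remains is (1 - εΩ/2) 2 B. -/
theorem hamField_hamK_soliton {p : ℕ} (hε : 0 < ε) (hr : 1 ≤ r) {Ω : ℝ} {B : L2 d}
    (hB : genDnls p Ω ε r B = 0) :
    hamField (hamK p ε r) (mkPhase ((2 : ℝ) • B) 0)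
      = (1 - ε * Ω / 2) • symp d (mkPhase ((2 : ℝ) • B) 0) := by
  set z : Phase d := mkPhase ((2 : ℝ) • B) 0 with hz
  have hdiff : ∀ s, 1 ≤ s → Differentiable ℝ (nfTerm (d := d) p ε r s) := by
    intro s hs
    rw [nfTerm_apply]
    split_ifs
    · exact zetS_differentiable hε hs
    · exact differentiable_const _
  have hrev : ∀ s, 1 ≤ s → ∀ z : Phase d, nfTerm p ε r s (reversal d z) = nfTerm p ε r s z := by
    intro s hs z
    obtain ⟨j, rfl⟩ : ∃ j, s = j + 1 := ⟨s - 1, by omega⟩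
    rw [nfTerm_apply]
    split_ifs
    · exact (normalForm_reversal hε j).2.1 z
    · rfl
  set W : Phase d → ℝ := fun z => ∑ s ∈ Finset.Icc 2 r, nfTerm p ε r s z with hW
  have hWd : Differentiable ℝ W :=
    Differentiable.fun_sum fun s hs => hdiff s (by have := Finset.mem_Icc.1 hs; omega)
  have hWr : ∀ z : Phase d, W (reversal d z) = W z := fun z =>
    Finset.sum_congr rfl fun s hs => hrev s (by have := Finset.mem_Icc.1 hs; omega) z
  have hK : hamK (d := d) p ε r = fun z => hamG z + (nfTerm p ε r 1 z + W z) := by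
    ext z
    rw [hamK, hW, ← Finset.add_sum_Ioc_eq_sum_Icc hr]
    rfl
  have hg : gradient (hamK p ε r) z
      = gradient hamG z + (gradient (nfTerm p ε r 1) z + gradient W z) := by
    have hG := (hasFDerivAt_hamG z)
    have h1 := (hdiff 1 le_rfl z).hasFDerivAt
    have h2 := (hWd z).hasFDerivAt
    have h3 : fderiv ℝ (hamK p ε r) z = fderiv ℝ hamG z + (fderiv ℝ (nfTerm p ε r 1) z
        + fderiv ℝ W z) := by
      rw [hK, hG.fderiv]
      exact (hG.add (h1.add h2)).fderiv
    rw [gradient, h3, map_add, map_add]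
    rfl
  have h2 : (gradient W z).fst = -(ε • dnls p Ω B) := by
    have h3 : genDnls p Ω ε r B = dnls p Ω B + highOrder p ε r B := genDnls_eq hε.ne' Ω r B
    rw [hB, highOrder] at h3
    have h4 : dnls p Ω B = ε⁻¹ • (sndC d (hamField W z)) := by
      exact add_neg_eq_zero.1 h3.symm
    rw [h4, smul_smul, mul_inv_cancel₀ hε.ne', one_smul, gradient_fst]
  refine phase_ext ?_ ?_
  · have h3 : (gradient (hamK p ε r) z).snd = 0 := by
      rw [hg]
      change (gradient hamG z).snd + ((gradient (nfTerm p ε r 1) z).snd + (gradient W z).snd) = 0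
      rw [gradient_hamG, gradient_snd_of_even (hrev 1 le_rfl), gradient_snd_of_even hWr]
      simp [hz]
    rw [hamField, mkPhase_fst, h3]
    simp [symp_apply, hz]
  · have h3 : (gradient (hamK p ε r) z).fst = (1 - ε * Ω / 2) • (2 : ℝ) • B := by
      rw [hg]
      change (gradient hamG z).fst + ((gradient (nfTerm p ε r 1) z).fst + (gradient W z).fst) = _
      rw [gradient_hamG, fst_gradient_nfTerm_one p ε hr, h2, dnls_eq, hz, mkPhase_fst]
      module
    rw [hamField, mkPhase_snd, h3]
    simp [symp_apply, hz]

theorem hamK_flowG (p : ℕ) (ε : ℝ) (r : ℕ) (t : ℝ) (z : Phase d) :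
    hamK p ε r (flowG t z) = hamK p ε r z := by
  have hG : hamG (flowG t z) = hamG z := by
    rw [hamG_eq, hamG_eq, inner_flowG_left, flowG_flowG, neg_add_cancel, flowG_zero]
  rw [hamK, hamK, hG]
  congr 1
  refine Finset.sum_congr rfl fun s hs => ?_
  rw [nfTerm_apply]
  split_ifs
  · exact zetS_flowG (Finset.mem_Icc.1 hs).1 t z
  · rfl

theorem soliton_eq_flowG (Ω ε : ℝ) (B : L2 d) (t : ℝ) :
    soliton Ω ε B t = flowG ((1 - ε * Ω / 2) * t) (mkPhase ((2 : ℝ) • B) 0) := by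
  rw [soliton, ofAmplitude_eq]

/-- K is invariant under the flow of X_G, so it is enough to know its field at phase zero; the flow
carries it to all other phases. -/
theorem hasDerivAt_soliton {p : ℕ} (hε : 0 < ε) (hr : 1 ≤ r) {Ω : ℝ} {B : L2 d}
    (hB : genDnls p Ω ε r B = 0) (t : ℝ) :
    HasDerivAt (soliton Ω ε B) (hamField (hamK p ε r) (soliton Ω ε B t)) t := by
  have e : soliton Ω ε B = fun t => flowG ((1 - ε * Ω / 2) * t) (mkPhase ((2 : ℝ) • B) 0) :=
    funext fun t => soliton_eq_flowG Ω ε B t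
  rw [e]
  have h := (hasDerivAt_flowG ((1 - ε * Ω / 2) * t) (mkPhase ((2 : ℝ) • B) 0 : Phase d)).scomp t
    ((hasDerivAt_id t).const_mul (1 - ε * Ω / 2))
  rw [mul_one] at h
  refine h.congr_deriv ?_
  rw [hamField_flowG (hamK_flowG p ε r), hamField_hamK_soliton hε hr hB, ← flowG_symp]
  exact ((flowE d _).map_smul _ _).symm

/-- The part of the equation coming from the terms of orders `2, …, r`, as a polynomial in the
coupling and the amplitude. -/
def highOrderPoly (p r : ℕ) (q : ℝ × L2 d) : L2 d :=
  -∑ s ∈ Finset.Icc 2 r, q.1 ^ (s - 1) •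
    sndC d (hamField (zetS p 1 s) (inlC d ((2 : ℝ) • q.2)))

theorem contDiff_highOrderPoly (p r : ℕ) : ContDiff ℝ ω (highOrderPoly (d := d) p r) := by
  refine ContDiff.neg (ContDiff.sum fun s hs => ?_)
  have hs' := Finset.mem_Icc.1 hs
  obtain ⟨j, rfl⟩ : ∃ j, s = j + 1 := ⟨s - 1, by omega⟩
  obtain ⟨f₀, S⟩ := exists_size d p (x := 5) (by norm_num)
  have h1 := (normalForm_size (ε := 1) (n := j + 1) (x := 5) (by norm_num) S.pos one_pos S.cls j
    le_rfl).2.1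
  have h2 := (h1.hamField (by norm_num)).isPoly.contDiff
  have h3 : ContDiff ℝ ω fun q : ℝ × L2 d => inlC d ((2 : ℝ) • q.2) :=
    (inlC d).contDiff.comp (contDiff_snd.const_smul 2)
  exact (contDiff_fst.pow _).smul ((sndC d).contDiff.comp (h2.comp h3))

theorem highOrderPoly_eq (hε : 0 < ε) (p r : ℕ) (B : L2 d) :
    highOrderPoly p r (ε, B) = highOrder p ε r B := by
  have h1 : ∀ z : Phase d, hamField (fun z => ∑ s ∈ Finset.Icc 2 r, nfTerm p ε r s z) z
      = ∑ s ∈ Finset.Icc 2 r, ε ^ s • hamField (zetS p 1 s) z := by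
    intro z
    have h2 : (fun z : Phase d => ∑ s ∈ Finset.Icc 2 r, nfTerm p ε r s z)
        = fun z => ∑ s ∈ Finset.Icc 2 r, ε ^ s * zetS p 1 s z := by
      ext z
      refine Finset.sum_congr rfl fun s hs => ?_
      have hs' := Finset.mem_Icc.1 hs
      obtain ⟨j, rfl⟩ : ∃ j, s = j + 1 := ⟨s - 1, by omega⟩
      rw [nfTerm_apply, if_pos hs'.2, (normalForm_scaling j).1]
    have hd : ∀ s ∈ Finset.Icc 2 r, Differentiable ℝ (zetS (d := d) p 1 s) := fun s hs =>
      zetS_differentiable one_pos (by have := Finset.mem_Icc.1 hs; omega)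
    rw [h2, hamField_eq, fderiv_fun_sum fun s hs => ((hd s hs) z).const_mul _, map_sum]
    refine Finset.sum_congr rfl fun s hs => ?_
    rw [fderiv_const_mul ((hd s hs) z), map_smul, hamField_eq]
  rw [highOrderPoly, highOrder, h1, map_sum, Finset.smul_sum]
  congr 1
  refine Finset.sum_congr rfl fun s hs => ?_
  have hs' := Finset.mem_Icc.1 hs
  obtain ⟨j, rfl⟩ : ∃ j, s = j + 1 := ⟨s - 1, by omega⟩
  have e : ε ^ j = ε⁻¹ * ε ^ (j + 1) := by field_simp; ring
  rw [map_smul (sndC d), smul_smul, Nat.add_sub_cancel]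
  change ε ^ j • _ = _
  rw [e]

/-- For positive ε the amplitude equation coincides with one that is polynomial in ε apart from the
dNLS operator. The analytic branch of the implicit function theorem stays in the ball of uniqueness
and hence is the given solution. -/
theorem analyticAt_soliton {p r : ℕ} {Ω ε₀ δ : ℝ} (hε : 0 < ε₀) {A : L2 d} {B : ℝ → L2 d}
    {D : L2 d →L[ℝ] L2 d} (hD : HasFDerivAt (genDnls p Ω ε₀ r) D (B ε₀)) (hu : IsUnit D)
    (h0 : ∀ᶠ ε in 𝓝 ε₀, genDnls p Ω ε r (B ε) = 0 ∧ B ε ∈ ball A δ ∧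
      ∀ B' ∈ ball A δ, genDnls p Ω ε r B' = 0 → B' = B ε) :
    AnalyticAt ℝ B ε₀ := by
  set f : ℝ × L2 d → L2 d := fun q => dnls p Ω q.2 + highOrderPoly p r q with hf
  have hfc : ContDiff ℝ ω f := ((contDiff_dnls p Ω).comp contDiff_snd).add
    (contDiff_highOrderPoly p r)
  have hfe : ∀ ε > 0, ∀ B, f (ε, B) = genDnls p Ω ε r B := fun ε hε B => by
    rw [hf, genDnls_eq hε.ne', ← highOrderPoly_eq hε]
  obtain ⟨hz, hmem, -⟩ := h0.self_of_nhds
  have hA : ∀ v, fderiv ℝ f (ε₀, B ε₀) (0, v) = D v := by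
    have h1 : HasFDerivAt (fun B => f (ε₀, B)) (fderiv ℝ f (ε₀, B ε₀) ∘L .inr ℝ ℝ (L2 d)) (B ε₀) :=
      ((hfc.differentiable (by simp) _).hasFDerivAt).comp (B ε₀) (hasFDerivAt_prodMk_right ε₀ (B ε₀))
    rw [funext (hfe ε₀ hε)] at h1
    exact fun v => DFunLike.congr_fun (h1.unique hD) v
  obtain ⟨u, rfl⟩ := hu
  have hb : Function.Bijective (u : L2 d →L[ℝ] L2 d) :=
    (ContinuousLinearEquiv.unitsEquiv ℝ (L2 d) u).bijective
  obtain ⟨g, hg0, hgc, hgz, -⟩ := exists_analytic_implicit hfc.contDiffAt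
    ((hfe ε₀ hε (B ε₀)).trans hz) hA hb
  refine (hgc.analyticAt).congr ?_
  have h1 : ∀ᶠ ε in 𝓝 ε₀, g ε ∈ ball A δ :=
    hgc.continuousAt.eventually (isOpen_ball.mem_nhds (by rw [hg0]; exact hmem))
  filter_upwards [h1, hgz, h0, lt_mem_nhds hε] with ε h1 h2 h3 h4
  exact h3.2.2 _ h1 ((hfe ε h4 _).symm.trans h2)

end SolitonField

/-! ### From half a period to all times -/

section Folding
open Set Filter Topology
variable {d : ℕ}

/-- The `2π`-periodic reversible function that agrees on `[0, π]` with `z`. -/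
def fold (z : ℝ → Phase d) (t : ℝ) : Phase d :=
  if 0 ≤ Real.sin t then z (Real.arccos (Real.cos t))
  else reversal d (z (Real.arccos (Real.cos t)))

theorem fold_of_mem (z : ℝ → Phase d) {t : ℝ} (ht : t ∈ Icc 0 Real.pi) : fold z t = z t := by
  rw [fold, if_pos (Real.sin_nonneg_of_mem_Icc ht), Real.arccos_cos ht.1 ht.2]

theorem fold_add_two_pi (z : ℝ → Phase d) (t : ℝ) : fold z (t + 2 * Real.pi) = fold z t := by
  simp [fold]

theorem reversal_eq_self {z : Phase d} (h : z.snd = 0) : reversal d z = z := by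
  rw [reversal_apply, h, neg_zero]
  exact phase_ext rfl h.symm

theorem fold_neg {z : ℝ → Phase d} (h0 : (z 0).snd = 0) (hπ : (z Real.pi).snd = 0) (t : ℝ) :
    fold z (-t) = reversal d (fold z t) := by
  simp only [fold, Real.sin_neg, Real.cos_neg, Left.nonneg_neg_iff]
  rcases lt_trichotomy (Real.sin t) 0 with h | h | h
  · rw [if_pos h.le, if_neg h.not_ge, reversal_reversal]
  · rw [if_pos h.le, if_pos h.ge]
    rcases Real.sin_eq_zero_iff_cos_eq.1 h with h | h
    · rw [h, Real.arccos_one, reversal_eq_self h0]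
    · rw [h, Real.arccos_neg_one, reversal_eq_self hπ]
  · rw [if_neg h.not_ge, if_pos h.le]

/-- A reversible periodic function whose restriction to half a period is a solution, is a
solution. -/
theorem hasDerivAt_of_reversible {Z : ℝ → Phase d} {f : Phase d → Phase d}
    (hf : ∀ z, f (reversal d z) = -reversal d (f z)) (hp : ∀ t, Z (t + 2 * Real.pi) = Z t)
    (hn : ∀ t, Z (-t) = reversal d (Z t))
    (hZ : ∀ t ∈ Icc 0 Real.pi, HasDerivWithinAt Z (f (Z t)) (Icc 0 Real.pi) t) (t : ℝ) :
    HasDerivAt Z (f (Z t)) t := by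
  have hperiodic : Function.Periodic Z (2 * Real.pi) := hp
  -- Reflection in c/2, used with c = 0 and c = 2π. At the fixed times 0 and π it supplies the
  -- missing one-sided derivative.
  have hrefl : ∀ (c t : ℝ) (s : Set ℝ), (∀ t, Z (c - t) = reversal d (Z t)) →
      HasDerivWithinAt Z (f (Z t)) s t → HasDerivWithinAt Z (f (Z (c - t))) ((c - ·) ⁻¹' s) (c - t) := by
    intro c t s hc h
    have h1 : HasDerivWithinAt (fun u => c - u) (-1) ((c - ·) ⁻¹' s) (c - t) :=
      ((hasDerivAt_id (c - t)).const_sub c).hasDerivWithinAt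
    have h2 : HasDerivWithinAt Z (f (Z t)) s (c - (c - t)) := by rwa [sub_sub_cancel]
    have h3 := h2.scomp (c - t) h1 (fun _ h => h)
    have h4 := (reversal d).toContinuousLinearEquiv.hasFDerivAt.comp_hasDerivWithinAt (c - t) h3
    have e : (fun u => reversal d (Z (c - u))) = Z := funext fun u => by
      rw [hc, reversal_reversal]
    have h5 : HasDerivWithinAt (fun u => reversal d (Z (c - u))) (reversal d ((-1 : ℝ) • f (Z t)))
      ((c - ·) ⁻¹' s) (c - t) := h4
    rw [e] at h5
    rwa [hc, hf, ← map_neg, ← neg_one_smul ℝ (f (Z t))]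
  have hc0 : ∀ t, Z (0 - t) = reversal d (Z t) := fun t => by rw [zero_sub, hn]
  have hcp : ∀ t, Z (2 * Real.pi - t) = reversal d (Z t) := fun t => by
    rw [← hn, ← hp (-t)]; congr 1; ring
  have hpi := Real.pi_pos
  have h1 : ∀ t ∈ Icc 0 Real.pi, HasDerivAt Z (f (Z t)) t := by
    intro t ht
    rcases ht.1.eq_or_lt with rfl | h0
    · have h2 := (hZ 0 ht).union (t := (fun u => 0 - u) ⁻¹' Icc 0 Real.pi) (by
        have := hrefl 0 0 _ hc0 (hZ 0 ht)
        rwa [sub_zero] at this)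
      refine h2.hasDerivAt (mem_of_superset (Ioo_mem_nhds (a := -Real.pi) (b := Real.pi)
        (by linarith) hpi) fun u hu => ?_)
      rcases le_total 0 u with h | h
      · exact Or.inl ⟨h, hu.2.le⟩
      · exact Or.inr ⟨by simpa using h, by simp; linarith [hu.1]⟩
    rcases ht.2.eq_or_lt with rfl | hlt
    · have h2 := (hZ Real.pi ht).union (t := (fun u => 2 * Real.pi - u) ⁻¹' Icc 0 Real.pi) (by
        have := hrefl (2 * Real.pi) Real.pi _ hcp (hZ Real.pi ht)
        rwa [show 2 * Real.pi - Real.pi = Real.pi by ring] at this)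
      refine h2.hasDerivAt (mem_of_superset (Ioo_mem_nhds (a := 0) (b := 2 * Real.pi)
        hpi (by linarith)) fun u hu => ?_)
      rcases le_total u Real.pi with h | h
      · exact Or.inl ⟨hu.1.le, h⟩
      · exact Or.inr ⟨by simpa using hu.2.le, by simp; linarith⟩
    · exact (hZ t ht).hasDerivAt (Icc_mem_nhds h0 hlt)
  have h2 : ∀ t ∈ Icc (-Real.pi) Real.pi, HasDerivAt Z (f (Z t)) t := by
    intro t ht
    rcases le_total 0 t with h | h
    · exact h1 t ⟨h, ht.2⟩
    · have := hrefl 0 (-t) univ hc0 (h1 (-t) ⟨by linarith, by linarith [ht.1]⟩).hasDerivWithinAt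
      simpa using this
  obtain ⟨n, hn, -⟩ := existsUnique_add_zsmul_mem_Ioc (a := 2 * Real.pi) (by positivity) t (-Real.pi)
  have h3 := h2 (t + n • (2 * Real.pi)) ⟨hn.1.le, by linarith [hn.2]⟩
  have h4 := h3.comp_add_const t (n • (2 * Real.pi))
  have e : ∀ u, Z (u + n • (2 * Real.pi)) = Z u := fun u => hperiodic.zsmul n u
  simp only [e] at h4
  exact h4

theorem hamField_reversal_of_even {f : Phase d → ℝ} (h : ∀ z, f (reversal d z) = f z)
    (z : Phase d) : hamField f (reversal d z) = -reversal d (hamField f z) := by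
  rw [hamField_eq_symp, hamField_eq_symp, gradient_reversal h, symp_reversal]

end Folding

/-! ### Fourier coefficients of reversible curves -/

section Fourier
open Set Filter Topology MeasureTheory
variable {d : ℕ}

/-- The Fourier coefficient of a curve over half a period, continued by reversibility. -/
def fourierC (d : ℕ) (m : ℤ) : HalfCurve d →L[ℝ] L2 d :=
  (1 / (2 * Real.pi)) • (fstC d ∘L
    ContinuousMap.evalCLM ℝ ⟨Real.pi, right_mem_Icc.2 pi_nonneg'⟩ ∘L primC d ∘L rotate d (-(m : ℝ)))

theorem fourierC_eq (m : ℤ) (y : HalfCurve d) :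
    fourierC d m y = (1 / (2 * Real.pi)) •
      (∫ s in (0 : ℝ)..Real.pi, IccExtend pi_nonneg' (rotate d (-(m : ℝ)) y) s).fst := rfl

theorem fourierC_apply {w : ℝ → Phase d} (hw : Continuous w) {y : HalfCurve d}
    (hy : ∀ t, y t = w t) (m : ℤ) :
    fourierC d m y = (1 / (2 * Real.pi)) •
      ∫ s in (0 : ℝ)..Real.pi, (flowG (-m * s) (w s)).fst := by
  rw [fourierC_eq]
  congr 1
  have h1 : ∀ s ∈ uIcc 0 Real.pi, IccExtend pi_nonneg' (rotate d (-(m : ℝ)) y) s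
      = flowG (-m * s) (w s) := by
    intro s hs
    rw [uIcc_of_le pi_nonneg'] at hs
    rw [IccExtend_of_mem _ _ hs, rotate_apply, hy]
  rw [intervalIntegral.integral_congr h1]
  exact ((fstC d).intervalIntegral_comp_comm ((continuous_flowG_comp (by fun_prop)
    hw).intervalIntegrable _ _)).symm

theorem integral_cos_int (k : ℤ) :
    ∫ s in (0 : ℝ)..Real.pi, Real.cos (k * s) = if k = 0 then Real.pi else 0 := by
  split_ifs with h
  · simp [h]
  · have h1 : (k : ℝ) ≠ 0 := by exact_mod_cast h
    rw [intervalIntegral.integral_comp_mul_left _ h1]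
    simp [Real.sin_int_mul_pi]

/-- A single harmonic, as a curve over half a period. -/
def harmonicC (m : ℤ) (a : L2 d) : HalfCurve d := rotate d m (constC d ((2 : ℝ) • a))

theorem harmonicC_apply (m : ℤ) (a : L2 d) (t : Icc 0 Real.pi) :
    harmonicC m a t = ofAmplitude a (m * t) := by
  rw [ofAmplitude_eq]; rfl

theorem norm_harmonicC_le (m : ℤ) (a : L2 d) : ‖harmonicC m a‖ ≤ 2 * ‖a‖ :=
  (ContinuousMap.norm_le _ (by positivity)).2 fun t => by
    rw [harmonicC_apply, norm_ofAmplitude]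

theorem continuous_ofAmplitude (a : L2 d) (c : ℝ) : Continuous fun s => ofAmplitude a (c * s) := by
  simp only [ofAmplitude_eq]
  exact continuous_flowG_comp (by fun_prop) continuous_const

theorem fourierC_harmonicC (m k : ℤ) (a : L2 d) :
    fourierC d m (harmonicC k a) = if m = k then a else 0 := by
  rw [fourierC_apply (continuous_ofAmplitude a k) (harmonicC_apply k a)]
  have h1 : ∀ s : ℝ, (flowG (-m * s) (ofAmplitude a (k * s))).fst
      = Real.cos ((k - m : ℤ) * s) • (2 : ℝ) • a := by
    intro s
    rw [ofAmplitude_eq, flowG_flowG]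
    simp only [flowG, mkPhase_fst, mkPhase_snd, smul_zero, add_zero]
    congr 2
    push_cast; ring
  simp only [h1]
  rw [intervalIntegral.integral_smul_const, integral_cos_int]
  have hpi := Real.pi_pos
  by_cases h : m = k
  · rw [if_pos (by omega), if_pos h, smul_smul, smul_smul]
    field_simp
    simp
  · rw [if_neg (by omega), if_neg h, zero_smul ℝ, smul_zero]

/-- Uniqueness of scalar Fourier series for each lattice site, applied to φ = u - i v. By
reversibility the two halves of a period have complex conjugate contributions, so the full
coefficients are determined by the half-period coefficients. -/
theorem eq_zero_of_fourierC {w : ℝ → Phase d} (hw : Continuous w)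
    (hp : ∀ t, w (t + 2 * Real.pi) = w t) (hn : ∀ t, w (-t) = reversal d (w t)) {y : HalfCurve d}
    (hy : ∀ t, y t = w t) (h0 : ∀ m, fourierC d m y = 0) (t : ℝ) : w t = 0 := by
  have : Fact (0 < 2 * Real.pi) := ⟨by positivity⟩
  have key : ∀ n : Fin d → ℤ, (w t).fst n = 0 ∧ (w t).snd n = 0 := by
    intro n
    set φ : ℝ → ℂ := fun s => ((w s).fst n : ℂ) - ((w s).snd n : ℂ) * Complex.I with hφ
    have hu : Continuous fun s => (w s).fst n :=
      (lp.evalCLM ℝ (fun _ : Fin d → ℤ => ℝ) 2 n).continuous.comp ((fstC d).continuous.comp hw)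
    have hv : Continuous fun s => (w s).snd n :=
      (lp.evalCLM ℝ (fun _ : Fin d → ℤ => ℝ) 2 n).continuous.comp ((sndC d).continuous.comp hw)
    have hφc : Continuous φ := by fun_prop
    have hφp : Function.Periodic φ (2 * Real.pi) := fun s => by simp only [hφ, hp]
    set f : C(AddCircle (2 * Real.pi), ℂ) := ⟨hφp.lift, continuous_coinduced_dom.2 hφc⟩ with hf
    have hfa : ∀ s : ℝ, f (s : AddCircle (2 * Real.pi)) = φ s := fun s => rfl
    have hcoef : ∀ m, fourierCoeff f m = 0 := by
      intro m
      rw [fourierCoeff_eq_intervalIntegral f m (-Real.pi)]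
      set ψ : ℝ → ℂ := fun s => fourier (-m) (s : AddCircle (2 * Real.pi)) • f s with hψ
      have hψe : ∀ s, ψ s = (((w s).fst n * Real.cos (m * s) - (w s).snd n * Real.sin (m * s) : ℝ)
          : ℂ) - (((w s).fst n * Real.sin (m * s) + (w s).snd n * Real.cos (m * s) : ℝ) : ℂ)
            * Complex.I := by
        intro s
        rw [hψ]
        simp only [hfa, hφ, fourier_coe_apply, smul_eq_mul]
        have : (2 * (Real.pi : ℂ) * Complex.I * ((-m : ℤ) : ℂ) * s / ((2 * Real.pi : ℝ) : ℂ))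
            = ((-(m * s) : ℝ) : ℂ) * Complex.I := by
          have : (Real.pi : ℂ) ≠ 0 := by exact_mod_cast Real.pi_ne_zero
          push_cast
          field_simp
        rw [this, Complex.exp_mul_I, ← Complex.ofReal_cos, ← Complex.ofReal_sin, Real.cos_neg,
          Real.sin_neg]
        push_cast
        linear_combination (Complex.sin (m * s)) * ((w s).snd n : ℂ) * Complex.I_sq
      have hψc : Continuous ψ := by
        simp only [funext hψe]
        fun_prop
      have e : -Real.pi + 2 * Real.pi = Real.pi := by ring
      rw [e, ← intervalIntegral.integral_add_adjacent_intervals (b := 0)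
        (hψc.intervalIntegrable _ _) (hψc.intervalIntegrable _ _)]
      have h2 : ∫ s in (-Real.pi)..0, ψ s = ∫ s in (0 : ℝ)..Real.pi, ψ (-s) := by
        rw [intervalIntegral.integral_comp_neg, neg_zero]
      have hψn : Continuous fun s => ψ (-s) := hψc.comp continuous_neg
      rw [h2, ← intervalIntegral.integral_add (hψn.intervalIntegrable _ _)
        (hψc.intervalIntegrable _ _)]
      have h3 : ∀ s, ψ (-s) + ψ s = ((2 * (flowG (-m * s) (w s)).fst n : ℝ) : ℂ) := by
        intro s
        rw [hψe, hψe, hn, reversal_apply]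
        have e1 : (flowG (-m * s) (w s)).fst n
            = (w s).fst n * Real.cos (m * s) - (w s).snd n * Real.sin (m * s) := by
          rw [flowG, mkPhase_fst, lp.coeFn_add, Pi.add_apply, lp.coeFn_smul, lp.coeFn_smul,
            Pi.smul_apply, Pi.smul_apply, neg_mul, Real.cos_neg, Real.sin_neg, smul_eq_mul,
            smul_eq_mul]
          ring
        rw [e1]
        simp only [mkPhase_fst, mkPhase_snd, lp.coeFn_neg, Pi.neg_apply, mul_neg, Real.cos_neg,
          Real.sin_neg]
        push_cast
        ring
      simp only [h3]
      rw [intervalIntegral.integral_ofReal, intervalIntegral.integral_const_mul]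
      have h4 : ∫ s in (0 : ℝ)..Real.pi, (flowG (-m * s) (w s)).fst n = 0 := by
        have h5 := h0 m
        rw [fourierC_apply hw hy, smul_eq_zero] at h5
        have h6 := h5.resolve_left (by positivity)
        have h7 : Continuous fun s => (flowG (-m * s) (w s)).fst :=
          (fstC d).continuous.comp (continuous_flowG_comp (by fun_prop) hw)
        have h8 := (lp.evalCLM ℝ (fun _ : Fin d → ℤ => ℝ) 2 n).intervalIntegral_comp_comm
          (h7.intervalIntegrable (μ := volume) 0 Real.pi)
        rw [h6, map_zero] at h8
        exact h8
      rw [h4]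
      simp
    have h9 := has_pointwise_sum_fourier_series_of_summable (f := f)
      (by rw [funext hcoef]; exact summable_zero) (t : AddCircle (2 * Real.pi))
    simp only [hcoef, zero_smul] at h9
    have h10 : φ t = 0 := (h9.unique hasSum_zero)
    have h11 := congrArg Complex.re h10
    have h12 := congrArg Complex.im h10
    simp [hφ] at h11 h12
    exact ⟨h11, h12⟩
  exact phase_ext (lp.ext (funext fun n => (key n).1)) (lp.ext (funext fun n => (key n).2))

end Fourier

/-! ### Weighted Fourier series of reversible functions -/

section FourierSeries
open Set Filter Topology MeasureTheory
variable {d : ℕ}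

/-- Periodic functions that are invariant under time reversal. -/
structure Reversible (w : ℝ → Phase d) : Prop where
  periodic : ∀ t, w (t + 2 * Real.pi) = w t
  neg : ∀ t, w (-t) = reversal d (w t)

theorem eq_zero_of_eq_neg {v : L2 d} (h : v = -v) : v = 0 := by
  have h1 : (2 : ℝ) • v = 0 := by
    rw [two_smul]
    nth_rewrite 1 [h]
    exact neg_add_cancel v
  exact (smul_eq_zero.1 h1).resolve_left two_ne_zero

theorem Reversible.snd_zero {w : ℝ → Phase d} (h : Reversible w) : (w 0).snd = 0 := by
  have h1 := congrArg WithLp.snd (h.neg 0)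
  rw [neg_zero, reversal_apply, mkPhase_snd] at h1
  exact eq_zero_of_eq_neg h1

theorem Reversible.snd_pi {w : ℝ → Phase d} (h : Reversible w) : (w Real.pi).snd = 0 := by
  have h1 := congrArg WithLp.snd (h.neg Real.pi)
  rw [← h.periodic, show -Real.pi + 2 * Real.pi = Real.pi by ring, reversal_apply,
    mkPhase_snd] at h1
  exact eq_zero_of_eq_neg h1

/-- Differentiation turns reversible functions into antireversible ones; the symplectic matrix
anticommutes with the reversal and corrects the sign. -/
theorem Reversible.deriv {w w' : ℝ → Phase d} (h : Reversible w)
    (hw : ∀ t, HasDerivAt w (w' t) t) : Reversible fun t => symp d (w' t) := by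
  constructor
  · intro t
    have h1 := (hw (t + 2 * Real.pi)).comp_add_const t (2 * Real.pi)
    simp only [h.periodic] at h1
    simp only [h1.unique (hw t)]
  · intro t
    have h1 := (hw (-t)).scomp t (hasDerivAt_neg t)
    have h2 : HasDerivAt (fun t => w (-t)) (reversal d (w' t)) t := by
      simp only [h.neg]
      exact (reversal d).toContinuousLinearEquiv.hasFDerivAt.comp_hasDerivAt t (hw t)
    have h3 := h1.unique h2
    rw [neg_one_smul ℝ (w' (-t)), neg_eq_iff_eq_neg] at h3
    simp only [h3, map_neg, symp_reversal, neg_neg]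

/-- Integration by parts over half a period. The boundary terms are v-components at 0 and π, which
vanish by reversibility. -/
theorem fourierC_deriv {w w' : ℝ → Phase d} (h : Reversible w) (hw : ∀ t, HasDerivAt w (w' t) t)
    (hc : Continuous w') {y y' : HalfCurve d} (hy : ∀ t, y t = w t) (hy' : ∀ t, y' t = symp d (w' t))
    (m : ℤ) : (m : ℝ) • fourierC d m y = -fourierC d m y' := by
  have hwc : Continuous w := continuous_iff_continuousAt.2 fun t => (hw t).continuousAt
  rw [fourierC_apply hwc hy, fourierC_apply ((symp d).continuous.comp hc) hy']
  have h1 : ∀ t, HasDerivAt (fun t => flowG (-m * t) (w t))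
      ((-m : ℝ) • symp d (flowG (-m * t) (w t)) + flowG (-m * t) (w' t)) t := fun t =>
    hasDerivWithinAt_univ.1 (hasDerivWithinAt_flowG_comp (-m) (hw t).hasDerivWithinAt)
  have h2 : ∀ t, HasDerivAt (fun t => (flowG (-m * t) (w t)).snd)
      ((m : ℝ) • (flowG (-m * t) (w t)).fst + (flowG (-m * t) (symp d (w' t))).fst) t := by
    intro t
    have h3 := (sndC d).hasFDerivAt.comp_hasDerivAt t (h1 t)
    refine h3.congr_deriv ?_
    rw [sndC_apply, WithLp.add_snd, WithLp.smul_snd, symp_apply, mkPhase_snd, flowG_symp,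
      symp_apply, mkPhase_fst]
    module
  have hc1 : Continuous fun t => (flowG (-m * t) (w t)).fst :=
    (fstC d).continuous.comp (continuous_flowG_comp (by fun_prop) hwc)
  have hc2 : Continuous fun t => (flowG (-m * t) (symp d (w' t))).fst :=
    (fstC d).continuous.comp (continuous_flowG_comp (by fun_prop) ((symp d).continuous.comp hc))
  have hc3 : Continuous fun t => (m : ℝ) • (flowG (-m * t) (w t)).fst := by exact hc1.const_smul (m : ℝ)
  have h3 := intervalIntegral.integral_eq_sub_of_hasDerivAt (a := 0) (b := Real.pi)
    (fun t _ => h2 t) ((hc3.add hc2).intervalIntegrable _ _)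
  have h4 : (flowG (-m * Real.pi) (w Real.pi)).snd = 0 := by
    rw [flowG, mkPhase_snd, h.snd_pi, neg_mul, Real.sin_neg, Real.sin_int_mul_pi]
    simp
  have h5 : (flowG (-m * 0) (w 0)).snd = 0 := by
    rw [mul_zero, flowG_zero, h.snd_zero]
  rw [h4, h5, sub_zero, intervalIntegral.integral_add (hc3.intervalIntegrable _ _)
    (hc2.intervalIntegrable _ _), intervalIntegral.integral_smul] at h3
  rw [smul_comm, ← smul_neg, eq_neg_of_add_eq_zero_left h3]
  rfl

/-- Bessel's inequality. -/
theorem sum_norm_fourierC_sq_le (y : HalfCurve d) (s : Finset ℤ) :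
    ∑ m ∈ s, ‖fourierC d m y‖ ^ 2 ≤ ‖y‖ ^ 2 := by
  set a : ℤ → L2 d := fun m => fourierC d m y with ha
  set P : HalfCurve d := ∑ m ∈ s, harmonicC m (a m) with hP
  have hPa : ∀ m ∈ s, fourierC d m P = a m := by
    intro m hm
    rw [hP, map_sum]
    simp only [fourierC_harmonicC]
    rw [Finset.sum_ite_eq s m, if_pos hm]
  set Y := IccExtend pi_nonneg' y with hY
  have hYc : Continuous Y := continuous_IccExtend _ _
  have hYy : ∀ t : Icc 0 Real.pi, y t = Y t := fun t => (IccExtend_val _ _ _).symm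
  have hip : ∀ (q : HalfCurve d) (m : ℤ) (b : L2 d),
      ∫ t in (0 : ℝ)..Real.pi, inner ℝ (IccExtend pi_nonneg' q t) (ofAmplitude b (m * t))
        = 4 * Real.pi * inner ℝ (fourierC d m q) b := by
    intro q m b
    set Q := IccExtend pi_nonneg' q with hQ
    have hQc : Continuous Q := continuous_IccExtend _ _
    have h1 : ∀ t, inner ℝ (Q t) (ofAmplitude b (m * t))
        = 2 * inner ℝ b (flowG (-m * t) (Q t)).fst := by
      intro t
      rw [ofAmplitude_eq, real_inner_comm, inner_flowG_left, phase_inner, mkPhase_fst, mkPhase_snd,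
        inner_zero_left, add_zero, inner_smul_left, neg_mul]
      rfl
    have h2 : Continuous fun t => (flowG (-m * t) (Q t)).fst :=
      (fstC d).continuous.comp (continuous_flowG_comp (by fun_prop) hQc)
    simp only [h1]
    rw [intervalIntegral.integral_const_mul, fourierC_apply hQc (fun t => (IccExtend_val _ _ _).symm),
      inner_smul_left, real_inner_comm]
    have h3 := (innerSL ℝ b).intervalIntegral_comp_comm (h2.intervalIntegrable (μ := volume) 0 Real.pi)
    simp only [innerSL_apply_apply] at h3
    rw [h3]
    simp only [conj_trivial]
    field_simp
    ring
  have hsum : ∀ q : HalfCurve d, ∫ t in (0 : ℝ)..Real.pi,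
      inner ℝ (IccExtend pi_nonneg' q t) (IccExtend pi_nonneg' P t)
        = 4 * Real.pi * ∑ m ∈ s, inner ℝ (fourierC d m q) (a m) := by
    intro q
    have hQc : Continuous (IccExtend pi_nonneg' q) := continuous_IccExtend _ _
    have h1 : ∀ t ∈ uIcc 0 Real.pi, inner ℝ (IccExtend pi_nonneg' q t) (IccExtend pi_nonneg' P t)
        = ∑ m ∈ s, inner ℝ (IccExtend pi_nonneg' q t) (ofAmplitude (a m) (m * t)) := by
      intro t ht
      rw [uIcc_of_le pi_nonneg'] at ht
      rw [IccExtend_of_mem _ P ht, hP, ContinuousMap.sum_apply, inner_sum]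
      simp only [harmonicC_apply]
    rw [intervalIntegral.integral_congr h1, intervalIntegral.integral_finsetSum
      fun m _ => (hQc.inner (continuous_ofAmplitude (a m) m)).intervalIntegrable _ _, Finset.mul_sum]
    exact Finset.sum_congr rfl fun m _ => hip q m (a m)
  have hPc : Continuous (IccExtend pi_nonneg' P) := continuous_IccExtend _ _
  have e1 := hsum y
  have e2 := hsum P
  have e3 : ∑ m ∈ s, inner ℝ (fourierC d m P) (a m) = ∑ m ∈ s, ‖a m‖ ^ 2 :=
    Finset.sum_congr rfl fun m hm => by rw [hPa m hm, real_inner_self_eq_norm_sq]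
  have e4 : ∑ m ∈ s, inner ℝ (fourierC d m y) (a m) = ∑ m ∈ s, ‖a m‖ ^ 2 :=
    Finset.sum_congr rfl fun m hm => by rw [← real_inner_self_eq_norm_sq]
  rw [e3] at e2
  rw [e4] at e1
  have h0 : 0 ≤ ∫ t in (0 : ℝ)..Real.pi, ‖Y t - IccExtend pi_nonneg' P t‖ ^ 2 :=
    intervalIntegral.integral_nonneg pi_nonneg' fun t _ => sq_nonneg _
  have h1 : ∀ t, ‖Y t - IccExtend pi_nonneg' P t‖ ^ 2 = ‖Y t‖ ^ 2
      - 2 * inner ℝ (Y t) (IccExtend pi_nonneg' P t)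
      + inner ℝ (IccExtend pi_nonneg' P t) (IccExtend pi_nonneg' P t) := fun t => by
    rw [norm_sub_sq_real, real_inner_self_eq_norm_sq]
  have i1 : Continuous fun t => ‖Y t‖ ^ 2 := hYc.norm.pow 2
  have i2 : Continuous fun t => 2 * inner ℝ (Y t) (IccExtend pi_nonneg' P t) :=
    continuous_const.mul (hYc.inner hPc)
  have i3 : Continuous fun t => inner ℝ (IccExtend pi_nonneg' P t) (IccExtend pi_nonneg' P t) :=
    hPc.inner hPc
  have i4 : Continuous fun t => ‖Y t‖ ^ 2 - 2 * inner ℝ (Y t) (IccExtend pi_nonneg' P t) := i1.sub i2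
  simp only [h1] at h0
  rw [intervalIntegral.integral_add (i4.intervalIntegrable _ _) (i3.intervalIntegrable _ _),    intervalIntegral.integral_sub (i1.intervalIntegrable _ _) (i2.intervalIntegrable _ _),
    intervalIntegral.integral_const_mul, e1, e2] at h0
  have h2 : ∫ t in (0 : ℝ)..Real.pi, ‖Y t‖ ^ 2 ≤ ∫ t in (0 : ℝ)..Real.pi, ‖y‖ ^ 2 :=
    intervalIntegral.integral_mono_on pi_nonneg' (i1.intervalIntegrable _ _) (by simp)
      fun t _ => by gcongr; exact norm_IccExtend_le _ _ _
  rw [intervalIntegral.integral_const, sub_zero, smul_eq_mul] at h2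
  have hpi := Real.pi_pos
  -- The L² identity gives 4π ∑ ‖a_m‖² ≤ ∫ ‖y‖², and the integral is at most π times the square of
  -- the uniform norm.
  have h3 : Real.pi * (4 * ∑ m ∈ s, ‖a m‖ ^ 2) ≤ Real.pi * ‖y‖ ^ 2 := by nlinarith
  have h4 := le_of_mul_le_mul_left h3 hpi
  have h5 : 0 ≤ ∑ m ∈ s, ‖a m‖ ^ 2 := Finset.sum_nonneg fun _ _ => sq_nonneg _
  linarith

theorem memlp_fourierC (y : HalfCurve d) : Memℓp (fun m : ℤ => fourierC d m y) 2 :=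
  memℓp_gen' (C := ‖y‖ ^ 2) fun s => by
    simpa using sum_norm_fourierC_sq_le y s

/-- The sequence of Fourier coefficients. -/
def fourierL (d : ℕ) : HalfCurve d →L[ℝ] L22 d :=
  LinearMap.mkContinuous
    { toFun := fun y => ⟨fun m => fourierC d m y, memlp_fourierC y⟩
      map_add' := fun y z => by ext1; funext m; exact map_add (fourierC d m) y z
      map_smul' := fun c y => by ext1; funext m; exact map_smul (fourierC d m) c y } 1 (fun y => by
        rw [one_mul]
        refine lp.norm_le_of_forall_sum_le (by norm_num) (norm_nonneg y) fun s => ?_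
        simpa using sum_norm_fourierC_sq_le y s)

theorem fourierL_apply (y : HalfCurve d) (m : ℤ) : fourierL d y m = fourierC d m y := rfl

theorem summable_inv_one_add_sq : Summable fun m : ℤ => (1 + (m : ℝ) ^ 2)⁻¹ := by
  refine (Real.summable_one_div_int_pow (p := 2).2 one_lt_two).of_norm_bounded_eventually ?_
  have h : ∀ᶠ m : ℤ in cofinite, m ≠ 0 := (finite_singleton (0 : ℤ)).compl_mem_cofinite
  filter_upwards [h] with m hm
  have hm' : (0 : ℝ) < (m : ℝ) ^ 2 := by positivity
  rw [Real.norm_of_nonneg (by positivity), one_div]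
  exact inv_anti₀ hm' (by linarith)

theorem summable_norm_coeff (b : L22 d) : Summable fun m => ‖coeff b m‖ := by
  have h1 : Summable fun m => ‖b m‖ ^ 2 := by
    simpa using (memℓp_gen_iff (p := 2) (by norm_num)).1 (lp.memℓp b)
  refine Summable.of_nonneg_of_le (fun _ => norm_nonneg _) (fun m => ?_)
    (summable_inv_one_add_sq.add h1)
  have hq : (0 : ℝ) < (1 + (m : ℝ) ^ 2)⁻¹ := by positivity
  have hq1 : (1 + (m : ℝ) ^ 2)⁻¹ ≤ 1 := inv_le_one_of_one_le₀ (by nlinarith [sq_nonneg (m : ℝ)])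
  rw [coeff, norm_smul, Real.norm_of_nonneg hq.le]
  nlinarith [sq_nonneg (1 - ‖b m‖), norm_nonneg (b m)]

theorem ofAmplitude_sub (a b : L2 d) (θ : ℝ) :
    ofAmplitude (a - b) θ = ofAmplitude a θ - ofAmplitude b θ := by
  refine phase_ext ?_ ?_
  · simp [ofAmplitude, smul_sub]
  · simp [ofAmplitude, smul_sub]

theorem summable_ofAmplitude (b : L22 d) (τ : ℝ) :
    Summable fun m : ℤ => ofAmplitude (coeff b m) (m * τ) :=
  Summable.of_norm (by simpa only [norm_ofAmplitude] using (summable_norm_coeff b).mul_left 2)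

/-- The restriction of `ofFourier b` to half a period. -/
def halfFourier (b : L22 d) : HalfCurve d := ∑' m, harmonicC m (coeff b m)

theorem summable_harmonicC (b : L22 d) : Summable fun m => harmonicC m (coeff b m) :=
  Summable.of_norm_bounded ((summable_norm_coeff b).mul_left 2) fun m => norm_harmonicC_le m _

theorem halfFourier_apply (b : L22 d) (t : Icc 0 Real.pi) : halfFourier b t = ofFourier b t := by
  have h := (summable_harmonicC b).hasSum.mapL (ContinuousMap.evalCLM ℝ t)
  refine Eq.trans h.tsum_eq.symm ?_
  rw [ofFourier]
  congr 1
  funext m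
  exact harmonicC_apply m _ t

theorem fourierC_halfFourier (b : L22 d) (m : ℤ) : fourierC d m (halfFourier b) = coeff b m := by
  have h := (summable_harmonicC b).hasSum.mapL (fourierC d m)
  simp only [fourierC_harmonicC] at h
  refine h.unique ?_
  have h1 := hasSum_ite_eq m (coeff b m)
  convert h1 using 2 with k
  by_cases hk : m = k
  · rw [if_pos hk, if_pos hk.symm, hk]
  · rw [if_neg hk, if_neg (Ne.symm hk)]

theorem continuous_ofFourier (b : L22 d) : Continuous (ofFourier b) :=
  continuous_tsum (fun _ => continuous_ofAmplitude _ _) ((summable_norm_coeff b).mul_left 2)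
    fun _ _ => (norm_ofAmplitude _ _).le

theorem reversible_ofFourier (b : L22 d) : Reversible (ofFourier b) := by
  constructor
  · intro t
    simp only [ofFourier]
    congr 1
    funext m
    rw [ofAmplitude, ofAmplitude, mul_add, Real.cos_add_int_mul_two_pi, Real.sin_add_int_mul_two_pi]
  · intro t
    have h := ((summable_ofAmplitude b t).hasSum.mapL
      ((reversal d).toContinuousLinearEquiv : Phase d →L[ℝ] Phase d)).tsum_eq
    refine Eq.trans ?_ h
    rw [ofFourier]
    congr 1
    funext m
    refine phase_ext ?_ ?_
    · simp [ofAmplitude, reversal_apply]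
    · simp [ofAmplitude, reversal_apply]

theorem ofFourier_injective {b b' : L22 d} (h : ∀ τ, ofFourier b τ = ofFourier b' τ) : b = b' := by
  have h1 : halfFourier b = halfFourier b' := by
    ext1 t; rw [halfFourier_apply, halfFourier_apply, h]
  ext1
  funext m
  have h2 : coeff b m = coeff b' m := by rw [← fourierC_halfFourier, h1, fourierC_halfFourier]
  have h3 : (1 + (m : ℝ) ^ 2)⁻¹ ≠ 0 := by positivity
  exact smul_right_injective _ h3 h2

/-- A reversible periodic function of class `C²` is the sum of its Fourier series. -/
theorem ofFourier_fourierL {w w' w'' : ℝ → Phase d} (h : Reversible w)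
    (hw : ∀ t, HasDerivAt w (w' t) t) (hw' : ∀ t, HasDerivAt w' (w'' t) t) (hc : Continuous w'')
    {y y'' : HalfCurve d} (hy : ∀ t, y t = w t) (hy'' : ∀ t, y'' t = w'' t) (τ : ℝ) :
    ofFourier (fourierL d (y - y'')) τ = w τ := by
  have hwc : Continuous w := continuous_iff_continuousAt.2 fun t => (hw t).continuousAt
  have hwc' : Continuous w' := continuous_iff_continuousAt.2 fun t => (hw' t).continuousAt
  set y' : HalfCurve d := ⟨fun t => symp d (w' t),
    ((symp d).continuous.comp hwc').comp continuous_subtype_val⟩ with hy'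
  have h1 := fun m => fourierC_deriv h hw hwc' hy (fun t => rfl : ∀ t, y' t = _) m
  have h2 := fun m => fourierC_deriv (h.deriv hw)
    (fun t => (symp d).toContinuousLinearEquiv.hasFDerivAt.comp_hasDerivAt t (hw' t))
    ((symp d).continuous.comp hc) (y' := -y'') (fun t => rfl : ∀ t, y' t = _)
    (fun t => by rw [ContinuousMap.neg_apply, hy'']; exact (symp_symp _).symm) m
  set b := fourierL d (y - y'') with hb
  -- The second derivative has the coefficients -m² a_m. Hence y - y'' has exactly the weighted
  -- coefficients (1 + m²) a_m that an element of `L22` stores.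
  have h3 : ∀ m, coeff b m = fourierC d m y := by
    intro m
    have h4 : ((m : ℝ) ^ 2) • fourierC d m y = -fourierC d m y'' := by
      rw [pow_two, mul_smul, h1, smul_neg, h2, map_neg, neg_neg]
    have h5 : (1 + (m : ℝ) ^ 2) ≠ 0 := by positivity
    rw [coeff, hb, fourierL_apply, map_sub, sub_eq_add_neg, ← h4, inv_smul_eq_iff₀ h5, add_smul,
      one_smul]
  refine sub_eq_zero.1 (eq_zero_of_fourierC (w := fun τ => ofFourier b τ - w τ)
    (y := halfFourier b - y) ((continuous_ofFourier b).sub hwc) (fun t => ?_) (fun t => ?_)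
    (fun t => ?_) (fun m => ?_) τ)
  · rw [(reversible_ofFourier b).periodic, h.periodic]
  · rw [(reversible_ofFourier b).neg, h.neg, map_sub]
  · rw [ContinuousMap.sub_apply, halfFourier_apply, hy]
  · rw [map_sub, fourierC_halfFourier, h3, sub_self]

/-- With q = 1 + m² one has a ≤ s/q + q a²/(2 s). The first terms sum to a constant times s, the
second to at most s by Bessel's inequality for the function and its derivative. -/
theorem tsum_norm_fourierC_le {w w' : ℝ → Phase d} (h : Reversible w)
    (hw : ∀ t, HasDerivAt w (w' t) t) (hc : Continuous w') {y : HalfCurve d}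
    (hy : ∀ t, y t = w t) {s : ℝ} (hs : 0 < s) (h0 : ∀ t, ‖w t‖ ≤ s) (h1 : ∀ t, ‖w' t‖ ≤ s) :
    ∑' m, ‖fourierC d m y‖ ≤ ((∑' m : ℤ, (1 + (m : ℝ) ^ 2)⁻¹) + 1) * s := by
  set y' : HalfCurve d := ⟨fun t => symp d (w' t),
    ((symp d).continuous.comp hc).comp continuous_subtype_val⟩ with hy'
  have hym := fun m => fourierC_deriv h hw hc hy (fun t => rfl : ∀ t, y' t = _) m
  have hy0 : ‖y‖ ≤ s := (ContinuousMap.norm_le _ hs.le).2 fun t => by rw [hy]; exact h0 t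
  have hy1 : ‖y'‖ ≤ s := (ContinuousMap.norm_le _ hs.le).2 fun t =>
    ((symp d).norm_map _).le.trans (h1 t)
  refine Real.tsum_le_of_sum_le (fun _ => norm_nonneg _) fun S => ?_
  have h2 : ∀ m ∈ S, ‖fourierC d m y‖ ≤ s * (1 + (m : ℝ) ^ 2)⁻¹
      + (‖fourierC d m y‖ ^ 2 + ‖fourierC d m y'‖ ^ 2) / (2 * s) := by
    intro m _
    have h3 : ‖fourierC d m y'‖ ^ 2 = (m : ℝ) ^ 2 * ‖fourierC d m y‖ ^ 2 := by
      rw [← norm_neg, ← hym m, norm_smul, mul_pow, Real.norm_eq_abs, sq_abs]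
    rw [h3]
    set a := ‖fourierC d m y‖
    set q := 1 + (m : ℝ) ^ 2 with hq
    have hq0 : 0 < q := by positivity
    have e : s * q⁻¹ + (a ^ 2 + (m : ℝ) ^ 2 * a ^ 2) / (2 * s) - a
        = ((s - q * a) ^ 2 + s ^ 2) / (2 * q * s) := by
      have : a ^ 2 + (m : ℝ) ^ 2 * a ^ 2 = q * a ^ 2 := by rw [hq]; ring
      rw [this]
      field_simp
      ring
    have : 0 ≤ ((s - q * a) ^ 2 + s ^ 2) / (2 * q * s) := by positivity
    linarith
  have h4 := summable_inv_one_add_sq.sum_le_tsum S (fun _ _ => by positivity)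
  have h5 := sum_norm_fourierC_sq_le y S
  have h6 := sum_norm_fourierC_sq_le y' S
  have h7 : ‖y‖ ^ 2 + ‖y'‖ ^ 2 ≤ 2 * s * s := by nlinarith [norm_nonneg y, norm_nonneg y']
  refine (Finset.sum_le_sum h2).trans ?_
  rw [Finset.sum_add_distrib, ← Finset.mul_sum, ← Finset.sum_div, Finset.sum_add_distrib]
  have h8 : (∑ m ∈ S, ‖fourierC d m y‖ ^ 2 + ∑ m ∈ S, ‖fourierC d m y'‖ ^ 2) / (2 * s) ≤ s := by
    rw [div_le_iff₀ (by positivity)]; nlinarith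
  nlinarith

theorem coeff_sub_eq (b : L22 d) (B : L2 d) (m : ℤ) :
    (coeff b m - if m = 1 then B else 0) = fourierC d m (halfFourier b - harmonicC 1 B) := by
  rw [map_sub, fourierC_halfFourier, fourierC_harmonicC]

theorem summable_fourierDist (b : L22 d) (B : L2 d) :
    Summable fun m : ℤ => ‖coeff b m - if m = 1 then B else 0‖ := by
  refine Summable.of_nonneg_of_le (fun _ => norm_nonneg _) (fun m => norm_sub_le _ _)
    ((summable_norm_coeff b).add ?_)
  refine (hasSum_ite_eq (1 : ℤ) ‖B‖).summable.congr fun m => ?_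
  split_ifs <;> simp

theorem norm_ofFourier_sub_le (b : L22 d) (B : L2 d) (τ : ℝ) :
    ‖ofFourier b τ - ofAmplitude B τ‖ ≤ 2 * fourierDist b B := by
  have h1 : HasSum (fun m : ℤ => ofAmplitude (if m = 1 then B else 0) (m * τ)) (ofAmplitude B τ) := by
    have h1 := hasSum_ite_eq (1 : ℤ) (ofAmplitude B τ)
    convert h1 using 2 with k
    split_ifs with hk
    · rw [hk, Int.cast_one, one_mul]
    · rw [ofAmplitude, smul_zero, smul_zero]
      rfl
  have h2 := (summable_ofAmplitude b τ).hasSum.sub h1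
  simp only [← ofAmplitude_sub] at h2
  have h3 := ((summable_fourierDist b B).mul_left 2).hasSum
  rw [tsum_mul_left] at h3
  exact h2.norm_le_of_bounded h3 fun m => (norm_ofAmplitude _ _).le

theorem fourierDist_le {b : L22 d} {B : L2 d} {w' : ℝ → Phase d}
    (hw : ∀ t, HasDerivAt (ofFourier b) (w' t) t) (hc : Continuous w') {s : ℝ} (hs : 0 < s)
    (h0 : ∀ t, ‖ofFourier b t - ofAmplitude B t‖ ≤ s)
    (h1 : ∀ t, ‖w' t - symp d (ofAmplitude B t)‖ ≤ s) :
    fourierDist b B ≤ ((∑' m : ℤ, (1 + (m : ℝ) ^ 2)⁻¹) + 1) * s := by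
  have hB : ∀ t, HasDerivAt (ofAmplitude B) (symp d (ofAmplitude B t)) t := by
    intro t
    rw [funext (ofAmplitude_eq B)]
    exact hasDerivAt_flowG t _
  have hBc : Continuous (ofAmplitude B) := continuous_iff_continuousAt.2 fun t => (hB t).continuousAt
  rw [fourierDist]
  simp only [coeff_sub_eq]
  refine tsum_norm_fourierC_le (w := fun t => ofFourier b t - ofAmplitude B t) ⟨fun t => ?_, fun t => ?_⟩
    (fun t => (hw t).sub (hB t)) (hc.sub ((symp d).continuous.comp hBc)) (fun t => ?_) hs h0 h1
  · rw [(reversible_ofFourier b).periodic, ofAmplitude_eq, flowG_add_two_pi, ofAmplitude_eq]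
  · rw [(reversible_ofFourier b).neg, map_sub]
    congr 1
    refine phase_ext ?_ ?_
    · simp [ofAmplitude, reversal_apply]
    · simp [ofAmplitude, reversal_apply]
  · rw [ContinuousMap.sub_apply, halfFourier_apply, harmonicC_apply, Int.cast_one, one_mul]

end FourierSeries

/-! ### Analytic dependence of polynomial flows on parameters -/

section PathField
open Set Filter Topology Metric
variable {E : Type} [NormedAddCommGroup E] [NormedSpace ℝ E]

variable (E) in
/-- Multiplication of paths by a power of the parameter. -/
def powC (k : ℕ) : C(Icc (0 : ℝ) 1, E) →L[ℝ] C(Icc (0 : ℝ) 1, E) :=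
  LinearMap.mkContinuous
    { toFun := fun y => ⟨fun θ => (θ : ℝ) ^ k • y θ,
        (continuous_subtype_val.pow k).smul y.continuous⟩
      map_add' := fun y z => by ext1 θ; exact smul_add _ (y θ) (z θ)
      map_smul' := fun c y => by ext1 θ; exact smul_comm _ c (y θ) } 1 (fun y => by
        rw [one_mul]
        refine (ContinuousMap.norm_le _ (norm_nonneg y)).2 fun θ => ?_
        change ‖(θ : ℝ) ^ k • y θ‖ ≤ ‖y‖
        rw [norm_smul, norm_pow, Real.norm_of_nonneg θ.2.1]
        exact (mul_le_of_le_one_left (norm_nonneg _) (pow_le_one₀ θ.2.1 θ.2.2)).trans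
          (y.norm_coe_le_norm θ))

theorem powC_apply (k : ℕ) (y : C(Icc (0 : ℝ) 1, E)) (θ : Icc (0 : ℝ) 1) :
    powC E k y θ = (θ : ℝ) ^ k • y θ := rfl

theorem ContDiffAt.path_eval_one {Q : Type} [NormedAddCommGroup Q] [NormedSpace ℝ Q]
    {g : Q → C(Icc (0 : ℝ) 1, E)} {q₀ : Q} (hg : ContDiffAt ℝ ω g q₀) :
    ContDiffAt ℝ ω (fun q => g q ⟨1, by simp⟩) q₀ :=
  (ContinuousMap.evalCLM ℝ ⟨1, by simp⟩ : C(Icc (0 : ℝ) 1, E) →L[ℝ] E).contDiff.contDiffAt.comp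
    q₀ hg

theorem path_mem_ball {y y₀ : C(Icc (0 : ℝ) 1, E)} {C ρ : ℝ} (hC : C < ρ)
    (h : ∀ θ, ‖y θ - y₀ θ‖ ≤ C) : y ∈ ball y₀ ρ := by
  rw [mem_ball, dist_eq_norm]
  refine lt_of_le_of_lt ((ContinuousMap.norm_le _ ?_).2 h) hC
  exact (norm_nonneg _).trans (h ⟨0, by simp⟩)

/-- A vector field that depends polynomially on the state and on time. -/
def pathField {Q : Type*} (n : ℕ) (κ : ℕ → Q → ℝ) (e : ℕ → ℕ) (Y : ℕ → E → E)
    (hY : ∀ l, IsPoly (Y l)) (v : Q × C(Icc (0 : ℝ) 1, E)) : C(Icc (0 : ℝ) 1, E) :=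
  ∑ l ∈ Finset.range n, κ l v.1 • powC E (e l) (superpose _ (Y l) (hY l).contDiff.continuous v.2)

variable {Q : Type} {n : ℕ} {κ : ℕ → Q → ℝ}
  {e : ℕ → ℕ} {Y : ℕ → E → E} {hY : ∀ l, IsPoly (Y l)}

theorem pathField_apply (q : Q) (y : C(Icc (0 : ℝ) 1, E)) (θ : Icc (0 : ℝ) 1) :
    pathField n κ e Y hY (q, y) θ = ∑ l ∈ Finset.range n, κ l q • (θ : ℝ) ^ e l • Y l (y θ) := by
  rw [pathField, ContinuousMap.sum_apply]
  rfl

theorem hasDerivWithinAt_of_path [CompleteSpace E] {q : Q} {c : E} {y : C(Icc (0 : ℝ) 1, E)}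
    (h : y = ContinuousMap.const _ c + volterra zero_le_one (pathField n κ e Y hY (q, y))) :
    IccExtend zero_le_one y 0 = c ∧ ∀ θ ∈ Icc (0 : ℝ) 1,
      HasDerivWithinAt (IccExtend zero_le_one y)
        (∑ l ∈ Finset.range n, κ l q • θ ^ e l • Y l (IccExtend zero_le_one y θ)) (Icc 0 1) θ := by
  set F := pathField n κ e Y hY (q, y) with hF
  refine ⟨?_, fun θ hθ => ?_⟩
  · have h1 := DFunLike.congr_fun h ⟨0, by simp⟩
    rw [IccExtend_of_mem zero_le_one y (show (0 : ℝ) ∈ Icc (0 : ℝ) 1 by simp), h1,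
      ContinuousMap.add_apply, ContinuousMap.const_apply, volterra_apply]
    simp
  · have h1 := hasDerivWithinAt_volterra zero_le_one c F hθ
    rw [← h] at h1
    refine h1.congr_deriv ?_
    rw [hF, pathField_apply, IccExtend_of_mem zero_le_one y hθ]

theorem path_of_hasDerivWithinAt [CompleteSpace E] {q : Q} {α : ℝ → E} {y : C(Icc (0 : ℝ) 1, E)}
    (hy : ∀ θ : Icc (0 : ℝ) 1, y θ = α θ)
    (h : ∀ θ ∈ Icc (0 : ℝ) 1, HasDerivWithinAt α
        (∑ l ∈ Finset.range n, κ l q • θ ^ e l • Y l (α θ)) (Icc 0 1) θ) :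
    y = ContinuousMap.const _ (α 0) + volterra zero_le_one (pathField n κ e Y hY (q, y)) := by
  refine eq_const_add_volterra zero_le_one hy fun θ => ?_
  rw [pathField_apply, hy]
  exact h θ θ.2

variable [NormedAddCommGroup Q] [NormedSpace ℝ Q]

theorem contDiffAt_pathField {q₀ : Q} (hκ : ∀ l, ContDiffAt ℝ ω (κ l) q₀)
    (y₀ : C(Icc (0 : ℝ) 1, E)) : ContDiffAt ℝ ω (pathField n κ e Y hY) (q₀, y₀) := by
  refine ContDiffAt.sum fun l _ => ?_
  have h1 : ContDiffAt ℝ ω (fun v : Q × C(Icc (0 : ℝ) 1, E) =>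
      superpose _ (Y l) (hY l).contDiff.continuous v.2) (q₀, y₀) :=
    (((hY l).superpose _).contDiff.comp contDiff_snd).contDiffAt
  exact ((hκ l).comp (f := Prod.fst) (q₀, y₀) contDiffAt_fst).smul
    ((powC E (e l)).contDiff.contDiffAt.comp (q₀, y₀) h1)

/-- Superposition is local in θ, so its derivative obeys the pointwise bound that makes the
linearized Volterra equation solvable without smallness. -/
theorem exists_norm_fderiv_pathField_le {q₀ : Q} (hκ : ∀ l, ContDiffAt ℝ ω (κ l) q₀)
    (y₀ : C(Icc (0 : ℝ) 1, E)) : ∃ M, 0 ≤ M ∧ ∀ (h : C(Icc (0 : ℝ) 1, E)) θ,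
      ‖fderiv ℝ (pathField n κ e Y hY) (q₀, y₀) (0, h) θ‖ ≤ M * ‖h θ‖ := by
  have hM : ∀ l, ∃ M, 0 ≤ M ∧ ∀ θ, ‖fderiv ℝ (Y l) (y₀ θ)‖ ≤ M := by
    intro l
    have hc : Continuous fun θ => ‖fderiv ℝ (Y l) (y₀ θ)‖ :=
      (((hY l).contDiff.continuous_fderiv (by simp)).comp y₀.continuous).norm
    obtain ⟨M, hM⟩ := (isCompact_range hc).bddAbove
    exact ⟨M, (norm_nonneg _).trans (hM ⟨⟨0, by simp⟩, rfl⟩), fun θ => hM ⟨θ, rfl⟩⟩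
  choose M hM0 hM using hM
  refine ⟨∑ l ∈ Finset.range n, |κ l q₀| * M l,
    Finset.sum_nonneg fun l _ => mul_nonneg (abs_nonneg _) (hM0 l), fun h θ => ?_⟩
  have h1 : HasFDerivAt (fun y => pathField n κ e Y hY (q₀, y))
      (∑ l ∈ Finset.range n, κ l q₀ • (powC E (e l) ∘L
        fderiv ℝ (superpose _ (Y l) (hY l).contDiff.continuous) y₀)) y₀ := by
    refine HasFDerivAt.fun_sum fun l _ => ?_
    have h1 := (((hY l).superpose (K := Icc (0 : ℝ) 1)
      (hY l).contDiff.continuous).contDiff.differentiable (by simp) y₀).hasFDerivAt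
    exact ((powC E (e l)).hasFDerivAt.comp y₀ h1).fun_const_smul (κ l q₀)
  have h2 := (((contDiffAt_pathField (n := n) (e := e) (hY := hY) hκ y₀).differentiableAt
    (by simp)).hasFDerivAt).comp y₀ (hasFDerivAt_prodMk_right q₀ y₀)
  have h3 : fderiv ℝ (pathField n κ e Y hY) (q₀, y₀) (0, h)
      = ∑ l ∈ Finset.range n, κ l q₀ • powC E (e l)
        (fderiv ℝ (superpose _ (Y l) (hY l).contDiff.continuous) y₀ h) := by
    have h4 := DFunLike.congr_fun (h2.unique h1) h
    rw [_root_.sum_apply] at h4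
    exact h4
  rw [h3, ContinuousMap.sum_apply, Finset.sum_mul]
  refine (norm_sum_le _ _).trans (Finset.sum_le_sum fun l _ => ?_)
  rw [ContinuousMap.smul_apply, norm_smul, Real.norm_eq_abs, powC_apply, norm_smul, norm_pow,
    Real.norm_of_nonneg θ.2.1, mul_assoc, (hY l).fderiv_superpose]
  refine mul_le_mul_of_nonneg_left ?_ (abs_nonneg _)
  exact (mul_le_of_le_one_left (norm_nonneg _) (pow_le_one₀ θ.2.1 θ.2.2)).trans
    ((fderiv ℝ (Y l) (y₀ θ)).le_of_opNorm_le (hM l θ) (h θ))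

theorem exists_analytic_path [CompleteSpace Q] [CompleteSpace E] {q₀ : Q}
    (hκ : ∀ l, ContDiffAt ℝ ω (κ l) q₀) {c : Q → E}
    (hc : ContDiffAt ℝ ω c q₀) {y₀ : C(Icc (0 : ℝ) 1, E)}
    (h0 : y₀ = ContinuousMap.const _ (c q₀)
      + volterra zero_le_one (pathField n κ e Y hY (q₀, y₀))) :
    ∃ g : Q → C(Icc (0 : ℝ) 1, E), g q₀ = y₀ ∧ ContDiffAt ℝ ω g q₀ ∧
      (∀ᶠ q in 𝓝 q₀, g q = ContinuousMap.const _ (c q)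
        + volterra zero_le_one (pathField n κ e Y hY (q, g q))) ∧
      ∃ ρ > 0, ∀ q ∈ ball q₀ ρ, ∀ y ∈ ball y₀ ρ,
        y = ContinuousMap.const _ (c q) + volterra zero_le_one (pathField n κ e Y hY (q, y)) →
          y = g q := by
  obtain ⟨M, hM, hb⟩ := exists_norm_fderiv_pathField_le (n := n) (e := e) (hY := hY) hκ y₀
  exact exists_analytic_flow zero_le_one (contDiffAt_pathField hκ y₀) hc hM hb h0

end PathField

/-! ### Translates of an analytic family of solutions -/

section Transport
open Set Filter Topology Metric
variable {d : ℕ}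

/-- Superposition with a polynomial map, on curves. -/
def curveMap (X : Phase d → Phase d) (hX : IsPoly X) (y : HalfCurve d) : HalfCurve d :=
  superpose _ X hX.contDiff.continuous y

theorem isPoly_curveMap {X : Phase d → Phase d} (hX : IsPoly X) : IsPoly (curveMap X hX) :=
  hX.superpose (K := Icc (0 : ℝ) Real.pi) hX.contDiff.continuous

theorem hasDerivWithinAt_eval {α : ℝ → HalfCurve d} {α' : HalfCurve d} {s : Set ℝ} {θ : ℝ}
    (h : HasDerivWithinAt α α' s θ) (t : Icc 0 Real.pi) :
    HasDerivWithinAt (fun θ => α θ t) (α' t) s θ :=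
  (ContinuousMap.evalCLM ℝ t : HalfCurve d →L[ℝ] Phase d).hasFDerivAt.comp_hasDerivWithinAt θ h

variable {n : ℕ} {X : ℕ → Phase d → Phase d}

/-- A path of curves solves the superposed equation if it does so pointwise. -/
theorem path_of_pointwise {Q : Type} {κ : ℕ → Q → ℝ}
    {e : ℕ → ℕ} (hX : ∀ l, IsPoly (X l)) {q : Q} {c : HalfCurve d}
    {y : C(Icc (0 : ℝ) 1, HalfCurve d)} {η : Icc 0 Real.pi → ℝ → Phase d}
    (h0 : ∀ t, η t 0 = c t) (hy : ∀ θ t, y θ t = η t θ)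
    (hη : ∀ t, ∀ θ ∈ Icc (0 : ℝ) 1, HasDerivWithinAt (η t)
      (∑ l ∈ Finset.range n, κ l q • θ ^ e l • X l (η t θ)) (Icc 0 1) θ) :
    y = ContinuousMap.const _ c + volterra zero_le_one
      (pathField n κ e (fun l => curveMap (X l) (hX l)) (fun l => isPoly_curveMap (hX l)) (q, y)) := by
  set F := pathField n κ e (fun l => curveMap (X l) (hX l)) (fun l => isPoly_curveMap (hX l)) (q, y)
    with hF
  ext1 θ
  ext1 t
  set ev : HalfCurve d →L[ℝ] Phase d := ContinuousMap.evalCLM ℝ t with hev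
  set yt : C(Icc (0 : ℝ) 1, Phase d) := ⟨fun θ => ev (y θ), ev.continuous.comp y.continuous⟩ with hyt
  set Ft : C(Icc (0 : ℝ) 1, Phase d) := ⟨fun θ => ev (F θ), ev.continuous.comp F.continuous⟩ with hFt
  have h1 : yt = ContinuousMap.const _ (η t 0) + volterra zero_le_one Ft := by
    refine eq_const_add_volterra zero_le_one (fun θ => hy θ t) fun θ => ?_
    refine (hη t θ θ.2).congr_deriv ?_
    change _ = (F θ) t
    rw [hF, pathField_apply, ContinuousMap.sum_apply]
    refine Finset.sum_congr rfl fun l _ => ?_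
    rw [← hy]
    rfl
  have h2 : y θ t = c t + ∫ s in (0 : ℝ)..θ, ev (IccExtend zero_le_one F s) := by
    rw [← h0]
    exact DFunLike.congr_fun h1 θ
  rw [h2, ev.intervalIntegral_comp_comm ((continuous_IccExtend zero_le_one F).intervalIntegrable _ _)]
  rfl

theorem isPoly_hamField_hamG : IsPoly (hamField (hamG (d := d))) :=
  ((cls_hamG (d := d) zero_le_one).hamField one_pos).isPoly

/-- The translates of an analytic family of solutions depend analytically on the parameter and
the translation. -/
theorem exists_analytic_translates {p : ℕ} {ε₀ L : ℝ} {w : ℝ → ℝ} (hw : ContDiffAt ℝ ω w ε₀)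
    (hw0 : w ε₀ ≠ 0) {yc : ℝ → HalfCurve d} (hyc : ContDiffAt ℝ ω yc ε₀) {Z : ℝ → ℝ → Phase d}
    (hZ : ∀ᶠ ε in 𝓝 ε₀, (∀ t, yc ε t = Z ε t) ∧ ∀ t,
      HasDerivAt (Z ε) ((w ε)⁻¹ • hamField (hamH p ε) (Z ε t)) t ∧
      ‖(w ε)⁻¹ • hamField (hamH p ε) (Z ε t)‖ ≤ L) :
    ∃ c : ℝ × ℝ → HalfCurve d, ContDiffAt ℝ ω c (ε₀, 0) ∧ c (ε₀, 0) = yc ε₀ ∧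
      ∀ᶠ q in 𝓝 (ε₀, (0 : ℝ)), ∀ t, c q t = Z q.1 (t + q.2) := by
  set X : ℕ → Phase d → Phase d := fun l => hamField (if l = 0 then hamG else hamF p 1) with hXd
  have hX : ∀ l, IsPoly (X l) := by
    intro l
    rw [hXd]
    by_cases h : l = 0
    · simp only [h, if_true]; exact isPoly_hamField_hamG
    · simp only [if_neg h]; exact isPoly_hamField_hamF d p
  -- With q = (ε, τ), the path θ ↦ Z_ε(t + θ τ) from the curve to its translate solves an autonomous
  -- equation in θ with field τ w⁻¹ X_H. Its parts from G and F carry the powers l = 0, 1 of ε.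
  set κ : ℕ → ℝ × ℝ → ℝ := fun l q => q.2 * (w q.1)⁻¹ * q.1 ^ l with hκd
  have hw1 : ContDiffAt ℝ ω (fun q : ℝ × ℝ => (w q.1)⁻¹) (ε₀, 0) :=
    (hw.comp (f := Prod.fst) ((ε₀, 0) : ℝ × ℝ) contDiffAt_fst).inv hw0
  have hκ : ∀ l, ContDiffAt ℝ ω (κ l) (ε₀, 0) := fun l =>
    (contDiffAt_snd.mul hw1).mul (contDiffAt_fst.pow l)
  have hfield : ∀ (q : ℝ × ℝ) (θ : ℝ) (z : Phase d),
      ∑ l ∈ Finset.range 2, κ l q • θ ^ (0 : ℕ) • X l z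
        = q.2 • (w q.1)⁻¹ • hamField (hamH p q.1) z := by
    intro q θ z
    rw [Finset.sum_range_succ, Finset.sum_range_one, hamField_hamH, ← hamField_hamG]
    simp only [hκd, hXd, if_true, one_ne_zero, if_false, pow_zero, one_smul, pow_one, mul_one]
    module
  have hc : ContDiffAt ℝ ω (fun q : ℝ × ℝ => yc q.1) (ε₀, 0) :=
    hyc.comp (f := Prod.fst) ((ε₀, 0) : ℝ × ℝ) contDiffAt_fst
  -- For τ = 0 the field vanishes, so the base solution is a constant path.
  set y₀ : C(Icc (0 : ℝ) 1, HalfCurve d) := ContinuousMap.const _ (yc ε₀) with hy₀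
  obtain ⟨g, hg0, hgc, -, ρ, hρ, hg⟩ := exists_analytic_path (n := 2) (κ := κ) (e := fun _ => 0)
    (Y := fun l => curveMap (X l) (hX l)) (hY := fun l => isPoly_curveMap (hX l)) (q₀ := (ε₀, 0))
    hκ hc (y₀ := y₀) (path_of_pointwise hX (η := fun t _ => yc ε₀ t) (fun t => rfl)
      (fun θ t => rfl) fun t θ hθ => by
        rw [hfield, zero_smul ℝ]
        exact hasDerivWithinAt_const _ _ _)
  refine ⟨fun q => g q ⟨1, by simp⟩, ContDiffAt.path_eval_one hgc,
    DFunLike.congr_fun hg0 _, ?_⟩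
  -- The velocities are bounded by L for all nearby couplings, so the actual path of translates is
  -- close to the constant one, and local uniqueness identifies it with the analytic branch.
  have h1 : ∀ᶠ q : ℝ × ℝ in 𝓝 (ε₀, 0), L * |q.2| + ‖yc q.1 - yc ε₀‖ < ρ := by
    have hf : ContinuousAt (fun q : ℝ × ℝ => L * |q.2| + ‖yc q.1 - yc ε₀‖) (ε₀, 0) :=
      (continuousAt_const.mul continuousAt_snd.abs).add
        ((hc.continuousAt.sub continuousAt_const).norm)
    refine hf.eventually (gt_mem_nhds ?_)
    simpa using hρ
  have h2 : ∀ᶠ q : ℝ × ℝ in 𝓝 (ε₀, 0), (∀ t, yc q.1 t = Z q.1 t) ∧ ∀ t,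
      HasDerivAt (Z q.1) ((w q.1)⁻¹ • hamField (hamH p q.1) (Z q.1 t)) t ∧
      ‖(w q.1)⁻¹ • hamField (hamH p q.1) (Z q.1 t)‖ ≤ L :=
    (continuousAt_fst (p := ((ε₀, 0) : ℝ × ℝ))).eventually hZ
  filter_upwards [h1, h2, ball_mem_nhds _ hρ] with q hq1 hq2 hq3 t
  have hZc : Continuous (Z q.1) :=
    continuous_iff_continuousAt.2 fun t => (hq2.2 t).1.continuousAt
  set y : C(Icc (0 : ℝ) 1, HalfCurve d) := ContinuousMap.curry
    ⟨fun v : Icc (0 : ℝ) 1 × Icc 0 Real.pi => Z q.1 (v.2 + v.1 * q.2), by fun_prop⟩ with hy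
  have hya : ∀ θ t, y θ t = Z q.1 (t + θ * q.2) := fun _ _ => rfl
  have hL : 0 ≤ L := (norm_nonneg _).trans (hq2.2 0).2
  have hlip : ∀ a b, ‖Z q.1 a - Z q.1 b‖ ≤ L * ‖a - b‖ := fun a b =>
    convex_univ.norm_image_sub_le_of_norm_hasDerivWithin_le
      (fun t _ => (hq2.2 t).1.hasDerivWithinAt) (fun t _ => (hq2.2 t).2) (mem_univ b) (mem_univ a)
  have hmem : y ∈ ball y₀ ρ := by
    refine path_mem_ball hq1 fun θ => ?_
    refine (ContinuousMap.norm_le _ (by positivity)).2 fun t => ?_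
    rw [ContinuousMap.sub_apply, hya]
    have e : Z q.1 (t + θ * q.2) - y₀ θ t
        = (Z q.1 (t + θ * q.2) - Z q.1 t) + (yc q.1 - yc ε₀) t := by
      rw [ContinuousMap.sub_apply, hq2.1, hy₀]; simp
    rw [e]
    refine (norm_add_le _ _).trans (add_le_add ((hlip _ _).trans ?_)
      (ContinuousMap.norm_coe_le_norm _ t))
    rw [add_sub_cancel_left, norm_mul, Real.norm_of_nonneg θ.2.1, Real.norm_eq_abs]
    exact mul_le_mul_of_nonneg_left (mul_le_of_le_one_left (abs_nonneg _) θ.2.2) hL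
  have hyg := hg q hq3 y hmem (path_of_pointwise hX (η := fun t θ => Z q.1 (t + θ * q.2))
    (fun t => by rw [zero_mul, add_zero, hq2.1]) hya fun t θ hθ => by
      rw [hfield]
      have h3 : HasDerivAt (fun θ : ℝ => (t : ℝ) + θ * q.2) q.2 θ := by
        simpa using ((hasDerivAt_id θ).mul_const q.2).const_add (t : ℝ)
      exact ((hq2.2 _).1.scomp θ h3).hasDerivWithinAt)
  change g q ⟨1, _⟩ t = _
  rw [← hyg, hya, one_mul]

end Transport

/-! ### Analyticity of the inverse change of coordinates on curves -/

section Pullback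
open Set Filter Topology Metric
open Size
variable {d p : ℕ} {x f₀ : ℝ} {r : ℕ}

theorem isPoly_hamField_chiS (d p l : ℕ) : IsPoly (hamField (chiS (d := d) p 1 (l + 1))) := by
  obtain ⟨f₀, S⟩ := exists_size d p (x := 5) (by norm_num)
  exact ((normalForm_size (ε := 1) (n := l + 1) (x := 5) (by norm_num) S.pos one_pos S.cls l
    le_rfl).2.2.hamField (by norm_num)).isPoly

theorem neg_drift_genSeq (p : ℕ) (ε θ : ℝ) (r : ℕ) (z : Phase d) :
    -drift (genSeq p ε r) r θ z = ∑ l ∈ Finset.range r,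
      (-(((l : ℝ) + 1) * ε ^ (l + 1))) • θ ^ l • hamField (chiS p 1 (l + 1)) z := by
  rw [drift, ← Finset.sum_neg_distrib]
  refine Finset.sum_congr rfl fun l hl => ?_
  have h1 : (chiS (d := d) p ε (l + 1)) = fun z => ε ^ (l + 1) * chiS p 1 (l + 1) z :=
    funext (normalForm_scaling l).2
  rw [genSeq_apply, if_pos (Nat.succ_le_of_lt (Finset.mem_range.1 hl)), h1,
    hamField_smul (chiS_differentiable one_pos (by omega))]
  module

/-- The inverse of the change of coordinates is analytic on curves, jointly with parameters. -/
theorem exists_analytic_pullback (S : Size d p x f₀) {ε₀ : ℝ} {c : ℝ × ℝ → HalfCurve d}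
    (hS : ∀ᶠ ε in 𝓝 ε₀, Small p x f₀ r ε) (hc : ContDiffAt ℝ ω c (ε₀, 0))
    (hcx : ‖c (ε₀, 0)‖ ≤ x - 3) :
    ∃ G : ℝ × ℝ → HalfCurve d, ContDiffAt ℝ ω G (ε₀, 0) ∧
      ∀ᶠ q in 𝓝 (ε₀, (0 : ℝ)), ∀ t, coordMap p q.1 r (G q t) = c q t ∧ ‖G q t‖ ≤ x - 2 := by
  set X : ℕ → Phase d → Phase d := fun l => hamField (chiS p 1 (l + 1)) with hXd
  have hX : ∀ l, IsPoly (X l) := fun l => isPoly_hamField_chiS d p l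
  set κ : ℕ → ℝ × ℝ → ℝ := fun l q => -(((l : ℝ) + 1) * q.1 ^ (l + 1)) with hκd
  have hκ : ∀ l, ContDiffAt ℝ ω (κ l) (ε₀, 0) := fun l =>
    (contDiffAt_const.mul (contDiffAt_fst.pow _)).neg
  set Y : ℕ → HalfCurve d → HalfCurve d := fun l => curveMap (X l) (hX l) with hYd
  have hY : ∀ l, IsPoly (Y l) := fun l => isPoly_curveMap (hX l)
  set V : ℝ → HalfCurve d → HalfCurve d := fun θ y =>
    ∑ l ∈ Finset.range r, κ l (ε₀, 0) • θ ^ l • Y l y with hV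
  have hVa : ∀ θ y t, V θ y t = -drift (genSeq p ε₀ r) r θ (y t) := by
    intro θ y t
    rw [neg_drift_genSeq, hV, ContinuousMap.sum_apply]
    rfl
  have hG := S.smallGen hS.self_of_nhds
  have hball : ∀ y ∈ closedBall (c (ε₀, 0)) (1 / 4), ∀ t, ‖y t‖ ≤ x - 2 - 3 / 4 := by
    intro y hy t
    rw [mem_closedBall, dist_eq_norm] at hy
    have h1 := norm_le_norm_add_norm_sub' y (c (ε₀, 0))
    have h2 := y.norm_coe_le_norm t
    linarith
  -- The base solution is found directly in the space of curves, which makes it a continuous path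
  -- there; a solution for each time t separately would not give this.
  obtain ⟨α, hα0, hα⟩ := exists_curve (f := V) (x₀ := c (ε₀, 0)) (t₀ := 0) (by simp) (m := 1 / 4)
    (L := 1 / 4) (by norm_num) (by norm_num)
    (fun θ hθ y hy z hz => by
      refine (ContinuousMap.norm_le _ (by positivity)).2 fun t => ?_
      rw [ContinuousMap.sub_apply, hVa, hVa, ← neg_sub', norm_neg]
      refine (hG.drift_lip hθ ((hball y hy t).trans (by linarith))
        ((hball z hz t).trans (by linarith))).trans ?_
      gcongr
      exact (y - z).norm_coe_le_norm t)
    (fun y _ => by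
      refine Continuous.continuousOn ?_
      simp only [hV]
      exact continuous_finsetSum _ fun l _ => (by fun_prop))
    (fun θ hθ y hy => by
      refine (ContinuousMap.norm_le _ (by positivity)).2 fun t => ?_
      rw [hVa, norm_neg]
      exact hG.drift_le hθ ((hball y hy t).trans (by linarith)))
  have hαc : ContinuousOn α (Icc 0 1) := fun θ hθ => (hα θ hθ).2.continuousWithinAt
  set y₀ : C(Icc (0 : ℝ) 1, HalfCurve d) := ⟨fun θ => α θ, hαc.domRestrict⟩ with hy₀
  have h0 := path_of_hasDerivWithinAt (n := r) (κ := κ) (e := fun l => l) (Y := Y) (hY := hY)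
    (q := (ε₀, 0)) (α := α) (y := y₀) (fun _ => rfl) fun θ hθ => (hα θ hθ).2
  rw [hα0] at h0
  obtain ⟨g, hg0, hgc, hg, -⟩ := exists_analytic_path hκ hc h0
  refine ⟨fun q => g q ⟨1, by simp⟩, ContDiffAt.path_eval_one hgc, ?_⟩
  -- The base path moves by at most 1/4 and its perturbation by at most 3/4, one unit of radius in
  -- all.
  have h1 : ∀ᶠ q : ℝ × ℝ in 𝓝 (ε₀, 0), ‖g q - y₀‖ < 3 / 4 := by
    have hf : ContinuousAt (fun q => ‖g q - y₀‖) (ε₀, 0) :=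
      (hgc.continuousAt.sub continuousAt_const).norm
    refine hf.eventually (gt_mem_nhds ?_)
    change ‖g (ε₀, 0) - y₀‖ < 3 / 4
    rw [hg0, sub_self, norm_zero]
    norm_num
  have h2 : ∀ᶠ q : ℝ × ℝ in 𝓝 (ε₀, 0), Small p x f₀ r q.1 :=
    (continuousAt_fst (p := ((ε₀, 0) : ℝ × ℝ))).eventually hS
  filter_upwards [h1, h2, hg] with q hq1 hq2 hq3 t
  obtain ⟨h3, h4⟩ := hasDerivWithinAt_of_path hq3
  set η : ℝ → Phase d := fun θ => IccExtend zero_le_one (g q) θ t with hη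
  have h5 : ∀ θ ∈ Icc (0 : ℝ) 1, ‖η θ‖ ≤ x - 2 ∧
      HasDerivWithinAt η (-drift (genSeq p q.1 r) r θ (η θ)) (Icc 0 1) θ := by
    intro θ hθ
    constructor
    · rw [hη]
      simp only []
      rw [IccExtend_of_mem _ _ hθ]
      have h6 : ‖g q ⟨θ, hθ⟩ - y₀ ⟨θ, hθ⟩‖ ≤ 3 / 4 :=
        ((g q - y₀).norm_coe_le_norm ⟨θ, hθ⟩).trans hq1.le
      have h7 := hball (α θ) (by rw [mem_closedBall, dist_eq_norm]; exact (hα θ hθ).1) t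
      have h8 : ‖g q ⟨θ, hθ⟩ t - α θ t‖ ≤ 3 / 4 :=
        ((g q ⟨θ, hθ⟩ - y₀ ⟨θ, hθ⟩).norm_coe_le_norm t).trans h6
      have h9 := norm_le_norm_add_norm_sub' (g q ⟨θ, hθ⟩ t) (α θ t)
      linarith
    · refine (hasDerivWithinAt_eval (h4 θ hθ) t).congr_deriv ?_
      rw [neg_drift_genSeq, ContinuousMap.sum_apply]
      rfl
  have h6 := (S.smallGen hq2).lieMap_curve h5
  have e1 : η 1 = g q ⟨1, by simp⟩ t := by
    rw [hη]; simp only []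
    rw [IccExtend_of_mem zero_le_one (g q) (show (1 : ℝ) ∈ Icc (0 : ℝ) 1 by simp)]
  have e0 : η 0 = c q t := by
    rw [hη]; simp only []
    rw [h3]
  rw [← e1, coordMap_eq, h6, e0]
  exact ⟨rfl, (h5 1 (by simp)).1⟩

end Pullback

/-! ### Time derivatives and coefficients depending analytically on the coupling -/

section Regularity
open Set Filter Topology Metric
open Size
variable {d p : ℕ} {x f₀ : ℝ} {r : ℕ}

/-- For a jointly analytic family of translates the derivative in the translation is the time
derivative. Thus time derivatives are analytic in the coupling as continuous curves, and the
statement can be iterated. -/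
theorem exists_deriv_translates {G : ℝ × ℝ → HalfCurve d} {ε₀ : ℝ}
    (hG : ContDiffAt ℝ ω G (ε₀, 0)) {φ : ℝ → ℝ → Phase d}
    (h : ∀ᶠ q in 𝓝 (ε₀, (0 : ℝ)), ∀ t, G q t = φ q.1 (t + q.2)) :
    ∃ G' : ℝ × ℝ → HalfCurve d, ContDiffAt ℝ ω G' (ε₀, 0) ∧
      ∀ᶠ q in 𝓝 (ε₀, (0 : ℝ)), ∀ t, G' q t = deriv (φ q.1) (t + q.2) ∧
        DifferentiableAt ℝ (φ q.1) (t + q.2) := by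
  have h1 : ContDiffAt ℝ ω (fun q => fderiv ℝ G q) (ε₀, 0) := hG.fderiv_right (by simp)
  refine ⟨fun q => fderiv ℝ G q (0, 1), h1.clm_apply contDiffAt_const, ?_⟩
  have h2 : ∀ᶠ q in 𝓝 (ε₀, (0 : ℝ)), DifferentiableAt ℝ G q :=
    (hG.eventually (by simp)).mono fun q hq => hq.differentiableAt (by simp)
  filter_upwards [h2, h.eventually_nhds] with q hq1 hq2 t
  have h3 : HasDerivAt (fun s => G (q.1, s) t) (fderiv ℝ G q (0, 1) t) q.2 := by
    have h4 : HasDerivAt (fun s : ℝ => (q.1, s)) ((0 : ℝ), (1 : ℝ)) q.2 :=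
      (hasDerivAt_const q.2 q.1).prodMk (hasDerivAt_id q.2)
    have h5 : HasDerivAt (fun s => G (q.1, s)) (fderiv ℝ G q (0, 1)) q.2 :=
      HasFDerivAt.comp_hasDerivAt (f := fun s : ℝ => (q.1, s)) q.2 hq1.hasFDerivAt h4
    exact hasDerivWithinAt_univ.1 (hasDerivWithinAt_eval h5.hasDerivWithinAt t)
  have h6 : ∀ᶠ s in 𝓝 q.2, G (q.1, s) t = φ q.1 (t + s) := by
    have hc : ContinuousAt (fun s : ℝ => (q.1, s)) q.2 := by fun_prop
    exact (hc.eventually (p := fun q : ℝ × ℝ => ∀ t, G q t = φ q.1 (t + q.2)) hq2).mono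
      fun s hs => hs t
  have h7 : HasDerivAt (fun s => φ q.1 (t + s)) (fderiv ℝ G q (0, 1) t) q.2 :=
    h3.congr_of_eventuallyEq (h6.mono fun s hs => hs.symm)
  have h8 : HasDerivAt (φ q.1) (fderiv ℝ G q (0, 1) t) (t + q.2) := by
    rw [← add_sub_cancel_left (t : ℝ) q.2] at h7
    have h9 := h7.comp_sub_const (t + q.2) (t : ℝ)
    simpa only [add_sub_cancel] using h9
  exact ⟨h8.deriv.symm, h8.differentiableAt⟩

theorem Reversible.differentiable {w : ℝ → Phase d} (h : Reversible w)
    (hw : ∀ t ∈ Icc 0 Real.pi, DifferentiableAt ℝ w t) : Differentiable ℝ w := by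
  have h1 : ∀ t ∈ Icc (-Real.pi) Real.pi, DifferentiableAt ℝ w t := by
    intro t ht
    rcases le_total 0 t with h0 | h0
    · exact hw t ⟨h0, ht.2⟩
    · have h2 := hw (-t) ⟨by linarith, by linarith [ht.1]⟩
      have h3 : DifferentiableAt ℝ (fun t => reversal d (w (-t))) t :=
        (reversal d).toContinuousLinearEquiv.differentiableAt.comp t
          (h2.comp t differentiableAt_id.neg)
      simpa only [h.neg, reversal_reversal] using h3
  intro t
  obtain ⟨n, hn, -⟩ := existsUnique_add_zsmul_mem_Ioc (a := 2 * Real.pi) (by positivity) t (-Real.pi)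
  have h3 := h1 (t + n • (2 * Real.pi)) ⟨hn.1.le, by linarith [hn.2]⟩
  have h4 := h3.hasDerivAt.comp_add_const t (n • (2 * Real.pi))
  have hp : Function.Periodic w (2 * Real.pi) := h.periodic
  simp only [hp.zsmul n _] at h4
  exact h4.differentiableAt

theorem Reversible.deriv_differentiable {w : ℝ → Phase d} (h : Reversible w)
    (hd : Differentiable ℝ w) (hw : ∀ t ∈ Icc 0 Real.pi, DifferentiableAt ℝ (_root_.deriv w) t) :
    Differentiable ℝ (_root_.deriv w) := by
  have h1 := h.deriv fun t => (hd t).hasDerivAt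
  have h2 := h1.differentiable fun t ht =>
    (symp d).toContinuousLinearEquiv.differentiableAt.comp t (hw t ht)
  intro t
  have h3 : DifferentiableAt ℝ (fun t => -symp d (symp d (_root_.deriv w t))) t :=
    ((symp d).toContinuousLinearEquiv.differentiableAt.comp t (h2 t)).neg
  simpa only [symp_symp, neg_neg] using h3

theorem coordMap_reversal {ε : ℝ} (hε : 0 < ε) (r : ℕ) (z : Phase d) :
    coordMap p ε r (reversal d z) = reversal d (coordMap p ε r z) := by
  have h1 : ∀ l, 1 ≤ l → ∀ z : Phase d, genSeq p ε r l (reversal d z) = -genSeq p ε r l z := by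
    intro l hl z
    obtain ⟨j, rfl⟩ : ∃ j, l = j + 1 := ⟨l - 1, by omega⟩
    rw [genSeq_apply]
    split_ifs
    · exact (normalForm_reversal hε j).2.2 z
    · simp
  rw [coordMap, coordMap]
  refine Eq.trans ?_ ((reversal d).toContinuousLinearEquiv.map_tsum).symm
  congr 1
  funext k
  exact lieSeq_reversal (f := fun z => z) h1 (reversal d).toContinuousLinearEquiv (fun _ => rfl) k z

/-- The inverse of the change of coordinates. -/
def invMap (p : ℕ) (ε : ℝ) (r : ℕ) (x : ℝ) (z : Phase d) : Phase d :=
  Function.invFunOn (coordMap p ε r) (closedBall 0 (x - 2)) z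

theorem coordMap_invMap (S : Size d p x f₀) {ε : ℝ} (h : Small p x f₀ r ε) {z : Phase d}
    (hz : ‖z‖ ≤ x - 3) : coordMap p ε r (invMap p ε r x z) = z ∧ ‖invMap p ε r x z‖ ≤ x - 2 := by
  obtain ⟨y, hy, hyz⟩ := (S.smallGen h).exists_lieMap_eq hz
  have h1 : ∃ a ∈ closedBall (0 : Phase d) (x - 2), coordMap p ε r a = z :=
    ⟨y, by simpa using hy, by rw [coordMap_eq]; exact hyz⟩
  exact ⟨Function.invFunOn_eq h1, by simpa using! Function.invFunOn_mem h1⟩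

theorem coordMap_injOn (S : Size d p x f₀) {ε : ℝ} (h : Small p x f₀ r ε) :
    InjOn (coordMap (d := d) p ε r) (ball 0 (x - 1)) := by
  rw [coordMap_eq]; exact (S.smallGen h).injOn

theorem eq_invMap (S : Size d p x f₀) {ε : ℝ} (h : Small p x f₀ r ε) {y z : Phase d}
    (hy : ‖y‖ < x - 1) (hz : ‖z‖ ≤ x - 3) (hyz : coordMap p ε r y = z) :
    y = invMap p ε r x z := by
  obtain ⟨h1, h2⟩ := coordMap_invMap S h hz
  exact coordMap_injOn S h (by simpa using hy) (by simp; linarith) (hyz.trans h1.symm)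

theorem invMap_reversal (S : Size d p x f₀) {ε : ℝ} (h : Small p x f₀ r ε) {z : Phase d}
    (hz : ‖z‖ ≤ x - 3) : invMap p ε r x (reversal d z) = reversal d (invMap p ε r x z) := by
  obtain ⟨h1, h2⟩ := coordMap_invMap S h hz
  refine (eq_invMap S h ?_ ?_ ?_).symm
  · rw [(reversal d).norm_map]; linarith
  · rwa [(reversal d).norm_map]
  · rw [coordMap_reversal h.2.1, h1]

/-- The Fourier coefficients, in the normal form coordinates, of an analytic family of reversible
periodic solutions. -/
theorem exists_analytic_coefficients (S : Size d p x f₀) {ε₀ L : ℝ} {w : ℝ → ℝ}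
    (hw : ContDiffAt ℝ ω w ε₀) (hw0 : w ε₀ ≠ 0) {yc : ℝ → HalfCurve d}
    (hyc : ContDiffAt ℝ ω yc ε₀) {Z : ℝ → ℝ → Phase d}
    (hZ : ∀ᶠ ε in 𝓝 ε₀, (∀ t, yc ε t = Z ε t) ∧ ∀ t,
      HasDerivAt (Z ε) ((w ε)⁻¹ • hamField (hamH p ε) (Z ε t)) t ∧
      ‖(w ε)⁻¹ • hamField (hamH p ε) (Z ε t)‖ ≤ L)
    (hS : ∀ᶠ ε in 𝓝 ε₀, Small p x f₀ r ε)
    (hr : ∀ᶠ ε in 𝓝 ε₀, Reversible (Z ε) ∧ ∀ t, ‖Z ε t‖ ≤ x - 3) :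
    ∃ β : ℝ → L22 d, AnalyticAt ℝ β ε₀ ∧ ∀ᶠ ε in 𝓝 ε₀,
      Differentiable ℝ (ofFourier (β ε)) ∧ Differentiable ℝ (deriv (ofFourier (β ε))) ∧
      ∀ τ, ofFourier (β ε) τ = invMap p ε r x (Z ε τ) := by
  obtain ⟨c, hc, hc0, hcZ⟩ := exists_analytic_translates hw hw0 hyc hZ
  have hx4 := S.four_lt
  have hcx : ‖c (ε₀, 0)‖ ≤ x - 3 := by
    rw [hc0]
    refine (ContinuousMap.norm_le _ (by linarith)).2 fun t => ?_
    rw [hZ.self_of_nhds.1]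
    exact hr.self_of_nhds.2 t
  obtain ⟨G, hG, hGc⟩ := exists_analytic_pullback S hS hc hcx
  set φ : ℝ → ℝ → Phase d := fun ε τ => invMap p ε r x (Z ε τ) with hφ
  have hfst : ∀ {P : ℝ → Prop}, (∀ᶠ ε in 𝓝 ε₀, P ε) → ∀ᶠ q in 𝓝 (ε₀, (0 : ℝ)), P q.1 :=
    fun h => (continuousAt_fst (p := ((ε₀, 0) : ℝ × ℝ))).eventually h
  have h0 : ∀ᶠ q in 𝓝 (ε₀, (0 : ℝ)), ∀ t, G q t = φ q.1 (t + q.2) := by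
    filter_upwards [hGc, hcZ, hfst hS, hfst hr] with q h1 h2 h3 h4 t
    exact eq_invMap S h3 (by linarith [(h1 t).2]) (h4.2 _) ((h1 t).1.trans (h2 t))
  obtain ⟨G₁, hG₁, h1⟩ := exists_deriv_translates hG h0
  obtain ⟨G₂, hG₂, h2⟩ := exists_deriv_translates (φ := fun ε => deriv (φ ε)) hG₁ (h1.mono fun q h t => (h t).1)
  -- The coefficients use two time derivatives; the third one only serves to make the second
  -- continuous.
  obtain ⟨G₃, hG₃, h3⟩ := exists_deriv_translates (φ := fun ε => deriv (deriv (φ ε))) hG₂ (h2.mono fun q h t => (h t).1)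
  have hsl : ContDiffAt ℝ ω (fun ε : ℝ => (ε, (0 : ℝ))) ε₀ := contDiffAt_id.prodMk contDiffAt_const
  have hslc : ∀ {P : ℝ × ℝ → Prop}, (∀ᶠ q in 𝓝 (ε₀, (0 : ℝ)), P q) → ∀ᶠ ε in 𝓝 ε₀, P (ε, 0) :=
    fun h => (hsl.continuousAt).eventually h
  have hβ : ContDiffAt ℝ ω (fun ε : ℝ => G (ε, 0) - G₂ (ε, 0)) ε₀ :=
    (ContDiffAt.comp (g := G) ε₀ hG hsl).sub (ContDiffAt.comp (g := G₂) ε₀ hG₂ hsl)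
  refine ⟨fun ε => fourierL d (G (ε, 0) - G₂ (ε, 0)),
    ((fourierL d).contDiff.contDiffAt.comp ε₀ hβ).analyticAt, ?_⟩
  filter_upwards [hslc h0, hslc h1, hslc h2, hslc h3, hS, hr] with ε h0 h1 h2 h3 hS hr
  simp only [add_zero] at h0 h1 h2 h3
  have hrev : Reversible (φ ε) := by
    refine ⟨fun t => ?_, fun t => ?_⟩
    · rw [hφ]; simp only [hr.1.periodic]
    · rw [hφ]; simp only [hr.1.neg]; exact invMap_reversal S hS (hr.2 t)
  have d1 : Differentiable ℝ (φ ε) := hrev.differentiable fun t ht => (h1 ⟨t, ht⟩).2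
  have d2 : Differentiable ℝ (deriv (φ ε)) :=
    hrev.deriv_differentiable d1 fun t ht => (h2 ⟨t, ht⟩).2
  have hrev2 : Reversible (deriv (deriv (φ ε))) := by
    have := ((hrev.deriv fun t => (d1 t).hasDerivAt).deriv (w' := fun t => symp d (deriv (deriv (φ ε)) t))
      fun t => (symp d).toContinuousLinearEquiv.hasFDerivAt.comp_hasDerivAt t (d2 t).hasDerivAt)
    refine ⟨fun t => ?_, fun t => ?_⟩
    · have h := this.periodic t
      simpa only [symp_symp, neg_inj] using h
    · have h := this.neg t
      simpa only [symp_symp, neg_inj, map_neg] using h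
  have d3 : Differentiable ℝ (deriv (deriv (φ ε))) :=
    hrev2.differentiable fun t ht => (h3 ⟨t, ht⟩).2
  have key : ∀ τ, ofFourier (fourierL d (G (ε, 0) - G₂ (ε, 0))) τ = φ ε τ :=
    ofFourier_fourierL hrev (fun t => (d1 t).hasDerivAt) (fun t => (d2 t).hasDerivAt) d3.continuous
      h0 fun t => (h2 t).1
  rw [funext key]
  exact ⟨d1, d2, fun τ => rfl⟩

end Regularity

/-! ### Solutions in the two coordinate systems -/

section Conjugation
open Set Filter Topology Metric
open Size
variable {d p : ℕ} {x f₀ ε : ℝ} {r : ℕ}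

theorem differentiable_hamH (p : ℕ) (ε : ℝ) : Differentiable ℝ (hamH (d := d) p ε) := fun z =>
  (hasFDerivAt_hamG z).differentiableAt.add (hasFDerivAt_hamF p ε z).differentiableAt

theorem differentiableAt_coordMap (S : Size d p x f₀) (h : Small p x f₀ r ε) {y : Phase d}
    (hy : ‖y‖ < x - 1) : DifferentiableAt ℝ (coordMap p ε r) y := by
  rw [coordMap_eq]; exact ((S.smallGen h).hasFDerivAt_lieMap hy).differentiableAt

theorem differentiableAt_hamNF (S : Size d p x f₀) (h : Small p x f₀ r ε) {y : Phase d}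
    (hy : ‖y‖ < x - 1) : DifferentiableAt ℝ (hamNF p ε r) y :=
  (differentiable_hamH p ε _).comp y (differentiableAt_coordMap S h hy)

theorem fderiv_coordMap_hamField (S : Size d p x f₀) (h : Small p x f₀ r ε) {y : Phase d}
    (hy : ‖y‖ ≤ x - 3) : fderiv ℝ (coordMap p ε r) y (hamField (hamNF p ε r) y)
      = hamField (hamH p ε) (coordMap p ε r y) := by
  have h1 := (S.smallGen h).fderiv_lieMap_hamField hy (differentiable_hamH p ε _)
  rwa [← coordMap_eq] at h1

/-- The change of coordinates maps solutions to solutions. -/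
theorem hasDerivAt_coordMap (S : Size d p x f₀) (h : Small p x f₀ r ε) {ζ : ℝ → Phase d} {t c : ℝ}
    (hζ : HasDerivAt ζ (c • hamField (hamNF p ε r) (ζ t)) t) (hx : ‖ζ t‖ ≤ x - 3) :
    HasDerivAt (fun t => coordMap p ε r (ζ t)) (c • hamField (hamH p ε) (coordMap p ε r (ζ t))) t := by
  have h1 := (differentiableAt_coordMap S h (y := ζ t) (by linarith)).hasFDerivAt.comp_hasDerivAt t hζ
  rwa [map_smul, fderiv_coordMap_hamField S h hx] at h1

/-- The velocity and the wanted field have the same image under the derivative of the change of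
coordinates, which is injective. -/
theorem hasDerivAt_of_coordMap (S : Size d p x f₀) (h : Small p x f₀ r ε) {ζ : ℝ → Phase d}
    {t c : ℝ} (hd : DifferentiableAt ℝ ζ t) (hx : ‖ζ t‖ ≤ x - 3)
    (hζ : HasDerivAt (fun t => coordMap p ε r (ζ t))
      (c • hamField (hamH p ε) (coordMap p ε r (ζ t))) t) :
    HasDerivAt ζ (c • hamField (hamNF p ε r) (ζ t)) t := by
  have h1 := (differentiableAt_coordMap S h (y := ζ t)
    (by linarith)).hasFDerivAt.comp_hasDerivAt t hd.hasDerivAt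
  have h2 := h1.unique hζ
  rw [← fderiv_coordMap_hamField S h hx, ← map_smul] at h2
  have h3 : Function.Injective (fderiv ℝ (coordMap (d := d) p ε r) (ζ t)) := by
    rw [coordMap_eq]
    exact (S.smallGen h).fderiv_lieMap_injective (by linarith)
  exact h3 h2 ▸ hd.hasDerivAt

theorem cls_hamK (S : Size d p x f₀) (h : Small p x f₀ r ε) (hε : ε ≤ 1) :
    Cls x (2 + (2 * p + 2) * r) (x ^ 2 + 2 * f₀ + 4 * f₀ * nfC p x f₀) (hamK (d := d) p ε r) := by
  have hf := S.pos
  have hC := S.nfC_pos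
  have hε0 := h.2.1
  have hx := S.x_pos
  have hK : hamK (d := d) p ε r
      = fun z => hamG z + (nfTerm p ε r 1 z + ∑ s ∈ Finset.Icc 2 r, nfTerm p ε r s z) := by
    ext z
    rw [hamK, ← Finset.add_sum_Ioc_eq_sum_Icc h.1]
    rfl
  have h1 : Cls x (2 * p + 2) (2 * f₀ * ε) (nfTerm (d := d) p ε r 1) := by
    have h2 := (normalForm_size hx hf hε0 S.cls (n := 1) 0 le_rfl).2.1
    rw [nfTerm_apply, if_pos h.1]
    simpa using h2
  have hN : (2 * p + 2) * 1 ≤ (2 * p + 2) * r := Nat.mul_le_mul_left _ h.1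
  have hC' : 0 < f₀ * nfC p x f₀ := by positivity
  rw [hK]
  refine Cls.mono ?_ le_rfl (a := x ^ 2 + (2 * f₀ * ε + 4 * f₀ * nfC p x f₀ * ε ^ 2)) ?_
  · refine ((cls_hamG hx.le).mono (by omega) le_rfl).add
      ((h1.mono (by omega) le_rfl).add ((S.cls_sum_nfTerm h).mono (by omega) le_rfl))
  · nlinarith [mul_le_of_le_one_right hf.le hε, pow_le_one₀ hε0.le hε (n := 2),
      mul_le_of_le_one_right hC'.le (pow_le_one₀ hε0.le hε (n := 2))]

theorem differentiable_hamK (S : Size d p x f₀) (h : Small p x f₀ r ε) (hε : ε ≤ 1) :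
    Differentiable ℝ (hamK (d := d) p ε r) := (cls_hamK S h hε).differentiable

theorem norm_hamField_hamK_sub_le (S : Size d p x f₀) (h : Small p x f₀ r ε) (hε : ε ≤ 1)
    {y z : Phase d} (hy : ‖y‖ ≤ x - 2) (hz : ‖z‖ ≤ x - 2) :
    ‖hamField (hamK p ε r) y - hamField (hamK p ε r) z‖
      ≤ (x ^ 2 + 2 * f₀ + 4 * f₀ * nfC p x f₀) * ‖y - z‖ := by
  have hx4 := S.four_lt
  set a := x ^ 2 + 2 * f₀ + 4 * f₀ * nfC p x f₀ with ha
  have h1 : Cls (x - 1) (2 + (2 * p + 2) * r) (a / (x - (x - 1))) (hamField (hamK (d := d) p ε r)) :=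
    ((cls_hamK S h hε).fderiv (by linarith) (by linarith)).clm_comp (hamC d) norm_hamC_le
  rw [sub_sub_cancel, div_one] at h1
  have h2 := h1.fderiv (y := x - 2) (by linarith) (by linarith)
  rw [show x - 1 - (x - 2) = 1 by ring, div_one] at h2
  exact (convex_closedBall (0 : Phase d) (x - 2)).norm_image_sub_le_of_norm_fderiv_le
    (fun y _ => h1.differentiable y) (fun y hy => h2.norm_le (by simpa using hy))
    (by simpa using hz) (by simpa using hy)

theorem norm_hamField_hamNF_sub_le (S : Size d p x f₀) (h : Small p x f₀ r ε) (hε : ε ≤ 1)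
    {y : Phase d} (hy : ‖y‖ < x - 3) :
    ‖hamField (hamNF p ε r) y - hamField (hamK p ε r) y‖
      ≤ 2 * (x ^ 2 + f₀) * (nfC p x f₀ * r * ε) ^ r := by
  obtain ⟨R', hR, hd⟩ := S.exists_remainder h hε hy
  have h1 := (differentiableAt_hamNF S h (y := y) (by linarith)).hasFDerivAt.sub
    (differentiable_hamK S h hε y).hasFDerivAt
  have h2 : fderiv ℝ (hamNF p ε r) y - fderiv ℝ (hamK p ε r) y = R' := h1.unique hd
  rw [hamField_eq, hamField_eq, ← map_sub, h2]
  exact ((hamC d).le_of_opNorm_le norm_hamC_le R').trans (by rwa [one_mul])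

/-- A solution of the truncated normal form is, in the original coordinates, an approximate
solution. -/
theorem exists_residual (S : Size d p x f₀) (h : Small p x f₀ r ε) (hε : ε ≤ 1) {ζ : ℝ → Phase d}
    {t c : ℝ} (hc : 0 ≤ c) (hζ : HasDerivAt ζ (c • hamField (hamK p ε r) (ζ t)) t)
    (hx : ‖ζ t‖ < x - 3) : ∃ res, ‖res‖ ≤ c * (4 * (x ^ 2 + f₀) * (nfC p x f₀ * r * ε) ^ r) ∧
      HasDerivAt (fun t => coordMap p ε r (ζ t))
        (c • hamField (hamH p ε) (coordMap p ε r (ζ t)) + res) t := by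
  have h1 := (differentiableAt_coordMap S h (y := ζ t) (by linarith)).hasFDerivAt.comp_hasDerivAt t hζ
  set DT := fderiv ℝ (coordMap p ε r) (ζ t) with hDT
  refine ⟨c • DT (hamField (hamK p ε r) (ζ t) - hamField (hamNF p ε r) (ζ t)), ?_, ?_⟩
  · rw [norm_smul, Real.norm_of_nonneg hc]
    refine mul_le_mul_of_nonneg_left ?_ hc
    have h2 := norm_hamField_hamNF_sub_le S h hε hx
    rw [norm_sub_rev] at h2
    have h3 : ‖DT - ContinuousLinearMap.id ℝ (Phase d)‖ ≤ 1 := by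
      have := (S.smallGen h).norm_fderiv_lieMap_sub_le (y := ζ t) (by linarith)
      rw [hDT, coordMap_eq]
      linarith
    set v := hamField (hamK p ε r) (ζ t) - hamField (hamNF p ε r) (ζ t)
    have h4 := (DT - ContinuousLinearMap.id ℝ (Phase d)).le_of_opNorm_le h3 v
    rw [_root_.sub_apply, ContinuousLinearMap.id_apply] at h4
    have h5 := norm_le_norm_add_norm_sub' (DT v) v
    linarith
  · refine h1.congr_deriv ?_
    rw [map_smul, map_sub, fderiv_coordMap_hamField S h hx.le, ← smul_add]
    congr 1
    abel

end Conjugation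

/-! ### The family of breathers in the original coordinates and its stability -/

section Family
open Set Filter Topology Metric
variable {d p : ℕ}

theorem Reversible.sub {z w : ℝ → Phase d} (hz : Reversible z) (hw : Reversible w) :
    Reversible fun t => z t - w t :=
  ⟨fun t => by rw [hz.periodic, hw.periodic], fun t => by rw [hz.neg, hw.neg, map_sub]⟩

theorem reversible_ofAmplitude (A : L2 d) : Reversible (ofAmplitude A) := by
  refine ⟨fun t => by rw [ofAmplitude_eq, flowG_add_two_pi, ofAmplitude_eq], fun t => ?_⟩
  refine phase_ext ?_ ?_
  · simp [ofAmplitude, reversal_apply]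
  · simp [ofAmplitude, reversal_apply]

theorem Reversible.norm_le {w : ℝ → Phase d} (h : Reversible w) {c : ℝ}
    (hc : ∀ t ∈ Icc 0 Real.pi, ‖w t‖ ≤ c) (t : ℝ) : ‖w t‖ ≤ c := by
  have h1 : ∀ t ∈ Icc (-Real.pi) Real.pi, ‖w t‖ ≤ c := by
    intro t ht
    rcases le_total 0 t with h0 | h0
    · exact hc t ⟨h0, ht.2⟩
    · have h2 := hc (-t) ⟨by linarith, by linarith [ht.1]⟩
      rwa [h.neg, (reversal d).norm_map] at h2
  obtain ⟨n, hn, -⟩ := existsUnique_add_zsmul_mem_Ioc (a := 2 * Real.pi) (by positivity) t (-Real.pi)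
  have h3 := h1 (t + n • (2 * Real.pi)) ⟨hn.1.le, by linarith [hn.2]⟩
  have hp : Function.Periodic w (2 * Real.pi) := h.periodic
  rwa [hp.zsmul n t] at h3

/-- Reversible periodic functions that solve the Klein-Gordon equation, rescaled to the frequency
`w`, up to an error `s`. -/
structure ApproxSol (p : ℕ) (ε w s : ℝ) (z : ℝ → Phase d) : Prop where
  reversible : Reversible z
  residual : ∃ res : ℝ → Phase d, Continuous res ∧ (∀ t, ‖res t‖ ≤ s) ∧
    ∀ t, HasDerivAt z (w⁻¹ • hamField (hamH p ε) (z t) + res t) t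

theorem ApproxSol.of_hasDerivAt {ε w : ℝ} {z : ℝ → Phase d} (hz : Reversible z)
    (h : ∀ t, HasDerivAt z (w⁻¹ • hamField (hamH p ε) (z t)) t) {s : ℝ} (hs : 0 ≤ s) :
    ApproxSol p ε w s z :=
  ⟨hz, fun _ => 0, continuous_const, fun _ => by simpa using hs, fun t => by simpa using h t⟩

/-- The data of a reversible curve in the rotating frame. -/
def frame (z : ℝ → Phase d) (zc : HalfCurve d) : L2 d × HalfCurve d :=
  ((z 0).fst, rotate d (-1) zc)

theorem ApproxSol.norm_kgMap_le {ε w s : ℝ} {z : ℝ → Phase d} (h : ApproxSol p ε w s z)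
    (hε : 0 < ε) (hw : 0 < w) {zc : HalfCurve d} (hzc : ∀ t, zc t = z t) :
    ‖kgMap p ((ε / w, (1 - w) / ε), frame z zc)‖ ≤ Real.pi * (1 + w / ε) * s := by
  obtain ⟨res, hrc, hrs, hz⟩ := h.residual
  refine (KleinGordon.norm_kgMap_le hε hw (z := z)
    (res := ⟨fun t => res t, hrc.comp continuous_subtype_val⟩) hzc
    (fun t => (hz t).hasDerivWithinAt) h.reversible.snd_zero h.reversible.snd_pi).trans ?_
  gcongr
  exact (ContinuousMap.norm_le _ ((norm_nonneg _).trans (hrs 0))).2 fun t => hrs t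

theorem norm_frame_sub_le {z : ℝ → Phase d} {zc : HalfCurve d} (hzc : ∀ t, zc t = z t) {A : L2 d}
    {η : ℝ} (h : ∀ t, ‖z t - ofAmplitude A t‖ ≤ η) :
    ‖frame z zc - ((2 : ℝ) • A, constC d ((2 : ℝ) • A))‖ ≤ η := by
  have hη := (norm_nonneg _).trans (h 0)
  rw [frame, Prod.mk_sub_mk, Prod.norm_mk, max_le_iff]
  constructor
  · refine le_trans ?_ (h 0)
    rw [ofAmplitude_eq, flowG_zero]
    exact norm_fst_le (z 0 - mkPhase ((2 : ℝ) • A) 0)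
  · refine (ContinuousMap.norm_le _ hη).2 fun t => ?_
    rw [ContinuousMap.sub_apply, rotate_apply, hzc, constC_apply, ContinuousMap.const_apply]
    refine le_trans (le_of_eq ?_) (h t)
    rw [ofAmplitude_eq, ← norm_flowG (-1 * t) (z t - _), ← flowE_apply, ← flowE_apply, map_sub,
      flowE_apply, flowE_apply, flowG_flowG, neg_one_mul, neg_add_cancel, flowG_zero]

theorem norm_sub_le_of_frame {z z' : ℝ → Phase d} (hz : Reversible z) (hz' : Reversible z')
    {zc zc' : HalfCurve d} (hzc : ∀ t, zc t = z t) (hzc' : ∀ t, zc' t = z' t) (t : ℝ) :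
    ‖z t - z' t‖ ≤ ‖frame z zc - frame z' zc'‖ := by
  refine (hz.sub hz').norm_le (fun t ht => ?_) t
  have h1 : ‖rotate d (-1) (zc - zc')‖ ≤ ‖frame z zc - frame z' zc'‖ := by
    rw [map_sub]
    exact _root_.norm_snd_le (frame z zc - frame z' zc')
  refine le_trans ?_ h1
  have h2 := (rotate d (-1) (zc - zc')).norm_coe_le_norm ⟨t, ht⟩
  rwa [rotate_apply, norm_flowG, ContinuousMap.sub_apply, hzc, hzc'] at h2

theorem hamH_reversal (p : ℕ) (ε : ℝ) (z : Phase d) : hamH p ε (reversal d z) = hamH p ε z := by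
  rw [hamH, hamH, hamG_eq, hamG_eq, inner_reversal, hamF_reversal]

/-- Reversible periodic solutions of the Klein-Gordon equation near the anti-continuum limit, and
the stability of approximate ones. -/
theorem exists_kg_family {Ω : ℝ} {A : L2 d} (hA : dnls p Ω A = 0)
    (hJ : IsUnit (jacobian p Ω A)) :
    ∃ (yc : ℝ → HalfCurve d) (Z : ℝ → ℝ → Phase d), ∃ C > 0, ∃ ρ > 0,
      (∀ ε w s : ℝ, 0 < ε → 0 < w → ε / w < ρ → |(1 - w) / ε - Ω / 2| < ρ →
        ∀ z z' : ℝ → Phase d, ApproxSol p ε w s z → ApproxSol p ε w s z' →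
        (∀ t, ‖z t - ofAmplitude A t‖ ≤ ρ) → (∀ t, ‖z' t - ofAmplitude A t‖ ≤ ρ) →
        ∀ t, ‖z t - z' t‖ ≤ C * (1 + w / ε) * s) ∧
      ∀ η > 0, ∃ e > 0, ∀ ε, 0 < ε → ε < e → ContDiffAt ℝ ω yc ε ∧ (∀ t, yc ε t = Z ε t) ∧
        Reversible (Z ε) ∧
        (∀ t, HasDerivAt (Z ε) ((1 - ε * Ω / 2)⁻¹ • hamField (hamH p ε) (Z ε t)) t) ∧
        ∀ t, ‖Z ε t - ofAmplitude A t‖ ≤ η := by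
  obtain ⟨g, hg0, hgc, hgz, C, hC, ρ, hρ, hst⟩ := exists_kg_branch hA hJ
  -- The parameter σ = (1 - w)/ε is kept at Ω/2, which means w = 1 - εΩ/2 without correction: the
  -- breather gets exactly the frequency of the soliton.
  set qe : ℝ → ℝ × ℝ := fun ε => (ε / (1 - ε * Ω / 2), Ω / 2) with hqe
  set yc : ℝ → HalfCurve d := fun ε => rotate d 1 (g (qe ε)).2 with hyc
  set Z : ℝ → ℝ → Phase d := fun ε => fold (IccExtend pi_nonneg' (yc ε)) with hZ
  refine ⟨yc, Z, C * (2 * Real.pi), by positivity, ρ / 2, by positivity, ?_, ?_⟩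
  · intro ε w s hε hw hq1 hq2 z z' hz hz' h h' t
    have hcont : ∀ {z : ℝ → Phase d}, ApproxSol p ε w s z → Continuous z := fun hz => by
      obtain ⟨_, -, -, hd⟩ := hz.residual
      exact continuous_iff_continuousAt.2 fun t => (hd t).continuousAt
    set zc : HalfCurve d := ⟨fun t => z t, (hcont hz).comp continuous_subtype_val⟩
    set zc' : HalfCurve d := ⟨fun t => z' t, (hcont hz').comp continuous_subtype_val⟩
    refine (norm_sub_le_of_frame hz.reversible hz'.reversible (zc := zc) (zc' := zc')
      (fun _ => rfl) (fun _ => rfl) t).trans ?_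
    have hqm : (ε / w, (1 - w) / ε) ∈ ball ((0 : ℝ), Ω / 2) ρ := by
      rw [mem_ball, dist_eq_norm, Prod.mk_sub_mk, Prod.norm_mk, max_lt_iff, sub_zero,
        Real.norm_of_nonneg (by positivity)]
      exact ⟨by linarith, by rw [Real.norm_eq_abs]; linarith⟩
    have hb : ∀ {z : ℝ → Phase d} {zc : HalfCurve d}, (∀ t, zc t = z t) →
        (∀ t, ‖z t - ofAmplitude A t‖ ≤ ρ / 2) →
        frame z zc ∈ ball ((2 : ℝ) • A, constC d ((2 : ℝ) • A)) ρ := fun hzc h => by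
      rw [mem_ball, dist_eq_norm]
      exact (norm_frame_sub_le hzc h).trans_lt (by linarith)
    refine (hst _ hqm _ (hb (fun _ => rfl) h) _ (hb (fun _ => rfl) h')).trans ?_
    have h1 := hz.norm_kgMap_le hε hw (zc := zc) (fun _ => rfl)
    have h2 := hz'.norm_kgMap_le hε hw (zc := zc') (fun _ => rfl)
    have h3 := norm_sub_le (kgMap p ((ε / w, (1 - w) / ε), frame z zc))
      (kgMap p ((ε / w, (1 - w) / ε), frame z' zc'))
    calc _ ≤ C * (Real.pi * (1 + w / ε) * s + Real.pi * (1 + w / ε) * s) := by gcongr; linarith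
      _ = _ := by ring
  · intro η hη
    have hqc : ContinuousAt qe 0 := by
      refine ContinuousAt.prodMk (continuousAt_id.div (by fun_prop) (by simp)) continuousAt_const
    have hq0 : qe 0 = (0, Ω / 2) := by simp [hqe]
    have h1 : ∀ᶠ q in 𝓝 ((0 : ℝ), Ω / 2), ‖g q - g (0, Ω / 2)‖ < η :=
      ((hgc.continuousAt.sub continuousAt_const).norm).eventually
        (gt_mem_nhds (by simpa using hη))
    have h2 := h1.and (hgz.and (hgc.eventually (by simp)))
    have hqt : Tendsto qe (𝓝 0) (𝓝 (0, Ω / 2)) := hq0 ▸ hqc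
    have h3 : ∀ᶠ ε in 𝓝 (0 : ℝ), 0 < 1 - ε * Ω / 2 := by
      have : ContinuousAt (fun ε : ℝ => 1 - ε * Ω / 2) 0 := by fun_prop
      exact this.eventually (lt_mem_nhds (by simp))
    obtain ⟨e, he, h4⟩ := Metric.eventually_nhds_iff.1 ((hqt.eventually h2).and h3)
    refine ⟨e, he, fun ε hε hεe => ?_⟩
    obtain ⟨⟨k1, k2, k3⟩, k4⟩ := h4 (y := ε) (by rwa [dist_zero_right, Real.norm_of_nonneg hε.le])
    have hqa : ContDiffAt ℝ ω qe ε :=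
      (ContDiffAt.div (f := fun ε : ℝ => ε) (g := fun ε : ℝ => 1 - ε * Ω / 2) contDiffAt_id
        (by fun_prop) k4.ne').prodMk contDiffAt_const
    have hσ : (1 - (1 - ε * Ω / 2)) / ε = Ω / 2 := by field_simp; ring
    set a := (g (qe ε)).1 with ha
    set y := (g (qe ε)).2 with hy
    have hkg : kgMap p ((ε / (1 - ε * Ω / 2), (1 - (1 - ε * Ω / 2)) / ε), (a, y)) = 0 := by
      rw [hσ]; exact k2
    obtain ⟨m1, m2, m3⟩ := hasDerivWithinAt_of_kgMap hε.ne' k4.ne' hkg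
    have hya : ∀ t (ht : t ∈ Icc 0 Real.pi), Z ε t = yc ε ⟨t, ht⟩ := fun t ht => by
      rw [hZ]; simp only []
      rw [fold_of_mem _ ht, IccExtend_of_mem _ _ ht]
    have hs0 : (IccExtend pi_nonneg' (yc ε) 0).snd = 0 := by
      rw [IccExtend_of_mem pi_nonneg' (yc ε) (left_mem_Icc.2 pi_nonneg'), hyc]
      simp only []
      rw [rotate_apply, m2, mul_zero, flowG_zero, mkPhase_snd]
    have hsπ : (IccExtend pi_nonneg' (yc ε) Real.pi).snd = 0 := by
      rw [IccExtend_of_mem pi_nonneg' (yc ε) (right_mem_Icc.2 pi_nonneg'), hyc]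
      simp only []
      rw [rotate_apply, flowG, mkPhase_snd, m3]
      simp
    have hrev : Reversible (Z ε) := ⟨fold_add_two_pi _, fold_neg hs0 hsπ⟩
    refine ⟨?_, fun t => (hya t t.2).symm, hrev, ?_, ?_⟩
    · have h5 : ContDiffAt ℝ ω (fun ε => g (qe ε)) ε := ContDiffAt.comp (g := g) ε k3 hqa
      exact (rotate d 1).contDiff.contDiffAt.comp ε (contDiffAt_snd.comp ε h5)
    · refine hasDerivAt_of_reversible (f := fun z => (1 - ε * Ω / 2)⁻¹ • hamField (hamH p ε) z)
        (fun z => ?_) hrev.periodic hrev.neg fun t ht => ?_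
      · rw [hamField_reversal_of_even (hamH_reversal p ε), map_smul, smul_neg]
      · have h5 := (m1 t ht).congr (f₁ := Z ε) (fun s hs => by
          rw [hya s hs, IccExtend_of_mem _ _ hs]) (by rw [hya t ht, IccExtend_of_mem _ _ ht])
        rw [hya t ht]
        exact h5
    · refine (hrev.sub (reversible_ofAmplitude A)).norm_le fun t ht => ?_
      rw [hya t ht, ofAmplitude_eq, hyc]
      simp only []
      rw [rotate_apply, one_mul, ← flowE_apply, ← flowE_apply, ← map_sub, (flowE d t).norm_map]
      have h5 := (y - constC d ((2 : ℝ) • A)).norm_coe_le_norm ⟨t, ht⟩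
      refine h5.trans ?_
      have h6 : ‖(g (qe ε) - g (0, Ω / 2)).2‖ ≤ ‖g (qe ε) - g (0, Ω / 2)‖ :=
        _root_.norm_snd_le _
      rw [hg0] at h6 k1
      exact h6.trans k1.le

end Family

/-! ### Soliton and breather compared -/

section Comparison
open Set Filter Topology Metric
open Size
variable {d p : ℕ} {x f₀ ε : ℝ} {r : ℕ}

theorem continuousOn_fderiv_coordMap (S : Size d p x f₀) (h : Small p x f₀ r ε) :
    ContinuousOn (fderiv ℝ (coordMap (d := d) p ε r)) (ball 0 (x - 1)) := by
  have H := S.smallGen h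
  have h1 : ContinuousOn (fun y : Phase d => ∑' k, fderiv ℝ (lieSeq (genSeq p ε r) (fun z => z) k) y)
      (ball 0 (x - 1)) :=
    continuousOn_tsum (fun k => (((H.lieSeq H.cls_id k).smooth.fderiv_right (m := 0)
        (by norm_cast)).continuous).continuousOn)
      ((summable_geometric_of_lt_one H.μ_pos.le H.μ_lt).mul_right x)
      fun k z hz => H.fderiv_bound H.cls_id k (by simpa using (mem_ball.1 hz).le)
  refine h1.congr fun y hy => ?_
  rw [coordMap_eq]
  exact (H.hasFDerivAt_lieMap (by simpa using hy)).fderiv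

theorem norm_coordMap_sub_le (S : Size d p x f₀) (h : Small p x f₀ r ε) {y : Phase d}
    (hy : ‖y‖ ≤ x) : ‖coordMap p ε r y - y‖ ≤ 2 * x * (nfC p x f₀ * r * ε) := by
  rw [coordMap_eq]; exact (S.smallGen h).norm_lieMap_sub_le hy

theorem half_norm_sub_le_coordMap (S : Size d p x f₀) (h : Small p x f₀ r ε) {y z : Phase d}
    (hy : ‖y‖ < x - 1) (hz : ‖z‖ < x - 1) :
    1 / 2 * ‖y - z‖ ≤ ‖coordMap p ε r y - coordMap p ε r z‖ := by
  rw [coordMap_eq]; exact (S.smallGen h).half_norm_sub_le hy hz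

theorem norm_ofAmplitude_sub (A B : L2 d) (t : ℝ) :
    ‖ofAmplitude B t - ofAmplitude A t‖ = 2 * ‖B - A‖ := by
  rw [← ofAmplitude_sub, norm_ofAmplitude]

theorem norm_coordMap_sub_ofAmplitude_le (S : Size d p x f₀) (h : Small p x f₀ r ε) {A B : L2 d}
    {y : Phase d} (hy : ‖y‖ ≤ x) {s t : ℝ} (hs : ‖y - ofAmplitude B t‖ ≤ s) :
    ‖coordMap p ε r y - ofAmplitude A t‖ ≤ 2 * x * (nfC p x f₀ * r * ε) + s + 2 * ‖B - A‖ := by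
  have h1 := norm_coordMap_sub_le S h hy
  have h2 := norm_ofAmplitude_sub A B t
  have h3 := norm_add₃_le (a := coordMap p ε r y - y) (b := y - ofAmplitude B t)
    (c := ofAmplitude B t - ofAmplitude A t)
  rw [show coordMap p ε r y - y + (y - ofAmplitude B t) + (ofAmplitude B t - ofAmplitude A t)
    = coordMap p ε r y - ofAmplitude A t by abel] at h3
  linarith

theorem continuous_hamField_hamH (p : ℕ) (ε : ℝ) : Continuous (hamField (hamH (d := d) p ε)) := by
  rw [funext (hamField_hamH p ε)]
  exact (symp d).continuous.add ((continuous_hamField_hamF d p).const_smul ε)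

theorem hasDerivAt_ofAmplitude (B : L2 d) (t : ℝ) :
    HasDerivAt (ofAmplitude B) (symp d (ofAmplitude B t)) t := by
  rw [funext (ofAmplitude_eq B)]
  exact hasDerivAt_flowG t _

theorem continuous_ofAmplitude_angle (B : L2 d) : Continuous (ofAmplitude B) :=
  continuous_iff_continuousAt.2 fun t => (hasDerivAt_ofAmplitude B t).continuousAt

theorem hamField_hamK_ofAmplitude {Ω : ℝ} {B : L2 d} (hε : 0 < ε) (hr : 1 ≤ r)
    (hB : genDnls p Ω ε r B = 0) (t : ℝ) :
    hamField (hamK p ε r) (ofAmplitude B t) = (1 - ε * Ω / 2) • symp d (ofAmplitude B t) := by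
  rw [ofAmplitude_eq, hamField_flowG (hamK_flowG p ε r), hamField_hamK_soliton hε hr hB, ← flowG_symp]
  exact map_smul (flowE d t) _ _

/-- The soliton solves the Klein-Gordon equation up to the remainder of the normal form. -/
theorem approxSol_coordMap_ofAmplitude (S : Size d p x f₀) (h : Small p x f₀ r ε) (hε : ε ≤ 1)
    {Ω : ℝ} (hw : 0 < 1 - ε * Ω / 2) {B : L2 d} (hB : genDnls p Ω ε r B = 0)
    (hx : 2 * ‖B‖ < x - 3) :
    ApproxSol p ε (1 - ε * Ω / 2)
      ((1 - ε * Ω / 2)⁻¹ * (4 * (x ^ 2 + f₀) * (nfC p x f₀ * r * ε) ^ r))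
      (fun t => coordMap p ε r (ofAmplitude B t)) := by
  have hn : ∀ t, ‖ofAmplitude B t‖ < x - 3 := fun t => by rwa [norm_ofAmplitude]
  have hd : ∀ t, HasDerivAt (ofAmplitude B)
      ((1 - ε * Ω / 2)⁻¹ • hamField (hamK p ε r) (ofAmplitude B t)) t := fun t => by
    rw [hamField_hamK_ofAmplitude h.2.1 h.1 hB, inv_smul_smul₀ hw.ne']
    exact hasDerivAt_ofAmplitude B t
  have hres := fun t => exists_residual S h hε (inv_nonneg.2 hw.le) (hd t) (hn t)
  choose res hr1 hr2 using hres
  refine ⟨⟨fun t => ?_, fun t => ?_⟩, res, ?_, hr1, hr2⟩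
  · simp only [(reversible_ofAmplitude B).periodic]
  · simp only [(reversible_ofAmplitude B).neg, coordMap_reversal h.2.1]
  -- The residual was chosen separately for each t. It is determined by the curve and the field, and
  -- this expression shows that it is continuous.
  · have h1 : res = fun t => fderiv ℝ (coordMap p ε r) (ofAmplitude B t)
        (symp d (ofAmplitude B t)) - (1 - ε * Ω / 2)⁻¹ • hamField (hamH p ε)
          (coordMap p ε r (ofAmplitude B t)) := by
      funext t
      have h2 := (differentiableAt_coordMap S h (y := ofAmplitude B t)
        (by linarith [hn t])).hasFDerivAt.comp_hasDerivAt t (hasDerivAt_ofAmplitude B t)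
      rw [h2.unique (hr2 t), add_sub_cancel_left]
    have hB' := continuous_ofAmplitude_angle B
    have h3 : Continuous fun t => fderiv ℝ (coordMap p ε r) (ofAmplitude B t) :=
      (continuousOn_fderiv_coordMap S h).comp_continuous hB' fun t => by
        simpa using (hn t).trans (by linarith)
    have h4 : Continuous fun t => coordMap p ε r (ofAmplitude B t) :=
      continuous_iff_continuousAt.2 fun t => (hr2 t).continuousAt
    rw [h1]
    exact (h3.clm_apply ((symp d).continuous.comp hB')).sub
      (Continuous.fun_const_smul ((continuous_hamField_hamH p ε).comp h4) _)

theorem IsBreather.hasDerivAt_ofFourier {R w : ℝ} {b : L22 d} (h : IsBreather p ε r R w b)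
    (hw : w ≠ 0) (τ : ℝ) : ‖ofFourier b τ‖ < R ∧
      HasDerivAt (ofFourier b) (w⁻¹ • hamField (hamNF p ε r) (ofFourier b τ)) τ := by
  obtain ⟨h1, h2⟩ := h (w⁻¹ * τ)
  rw [mul_inv_cancel_left₀ hw] at h1 h2
  refine ⟨h1, ?_⟩
  have h3 : HasDerivAt (fun τ => w⁻¹ * τ) w⁻¹ τ := by simpa using (hasDerivAt_id τ).const_mul w⁻¹
  have h4 := HasDerivAt.scomp (g₁ := fun s => ofFourier b (w * s)) τ h2 h3
  simpa only [Function.comp_def, mul_inv_cancel_left₀ hw] using h4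

theorem isBreather_of_hasDerivAt {R w : ℝ} {b : L22 d} (hw : w ≠ 0)
    (h : ∀ τ, ‖ofFourier b τ‖ < R ∧
      HasDerivAt (ofFourier b) (w⁻¹ • hamField (hamNF p ε r) (ofFourier b τ)) τ) :
    IsBreather p ε r R w b := by
  intro t
  refine ⟨(h _).1, ?_⟩
  have h3 : HasDerivAt (fun s => w * s) w t := by simpa using (hasDerivAt_id t).const_mul w
  have h4 := HasDerivAt.scomp (g₁ := ofFourier b) t (h (w * t)).2 h3
  rwa [smul_inv_smul₀ hw] at h4

theorem IsBreather.approxSol (S : Size d p x f₀) (h : Small p x f₀ r ε) {R w : ℝ} (hR : R ≤ x - 3)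
    {b : L22 d} (hb : IsBreather p ε r R w b) (hw : w ≠ 0) :
    ApproxSol p ε w 0 (fun τ => coordMap p ε r (ofFourier b τ)) := by
  have hrev := reversible_ofFourier b
  refine ApproxSol.of_hasDerivAt ⟨fun t => ?_, fun t => ?_⟩ (fun t => ?_) le_rfl
  · simp only [hrev.periodic]
  · simp only [hrev.neg, coordMap_reversal h.2.1]
  · obtain ⟨h1, h2⟩ := hb.hasDerivAt_ofFourier hw t
    exact hasDerivAt_coordMap S h h2 (by linarith)

theorem IsBreather.eq_of_coordMap_eq (S : Size d p x f₀) (h : Small p x f₀ r ε) {R w : ℝ}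
    (hR : R ≤ x - 3) (hw : w ≠ 0) {b b' : L22 d} (hb : IsBreather p ε r R w b)
    (hb' : IsBreather p ε r R w b')
    (he : ∀ τ, coordMap p ε r (ofFourier b τ) = coordMap p ε r (ofFourier b' τ)) : b = b' := by
  refine ofFourier_injective fun τ => coordMap_injOn S h ?_ ?_ (he τ)
  · simpa using (hb.hasDerivAt_ofFourier hw τ).1.trans_le (by linarith)
  · simpa using (hb'.hasDerivAt_ofFourier hw τ).1.trans_le (by linarith)

/-- The distance of the Fourier coefficients of a breather and a soliton which are close. -/
theorem fourierDist_le_of_norm_sub_le (S : Size d p x f₀) (h : Small p x f₀ r ε) (hε : ε ≤ 1)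
    {Ω : ℝ} (hw : 1 / 2 ≤ 1 - ε * Ω / 2) {B : L2 d} (hB : genDnls p Ω ε r B = 0)
    (hx : 2 * ‖B‖ ≤ x - 3) {b : L22 d}
    (hb : ∀ τ, HasDerivAt (ofFourier b)
      ((1 - ε * Ω / 2)⁻¹ • hamField (hamNF p ε r) (ofFourier b τ)) τ)
    (hc : Differentiable ℝ (deriv (ofFourier b))) (hxb : ∀ τ, ‖ofFourier b τ‖ < x - 3) {η : ℝ}
    (hη : ∀ τ, ‖ofFourier b τ - ofAmplitude B τ‖ ≤ η) :
    fourierDist b B ≤ ((∑' m : ℤ, (1 + (m : ℝ) ^ 2)⁻¹) + 1) *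
      ((1 + 2 * (x ^ 2 + 2 * f₀ + 4 * f₀ * nfC p x f₀)) * η
        + 4 * (x ^ 2 + f₀) * (nfC p x f₀ * r * ε) ^ r) := by
  set L := x ^ 2 + 2 * f₀ + 4 * f₀ * nfC p x f₀ with hL
  set w := 1 - ε * Ω / 2 with hwd
  set m := (nfC p x f₀ * r * ε) ^ r with hm
  have hm0 : 0 < m := pow_pos (S.mu_pos h) r
  have hf := S.pos
  have hC := S.nfC_pos
  have hx0 := S.x_pos
  have hη0 : 0 ≤ η := (norm_nonneg _).trans (hη 0)
  have hL0 : 0 < L := by positivity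
  refine fourierDist_le (w' := deriv (ofFourier b)) (fun t => (hb t).differentiableAt.hasDerivAt)
    hc.continuous (by positivity) (fun t => (hη t).trans ?_) fun t => ?_
  · have : 0 < 4 * (x ^ 2 + f₀) * m := by positivity
    nlinarith
  -- The derivatives are compared through the equations: the remainder of the normal form for the
  -- field at the breather, and the Lipschitz constant of X_K between breather and soliton. The
  -- inverse frequency is at most 2.
  · have h1 : symp d (ofAmplitude B t) = w⁻¹ • hamField (hamK p ε r) (ofAmplitude B t) := by
      rw [hamField_hamK_ofAmplitude h.2.1 h.1 hB, ← hwd, inv_smul_smul₀ (by linarith)]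
    rw [(hb t).deriv, h1, ← smul_sub, norm_smul, Real.norm_of_nonneg (inv_nonneg.2 (by linarith))]
    have h2 := norm_hamField_hamNF_sub_le S h hε (hxb t)
    have h3 := norm_hamField_hamK_sub_le S h hε (y := ofFourier b t) (z := ofAmplitude B t)
      (by linarith [hxb t]) (by rw [norm_ofAmplitude]; linarith)
    have h4 : w⁻¹ ≤ 2 := by rw [inv_le_comm₀ (by linarith) (by norm_num)]; linarith
    have h5 := norm_sub_le_norm_sub_add_norm_sub (hamField (hamNF p ε r) (ofFourier b t))
      (hamField (hamK p ε r) (ofFourier b t)) (hamField (hamK p ε r) (ofAmplitude B t))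
    have h6 : L * ‖ofFourier b t - ofAmplitude B t‖ ≤ L * η := by gcongr; exact hη t
    calc _ ≤ 2 * (2 * (x ^ 2 + f₀) * m + L * η) := by
          gcongr
          linarith
      _ ≤ _ := by nlinarith

/-- The integer part loses less than one unit of the exponent, hence the factor e. -/
theorem pow_floor_le {μ ρ ε : ℝ} (h0 : 0 ≤ μ) (h1 : μ ≤ Real.exp (-1)) :
    μ ^ ⌊ρ / ε⌋₊ ≤ Real.exp 1 * Real.exp (-ρ / ε) := by
  refine (pow_le_pow_left₀ h0 h1 _).trans ?_
  rw [← Real.exp_nat_mul, ← Real.exp_add, Real.exp_le_exp]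
  have := Nat.lt_floor_add_one (ρ / ε)
  rw [neg_div]
  linarith

/-- From y e^(-y) ≤ 1 with y = ρ/(2 ε): half of the rate pays for the loss 1/ε of the stability
estimate. -/
theorem exp_div_le {ρ ε : ℝ} (hρ : 0 < ρ) (hε : 0 < ε) :
    1 / ε * Real.exp (-ρ / ε) ≤ 2 / ρ * Real.exp (-(ρ / 2) / ε) := by
  have h1 : -ρ / ε = -(ρ / 2 / ε) + -(ρ / 2) / ε := by field_simp; ring
  have h2 := Real.add_one_le_exp (ρ / 2 / ε)
  rw [h1, Real.exp_add, ← mul_assoc]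
  gcongr
  rw [Real.exp_neg, mul_inv_le_iff₀ (Real.exp_pos _)]
  calc 1 / ε = 2 / ρ * (ρ / 2 / ε) := by field_simp
    _ ≤ _ := by gcongr; linarith

end Comparison

/-! ### Solitons and breathers of all admissible orders and couplings -/

section Breather
open Set Filter Topology Metric
open Size
variable {d p : ℕ} {x f₀ ε : ℝ} {r : ℕ}

theorem norm_hamField_hamH_le (S : Size d p x f₀) (hε : 0 ≤ ε) {z : Phase d} (hz : ‖z‖ ≤ x - 1) :
    ‖hamField (hamH p ε) z‖ ≤ x + ε * f₀ := by
  have hx := S.four_lt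
  have h1 : Cls (x - 1) (2 * p + 2) (f₀ / (x - (x - 1))) (hamField (hamF (d := d) p 1)) :=
    (S.cls.fderiv (by linarith) (by linarith)).clm_comp (hamC d) norm_hamC_le
  rw [sub_sub_cancel, div_one] at h1
  rw [hamField_hamH]
  refine (norm_add_le _ _).trans ?_
  rw [(symp d).norm_map, norm_smul, Real.norm_of_nonneg hε]
  have := h1.norm_le hz
  gcongr
  linarith

/-- Near each coupling there is an analytic choice of coefficients. A function determines its
coefficients, so the local choices agree with one global choice, which is therefore analytic. -/
theorem exists_breather_family (S : Size d p x f₀) {Ω e : ℝ} {yc : ℝ → HalfCurve d}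
    {Z : ℝ → ℝ → Phase d} (hw : ∀ ε, 0 < ε → ε < e → 0 < 1 - ε * Ω / 2)
    (hZ : ∀ ε, 0 < ε → ε < e → ContDiffAt ℝ ω yc ε ∧ (∀ t, yc ε t = Z ε t) ∧ Reversible (Z ε) ∧
      (∀ t, HasDerivAt (Z ε) ((1 - ε * Ω / 2)⁻¹ • hamField (hamH p ε) (Z ε t)) t) ∧
      ∀ t, ‖Z ε t‖ ≤ x - 3) :
    ∃ b : ℕ → ℝ → L22 d, ∀ r ε, 0 < ε → ε < e → (∀ᶠ ε' in 𝓝 ε, Small p x f₀ r ε') →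
      AnalyticAt ℝ (b r) ε ∧ Differentiable ℝ (ofFourier (b r ε)) ∧
      Differentiable ℝ (deriv (ofFourier (b r ε))) ∧
      ∀ τ, ofFourier (b r ε) τ = invMap p ε r x (Z ε τ) := by
  classical
  set P : ℕ → ℝ → L22 d → Prop := fun r ε b => Differentiable ℝ (ofFourier b) ∧
    Differentiable ℝ (deriv (ofFourier b)) ∧ ∀ τ, ofFourier b τ = invMap p ε r x (Z ε τ) with hP
  have hu : ∀ {r ε b b'}, P r ε b → P r ε b' → b = b' := fun h h' =>
    ofFourier_injective fun τ => (h.2.2 τ).trans (h'.2.2 τ).symm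
  refine ⟨fun r ε => if h : ∃ b, P r ε b then h.choose else 0, fun r ε hε hεe hs => ?_⟩
  have hev : ∀ᶠ ε' in 𝓝 ε, 0 < ε' ∧ ε' < e :=
    (eventually_gt_nhds hε).and (eventually_lt_nhds hεe)
  have hwc : ContDiffAt ℝ ω (fun ε : ℝ => 1 - ε * Ω / 2) ε := by fun_prop
  have hwi : ∀ᶠ ε' in 𝓝 ε, (1 - ε' * Ω / 2)⁻¹ < (1 - ε * Ω / 2)⁻¹ + 1 :=
    (ContinuousAt.inv₀ hwc.continuousAt (hw ε hε hεe).ne' :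
      ContinuousAt (fun ε : ℝ => (1 - ε * Ω / 2)⁻¹) ε).eventually (gt_mem_nhds (lt_add_one _))
  obtain ⟨β, hβ, hβP⟩ := exists_analytic_coefficients S (r := r) (w := fun ε => 1 - ε * Ω / 2)
    (L := ((1 - ε * Ω / 2)⁻¹ + 1) * (x + e * f₀)) hwc (hw ε hε hεe).ne' (hZ ε hε hεe).1 (Z := Z) (by
      filter_upwards [hev, hwi] with ε' h1 h2
      obtain ⟨-, k1, -, k2, k3⟩ := hZ ε' h1.1 h1.2
      refine ⟨k1, fun t => ⟨k2 t, ?_⟩⟩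
      have h3 := inv_pos.2 (hw ε' h1.1 h1.2)
      rw [norm_smul, Real.norm_of_nonneg h3.le]
      have h4 := norm_hamField_hamH_le S h1.1.le (z := Z ε' t) (by linarith [k3 t])
      have h5 : ε' * f₀ ≤ e * f₀ := mul_le_mul_of_nonneg_right h1.2.le S.pos.le
      exact mul_le_mul h2.le (by linarith) (norm_nonneg _) (by linarith)) hs (by
      filter_upwards [hev] with ε' h1
      obtain ⟨-, -, k1, -, k3⟩ := hZ ε' h1.1 h1.2
      exact ⟨k1, k3⟩)
  have heq : ∀ᶠ ε' in 𝓝 ε, β ε' = if h : ∃ b, P r ε' b then h.choose else 0 := by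
    filter_upwards [hβP] with ε' h1
    have h2 : ∃ b, P r ε' b := ⟨_, h1⟩
    rw [dif_pos h2]
    exact hu h1 h2.choose_spec
  refine ⟨hβ.congr heq, ?_⟩
  have h3 := hβP.self_of_nhds
  rw [heq.self_of_nhds] at h3
  exact h3

/-- The curve with values in the normal form coordinates given by a solution. -/
theorem invMap_curve (S : Size d p x f₀) (h : Small p x f₀ r ε) {w : ℝ} {Z ζ : ℝ → Phase d}
    (hZ : ∀ t, HasDerivAt Z (w⁻¹ • hamField (hamH p ε) (Z t)) t) (hx : ∀ t, ‖Z t‖ < x - 4)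
    (hd : Differentiable ℝ ζ) (hζ : ∀ t, ζ t = invMap p ε r x (Z t)) (t : ℝ) :
    coordMap p ε r (ζ t) = Z t ∧ ‖ζ t - Z t‖ ≤ 2 * x * (nfC p x f₀ * r * ε) ∧ ‖ζ t‖ < x - 3 ∧
      HasDerivAt ζ (w⁻¹ • hamField (hamNF p ε r) (ζ t)) t := by
  have h1 : ∀ t, coordMap p ε r (ζ t) = Z t ∧ ‖ζ t‖ ≤ x - 2 := fun t => by
    rw [hζ]; exact coordMap_invMap S h (by linarith [hx t])
  have h2 := norm_coordMap_sub_le S h (y := ζ t) (by linarith [(h1 t).2])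
  rw [(h1 t).1, norm_sub_rev] at h2
  have h3 : ‖ζ t‖ < x - 3 := by
    have := (S.smallGen h).tail_le.2
    have := norm_le_norm_add_norm_sub' (ζ t) (Z t)
    linarith [hx t]
  refine ⟨(h1 t).1, h2, h3, hasDerivAt_of_coordMap S h (hd t) h3.le ?_⟩
  simp only [(h1 _).1]
  exact hZ t

theorem small_of_mul_le (S : Size d p x f₀) {ρ : ℝ} (hr : 1 ≤ r) (hε : 0 < ε) (h : r * ε ≤ ρ)
    (hρ : 4 * (x + x ^ 2) * (nfC p x f₀ * ρ) ≤ 1) : Small p x f₀ r ε := by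
  have hx := S.x_pos
  have hC := S.nfC_pos
  refine ⟨hr, hε, le_trans ?_ hρ⟩
  rw [mul_assoc (nfC p x f₀)]
  gcongr

/-- The condition r ε ≤ ρ is closed, whereas analyticity needs a neighbourhood; smallness is
therefore required up to r ε = 2 ρ. -/
theorem eventually_small (S : Size d p x f₀) {ρ e : ℝ} (hρ0 : 0 < ρ)
    (hρ : 4 * (x + x ^ 2) * (nfC p x f₀ * (2 * ρ)) ≤ 1) (h : Admissible ρ e r ε) :
    ∀ᶠ ε' in 𝓝 ε, Small p x f₀ r ε' := by
  have h1 : ∀ᶠ ε' in 𝓝 ε, r * ε' < 2 * ρ := by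
    have : ContinuousAt (fun ε' : ℝ => r * ε') ε := by fun_prop
    exact this.eventually (gt_mem_nhds (by linarith [h.2.2.2]))
  filter_upwards [h1, eventually_gt_nhds h.2.1] with ε' h2 h3
  exact small_of_mul_le S h.1 h3 h2.le hρ

theorem exists_soliton_family (S : Size d p x f₀) {Ω : ℝ} {A : L2 d} {δ e C ρ : ℝ}
    (hρ0 : 0 < ρ) (hρ : 4 * (x + x ^ 2) * (nfC p x f₀ * (2 * ρ)) ≤ 1) (hC : 0 ≤ C)
    (hs : ∀ r ε, Small p x f₀ r ε → ε < e →
      (∀ B ∈ ball A δ, ∀ B' ∈ ball A δ, genDnls p Ω ε r B = 0 → genDnls p Ω ε r B' = 0 → B = B') ∧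
      (∀ B ∈ ball A δ, ∃ D : L2 d →L[ℝ] L2 d, HasFDerivAt (genDnls p Ω ε r) D B ∧ IsUnit D ∧
        ‖D - jacobian p Ω A‖ ≤ C * (‖B - A‖ + ε)) ∧
      ∃ B ∈ ball A δ, genDnls p Ω ε r B = 0 ∧ ‖B - A‖ ≤ C * ε) :
    ∃ B : ℕ → ℝ → L2 d, (∀ r, AnalyticOnNhd ℝ (B r) {ε | Admissible ρ e r ε}) ∧
      ∀ r ε, Admissible ρ e r ε → genDnls p Ω ε r (B r ε) = 0 ∧ ‖B r ε - A‖ < δ ∧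
        (∀ B', ‖B' - A‖ < δ → genDnls p Ω ε r B' = 0 → B' = B r ε) ∧ ‖B r ε - A‖ ≤ C * ε ∧
        DifferentiableAt ℝ (genDnls p Ω ε r) (B r ε) ∧
        ‖fderiv ℝ (genDnls p Ω ε r) (B r ε) - jacobian p Ω A‖ ≤ C * (C + 1) * ε := by
  classical
  set P : ℕ → ℝ → L2 d → Prop := fun r ε B =>
    B ∈ ball A δ ∧ genDnls p Ω ε r B = 0 ∧ ‖B - A‖ ≤ C * ε with hP
  set B : ℕ → ℝ → L2 d := fun r ε => if h : ∃ B, P r ε B then h.choose else 0 with hB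
  have hBP : ∀ r ε, Small p x f₀ r ε → ε < e → P r ε (B r ε) := fun r ε h1 h2 => by
    have h3 : ∃ B, P r ε B := (hs r ε h1 h2).2.2
    rw [hB]
    simp only [dif_pos h3]
    exact h3.choose_spec
  refine ⟨B, fun r ε h => ?_, fun r ε h => ?_⟩
  · have h1 := eventually_small S hρ0 hρ h
    have h2 := hBP r ε h1.self_of_nhds h.2.2.1
    obtain ⟨D, hD, hu, -⟩ := (hs r ε h1.self_of_nhds h.2.2.1).2.1 _ h2.1
    refine analyticAt_soliton (A := A) (δ := δ) h.2.1 hD hu ?_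
    filter_upwards [h1, eventually_lt_nhds h.2.2.1] with ε' k1 k2
    have k3 := hBP r ε' k1 k2
    exact ⟨k3.2.1, k3.1, fun B' hB' hz => (hs r ε' k1 k2).1 _ hB' _ k3.1 hz k3.2.1⟩
  · have h1 := (eventually_small S hρ0 hρ h).self_of_nhds
    have h2 := hBP r ε h1 h.2.2.1
    obtain ⟨D, hD, -, hDJ⟩ := (hs r ε h1 h.2.2.1).2.1 _ h2.1
    refine ⟨h2.2.1, by simpa [dist_eq_norm] using h2.1, fun B' hB' hz =>
      (hs r ε h1 h.2.2.1).1 _ (by simpa [dist_eq_norm] using hB') _ h2.1 hz h2.2.1, h2.2.2,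
      hD.differentiableAt, ?_⟩
    rw [hD.fderiv]
    refine hDJ.trans ?_
    calc _ ≤ C * (C * ε + ε) := by gcongr; exact h2.2.2
      _ = _ := by ring

end Breather

/-! ### Estimates with common constants -/

section Assembly
open Set Filter Topology Metric
open Size
variable {d p : ℕ} {x f₀ ε : ℝ} {r : ℕ}

/-- The remainder of the optimal order is exponentially small. -/
theorem residual_le_exp {ρ w μ K C : ℝ} (hρ : 0 < ρ) (hε : 0 < ε) (hε1 : ε ≤ 1) (hw : 1 / 2 ≤ w)
    (hK : 0 ≤ K) (hC : 0 ≤ C) (h0 : 0 ≤ μ) (h1 : μ ≤ Real.exp (-1)) (hr : r = ⌊ρ / ε⌋₊) :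
    C * (1 + w / ε) * (w⁻¹ * (4 * K * μ ^ r))
      ≤ 24 * C * K * Real.exp 1 / ρ * Real.exp (-(ρ / 2) / ε) := by
  have hw0 : 0 < w := by linarith
  have h2 := pow_floor_le (ρ := ρ) (ε := ε) h0 h1
  rw [← hr] at h2
  have h3 : (1 + w / ε) * w⁻¹ ≤ 3 / ε := by
    have h4 : w⁻¹ ≤ 2 := by rw [inv_le_comm₀ hw0 (by norm_num)]; linarith
    have h5 : 1 ≤ 1 / ε := by rw [le_div_iff₀ hε]; linarith
    calc (1 + w / ε) * w⁻¹ = w⁻¹ + 1 / ε := by field_simp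
      _ ≤ 2 * (1 / ε) + 1 / ε := by linarith
      _ = 3 / ε := by ring
  calc C * (1 + w / ε) * (w⁻¹ * (4 * K * μ ^ r))
      = C * ((1 + w / ε) * w⁻¹) * (4 * K * μ ^ r) := by ring
    _ ≤ C * (3 / ε) * (4 * K * (Real.exp 1 * Real.exp (-ρ / ε))) := by gcongr
    _ = 12 * C * K * Real.exp 1 * (1 / ε * Real.exp (-ρ / ε)) := by ring
    _ ≤ 12 * C * K * Real.exp 1 * (2 / ρ * Real.exp (-(ρ / 2) / ε)) := by
      exact mul_le_mul_of_nonneg_left (exp_div_le hρ hε) (by positivity)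
    _ = _ := by ring

theorem exp_le_exp_half {ρ : ℝ} (hρ : 0 < ρ) (hε : 0 < ε) :
    Real.exp (-ρ / ε) ≤ Real.exp (-(ρ / 2) / ε) := by
  rw [Real.exp_le_exp]
  gcongr
  linarith

/-- A frequency close to that of the soliton lies in the range of the stability estimate. -/
theorem frequency_mem {C w Ω ρ : ℝ} (hε : 0 < ε) (hε1 : ε ≤ 1) (hC : 0 < C)
    (hΩ : 1 / 2 ≤ 1 - ε * Ω / 2) (hw : |w - 1 + ε / 2 * Ω| ≤ C * ε ^ 2) (h1 : ε < 1 / (4 * C))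
    (h2 : ε < ρ / 4) (h3 : ε < ρ / C) : 0 < w ∧ ε / w < ρ ∧ |(1 - w) / ε - Ω / 2| < ρ := by
  rw [lt_div_iff₀ (by positivity)] at h1 h3
  have h4 : C * ε ^ 2 ≤ 1 / 4 := by nlinarith [mul_pos hC hε]
  have h5 := (abs_le.1 hw).1
  have hw4 : 1 / 4 ≤ w := by linarith
  refine ⟨by linarith, ?_, ?_⟩
  · rw [div_lt_iff₀ (by linarith)]
    nlinarith
  · have h6 : (1 - w) / ε - Ω / 2 = -((w - 1 + ε / 2 * Ω) / ε) := by field_simp; ring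
    rw [h6, abs_neg, abs_div, abs_of_pos hε, div_lt_iff₀ hε]
    nlinarith

/-- The number κ is a common tolerance: a quarter for the distance of the orbit from the amplitude
A, a quarter for that of B from A, and an eighth for the change of coordinates. Together they keep
the breather in the ball of radius R. -/
theorem breather_estimates (S : Size d p x f₀) (h : Small p x f₀ r ε) (hε : ε ≤ 1) {Ω R κ : ℝ}
    (hw : 1 / 2 ≤ 1 - ε * Ω / 2) (hx : x = R + 5) {A B : L2 d} (hB : genDnls p Ω ε r B = 0)
    (hBA : 2 * ‖B - A‖ ≤ κ / 4) (hR : 2 * ‖A‖ + κ ≤ R) (hμ : 2 * x * (nfC p x f₀ * r * ε) ≤ κ / 8)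
    {Z : ℝ → Phase d}
    (hZ : ∀ t, HasDerivAt Z ((1 - ε * Ω / 2)⁻¹ • hamField (hamH p ε) (Z t)) t)
    (hZA : ∀ t, ‖Z t - ofAmplitude A t‖ ≤ κ / 4) {b : L22 d}
    (hb1 : Differentiable ℝ (ofFourier b)) (hb2 : Differentiable ℝ (deriv (ofFourier b)))
    (hb : ∀ τ, ofFourier b τ = invMap p ε r x (Z τ)) :
    IsBreather p ε r R (1 - ε * Ω / 2) b ∧ (∀ τ, coordMap p ε r (ofFourier b τ) = Z τ) ∧
      (∀ τ, ‖ofFourier b τ - ofAmplitude B τ‖ ≤ κ) ∧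
      ∀ η, (∀ τ, ‖ofFourier b τ - ofAmplitude B τ‖ ≤ η) →
        fourierDist b B ≤ ((∑' m : ℤ, (1 + (m : ℝ) ^ 2)⁻¹) + 1) *
          ((1 + 2 * (x ^ 2 + 2 * f₀ + 4 * f₀ * nfC p x f₀)) * η
            + 4 * (x ^ 2 + f₀) * (nfC p x f₀ * r * ε) ^ r) := by
  have hZn : ∀ t, ‖Z t‖ ≤ 2 * ‖A‖ + κ / 4 := fun t => by
    have h4 := norm_le_norm_add_norm_sub' (Z t) (ofAmplitude A t)
    rw [norm_ofAmplitude] at h4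
    linarith [hZA t]
  have hκ : 0 < κ := by
    have := S.mu_pos h
    have := S.x_pos
    have : 0 < 2 * x * (nfC p x f₀ * r * ε) := by positivity
    linarith
  have hcurve := invMap_curve S h hZ (fun t => by linarith [hZn t]) hb1 hb
  have hn : ∀ t, ‖ofFourier b t‖ < R := fun t => by
    have := norm_le_norm_add_norm_sub' (ofFourier b t) (Z t)
    linarith [hZn t, (hcurve t).2.1]
  refine ⟨isBreather_of_hasDerivAt (by linarith) fun τ => ⟨hn τ, (hcurve τ).2.2.2⟩,
    fun τ => (hcurve τ).1, fun τ => ?_, fun η hη => ?_⟩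
  · have h1 := norm_add₃_le (a := ofFourier b τ - Z τ) (b := Z τ - ofAmplitude A τ)
      (c := ofAmplitude A τ - ofAmplitude B τ)
    rw [sub_add_sub_cancel, sub_add_sub_cancel, norm_ofAmplitude_sub, norm_sub_rev A B] at h1
    linarith [(hcurve τ).2.1, hZA τ]
  · refine fourierDist_le_of_norm_sub_le S h hε hw hB ?_ (fun τ => (hcurve τ).2.2.2) hb2
      (fun τ => (hcurve τ).2.2.1) hη
    have h1 := norm_le_norm_add_norm_sub' B A
    linarith

/-- The soliton and the breather differ by a multiple of the remainder of the normal form. -/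
theorem norm_soliton_sub_breather_le (S : Size d p x f₀) (h : Small p x f₀ r ε) (hε : ε ≤ 1)
    {Ω R κ C ρ : ℝ} (hw : 1 / 2 ≤ 1 - ε * Ω / 2) (hx : x = R + 5) {A B : L2 d}
    (hB : genDnls p Ω ε r B = 0) (hBA : 2 * ‖B - A‖ ≤ κ / 4) (hR : 2 * ‖A‖ + κ ≤ R)
    (hμ : 2 * x * (nfC p x f₀ * r * ε) ≤ κ / 8) (hκρ : κ ≤ ρ) {Z : ℝ → Phase d}
    (hZr : Reversible Z)
    (hZ : ∀ t, HasDerivAt Z ((1 - ε * Ω / 2)⁻¹ • hamField (hamH p ε) (Z t)) t)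
    (hZA : ∀ t, ‖Z t - ofAmplitude A t‖ ≤ κ / 4)
    (hst : ∀ s, ∀ z z' : ℝ → Phase d, ApproxSol p ε (1 - ε * Ω / 2) s z →
      ApproxSol p ε (1 - ε * Ω / 2) s z' → (∀ t, ‖z t - ofAmplitude A t‖ ≤ ρ) →
      (∀ t, ‖z' t - ofAmplitude A t‖ ≤ ρ) →
      ∀ t, ‖z t - z' t‖ ≤ C * (1 + (1 - ε * Ω / 2) / ε) * s) (t : ℝ) :
    ‖coordMap p ε r (ofAmplitude B t) - Z t‖ ≤ C * (1 + (1 - ε * Ω / 2) / ε) *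
      ((1 - ε * Ω / 2)⁻¹ * (4 * (x ^ 2 + f₀) * (nfC p x f₀ * r * ε) ^ r)) := by
  have hmu := S.mu_pos h
  have hx0 := S.x_pos
  have hf := S.pos
  have hw0 : 0 < 1 - ε * Ω / 2 := by linarith
  have hBn : 2 * ‖B‖ < x - 3 := by
    have h1 := norm_le_norm_add_norm_sub' B A
    have : 0 < 2 * x * (nfC p x f₀ * r * ε) := by positivity
    linarith
  refine hst _ _ _ (approxSol_coordMap_ofAmplitude S h hε hw0 hB hBn)
    (ApproxSol.of_hasDerivAt hZr hZ (by positivity)) (fun t => ?_) (fun t => ?_) t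
  · have h1 := norm_coordMap_sub_ofAmplitude_le S h (A := A) (B := B) (y := ofAmplitude B t) (s := 0)
      (t := t) (by rw [norm_ofAmplitude]; linarith) (by simp)
    linarith [norm_nonneg (B - A)]
  · linarith [hZA t, norm_nonneg (Z t - ofAmplitude A t)]

/-- In the original coordinates both breathers are exact solutions near the soliton of amplitude A,
so they coincide by the stability estimate with zero residual; the change of coordinates is
injective. -/
theorem IsBreather.unique (S : Size d p x f₀) (h : Small p x f₀ r ε) {R w δ κ ρ : ℝ}
    (hx : x = R + 5) (hw : w ≠ 0) {A B : L2 d} (hBA : 2 * ‖B - A‖ ≤ κ / 4)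
    (hμ : 2 * x * (nfC p x f₀ * r * ε) ≤ κ / 8) (hρ : κ + 2 * δ ≤ ρ) {C : ℝ}
    (hst : ∀ z z' : ℝ → Phase d, ApproxSol p ε w 0 z → ApproxSol p ε w 0 z' →
      (∀ t, ‖z t - ofAmplitude A t‖ ≤ ρ) → (∀ t, ‖z' t - ofAmplitude A t‖ ≤ ρ) →
      ∀ t, ‖z t - z' t‖ ≤ C * 0) {b₁ b₂ : L22 d}
    (hb₁ : IsBreather p ε r R w b₁) (hd₁ : fourierDist b₁ B < δ)
    (hb₂ : IsBreather p ε r R w b₂) (hd₂ : fourierDist b₂ B < δ) : b₁ = b₂ := by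
  have hnear : ∀ b : L22 d, IsBreather p ε r R w b → fourierDist b B < δ →
      ∀ t, ‖coordMap p ε r (ofFourier b t) - ofAmplitude A t‖ ≤ ρ := fun b hb hd t => by
    have h1 := norm_coordMap_sub_ofAmplitude_le S h (A := A)
      (by linarith [(hb.hasDerivAt_ofFourier hw t).1] : ‖ofFourier b t‖ ≤ x)
      (norm_ofFourier_sub_le b B t)
    linarith [norm_nonneg (B - A)]
  refine hb₁.eq_of_coordMap_eq S h (by linarith) hw hb₂ fun τ => ?_
  have h1 := hst _ _ (hb₁.approxSol S h (by linarith) hw) (hb₂.approxSol S h (by linarith) hw)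
    (hnear b₁ hb₁ hd₁) (hnear b₂ hb₂ hd₂) τ
  rw [mul_zero] at h1
  exact sub_eq_zero.1 (norm_le_zero_iff.1 h1)

end Assembly
end KleinGordon
end

/-! ### The theorem -/

open KleinGordon in
open Set Filter Topology Metric Size in
set_option maxHeartbeats 1000000 in
theorem theorem5 (d p : ℕ) (hd : 1 ≤ d) (hp : 1 ≤ p) (Ω : ℝ) (A : L2 d)
    (hA : dnls p Ω A = 0) (hJ : IsUnit (jacobian p Ω A)) (R : ℝ) (hR : 2 * ‖A‖ < R) :
    ∃ ρ ε₀ ε₁ ε₂ c C δ : ℝ,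
      0 < c ∧ 0 < C ∧ 0 < δ ∧ 0 < ε₂ ∧ ε₂ < ε₁ ∧ ε₁ < ε₀ ∧ ε₀ ≤ ρ ∧
      -- the change of coordinates is well defined on the ball of radius `R`
      (∀ r ε, Admissible ρ ε₀ r ε →
        (∀ z : Phase d, ‖z‖ < R → Summable fun k => ‖coordTerm p ε r k z‖) ∧
        Set.InjOn (coordMap (d := d) p ε r) (Metric.ball 0 R)) ∧
      ∃ B : ℕ → ℝ → L2 d,
        -- (1) the soliton of the generalized dNLS equation
        (∀ r, AnalyticOnNhd ℝ (B r) {ε | Admissible ρ ε₁ r ε}) ∧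
        (∀ r ε, Admissible ρ ε₁ r ε →
          genDnls p Ω ε r (B r ε) = 0 ∧
          ‖B r ε - A‖ < δ ∧
          (∀ B' : L2 d, ‖B' - A‖ < δ → genDnls p Ω ε r B' = 0 → B' = B r ε) ∧
          ‖B r ε - A‖ ≤ C * ε ∧
          DifferentiableAt ℝ (genDnls p Ω ε r) (B r ε) ∧
          ‖fderiv ℝ (genDnls p Ω ε r) (B r ε) - jacobian p Ω A‖ ≤ C * ε ∧
          (∀ t : ℝ, ‖soliton Ω ε (B r ε) t‖ < R ∧
            HasDerivAt (soliton Ω ε (B r ε))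
              (hamField (hamK p ε r) (soliton Ω ε (B r ε) t)) t)) ∧
        -- (2) the breather
        ∃ (ω : ℝ → ℝ) (b : ℕ → ℝ → L22 d),
          AnalyticOnNhd ℝ ω (Set.Ioo 0 ε₂) ∧
          (∀ ε ∈ Set.Ioo 0 ε₂,
            0 < ω ε ∧ 0 < 1 - ε * Ω / 2 ∧ |ω ε - 1 + ε / 2 * Ω| ≤ C * ε ^ 2) ∧
          (∀ r, AnalyticOnNhd ℝ (b r) {ε | Admissible ρ ε₂ r ε}) ∧
          (∀ r ε, Admissible ρ ε₂ r ε →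
            IsBreather p ε r R (ω ε) (b r ε) ∧
            fourierDist (b r ε) (B r ε) < δ ∧
            (∀ (w : ℝ) (b₁ b₂ : L22 d), |w - 1 + ε / 2 * Ω| ≤ C * ε ^ 2 →
              IsBreather p ε r R w b₁ → fourierDist b₁ (B r ε) < δ →
              IsBreather p ε r R w b₂ → fourierDist b₂ (B r ε) < δ → b₁ = b₂) ∧
            -- in the original coordinates it solves the Klein-Gordon equation, whatever `r` is
            (∀ t : ℝ, HasDerivAt (fun s => coordMap p ε r (ofFourier (b r ε) (ω ε * s)))
              (hamField (hamH p ε) (coordMap p ε r (ofFourier (b r ε) (ω ε * t)))) t) ∧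
            (∀ r', Admissible ρ ε₂ r' ε → ∀ τ : ℝ,
              coordMap p ε r (ofFourier (b r ε) τ) = coordMap p ε r' (ofFourier (b r' ε) τ)) ∧
            -- the exponential estimates, at the optimal order
            (r = ⌊ρ / ε⌋₊ →
              fourierDist (b r ε) (B r ε) ≤ C * Real.exp (-c / ε) ∧
              -- (3) closeness in the original coordinates over one period
              (∀ t : ℝ, |t| ≤ max (2 * Real.pi / (1 - ε * Ω / 2)) (2 * Real.pi / ω ε) →
                ‖coordMap p ε r (soliton Ω ε (B r ε) t)
                  - coordMap p ε r (ofFourier (b r ε) (ω ε * t))‖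
                  ≤ C * Real.exp (-c / ε)))) := by
  have hA0 := norm_nonneg A
  -- The radius beyond R is spent on Cauchy estimates, on the flow of the generating fields and on
  -- the passage between the two coordinate systems.
  obtain ⟨x, hx⟩ : ∃ x, x = R + 5 := ⟨_, rfl⟩
  obtain ⟨f₀, S⟩ := exists_size d p (x := x) (by linarith)
  obtain ⟨δ₁, hδ₁, e₁, he₁, C₁, hC₁, hδx, hsol⟩ := exists_soliton S hA hJ (by linarith)
  obtain ⟨yc, Z, C₂, hC₂, ρ₂, hρ₂, hst, hKG⟩ := exists_kg_family hA hJ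
  have hnf := S.nfC_pos
  have hx0 := S.x_pos
  have hf := S.pos
  obtain ⟨n, hn⟩ : ∃ n, n = nfC p x f₀ := ⟨_, rfl⟩
  obtain ⟨K, hK⟩ : ∃ K, K = x ^ 2 + f₀ := ⟨_, rfl⟩
  obtain ⟨L, hL⟩ : ∃ L, L = x ^ 2 + 2 * f₀ + 4 * f₀ * nfC p x f₀ := ⟨_, rfl⟩
  obtain ⟨Q, hQ⟩ : ∃ Q, Q = (∑' m : ℤ, (1 + (m : ℝ) ^ 2)⁻¹) + 1 := ⟨_, rfl⟩
  have hn0 : 0 < n := hn ▸ hnf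
  have hK0 : 0 < K := by rw [hK]; positivity
  have hL0 : 0 < L := by rw [hL]; positivity
  have hQ1 : 1 ≤ Q := by
    have : 0 ≤ ∑' m : ℤ, (1 + (m : ℝ) ^ 2)⁻¹ := tsum_nonneg fun m => by positivity
    linarith
  have hQ0 : 0 < Q := by linarith
  -- The three bounds: the ball of uniqueness for the soliton, the ball of stability for breathers
  -- within δ of it, and the ball of radius R for the soliton itself.
  obtain ⟨δ, hδ0, hδ1, hδ2, hδ3⟩ : ∃ δ : ℝ, 0 < δ ∧ δ ≤ δ₁ ∧ δ ≤ ρ₂ / 8 ∧ δ ≤ (R - 2 * ‖A‖) / 4 :=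
    ⟨min δ₁ (min (ρ₂ / 8) ((R - 2 * ‖A‖) / 4)), lt_min hδ₁ (lt_min (by linarith) (by linarith)),
      by simp, by simp, by simp⟩
  -- The last bound makes the part Q (1 + 2 L) κ of the estimate of the Fourier distance at most
  -- δ/2.
  obtain ⟨κ, hκ0, hκ1, hκ2, hκ3⟩ : ∃ κ : ℝ, 0 < κ ∧ κ ≤ ρ₂ / 4 ∧ κ ≤ (R - 2 * ‖A‖) / 4 ∧
      κ ≤ δ / (2 * (Q * (1 + 2 * L))) :=
    ⟨min (ρ₂ / 4) (min ((R - 2 * ‖A‖) / 4) (δ / (2 * (Q * (1 + 2 * L))))),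
      lt_min (by linarith) (lt_min (by linarith) (by positivity)), by simp, by simp, by simp⟩
  -- The number m will be 2 n ρ, so C r ε ≤ m/2 for all admissible orders. The bounds serve, in this
  -- order, the convergence of the Lie series, the exponential decay at the optimal order, the
  -- closeness of T_r to the identity, and the remaining part of the Fourier distance.
  obtain ⟨m, hm0, hm1, hm2, hm3, hm4⟩ : ∃ m : ℝ, 0 < m ∧ m ≤ 1 / (4 * (x + x ^ 2)) ∧
      m ≤ Real.exp (-1) ∧ m ≤ κ / (8 * x) ∧ m ≤ δ / (16 * K * Q) :=
    ⟨min (1 / (4 * (x + x ^ 2))) (min (Real.exp (-1)) (min (κ / (8 * x)) (δ / (16 * K * Q)))),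
      lt_min (by positivity) (lt_min (Real.exp_pos _) (lt_min (by positivity) (by positivity))),
      by simp, by simp, by simp, by simp⟩
  obtain ⟨ρ, hρ⟩ : ∃ ρ, ρ = m / (2 * n) := ⟨_, rfl⟩
  have hρ0 : 0 < ρ := by rw [hρ]; positivity
  have hnρ : n * ρ = m / 2 := by rw [hρ]; field_simp
  obtain ⟨e₂, he₂, hKG⟩ := hKG (κ / 4) (by positivity)
  rw [le_div_iff₀ (by positivity)] at hκ3 hm1 hm3 hm4
  have hκδ : κ ≤ δ / 2 := by nlinarith [mul_pos hκ0 hQ0, mul_pos hQ0 hL0, mul_pos hκ0 hL0]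
  -- The bound by 1/(|Ω| + 1) keeps the frequency above 1/2, and the bound by κ/(8 C₁) keeps the
  -- soliton within the tolerance of A.
  obtain ⟨e, he0, heρ, he1, heΩ, hee₁, hee₂, heC⟩ : ∃ e : ℝ, 0 < e ∧ e ≤ ρ ∧ e ≤ 1 ∧
      e ≤ 1 / (|Ω| + 1) ∧ e ≤ e₁ ∧ e ≤ e₂ ∧ e ≤ κ / (8 * C₁) :=
    ⟨min ρ (min 1 (min (1 / (|Ω| + 1)) (min e₁ (min e₂ (κ / (8 * C₁)))))),
      lt_min hρ0 (lt_min one_pos (lt_min (by positivity) (lt_min he₁ (lt_min he₂ (by positivity))))),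
      by simp, by simp, by simp, by simp, by simp, by simp⟩
  rw [le_div_iff₀ (by positivity)] at heΩ heC
  have hsmall : 4 * (x + x ^ 2) * (nfC p x f₀ * (2 * ρ)) ≤ 1 := by
    rw [← hn, show n * (2 * ρ) = m by linarith]; linarith
  have hfreq : ∀ ε, 0 < ε → ε < e → 1 / 2 ≤ 1 - ε * Ω / 2 := fun ε h1 h2 => by
    have h3 : ε * Ω ≤ ε * |Ω| := mul_le_mul_of_nonneg_left (le_abs_self Ω) h1.le
    have h4 : ε * (|Ω| + 1) ≤ e * (|Ω| + 1) := by gcongr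
    linarith
  have hCε : ∀ ε, ε < e → C₁ * ε ≤ κ / 8 := fun ε h2 => by nlinarith
  obtain ⟨B, hBa, hB⟩ := exists_soliton_family S (A := A) (Ω := Ω) (δ := δ) (e := e) (C := C₁)
    hρ0 hsmall hC₁.le fun r ε h1 h2 => by
      obtain ⟨k1, k2, B, k3, k4, k5⟩ := hsol r ε h1 (by linarith)
      have hsub := ball_subset_ball (x := A) hδ1
      refine ⟨fun B hB B' hB' => k1 B (hsub hB) B' (hsub hB'), fun B hB => k2 B (hsub hB), B, ?_,
        k4, k5⟩
      rw [mem_ball, dist_eq_norm]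
      linarith [hCε ε h2]
  have hZx : ∀ ε, 0 < ε → ε < e → ∀ t, ‖Z ε t‖ ≤ R - κ := fun ε h1 h2 t => by
    have h3 := (hKG ε h1 (by linarith)).2.2.2.2 t
    have h4 := norm_le_norm_add_norm_sub' (Z ε t) (ofAmplitude A t)
    rw [norm_ofAmplitude] at h4
    linarith
  obtain ⟨b, hb⟩ := exists_breather_family S (Ω := Ω) (e := e) (yc := yc) (Z := Z)
    (fun ε h1 h2 => by linarith [hfreq ε h1 h2]) fun ε h1 h2 => by
      obtain ⟨k1, k2, k3, k4, -⟩ := hKG ε h1 (by linarith)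
      exact ⟨k1, k2, k3, k4, fun t => by linarith [hZx ε h1 h2 t]⟩
  -- C₃ is the constant of the distance in the original coordinates, from `residual_le_exp`. C₄ is
  -- that of the Fourier coefficients: the inverse change of coordinates doubles C₃, and the
  -- remainder enters once more through the time derivative.
  obtain ⟨C₃, hC₃⟩ : ∃ C₃, C₃ = 24 * C₂ * K * Real.exp 1 / ρ := ⟨_, rfl⟩
  have hC₃0 : 0 < C₃ := by rw [hC₃]; positivity
  obtain ⟨C₄, hC₄⟩ : ∃ C₄, C₄ = Q * ((1 + 2 * L) * (2 * C₃) + 4 * K * Real.exp 1) := ⟨_, rfl⟩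
  have hC₄0 : 0 < C₄ := by rw [hC₄]; positivity
  have hC₁2 : 0 < C₁ * (C₁ + 1) := by positivity
  obtain ⟨C, hC0, hCC₁, hCC₂, hCC₃, hCC₄⟩ : ∃ C : ℝ, 0 < C ∧ C₁ ≤ C ∧ C₁ * (C₁ + 1) ≤ C ∧
      C₃ ≤ C ∧ C₄ ≤ C := by
    refine ⟨C₁ + C₁ * (C₁ + 1) + C₃ + C₄, ?_, ?_, ?_, ?_, ?_⟩ <;> linarith
  -- Beyond e' ≤ e/4 these are the conditions under which every frequency allowed in the uniqueness
  -- statement lies in the range of the stability estimate.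
  obtain ⟨e', he'0, he'e, he'1, he'2, he'3⟩ : ∃ e' : ℝ, 0 < e' ∧ e' ≤ e / 4 ∧ e' ≤ 1 / (4 * C) ∧
      e' ≤ ρ₂ / 4 ∧ e' ≤ ρ₂ / C :=
    ⟨min (e / 4) (min (1 / (4 * C)) (min (ρ₂ / 4) (ρ₂ / C))),
      lt_min (by positivity) (lt_min (by positivity) (lt_min (by positivity) (by positivity))),
      by simp, by simp, by simp, by simp⟩
  have hadm : ∀ {e₁ r ε}, e₁ ≤ e → Admissible ρ e₁ r ε → Admissible ρ e r ε :=
    fun h1 h => ⟨h.1, h.2.1, h.2.2.1.trans_le h1, h.2.2.2⟩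
  have hsm : ∀ {r ε}, Admissible ρ e r ε → Small p x f₀ r ε := fun h =>
    (eventually_small S hρ0 hsmall h).self_of_nhds
  have hmu : ∀ {r ε}, Admissible ρ e r ε → nfC p x f₀ * r * ε ≤ m / 2 := fun {r ε} h => by
    rw [← hnρ, ← hn, mul_assoc]
    exact mul_le_mul_of_nonneg_left h.2.2.2 hn0.le
  have hxmu : ∀ {r ε}, Admissible ρ e r ε → 2 * x * (nfC p x f₀ * r * ε) ≤ κ / 8 := fun {r ε} h => by
    have h1 := mul_le_mul_of_nonneg_left (hmu h) (by positivity : 0 ≤ 2 * x)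
    linarith
  have hest : ∀ {r ε}, Admissible ρ e r ε → _ := fun {r ε} h => 
    breather_estimates S (hsm h) (h.2.2.1.le.trans he1) (hfreq ε h.2.1 h.2.2.1) hx
      (hB r ε h).1 (A := A) (by linarith [(hB r ε h).2.2.2.1, hCε ε h.2.2.1]) (by linarith) (hxmu h)
      (hKG ε h.2.1 (h.2.2.1.trans_le hee₂)).2.2.2.1 (hKG ε h.2.1 (h.2.2.1.trans_le hee₂)).2.2.2.2
      (hb r ε h.2.1 h.2.2.1 (eventually_small S hρ0 hsmall h)).2.1
      (hb r ε h.2.1 h.2.2.1 (eventually_small S hρ0 hsmall h)).2.2.1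
      (hb r ε h.2.1 h.2.2.1 (eventually_small S hρ0 hsmall h)).2.2.2
  have hBR : ∀ {r ε}, Admissible ρ e r ε → 2 * ‖B r ε‖ < R := fun {r ε} h => by
    have h1 := norm_le_norm_add_norm_sub' (B r ε) A
    linarith [(hB r ε h).2.1]
  rw [← hK, ← hL, ← hQ] at hest
  refine ⟨ρ, e, e / 2, e', ρ / 2, C, δ, by linarith, hC0, hδ0, he'0, by linarith, by linarith, heρ,
    fun r ε h => ⟨fun z hz => (S.smallGen (hsm h)).summable_norm (by linarith),
      (coordMap_injOn S (hsm h)).mono (ball_subset_ball (by linarith))⟩, B,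
    fun r => (hBa r).mono fun ε h => hadm (by linarith) h, fun r ε h => ?_,
    -- The frequency is affine in ε, hence analytic, and meets the required expansion with no error.
    fun ε => 1 - ε * Ω / 2, b, ?_, fun ε hε => ?_, fun r ε h => ?_, fun r ε h => ?_⟩
  · replace h := hadm (by linarith) h
    obtain ⟨k1, k2, k3, k4, k5, k6⟩ := hB r ε h
    refine ⟨k1, k2, k3, k4.trans (by gcongr; exact h.2.1.le), k5,
      k6.trans (by gcongr; exact h.2.1.le), fun t => ⟨?_, hasDerivAt_soliton h.2.1 h.1 k1 t⟩⟩
    rw [soliton, norm_ofAmplitude]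
    exact hBR h
  · exact fun ε _ => by fun_prop
  · have h1 := hfreq ε hε.1 (by linarith [hε.2])
    refine ⟨by linarith, by linarith, ?_⟩
    rw [show 1 - ε * Ω / 2 - 1 + ε / 2 * Ω = 0 by ring, abs_zero]
    positivity
  · replace h := hadm (by linarith) h
    exact (hb r ε h.2.1 h.2.2.1 (eventually_small S hρ0 hsmall h)).1
  · have hε' := h.2.2.1
    replace h := hadm (by linarith) h
    have hε0 := h.2.1
    obtain ⟨k1, k2, k3, k4⟩ := hest h
    have hε1 := h.2.2.1.le.trans he1
    have hw := hfreq ε h.2.1 h.2.2.1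
    have hBA : 2 * ‖B r ε - A‖ ≤ κ / 4 := by linarith [(hB r ε h).2.2.2.1, hCε ε h.2.2.1]
    have hμ0 := S.mu_pos (hsm h)
    obtain ⟨-, -, hZr, hZd, hZA⟩ := hKG ε h.2.1 (h.2.2.1.trans_le hee₂)
    have hwd : 0 < 1 - ε * Ω / 2 := by linarith
    refine ⟨k1, (k4 κ k3).trans_lt ?_, fun w b₁ b₂ hw' hb₁ hd₁ hb₂ hd₂ => ?_, fun t => ?_,
      fun r' h' τ => ?_, fun hr => ?_⟩
    -- At an arbitrary admissible order only the crude bound of the remainder by its ratio is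
    -- available; the contributions of κ and of m/2 are δ/2 and δ/8 at most.
    · have h1 : (nfC p x f₀ * r * ε) ^ r ≤ m / 2 := by
        refine le_trans (pow_le_of_le_one hμ0.le ?_ (by have := h.1; omega)) (hmu h)
        have : Real.exp (-1) ≤ 1 := Real.exp_le_one_iff.2 (by norm_num)
        linarith [hmu h]
      calc _ ≤ Q * ((1 + 2 * L) * κ + 4 * K * (m / 2)) := by gcongr
        _ < δ := by linarith
    · obtain ⟨h1, h2, h3⟩ := frequency_mem (ρ := ρ₂) hε0 hε1 hC0 hw hw' (by linarith) (by linarith)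
        (by linarith)
      exact hb₁.unique S (hsm h) hx h1.ne' hBA (hxmu h) (by linarith)
        (hst ε w 0 hε0 h1 h2 h3) hd₁ hb₂ hd₂
    · obtain ⟨h1, h2⟩ := k1 t
      have h3 := hasDerivAt_coordMap S (hsm h) (c := 1) (by rwa [one_smul]) (by linarith)
      rwa [one_smul] at h3
    · rw [k2, (hest (hadm (by linarith) h')).2.1]
    · have h1 := residual_le_exp (w := 1 - ε * Ω / 2) hρ0 hε0 hε1 hw hK0.le hC₂.le hμ0.le
        (by linarith [hmu h]) hr
      have h0 := frequency_mem (ρ := ρ₂) (w := 1 - ε * Ω / 2) hε0 hε1 hC0 hw (by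
        rw [show 1 - ε * Ω / 2 - 1 + ε / 2 * Ω = 0 by ring, abs_zero]
        positivity) (by linarith) (by linarith) (by linarith)
      have h2 : ∀ t, ‖coordMap p ε r (ofAmplitude (B r ε) t) - Z ε t‖
          ≤ C₃ * Real.exp (-(ρ / 2) / ε) := fun t => by
        have h3 := norm_soliton_sub_breather_le S (hsm h) hε1 hw hx (hB r ε h).1 hBA (by linarith)
          (hxmu h) (by linarith) hZr hZd hZA (fun s => hst ε _ s hε0 h0.1 h0.2.1 h0.2.2) t
        rw [← hK] at h3
        rw [hC₃]
        exact h3.trans h1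
      have hE := Real.exp_pos (-(ρ / 2) / ε)
      refine ⟨?_, fun t _ => ?_⟩
      -- Distances in the normal form coordinates are at most twice those in the original ones.
      · have h3 : ∀ t, ‖ofFourier (b r ε) t - ofAmplitude (B r ε) t‖
            ≤ 2 * C₃ * Real.exp (-(ρ / 2) / ε) := fun t => by
          have hbn : ‖ofFourier (b r ε) t‖ < R := (k1.hasDerivAt_ofFourier hwd.ne' t).1
          have h4 := half_norm_sub_le_coordMap S (hsm h) (y := ofFourier (b r ε) t)
            (z := ofAmplitude (B r ε) t) (by linarith)
            (by rw [norm_ofAmplitude]; linarith [hBR h])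
          rw [k2, norm_sub_rev (Z ε t)] at h4
          linarith [h2 t]
        refine (k4 _ h3).trans ?_
        have h5 := pow_floor_le (ρ := ρ) (ε := ε) hμ0.le (by linarith [hmu h])
        rw [← hr] at h5
        have h6 := exp_le_exp_half hρ0 hε0
        calc _ ≤ Q * ((1 + 2 * L) * (2 * C₃ * Real.exp (-(ρ / 2) / ε))
              + 4 * K * (Real.exp 1 * Real.exp (-(ρ / 2) / ε))) := by
                gcongr
                exact h5.trans (by gcongr)
          _ = C₄ * Real.exp (-(ρ / 2) / ε) := by rw [hC₄]; ring
          _ ≤ _ := by gcongr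
      -- Both orbits are at the same phase (1 - εΩ/2) t, so the estimate at equal phases applies
      -- directly.
      · rw [soliton, k2]
        exact (h2 _).trans (by gcongr)
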